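/- **Notation.** Let $k,L,M,t\ge 1$ be integers and let $\psi$, $\varrho$ be Dirichlet characters mod $L$ and mod $M$ with $\psi(-1)\varrho(-1)=(-1)^k$. Write $z=x+iy\in\mathbb H$ (so $y>0$), $q=e^{2\pi i z}$, $\mathbf 1_N$ for the trivial character mod $N$, $\chi^0$ for the primitive character inducing $\chi$, $\ell_\varrho=M/(\text{conductor of }\varrho)$, $W(\chi^0)=\sum_{n=1}^{m}\chi^0(n)e^{2\pi i n/m}$ for $\chi^0$ of conductor $m$, and $L(s,\chi)$ for the (analytically continued) Dirichlet $L$-function. *Holomorphic Eisenstein series.* Put $$\sigma_{k-1}^{\psi,\varrho}(n)=\sum_{0<c\mid n}\psi(n/c)c^{k-1}\sum_{0<d\mid\gcd(\ell_\varrho,c)}d\,\mu(\ell_\varrho/d)\,\overline{\varrho^0}(\ell_\varrho/d)\,\varrho^0(c/d),$$ $C_k(\psi,\varrho)=L(k,\overline\varrho)$ if $\psi=\mathbf 1_1$ and $0$ otherwise; $D(\psi,\varrho)=-\pi i L(0,\psi)\prod_{p\mid M}(1-p^{-1})$ if $\varrho=\mathbf 1_M$ and $0$ otherwise; and $$E_k^{\psi,\varrho}(z)=C_k(\psi,\varrho)+\delta_k(z)+\Big(-\frac{2\pi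 i}{M}\Big)^k\frac{W(\overline{\varrho^0})}{(k-1)!}\sum_{n\ge1}\sigma_{k-1}^{\psi,\varrho}(n)q^n,$$ where $\delta_1(z)=D(\psi,\varrho)$, where $\delta_2(z)=-\frac{\pi}{2My}\prod_{p\mid M}(1-p^{-1})\prod_{p\mid L}(1-p^{-1})$ if $(\psi,\varrho)=(\mathbf 1_L,\mathbf 1_M)$, and where $\delta_k(z)=0$ in all other cases. Let $E_k^{\psi,\varrho,t}(z)=E_k^{\psi,\varrho}(z)-tE_k^{\psi,\varrho}(tz)$ if $k=2$ and $(\psi,\varrho)=(\mathbf 1_L,\mathbf 1_M)$, and $E_k^{\psi,\varrho,t}(z)=E_k^{\psi,\varrho}(tz)$ otherwise. *Non-holomorphic Eisenstein series.* For $\kappa\in\mathbb Z$ and $\kappa+2\operatorname{Re}(s)>2$ let $$E_\kappa(z,s,\psi,\varrho)=\frac12\sum_{(m,n)\in\mathbb Z^2\setminus\{(0,0)\}}\psi(m)\varrho(n)(mz+n)^{-\kappa}|mz+n|^{-2s},$$ and denote by the same symbol its meromorphic continuation in $s$. Define $$\mathcal E_{2-k}^{\psi,\varrho,t}(z)=\begin{cases}(k-1)^{-1}y^{k-1}E_{2-k}(tMz,k-1,\overline\psi,\varrho),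 & k>2,\\[2pt] y\,E_0(tMz,1,\overline\psi,\varrho), & k=2,\ (\psi,\varrho)\ne(\mathbf 1_L,\mathbf 1_M),\\[2pt] \lim_{s\to1}\big(y^sE_0(Mz,s,\mathbf 1_L,\mathbf 1_M)-t\,y^sE_0(tMz,s,\mathbf 1_L,\mathbf 1_M)\big), & k=2,\ (\psi,\varrho)=(\mathbf 1_L,\mathbf 1_M),\\[2pt] \frac{\partial}{\partial s}\big(y^sE_1(tMz,s,\overline\psi,\varrho)\big)\big|_{s=0}, & k=1.\end{cases}$$ *Harmonic Maass forms.* For $\kappa\in\mathbb Z$ let $\xi_\kappa f=2iy^\kappa\,\overline{\partial f/\partial\bar z}$ and $\Delta_\kappa=y^2(\partial_x^2+\partial_y^2)-i\kappa y(\partial_x+i\partial_y)$. For a Dirichlet character $\chi$ mod $N$, $H_\kappa(N,\chi)$ is the space of real-analytic $F:\mathbb H\to\mathbb C$ with $F(\gamma z)=\chi(d)(cz+d)^\kappa F(z)$ for all $\gamma=\left(\begin{smallmatrix}a&b\\c&d\end{smallmatrix}\right)\in\Gamma_0(N)$, with $\Delta_\kappa F=0$, with at most linear exponential growth at the cusps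 (for each $\gamma\in \mathrm{SL}_2(\mathbb Z)$ there is $C$ with $(F|_\kappa\gamma)(z)=O(e^{Cy})$ as $y\to\infty$, uniformly in $x$), and such that $\xi_\kappa F$ is holomorphic on $\mathbb H$ and at every cusp. **Theorem.** The function $\mathcal E_{2-k}^{\psi,\varrho,t}$ is well defined: for $k>2$ the series at $s=k-1$ converges absolutely; for $k\le2$ and every $z\in\mathbb H$ the meromorphic continuation of $E_{2-k}(z,s,\overline\psi,\varrho)$ to all $s\in\mathbb C$ exists; $E_0(tMz,s,\overline\psi,\varrho)$ is analytic at $s=1$ if $k=2$ and $(\psi,\varrho)\neq(\mathbf 1_L,\mathbf 1_M)$; the limit at $s=1$ exists if $k=2$ and $(\psi,\varrho)=(\mathbf 1_L,\mathbf 1_M)$; and $E_1(tMz,s,\overline\psi,\varrho)$ is analytic at $s=0$ if $k=1$. Moreover $$\mathcal E_{2-k}^{\psi,\varrho,t}\in H_{2-k}(tLM,\overline{\psi\varrho})\qquad\text{and}\qquad \xi_{2-k}\big(\mathcal E_{2-k}^{\psi,\varrho,t}\big)=E_k^{\psi,\varrho,t}.$$ -/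

import Mathlib

open UpperHalfPlane Filter Topology
open scoped MatrixGroups ModularForm ComplexConjugate Real

noncomputable section

namespace EisPreimage

/-! ### Differential operators on functions on the upper half-plane -/

/-- `∂g/∂x` for a function of `z = x + iy`. -/
def partialX (g : ℂ → ℂ) (z : ℂ) : ℂ := fderiv ℝ g z 1

/-- `∂g/∂y` for a function of `z = x + iy`. -/
def partialY (g : ℂ → ℂ) (z : ℂ) : ℂ := fderiv ℝ g z Complex.I

/-- `∂g/∂z̄ = (1/2) (∂g/∂x + i ∂g/∂y)`. -/
def partialZbar (g : ℂ → ℂ) (z : ℂ) : ℂ :=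
  (1 / 2 : ℂ) * (partialX g z + Complex.I * partialY g z)

/-- The operator `ξ_κ f = 2 i y^κ conj(∂f/∂z̄)`. -/
def xi (κ : ℤ) (f : ℍ → ℂ) (z : ℍ) : ℂ :=
  2 * Complex.I * (z.im : ℂ) ^ κ * conj (partialZbar (f ∘ ofComplex) (z : ℂ))

/-- The weight `κ` hyperbolic Laplacian
`y² (∂²/∂x² + ∂²/∂y²) - i κ y (∂/∂x + i ∂/∂y)`. -/
def hypLaplacian (κ : ℤ) (f : ℍ → ℂ) (z : ℍ) : ℂ :=
  (z.im : ℂ) ^ 2 * (partialX (partialX (f ∘ ofComplex)) (z : ℂ)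
      + partialY (partialY (f ∘ ofComplex)) (z : ℂ))
    - Complex.I * (κ : ℂ) * (z.im : ℂ) *
      (partialX (f ∘ ofComplex) (z : ℂ) + Complex.I * partialY (f ∘ ofComplex) (z : ℂ))

/-! ### Weakly harmonic Maass forms -/

/-- Weakly harmonic Maass forms of weight `κ`, level `N` and character `χ`. The cusps of `Γ₀(N)`
are the points `γ ∞` with `γ ∈ SL₂(ℤ)`. -/
structure IsWeaklyHarmonicMaassForm (κ : ℤ) (N : ℕ) (χ : DirichletCharacter ℂ N)
    (F : ℍ → ℂ) : Prop where
  realAnalytic : AnalyticOnNhd ℝ (F ∘ ofComplex) {z : ℂ | 0 < z.im}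
  modular : ∀ γ ∈ CongruenceSubgroup.Gamma0 N, ∀ z : ℍ,
    F (γ • z) = χ ((γ 1 1 : ℤ) : ZMod N) * ((γ 1 0 : ℂ) * z + (γ 1 1 : ℂ)) ^ κ * F z
  harmonic : ∀ z : ℍ, hypLaplacian κ F z = 0
  growth : ∀ γ : SL(2, ℤ), ∃ C : ℝ,
    (F ∣[κ] γ) =O[atImInfty] fun z : ℍ => Real.exp (C * z.im)

/-- The space `H_κ(N, χ)`: weakly harmonic Maass forms whose image under `ξ_κ` is a holomorphic
function that is holomorphic at every cusp (it is modular of weight `2 - κ`, so that being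
holomorphic at a cusp is boundedness there). -/
structure MemH (κ : ℤ) (N : ℕ) (χ : DirichletCharacter ℂ N) (F : ℍ → ℂ) : Prop
    extends IsWeaklyHarmonicMaassForm κ N χ F where
  xi_holomorphic : DifferentiableOn ℂ (xi κ F ∘ ofComplex) {z : ℂ | 0 < z.im}
  xi_holomorphicAtCusps : ∀ γ : SL(2, ℤ), IsBoundedAtImInfty (xi κ F ∣[2 - κ] γ)

/-! ### The holomorphic Eisenstein series -/

/-- The Gauss sum `W(χ) = ∑_{n=1}^{m} χ(n) e^{2πin/m}` of a character mod `m`. -/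
def gaussW {m : ℕ} (χ : DirichletCharacter ℂ m) : ℂ :=
  ∑ n ∈ Finset.Icc 1 m, χ (n : ZMod m) * Complex.exp (2 * π * Complex.I * n / m)

/-- `ℓ_χ = N / m_χ`, where `m_χ` is the conductor of the character `χ` mod `N`. -/
def ell {N : ℕ} (χ : DirichletCharacter ℂ N) : ℕ := N / χ.conductor

/-- `∏_{p ∣ N} (1 - p⁻¹)`, over the primes dividing `N`. -/
def eulerProd (N : ℕ) : ℂ := ∏ p ∈ N.primeFactors, (1 - (p : ℂ)⁻¹)

/-- `σ_{k-1}^{ψ,ϱ}(n)`. -/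
def sigma {L M : ℕ} (k : ℕ) (ψ : DirichletCharacter ℂ L) (ϱ : DirichletCharacter ℂ M)
    (n : ℕ) : ℂ :=
  ∑ c ∈ n.divisors, ψ ((n / c : ℕ) : ZMod L) * (c : ℂ) ^ (k - 1) *
    ∑ d ∈ (Nat.gcd (ell ϱ) c).divisors,
      (d : ℂ) * (ArithmeticFunction.moebius (ell ϱ / d) : ℂ) *
        conj (ϱ.primitiveCharacter ((ell ϱ / d : ℕ) : ZMod ϱ.conductor)) *
        ϱ.primitiveCharacter ((c / d : ℕ) : ZMod ϱ.conductor)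

/-- `C_k(ψ, ϱ)`; the condition `ψ = 1₁` says that `ψ` is the character mod `1`. -/
def constC {M : ℕ} [NeZero M] (k L : ℕ) (ϱ : DirichletCharacter ℂ M) : ℂ :=
  if L = 1 then DirichletCharacter.LFunction (star ϱ) k else 0

open Classical in
/-- `D(ψ, ϱ)`. -/
def constD {L M : ℕ} [NeZero L] (ψ : DirichletCharacter ℂ L) (ϱ : DirichletCharacter ℂ M) : ℂ :=
  if ϱ = 1 then -(π * Complex.I * DirichletCharacter.LFunction ψ 0 * eulerProd M) else 0

/-- `(-2πi/M)^k W(conj ϱ⁰) / (k-1)! ∑_{n ≥ 1} σ_{k-1}^{ψ,ϱ}(n) q^n`. -/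
def eisNonconst {L M : ℕ} (k : ℕ) (ψ : DirichletCharacter ℂ L) (ϱ : DirichletCharacter ℂ M)
    (z : ℂ) : ℂ :=
  (-(2 * π * Complex.I / M)) ^ k * gaussW (star ϱ.primitiveCharacter) / ((k - 1).factorial : ℂ) *
    ∑' n : ℕ, sigma k ψ ϱ (n + 1) * Complex.exp (2 * π * Complex.I * ((n + 1 : ℕ) : ℂ) * z)

open Classical in
/-- `E_k^{ψ,ϱ}(z)`, for `k ≥ 1` and `Im z > 0`. -/
def eisBase {L M : ℕ} [NeZero L] [NeZero M] (k : ℕ) (ψ : DirichletCharacter ℂ L)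
    (ϱ : DirichletCharacter ℂ M) (z : ℂ) : ℂ :=
  if k = 1 then constC k L ϱ + constD ψ ϱ + eisNonconst k ψ ϱ z
  else if k = 2 ∧ ψ = 1 ∧ ϱ = 1 then
    constC k L ϱ - π / (2 * M * z.im) * eulerProd M * eulerProd L + eisNonconst k ψ ϱ z
  else constC k L ϱ + eisNonconst k ψ ϱ z

open Classical in
/-- `E_k^{ψ,ϱ,t}(z)`. -/
def eis {L M : ℕ} [NeZero L] [NeZero M] (k t : ℕ) (ψ : DirichletCharacter ℂ L)
    (ϱ : DirichletCharacter ℂ M) (z : ℍ) : ℂ :=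
  if k = 2 ∧ ψ = 1 ∧ ϱ = 1 then eisBase k ψ ϱ (z : ℂ) - t * eisBase k ψ ϱ (t * (z : ℂ))
  else eisBase k ψ ϱ (t * (z : ℂ))

/-! ### The non-holomorphic Eisenstein series -/

/-- The term `ψ(m) ϱ(n) (mz+n)^{-κ} |mz+n|^{-2s}` for `(m,n) ≠ (0,0)`, and `0` for
`(m,n) = (0,0)`. -/
def nonholTerm {L M : ℕ} (κ : ℤ) (ψ : DirichletCharacter ℂ L) (ϱ : DirichletCharacter ℂ M)
    (z s : ℂ) (p : ℤ × ℤ) : ℂ :=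
  if p = 0 then 0 else
    ψ (p.1 : ZMod L) * ϱ (p.2 : ZMod M) * ((p.1 : ℂ) * z + p.2) ^ (-κ) *
      ((‖(p.1 : ℂ) * z + p.2‖ : ℝ) : ℂ) ^ (-2 * s)

/-- The series defining `E_κ(z, s, ψ, ϱ)` for `κ + 2 Re s > 2`. -/
def nonholSeries {L M : ℕ} (κ : ℤ) (ψ : DirichletCharacter ℂ L) (ϱ : DirichletCharacter ℂ M)
    (z s : ℂ) : ℂ :=
  (1 / 2 : ℂ) * ∑' p : ℤ × ℤ, nonholTerm κ ψ ϱ z s p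

/-- `g` is the meromorphic continuation to `ℂ` of `s ↦ E_κ(z, s, ψ, ϱ)`: it is meromorphic in
normal form (it takes the analytic value wherever its singularity is removable, and the value `0`
at poles; this makes `g` unique) and it is given by the series for `κ + 2 Re s > 2`. -/
def IsContinuation {L M : ℕ} (κ : ℤ) (ψ : DirichletCharacter ℂ L) (ϱ : DirichletCharacter ℂ M)
    (z : ℂ) (g : ℂ → ℂ) : Prop :=
  MeromorphicNFOn g Set.univ ∧ ∀ s : ℂ, 2 < (κ : ℝ) + 2 * s.re → g s = nonholSeries κ ψ ϱ z s

open Classical in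
/-- The meromorphic continuation of `s ↦ E_κ(z, s, ψ, ϱ)` to `ℂ`. -/
def nonholCont {L M : ℕ} (κ : ℤ) (ψ : DirichletCharacter ℂ L) (ϱ : DirichletCharacter ℂ M)
    (z : ℂ) : ℂ → ℂ :=
  if h : ∃ g : ℂ → ℂ, IsContinuation κ ψ ϱ z g then h.choose else 0

/-! ### The harmonic pre-image -/

/-- `y^s E_0(Mz, s, 1_L, 1_M) - t y^s E_0(tMz, s, 1_L, 1_M)`. -/
def regularized (L M t : ℕ) (z : ℍ) (s : ℂ) : ℂ :=
  (z.im : ℂ) ^ s *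
      nonholCont 0 (1 : DirichletCharacter ℂ L) (1 : DirichletCharacter ℂ M) (M * (z : ℂ)) s
    - t * (z.im : ℂ) ^ s *
      nonholCont 0 (1 : DirichletCharacter ℂ L) (1 : DirichletCharacter ℂ M) (t * M * (z : ℂ)) s

open Classical in
/-- The function `𝓔_{2-k}^{ψ,ϱ,t}` on the upper half-plane, for `k ≥ 1`. -/
def preimage {L M : ℕ} (k t : ℕ) (ψ : DirichletCharacter ℂ L) (ϱ : DirichletCharacter ℂ M)
    (z : ℍ) : ℂ :=
  if 2 < k then
    ((k : ℂ) - 1)⁻¹ * (z.im : ℂ) ^ (k - 1) *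
      nonholSeries (2 - (k : ℤ)) (star ψ) ϱ (t * M * (z : ℂ)) ((k : ℂ) - 1)
  else if k = 2 then
    if ψ = 1 ∧ ϱ = 1 then limUnder (𝓝[≠] (1 : ℂ)) (regularized L M t z)
    else (z.im : ℂ) * nonholCont 0 (star ψ) ϱ (t * M * (z : ℂ)) 1
  else deriv (fun s : ℂ => (z.im : ℂ) ^ s * nonholCont 1 (star ψ) ϱ (t * M * (z : ℂ)) s) 0

/-- The character `ψϱ`, as a character mod `tLM`. -/
def prodChar {L M : ℕ} (t : ℕ) (ψ : DirichletCharacter ℂ L) (ϱ : DirichletCharacter ℂ M) :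
    DirichletCharacter ℂ (t * L * M) :=
  DirichletCharacter.changeLevel (Dvd.intro (t * M) (by ring) : L ∣ t * L * M) ψ *
    DirichletCharacter.changeLevel (Dvd.intro_left (t * L) rfl : M ∣ t * L * M) ϱ

end EisPreimage

end

noncomputable section

set_option linter.unusedSectionVars false

namespace EisPreimage

/-! The product ψ(m)ϱ(n) is replaced throughout by an arbitrary function g on pairs of residues, and
the basic object is the lattice sum ½ Σ g(m,n) conj(w)^κ |w|^{-2σ} with w = mz + n, multiplied by
y^{σ-κ}. An element of SL₂(ℤ) permutes the lattice, so up to the automorphy factor it only changes g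
(`latSum_smul`). Hence the behaviour at any cusp is the behaviour at i∞ of the same kind of object,
and every growth statement is proved at i∞ only, but for all g. The dilation z ↦ tMz is absorbed
into g as well (`latSum_scale`), and on the resulting coefficients Γ₀(tLM) acts by a character
(`slashCoeff_scaleCoeff`, `star_prodChar_apply`).

For k > 2 everything converges. The antiholomorphic derivative of y^{k-1} w^{-1} conj(w)^{1-k} is
(i/2)(k-1) y^{k-2} conj(w)^{-k} (`hasWirt_negTerm`), so ξ sends the series term by term to a
holomorphic Eisenstein series, whose q-expansion comes from the Lipschitz formula
(`latSum_conj_eq_xiImage`).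

For k ≤ 2 a continuation is needed. Poisson summation in n along each row, applied under a Mellin
transform, gives the Fourier expansion `latSum_eq_latCont`: two L-functions and a sum of Bessel-type
integrals that decay exponentially. The right-hand side is meromorphic in σ and is the continuation.
At σ = 1 the only possible poles come from the L-functions; they vanish by parity or because g has
total sum 0, and the combination E(Mz) - tE(tMz) in weight two is made so that this sum is 0
(`isEisCoeff_regCoeff`).

At σ = 1 the Bessel integrals are elementary (`besselInt_aux`). In weight 0 the frequencies r > 0
give holomorphic exponentials and r < 0 give conjugates of such; ξ sees the latter only. In weight 1
the value at σ = 1 contains r > 0 only and is holomorphic, which is why the definition takes a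
derivative in s. The differentiated Bessel integral satisfies a first-order differential equation in
y whose inhomogeneous term is present exactly for r < 0 (`hasDerivAt_besselDer`), and ξ extracts
this term.

The coefficients so obtained contain finite Fourier transforms of conj ϱ. These are Gauss sums of a
possibly imprimitive character; `sum_conj_char_mul_stdAddChar` evaluates them and produces the inner
divisor sum of σ_{k-1}^{ψ,ϱ}.

Finally, a real differentiable F with holomorphic ξF is automatically real analytic and annihilated
by Δ (`analytic_and_harmonic`), so neither property has to be read off the expansions. -/

/-! ### Wirtinger calculus -/

/-- The real-linear map `v ↦ a v + b conj v`. -/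
def wirt (a b : ℂ) : ℂ →L[ℝ] ℂ :=
  a • (ContinuousLinearMap.id ℝ ℂ) + b • (Complex.conjCLE : ℂ →L[ℝ] ℂ)

@[simp] lemma wirt_apply (a b v : ℂ) : wirt a b v = a * v + b * conj v := by
  simp [wirt]

/-- `f` is real differentiable at `z`, with `∂f/∂z = a` and `∂f/∂z̄ = b`. -/
def HasWirt (f : ℂ → ℂ) (a b z : ℂ) : Prop := HasFDerivAt (𝕜 := ℝ) f (wirt a b) z

/-- A real-linear map is determined by its values at 1 and i; the coefficients solve a + b = l 1 and
i(a - b) = l i. -/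
lemma clm_eq_wirt (l : ℂ →L[ℝ] ℂ) :
    l = wirt ((l 1 - Complex.I * l Complex.I) / 2) ((l 1 + Complex.I * l Complex.I) / 2) := by
  ext v
  obtain ⟨a, b⟩ := v
  have h : (⟨a, b⟩ : ℂ) = a • (1 : ℂ) + b • Complex.I := by apply Complex.ext <;> simp
  have h1 : conj (⟨a, b⟩ : ℂ) = a - b * Complex.I := by apply Complex.ext <;> simp
  have h2 : (⟨a, b⟩ : ℂ) = a + b * Complex.I := by apply Complex.ext <;> simp
  rw [wirt_apply, h1]
  conv_lhs => rw [h, map_add, map_smul, map_smul]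
  rw [h2]
  simp only [Complex.real_smul]
  linear_combination ((b : ℂ) * l Complex.I) * Complex.I_sq

lemma wirt_norm_le (a b : ℂ) : ‖wirt a b‖ ≤ ‖a‖ + ‖b‖ := by
  refine ContinuousLinearMap.opNorm_le_bound _ (by positivity) fun v => ?_
  rw [wirt_apply]
  refine (norm_add_le _ _).trans ?_
  simp [add_mul]

lemma wirt_add (a b c d : ℂ) : wirt a b + wirt c d = wirt (a + c) (b + d) := by
  ext v; simp; ring

lemma HasWirt.congr {f : ℂ → ℂ} {a b a' b' z : ℂ} (h : HasWirt f a b z) (ha : a = a')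
    (hb : b = b') : HasWirt f a' b' z := by subst ha; subst hb; exact h

lemma hasWirt_of_differentiableAt {f : ℂ → ℂ} {z : ℂ} (h : DifferentiableAt ℝ f z) :
    HasWirt f ((partialX f z - Complex.I * partialY f z) / 2) (partialZbar f z) z := by
  have := h.hasFDerivAt
  rw [clm_eq_wirt (fderiv ℝ f z)] at this
  refine HasWirt.congr this rfl ?_
  simp only [partialZbar, partialX, partialY]; ring

lemma HasWirt.differentiableAt {f : ℂ → ℂ} {a b z : ℂ} (h : HasWirt f a b z) :
    DifferentiableAt ℝ f z := HasFDerivAt.differentiableAt h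

lemma HasWirt.partialX_eq {f : ℂ → ℂ} {a b z : ℂ} (h : HasWirt f a b z) :
    partialX f z = a + b := by
  rw [partialX, HasFDerivAt.fderiv h]; simp

lemma HasWirt.partialY_eq {f : ℂ → ℂ} {a b z : ℂ} (h : HasWirt f a b z) :
    partialY f z = Complex.I * (a - b) := by
  rw [partialY, HasFDerivAt.fderiv h]; simp; ring

lemma HasWirt.partialZbar_eq {f : ℂ → ℂ} {a b z : ℂ} (h : HasWirt f a b z) :
    partialZbar f z = b := by
  rw [partialZbar, h.partialX_eq, h.partialY_eq]
  linear_combination ((a - b) / 2) * Complex.I_sq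

lemma HasWirt.add {f g : ℂ → ℂ} {a b c d z : ℂ} (hf : HasWirt f a b z) (hg : HasWirt g c d z) :
    HasWirt (fun w => f w + g w) (a + c) (b + d) z := by
  have := HasFDerivAt.add hf hg
  rw [wirt_add] at this
  exact this

lemma HasWirt.mul {f g : ℂ → ℂ} {a b c d z : ℂ} (hf : HasWirt f a b z) (hg : HasWirt g c d z) :
    HasWirt (fun w => f w * g w) (f z * c + g z * a) (f z * d + g z * b) z := by
  have h := HasFDerivAt.mul hf hg
  refine HasFDerivAt.congr_fderiv h ?_
  ext v; simp; ring

lemma HasDerivAt.hasWirt {f : ℂ → ℂ} {a z : ℂ} (h : HasDerivAt f a z) : HasWirt f a 0 z := by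
  have h1 := h.hasFDerivAt.restrictScalars ℝ
  refine HasFDerivAt.congr_fderiv h1 ?_
  ext v; simp; ring

/-- The Cauchy–Riemann equations: without the conj v part the real derivative is complex linear. -/
lemma HasWirt.hasDerivAt {f : ℂ → ℂ} {a b z : ℂ} (h : HasWirt f a b z) (hb : b = 0) :
    HasDerivAt f a z := by
  subst hb
  rw [hasDerivAt_iff_hasFDerivAt]
  refine hasFDerivAt_of_restrictScalars ℝ h ?_
  ext v; simp; ring

lemma hasWirt_const (c z : ℂ) : HasWirt (fun _ => c) 0 0 z :=
  HasDerivAt.hasWirt (hasDerivAt_const z c)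

lemma HasWirt.const_mul {f : ℂ → ℂ} {a b z : ℂ} (c : ℂ) (hf : HasWirt f a b z) :
    HasWirt (fun w => c * f w) (c * a) (c * b) z :=
  ((hasWirt_const c z).mul hf).congr (by ring) (by ring)

lemma HasWirt.conj {f : ℂ → ℂ} {a b z : ℂ} (hf : HasWirt f a b z) :
    HasWirt (fun w => conj (f w)) (conj b) (conj a) z := by
  have h := (Complex.conjCLE : ℂ →L[ℝ] ℂ).hasFDerivAt.comp z hf
  refine HasFDerivAt.congr_fderiv h ?_
  ext v; simp; ring

lemma hasWirt_im (z : ℂ) : HasWirt (fun w => (w.im : ℂ)) (-Complex.I / 2) (Complex.I / 2) z := by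
  have h := (Complex.ofRealCLM.comp Complex.imCLM).hasFDerivAt (x := z)
  refine HasFDerivAt.congr_fderiv h ?_
  ext v
  have : ((v.im : ℝ) : ℂ) = (v - (starRingEnd ℂ) v) / (2 * Complex.I) := by
    rw [Complex.sub_conj]; field_simp; push_cast; ring
  simp only [ContinuousLinearMap.comp_apply, Complex.imCLM_apply, Complex.ofRealCLM_apply,
    wirt_apply, this]
  field_simp
  linear_combination (v - (starRingEnd ℂ) v) * Complex.I_sq

lemma HasWirt.scomp {h f : ℂ → ℂ} {h' a b z : ℂ} (hh : HasDerivAt h h' (f z))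
    (hf : HasWirt f a b z) : HasWirt (fun w => h (f w)) (h' * a) (h' * b) z := by
  have := (hh.hasFDerivAt.restrictScalars ℝ).comp z hf
  refine HasFDerivAt.congr_fderiv this ?_
  ext v; simp; ring

/-- The conjugate of h' in the second coefficient is what makes ξ change the weight from κ to 2 - κ.
-/
lemma HasWirt.comp_hol {h f : ℂ → ℂ} {h' a b z : ℂ} (hf : HasWirt f a b (h z))
    (hh : HasDerivAt h h' z) :
    HasWirt (fun w => f (h w)) (a * h') (b * (starRingEnd ℂ) h') z := by
  have := HasFDerivAt.comp z hf (hh.hasFDerivAt.restrictScalars ℝ)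
  refine HasFDerivAt.congr_fderiv this ?_
  ext v; simp; ring

lemma hasWirt_comp_im {φ : ℝ → ℂ} {φ' z : ℂ} (h : HasDerivAt φ φ' z.im) :
    HasWirt (fun w => φ w.im) (-Complex.I / 2 * φ') (Complex.I / 2 * φ') z := by
  have h0 := HasFDerivAt.comp z h.hasFDerivAt (Complex.imCLM.hasFDerivAt (x := z))
  refine HasFDerivAt.congr_fderiv h0 ?_
  ext v
  have : ((v.im : ℝ) : ℂ) = (v - (starRingEnd ℂ) v) / (2 * Complex.I) := by
    rw [Complex.sub_conj]; field_simp; push_cast; ring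
  simp only [ContinuousLinearMap.comp_apply, Complex.imCLM_apply,
    wirt_apply, ContinuousLinearMap.toSpanSingleton_apply, Complex.real_smul, this]
  field_simp
  linear_combination (φ' * (v - (starRingEnd ℂ) v)) * Complex.I_sq

lemma HasWirt.congr_of_eventuallyEq {f g : ℂ → ℂ} {a b z : ℂ} (hf : HasWirt f a b z)
    (h : g =ᶠ[𝓝 z] f) : HasWirt g a b z := HasFDerivAt.congr_of_eventuallyEq hf h

/-- Termwise differentiation for series whose terms are neither holomorphic nor antiholomorphic; the
two Wirtinger derivatives together bound the operator norm of the real derivative. -/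
lemma hasWirt_tsum {ι : Type*} {u : ι → ℝ} (hu : Summable u) {s : Set ℂ} (hs : IsOpen s)
    (hs' : IsPreconnected s) {f a b : ι → ℂ → ℂ}
    (hf : ∀ i, ∀ z ∈ s, HasWirt (f i) (a i z) (b i z) z)
    (hbd : ∀ i, ∀ z ∈ s, ‖a i z‖ + ‖b i z‖ ≤ u i) {z₀ : ℂ} (hz₀ : z₀ ∈ s)
    (hsum : Summable fun i => f i z₀) {z : ℂ} (hz : z ∈ s) :
    HasWirt (fun w => ∑' i, f i w) (∑' i, a i z) (∑' i, b i z) z := by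
  have h := hasFDerivAt_tsum_of_isPreconnected hu hs hs' hf
    (fun i w hw => (wirt_norm_le _ _).trans (hbd i w hw)) hz₀ hsum hz
  refine HasFDerivAt.congr_fderiv h ?_
  have h1 : Summable fun i => a i z := hu.of_norm_bounded
    fun i => (le_add_of_nonneg_right (norm_nonneg _)).trans (hbd i z hz)
  have h2 : Summable fun i => b i z := hu.of_norm_bounded
    fun i => (le_add_of_nonneg_left (norm_nonneg _)).trans (hbd i z hz)
  have h3 : Summable fun i => wirt (a i z) (b i z) := hu.of_norm_bounded
    fun i => (wirt_norm_le _ _).trans (hbd i z hz)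
  ext v
  have h4 : (∑' i, wirt (a i z) (b i z)) v = ∑' i, wirt (a i z) (b i z) v :=
    (ContinuousLinearMap.apply ℝ ℂ v).map_tsum h3
  rw [h4, wirt_apply, ← tsum_mul_right, ← tsum_mul_right,
    ← Summable.tsum_add (h1.mul_right _) (h2.mul_right _)]
  simp

/-! ### Real analyticity -/

open Metric in
/-- Integration along a circle, as a functional on the continuous functions on this circle. -/
lemma exists_circle_functional (c : ℂ) {r : ℝ} (hr : 0 < r) :
    ∃ Λ : C(sphere c r, ℂ) →L[ℂ] ℂ, ∀ (h : C(sphere c r, ℂ)) (f : ℂ → ℂ),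
      (∀ ζ : sphere c r, h ζ = f ζ) → Λ h = ∮ ζ in C(c, r), f ζ := by
  let pt : ℝ → sphere c r := fun θ => ⟨circleMap c r θ, circleMap_mem_sphere c hr.le θ⟩
  have hpt : Continuous pt := (continuous_circleMap c r).subtype_mk _
  have hcont : ∀ h : C(sphere c r, ℂ), Continuous fun θ => deriv (circleMap c r) θ * h (pt θ) := by
    intro h
    have : Continuous (deriv (circleMap c r)) := by
      simp only [funext (deriv_circleMap c r)]
      fun_prop
    exact this.mul (h.continuous.comp hpt)
  let Λ₀ : C(sphere c r, ℂ) →ₗ[ℂ] ℂ :=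
    { toFun := fun h => ∫ θ in (0:ℝ)..2 * π, deriv (circleMap c r) θ * h (pt θ)
      map_add' := fun h₁ h₂ => by
        rw [← intervalIntegral.integral_add ((hcont h₁).intervalIntegrable _ _)
          ((hcont h₂).intervalIntegrable _ _)]
        simp [mul_add]
      map_smul' := fun a h => by
        simp only [ContinuousMap.coe_smul, Pi.smul_apply, smul_eq_mul, RingHom.id_apply,
          ← intervalIntegral.integral_const_mul]
        congr 1; ext θ; ring }
  refine ⟨Λ₀.mkContinuous (r * |2 * π - 0|) fun h => ?_, fun h f hf => ?_⟩
  · have := intervalIntegral.norm_integral_le_of_norm_le_const (a := (0:ℝ)) (b := 2 * π)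
      (f := fun θ => deriv (circleMap c r) θ * h (pt θ)) (C := r * ‖h‖) fun θ _ => by
        rw [norm_mul]
        refine mul_le_mul (le_of_eq ?_) (h.norm_coe_le_norm _) (norm_nonneg _) hr.le
        simp [deriv_circleMap, abs_of_pos hr]
    calc _ ≤ _ := this
      _ = _ := by ring
  · change ∫ θ in (0:ℝ)..2 * π, deriv (circleMap c r) θ * h (pt θ) = _
    rw [circleIntegral]
    congr 1; ext θ
    rw [hf]; rfl

/-- The upper half plane, as a subset of `ℂ`. -/
abbrev upperHalf : Set ℂ := {z : ℂ | 0 < z.im}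

lemma isOpen_upperHalf : IsOpen upperHalf := isOpen_lt continuous_const Complex.continuous_im

lemma closedBall_subset_upperHalf (c : upperHalf) :
    Metric.closedBall (c : ℂ) ((c : ℂ).im / 2) ⊆ upperHalf := by
  intro z hz
  rw [Metric.mem_closedBall, dist_eq_norm] at hz
  have h1 := (Complex.abs_im_le_norm (z - c)).trans hz
  have h2 := c.2
  simp only [Set.mem_ofPred_eq, Complex.sub_im] at h1 h2 ⊢
  have := (abs_le.1 h1).1
  linarith

-- The kernel is y^{-κ} with conj z replaced by an independent variable w. Its values on a circle
-- are treated as one element of the Banach algebra of continuous functions, so holomorphy in w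
-- follows from that of inversion and powers in this algebra, with no estimate uniform in ζ.
open Metric in
lemma exists_kernel_family (κ : ℤ) (c : upperHalf) :
    ∃ Q : ℂ → C(sphere (c : ℂ) ((c : ℂ).im / 2), ℂ),
      DifferentiableOn ℂ Q {w | w.im < 0} ∧ ∀ w : ℂ, w.im < 0 → ∀ ζ,
        Q w ζ = (((ζ : ℂ) - w) / (2 * Complex.I)) ^ (-κ) := by
  set K := sphere (c : ℂ) ((c : ℂ).im / 2)
  let idK : C(K, ℂ) := ⟨fun ζ => ζ, continuous_subtype_val⟩
  let T : ℂ → C(K, ℂ) := fun w => (2 * Complex.I)⁻¹ • (idK - w • 1)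
  have hT : ∀ w ζ, T w ζ = ((ζ : ℂ) - w) / (2 * Complex.I) := by
    intro w ζ
    simp only [T, idK, ContinuousMap.smul_apply, ContinuousMap.sub_apply, ContinuousMap.coe_mk,
      ContinuousMap.one_apply, smul_eq_mul, mul_one, div_eq_inv_mul]
  have hTd : Differentiable ℂ T := by
    intro w; fun_prop
  have hne : ∀ w : ℂ, w.im < 0 → ∀ ζ : K, ((ζ : ℂ) - w) / (2 * Complex.I) ≠ 0 := by
    intro w hw ζ h
    rw [div_eq_zero_iff] at h
    rcases h with h | h
    · have h1 := closedBall_subset_upperHalf c (sphere_subset_closedBall ζ.2)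
      have h2 := congrArg Complex.im h
      simp at h1 h2
      linarith
    · simp at h
  have hu : ∀ w : ℂ, w.im < 0 → IsUnit (T w) := by
    intro w hw
    rw [ContinuousMap.isUnit_iff_forall_ne_zero]
    intro ζ; rw [hT]; exact hne w hw ζ
  obtain ⟨n, rfl | rfl⟩ := Int.eq_nat_or_neg κ
  · refine ⟨fun w => (Ring.inverse (T w)) ^ n, ?_, ?_⟩
    · intro w hw
      have h1 : DifferentiableAt ℂ Ring.inverse (T w) :=
        (analyticAt_inverse (𝕜 := ℂ) (hu w hw).unit).differentiableAt
      exact ((DifferentiableAt.comp w h1 (hTd w)).pow n).differentiableWithinAt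
    · intro w hw ζ
      have h1 : Ring.inverse (T w) ζ * T w ζ = 1 := by
        have := Ring.inverse_mul_cancel _ (hu w hw)
        exact congrArg (fun h : C(K, ℂ) => h ζ) this
      rw [ContinuousMap.pow_apply, zpow_neg, zpow_natCast, ← inv_pow, ← hT]
      congr 1
      exact eq_inv_of_mul_eq_one_left h1
  · refine ⟨fun w => (T w) ^ n, (hTd.pow n).differentiableOn, fun w hw ζ => ?_⟩
    rw [ContinuousMap.pow_apply, hT, neg_neg, zpow_natCast]

open Metric in
/-- A function whose `∂/∂z̄`-derivative is `(i/2) y^{-κ} conj g` with holomorphic `g` is real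
analytic. -/
lemma analyticOnNhd_of_hasWirt (κ : ℤ) {f a g : ℂ → ℂ} (hg : DifferentiableOn ℂ g upperHalf)
    (hf : ∀ z ∈ upperHalf,
      HasWirt f (a z) (Complex.I / 2 * (z.im : ℂ) ^ (-κ) * conj (g z)) z) :
    AnalyticOnNhd ℝ f upperHalf := by
  intro z₀ hz₀
  set c : upperHalf := ⟨z₀, hz₀⟩
  set r : ℝ := z₀.im / 2 with hr_def
  have hr : 0 < r := half_pos hz₀
  set K := sphere z₀ r
  obtain ⟨Q, hQd, hQ⟩ := exists_kernel_family κ c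
  obtain ⟨Λ, hΛ⟩ := exists_circle_functional z₀ hr
  have hcb : closedBall z₀ r ⊆ upperHalf := closedBall_subset_upperHalf c
  have hbl : ∀ w ∈ ball (conj z₀) r, conj w ∈ ball z₀ r := by
    intro w hw
    rw [mem_ball, dist_eq_norm] at hw ⊢
    rw [← Complex.norm_conj]
    simpa using hw
  have hbl' : ∀ w ∈ ball (conj z₀) r, w.im < 0 := by
    intro w hw
    have := hcb (ball_subset_closedBall (hbl w hw))
    simpa using this
  -- the antiholomorphic conjugate of `g`
  have hgc : DifferentiableOn ℂ (fun w => conj (g (conj w))) (ball (conj z₀) r) := by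
    intro w hw
    have h1 : DifferentiableAt ℂ g (conj w) :=
      hg.differentiableAt (isOpen_upperHalf.mem_nhds (hcb (ball_subset_closedBall (hbl w hw))))
    have h2 := h1.conj_conj
    rw [Complex.conj_conj] at h2
    exact h2.differentiableWithinAt
  -- Polarisation: with w in place of conj z the prescribed derivative becomes holomorphic in both
  -- variables, since y turns into (ζ - w)/2i and conj(g(z)) into conj(g(conj w)).
  let q : ℂ → C(K, ℂ) := fun w => (Complex.I / 2 * conj (g (conj w))) • Q w
  have hq : DifferentiableOn ℂ q (ball (conj z₀) r) :=
    (hgc.const_mul _).smul (hQd.mono hbl')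
  -- A Banach-valued holomorphic function on a disc has a primitive; this integrates in w
  -- simultaneously for all ζ on the circle.
  obtain ⟨A, hA⟩ := hq.isExactOn_ball
  have hAan : ∀ w ∈ ball (conj z₀) r, AnalyticAt ℂ A w := by
    intro w hw
    have : DifferentiableOn ℂ A (ball (conj z₀) r) := fun w hw =>
      (hA w hw).differentiableAt.differentiableWithinAt
    exact this.analyticAt (isOpen_ball.mem_nhds hw)
  let idK : C(K, ℂ) := ⟨fun ζ => ζ, continuous_subtype_val⟩
  let R : ℂ → C(K, ℂ) := fun z => Ring.inverse (idK - z • 1)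
  have hRu : ∀ z ∈ ball z₀ r, IsUnit (idK - z • 1) := by
    intro z hz
    rw [ContinuousMap.isUnit_iff_forall_ne_zero]
    intro ζ h
    have h1 : (ζ : ℂ) = z := by simpa [idK, sub_eq_zero] using h
    have h2 := ζ.2
    rw [h1, mem_sphere] at h2
    rw [mem_ball] at hz
    exact hz.ne h2
  have hRan : ∀ z ∈ ball z₀ r, AnalyticAt ℂ R z := by
    intro z hz
    have h1 : AnalyticAt ℂ Ring.inverse (idK - z • 1) :=
      analyticAt_inverse (𝕜 := ℂ) (hRu z hz).unit
    have h2 : AnalyticAt ℂ (fun z : ℂ => idK - z • (1 : C(K, ℂ))) z :=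
      analyticAt_const.sub (analyticAt_id.smul analyticAt_const)
    exact h1.comp_of_eq h2 rfl
  have hRv : ∀ z ∈ ball z₀ r, ∀ ζ, R z ζ = ((ζ : ℂ) - z)⁻¹ := by
    intro z hz ζ
    have := congrArg (fun h : C(K, ℂ) => h ζ) (Ring.inverse_mul_cancel _ (hRu z hz))
    have h2 : R z ζ * ((ζ : ℂ) - z) = 1 := by simpa [idK, R] using this
    exact eq_inv_of_mul_eq_one_left h2
  -- Cauchy's integral carries the boundary values A(w) into the disc. Joint analyticity in (z, w)
  -- is immediate, as P is a continuous functional of a product of two analytic maps.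
  let P : ℂ × ℂ → ℂ := fun p => (2 * π * Complex.I : ℂ)⁻¹ * Λ (R p.1 * A p.2)
  have hPan : ∀ z ∈ ball z₀ r, ∀ w ∈ ball (conj z₀) r, AnalyticAt ℂ P (z, w) := by
    intro z hz w hw
    have h1 : AnalyticAt ℂ (fun p : ℂ × ℂ => R p.1) (z, w) :=
      (hRan z hz).comp_of_eq analyticAt_fst rfl
    have h2 : AnalyticAt ℂ (fun p : ℂ × ℂ => A p.2) (z, w) :=
      (hAan w hw).comp_of_eq analyticAt_snd rfl
    exact analyticAt_const.mul ((Λ.analyticAt _).comp (h1.mul h2))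
  have hPw : ∀ z ∈ ball z₀ r, ∀ w ∈ ball (conj z₀) r, HasDerivAt (fun w => P (z, w))
      (Complex.I / 2 * conj (g (conj w)) * ((z - w) / (2 * Complex.I)) ^ (-κ)) w := by
    intro z hz w hw
    have h1 : HasDerivAt (fun w => Λ (R z * A w)) (Λ (R z * q w)) w :=
      Λ.hasFDerivAt.comp_hasDerivAt w ((hA w hw).const_mul (R z))
    have h2 := h1.const_mul (2 * π * Complex.I : ℂ)⁻¹
    refine h2.congr_deriv ?_
    have h3 := hΛ (R z * q w) (fun ζ => (ζ - z)⁻¹ • (Complex.I / 2 * conj (g (conj w)) *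
        ((ζ - w) / (2 * Complex.I)) ^ (-κ))) (fun ζ => by
      rw [ContinuousMap.mul_apply, hRv z hz]
      simp only [q, ContinuousMap.smul_apply, smul_eq_mul]
      rw [hQ w (hbl' w hw)])
    rw [h3]
    have h4 : DifferentiableOn ℂ (fun ζ => Complex.I / 2 * conj (g (conj w)) *
        ((ζ - w) / (2 * Complex.I)) ^ (-κ)) (closedBall z₀ r) := by
      intro ζ hζ
      refine (DifferentiableAt.const_mul ?_ _).differentiableWithinAt
      refine DifferentiableAt.zpow (by fun_prop) (Or.inl ?_)
      intro h
      rw [div_eq_zero_iff] at h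
      rcases h with h | h
      · have h1 := hcb hζ
        have h2 := congrArg Complex.im h
        have h3 := hbl' w hw
        simp at h1 h2
        linarith
      · simp at h
    have h5 := (h4.mono closure_ball_subset_closedBall).diffContOnCl
    have h6 := h5.two_pi_i_inv_smul_circleIntegral_sub_inv_smul hz
    rw [smul_eq_mul] at h6
    exact h6
  -- the particular solution
  let p : ℂ → ℂ := fun z => P (z, conj z)
  have hcz : ∀ z ∈ ball z₀ r, conj z ∈ ball (conj z₀) r := by
    intro z hz
    rw [mem_ball, dist_eq_norm] at hz ⊢
    rw [← Complex.norm_conj]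
    simpa using hz
  have hpan : ∀ z ∈ ball z₀ r, AnalyticAt ℝ p z := by
    intro z hz
    have h1 := (hPan z hz _ (hcz z hz)).restrictScalars (𝕜 := ℝ)
    have h2 : AnalyticAt ℝ (fun z : ℂ => (z, conj z)) z :=
      analyticAt_id.prod ((Complex.conjCLE : ℂ →L[ℝ] ℂ).analyticAt z)
    exact h1.comp_of_eq h2 rfl
  have hpw : ∀ z ∈ ball z₀ r, ∃ a', HasWirt p a'
      (Complex.I / 2 * (z.im : ℂ) ^ (-κ) * conj (g z)) z := by
    intro z hz
    have hd := (hPan z hz _ (hcz z hz)).differentiableAt.hasFDerivAt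
    set D := fderiv ℂ P (z, conj z)
    have h1 : HasFDerivAt (𝕜 := ℝ) (fun z : ℂ => (z, conj z))
        ((ContinuousLinearMap.id ℝ ℂ).prod (Complex.conjCLE : ℂ →L[ℝ] ℂ)) z :=
      (hasFDerivAt_id z).prodMk (Complex.conjCLE : ℂ →L[ℝ] ℂ).hasFDerivAt
    have h2 := HasFDerivAt.comp z (hd.restrictScalars ℝ) h1
    have h3 : D (0, 1) = Complex.I / 2 * (z.im : ℂ) ^ (-κ) * conj (g z) := by
      have h4 : HasDerivAt (fun w : ℂ => (z, w)) (0, 1) (conj z) :=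
        (hasDerivAt_const _ _).prodMk (hasDerivAt_id _)
      have h5 : HasDerivAt (fun w => P (z, w)) (D (0, 1)) (conj z) :=
        HasFDerivAt.comp_hasDerivAt (f := fun w : ℂ => (z, w)) (conj z) hd h4
      rw [h5.unique (hPw z hz _ (hcz z hz)), Complex.conj_conj, Complex.sub_conj]
      have : (((2 * z.im : ℝ) : ℂ) * Complex.I) / (2 * Complex.I) = z.im := by
        push_cast; field_simp
      rw [this]; ring
    refine ⟨D (1, 0), ?_⟩
    rw [← h3]
    refine HasFDerivAt.congr_fderiv h2 ?_
    ext v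
    have h6 : ((v, conj v) : ℂ × ℂ) = v • ((1, 0) : ℂ × ℂ) + conj v • ((0, 1) : ℂ × ℂ) := by
      simp
    simp only [ContinuousLinearMap.comp_apply, ContinuousLinearMap.prod_apply,
      ContinuousLinearMap.coe_restrictScalars', ContinuousLinearMap.id_apply, wirt_apply]
    change D (v, conj v) = _
    rw [h6, map_add, map_smul, map_smul, smul_eq_mul, smul_eq_mul]
    ring
  -- f and p have the same antiholomorphic derivative, so their difference is holomorphic.
  have hdiff : DifferentiableOn ℂ (fun z => f z + (-1) * p z) (ball z₀ r) := by
    intro z hz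
    obtain ⟨a', ha'⟩ := hpw z hz
    have h1 := (hf z (hcb (ball_subset_closedBall hz))).add (ha'.const_mul (-1))
    exact (h1.hasDerivAt (by ring)).differentiableAt.differentiableWithinAt
  have h1 := (hdiff.analyticAt (isOpen_ball.mem_nhds (mem_ball_self hr))).restrictScalars (𝕜 := ℝ)
  have h2 := h1.add (hpan z₀ (mem_ball_self hr))
  refine h2.congr (Eventually.of_forall fun z => ?_)
  simp

/-! ### The operators `ξ_κ` and `Δ_κ` -/

lemma comp_ofComplex_eventuallyEq {F : ℍ → ℂ} {f : ℂ → ℂ} (h : ∀ z : ℍ, F z = f z) {z : ℂ}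
    (hz : z ∈ upperHalf) : F ∘ ofComplex =ᶠ[𝓝 z] f := by
  filter_upwards [isOpen_upperHalf.mem_nhds hz] with w hw
  rw [Function.comp_apply, ofComplex_apply_of_im_pos hw, h]

lemma xi_eq_of_hasWirt {κ : ℤ} {F : ℍ → ℂ} {z : ℍ} {a b : ℂ}
    (h : HasWirt (F ∘ ofComplex) a b z) :
    xi κ F z = 2 * Complex.I * (z.im : ℂ) ^ κ * conj b := by
  rw [xi, h.partialZbar_eq]

lemma im_ofReal_ne_zero (z : ℍ) : (z.im : ℂ) ≠ 0 := Complex.ofReal_ne_zero.2 z.im_ne_zero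

lemma hasWirt_of_xi {κ : ℤ} {F : ℍ → ℂ} {z : ℍ}
    (h : DifferentiableAt ℝ (F ∘ ofComplex) z) :
    HasWirt (F ∘ ofComplex)
      ((partialX (F ∘ ofComplex) z - Complex.I * partialY (F ∘ ofComplex) z) / 2)
      (Complex.I / 2 * (z.im : ℂ) ^ (-κ) * conj (xi κ F z)) z := by
  refine (hasWirt_of_differentiableAt h).congr rfl ?_
  rw [xi]
  simp only [map_mul, map_zpow₀, Complex.conj_ofReal, Complex.conj_I, Complex.conj_conj, map_ofNat]
  rw [zpow_neg]
  have := zpow_ne_zero κ (im_ofReal_ne_zero z)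
  field_simp
  linear_combination (partialZbar (F ∘ ofComplex) z) * Complex.I_sq

/-- The Laplacian is 4 ∂_z ∂_z̄. Analyticity supplies the symmetry of the second derivative by which
the mixed terms cancel. -/
lemma partials_of_analyticAt {f : ℂ → ℂ} {z A B : ℂ} (hf : AnalyticAt ℝ f z)
    (hb : HasWirt (partialZbar f) A B z) :
    partialX (partialX f) z + partialY (partialY f) z = 4 * A := by
  have hD : DifferentiableAt ℝ (fderiv ℝ f) z := hf.fderiv.differentiableAt
  have hsymm : IsSymmSndFDerivAt ℝ f z :=
    ContDiffAt.isSymmSndFDerivAt (n := ⊤) hf.contDiffAt (by simp)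
  have hap : ∀ v w : ℂ, fderiv ℝ (fun z => fderiv ℝ f z v) z w
      = fderiv ℝ (fderiv ℝ f) z w v := by
    intro v w
    rw [fderiv_clm_apply hD (differentiableAt_const v)]
    simp
  have hda : ∀ v : ℂ, DifferentiableAt ℝ (fun z => fderiv ℝ f z v) z := fun v =>
    hD.clm_apply (differentiableAt_const v)
  have hbw : ∀ w : ℂ, fderiv ℝ (partialZbar f) z w = (1 / 2 : ℂ) *
      (fderiv ℝ (fderiv ℝ f) z w 1 + Complex.I * fderiv ℝ (fderiv ℝ f) z w Complex.I) := by
    intro w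
    have h1 := (((hda 1).hasFDerivAt.add
      ((hda Complex.I).hasFDerivAt.const_mul Complex.I)).const_mul (1 / 2 : ℂ))
    have h2 : HasFDerivAt (𝕜 := ℝ) (partialZbar f) _ z := h1
    rw [h2.fderiv]
    simp only [smul_apply, add_apply, smul_eq_mul, hap]
  have hX := hb.partialX_eq
  have hY := hb.partialY_eq
  rw [partialX, hbw] at hX
  rw [partialY, hbw] at hY
  have hs := hsymm.eq 1 Complex.I
  change fderiv ℝ (fun z => fderiv ℝ f z 1) z 1
    + fderiv ℝ (fun z => fderiv ℝ f z Complex.I) z Complex.I = _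
  rw [hap, hap]
  linear_combination 2 * hX - 2 * Complex.I * hY - Complex.I * hs
    + (fderiv ℝ (fderiv ℝ f) z Complex.I Complex.I - 2 * (A - B)) * Complex.I_sq

/-- A real differentiable function with holomorphic image under `ξ_κ` is real analytic and
annihilated by `Δ_κ`. -/
lemma analytic_and_harmonic {κ : ℤ} {F : ℍ → ℂ} {G : ℂ → ℂ}
    (hF : ∀ z : ℍ, DifferentiableAt ℝ (F ∘ ofComplex) z)
    (hG : DifferentiableOn ℂ G upperHalf) (hFG : ∀ z : ℍ, xi κ F z = G z) :
    AnalyticOnNhd ℝ (F ∘ ofComplex) upperHalf ∧ ∀ z : ℍ, hypLaplacian κ F z = 0 := by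
  set f := F ∘ ofComplex
  have hw : ∀ z ∈ upperHalf,
      HasWirt f ((partialX f z - Complex.I * partialY f z) / 2)
        (Complex.I / 2 * (z.im : ℂ) ^ (-κ) * conj (G z)) z := by
    intro z hz
    have := hasWirt_of_xi (κ := κ) (hF ⟨z, hz⟩)
    rw [hFG] at this
    exact this
  have han := analyticOnNhd_of_hasWirt κ hG hw
  refine ⟨han, fun z => ?_⟩
  have hz : (z : ℂ) ∈ upperHalf := z.im_pos
  have hG' : HasDerivAt G (deriv G z) z :=
    (hG.differentiableAt (isOpen_upperHalf.mem_nhds hz)).hasDerivAt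
  have hpow : HasDerivAt (fun y : ℝ => (y : ℂ) ^ (-κ))
      (((-κ : ℤ) : ℂ) * (z.im : ℂ) ^ (-κ - 1)) (z : ℂ).im := by
    have h1 := (hasDerivAt_zpow (-κ) ((z : ℂ).im : ℂ) (Or.inl (im_ofReal_ne_zero z)))
    exact h1.comp_ofReal
  -- In ∂_z(y^{-κ} conj G) only the power of y is differentiated, as conj G is antiholomorphic. So
  -- the second-order part of Δ_κ is -κ y^{1-κ} conj G, the negative of the first-order part.
  have h1 := ((hasWirt_comp_im hpow).const_mul (Complex.I / 2)).mul
    (HasDerivAt.hasWirt hG').conj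
  have h2 : HasWirt (partialZbar f) _ _ z := h1.congr_of_eventuallyEq (by
    filter_upwards [isOpen_upperHalf.mem_nhds hz] with w hw'
    exact (hw w hw').partialZbar_eq)
  have h3 := partials_of_analyticAt (han z hz) h2
  have h4 := (hw z hz).partialZbar_eq
  rw [partialZbar] at h4
  have h5 : partialX f z + Complex.I * partialY f z
      = Complex.I * (z.im : ℂ) ^ (-κ) * conj (G z) := by
    simp only [UpperHalfPlane.coe_im] at h4
    linear_combination 2 * h4
  rw [hypLaplacian]
  change _ * (partialX (partialX f) z + partialY (partialY f) z) - _ * _ * _ * 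
    (partialX f z + Complex.I * partialY f z) = 0
  rw [h3, h5, zpow_sub_one₀ (im_ofReal_ne_zero z)]
  have := im_ofReal_ne_zero z
  simp only [UpperHalfPlane.coe_im, map_zero, mul_zero, zero_add]
  push_cast
  field_simp
  ring

lemma coe_smul_eq (γ : SL(2, ℤ)) (z : ℍ) : ((γ • z : ℍ) : ℂ)
    = ((γ 0 0 : ℂ) * z + (γ 0 1 : ℂ)) / ((γ 1 0 : ℂ) * z + (γ 1 1 : ℂ)) := by
  rw [UpperHalfPlane.coe_specialLinearGroup_apply]
  simp

lemma denom_eq (γ : SL(2, ℤ)) (z : ℍ) :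
    denom γ z = (γ 1 0 : ℂ) * z + (γ 1 1 : ℂ) := by
  simp [denom]

lemma denom_ne_zero' (γ : SL(2, ℤ)) {z : ℂ} (hz : z ∈ upperHalf) :
    (γ 1 0 : ℂ) * z + (γ 1 1 : ℂ) ≠ 0 := by
  have := denom_ne_zero γ (⟨z, hz⟩ : ℍ)
  rwa [denom_eq] at this

lemma det_eq_one (γ : SL(2, ℤ)) :
    (γ 0 0 : ℂ) * (γ 1 1 : ℂ) - (γ 0 1 : ℂ) * (γ 1 0 : ℂ) = 1 := by
  have h := γ.det_coe
  rw [Matrix.det_fin_two] at h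
  exact_mod_cast h

/-- Chain rule: the Möbius map has derivative j^{-2} because the determinant is 1, and j^{-κ} is
holomorphic, so it is a mere factor. -/
lemma hasWirt_slash {κ : ℤ} {F : ℍ → ℂ} (γ : SL(2, ℤ)) (z : ℍ)
    (hF : DifferentiableAt ℝ (F ∘ ofComplex) (γ • z : ℍ)) :
    ∃ a, HasWirt ((F ∣[κ] γ) ∘ ofComplex) a
      (partialZbar (F ∘ ofComplex) (γ • z : ℍ) * conj ((((γ 1 0 : ℂ) * z + (γ 1 1 : ℂ)) ^ 2)⁻¹)
        * ((γ 1 0 : ℂ) * z + (γ 1 1 : ℂ)) ^ (-κ)) z := by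
  have hz : (z : ℂ) ∈ upperHalf := z.im_pos
  set j : ℂ → ℂ := fun w => (γ 1 0 : ℂ) * w + (γ 1 1 : ℂ) with hj
  set h : ℂ → ℂ := fun w => ((γ 0 0 : ℂ) * w + (γ 0 1 : ℂ)) / j w with hh
  have hjz : j z ≠ 0 := denom_ne_zero' γ hz
  have hjd : HasDerivAt j (γ 1 0 : ℂ) z := by
    exact (((hasDerivAt_id (z : ℂ)).const_mul (γ 1 0 : ℂ)).add_const (γ 1 1 : ℂ)).congr_deriv
      (mul_one _)
  have hnd : HasDerivAt (fun w : ℂ => (γ 0 0 : ℂ) * w + (γ 0 1 : ℂ)) (γ 0 0 : ℂ) z := by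
    exact (((hasDerivAt_id (z : ℂ)).const_mul (γ 0 0 : ℂ)).add_const (γ 0 1 : ℂ)).congr_deriv
      (mul_one _)
  have hhd : HasDerivAt h (((j z) ^ 2)⁻¹) z := by
    refine (hnd.div hjd hjz).congr_deriv ?_
    rw [inv_eq_one_div]
    congr 1
    simp only [hj]
    linear_combination det_eq_one γ
  have hp : HasDerivAt (fun w => j w ^ (-κ)) _ z :=
    (hasDerivAt_zpow (-κ) (j z) (Or.inl hjz)).comp (z : ℂ) hjd
  have hγz : ((γ • z : ℍ) : ℂ) = h z := coe_smul_eq γ z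
  have hFw := hasWirt_of_differentiableAt hF
  rw [hγz] at hFw ⊢
  have h1 := (hFw.comp_hol hhd).mul (HasDerivAt.hasWirt hp)
  refine ⟨_, (h1.congr_of_eventuallyEq ?_).congr rfl ?_⟩
  · filter_upwards [isOpen_upperHalf.mem_nhds hz] with w hw
    rw [Function.comp_apply, ofComplex_apply_of_im_pos hw, ModularForm.SL_slash_apply, denom_eq]
    simp only [hh]
    rw [← coe_smul_eq γ ⟨w, hw⟩, Function.comp_apply, ofComplex_apply]
  · ring

/-- `ξ_κ` is equivariant for the slash operators. -/
lemma xi_slash {κ : ℤ} {F : ℍ → ℂ} (γ : SL(2, ℤ))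
    (hF : ∀ z : ℍ, DifferentiableAt ℝ (F ∘ ofComplex) z) :
    xi κ (F ∣[κ] γ) = (xi κ F) ∣[2 - κ] γ := by
  ext z
  obtain ⟨a, ha⟩ := hasWirt_slash (κ := κ) γ z (hF _)
  have hjz : (γ 1 0 : ℂ) * z + (γ 1 1 : ℂ) ≠ 0 := denom_ne_zero' γ z.im_pos
  rw [xi_eq_of_hasWirt ha, ModularForm.SL_slash_apply, denom_eq, xi,
    ModularGroup.im_smul_eq_div_normSq]
  simp only [denom_eq, Complex.ofReal_div, ← Complex.mul_conj, div_zpow, mul_zpow, map_mul,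
    map_zpow₀, Complex.conj_conj]
  have hjc : conj ((γ 1 0 : ℂ) * z + (γ 1 1 : ℂ)) ≠ 0 := (map_ne_zero _).2 hjz
  generalize (γ 1 0 : ℂ) * z + (γ 1 1 : ℂ) = j at *
  have : j ^ (-(2 - κ)) = j ^ κ * (j ^ 2)⁻¹ := by
    rw [neg_sub, zpow_sub₀ hjz]; rfl
  rw [this, zpow_neg]
  have := zpow_ne_zero κ hjz
  have := zpow_ne_zero κ hjc
  field_simp

/-- Sufficient conditions for belonging to `H_κ(N, χ)`. -/
lemma memH_of_xi {κ : ℤ} {N : ℕ} {χ : DirichletCharacter ℂ N} {F : ℍ → ℂ} {G : ℂ → ℂ}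
    (hF : ∀ z : ℍ, DifferentiableAt ℝ (F ∘ ofComplex) z)
    (hG : DifferentiableOn ℂ G upperHalf) (hFG : ∀ z : ℍ, xi κ F z = G z)
    (hmod : ∀ γ ∈ CongruenceSubgroup.Gamma0 N, ∀ z : ℍ,
      F (γ • z) = χ ((γ 1 1 : ℤ) : ZMod N) * ((γ 1 0 : ℂ) * z + (γ 1 1 : ℂ)) ^ κ * F z)
    (hgr : ∀ γ : SL(2, ℤ), ∃ C : ℝ,
      (F ∣[κ] γ) =O[atImInfty] fun z : ℍ => Real.exp (C * z.im))
    (hbd : ∀ γ : SL(2, ℤ), IsBoundedAtImInfty (xi κ (F ∣[κ] γ))) :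
    MemH κ N χ F where
  realAnalytic := (analytic_and_harmonic hF hG hFG).1
  modular := hmod
  harmonic := (analytic_and_harmonic hF hG hFG).2
  growth := hgr
  xi_holomorphic := hG.congr fun z hz => by
    rw [Function.comp_apply, ofComplex_apply_of_im_pos hz, hFG]
  xi_holomorphicAtCusps := fun γ => by rw [← xi_slash γ hF]; exact hbd γ

/-! ### Integrals of Bessel type -/

open MeasureTheory Set

/-- The kernel `e^{-(au + b/u)}`. -/
def expKer (a b u : ℝ) : ℝ := Real.exp (-(a * u + b / u))

lemma continuousOn_expKer (a b : ℝ) : ContinuousOn (expKer a b) (Ioi 0) := by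
  unfold expKer
  refine Real.continuous_exp.comp_continuousOn ((ContinuousOn.add (by fun_prop) ?_).neg)
  exact continuousOn_const.div continuousOn_id fun u hu => (ne_of_gt hu)

lemma tendsto_rpow_mul_expKer_atTop {a b : ℝ} (ha : 0 < a) (hb : 0 < b) (p : ℝ) :
    Tendsto (fun u => u ^ p * expKer a b u) atTop (𝓝 0) := by
  refine squeeze_zero' ?_ ?_ (tendsto_rpow_mul_exp_neg_mul_atTop_nhds_zero p a ha)
  · filter_upwards [eventually_gt_atTop 0] with u hu
    have := Real.exp_pos (-(a * u + b / u))
    unfold expKer; positivity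
  · filter_upwards [eventually_gt_atTop 0] with u hu
    have := Real.rpow_nonneg hu.le p
    unfold expKer
    gcongr
    have : 0 ≤ b / u := by positivity
    linarith

lemma expKer_inv (a b u : ℝ) : expKer a b u⁻¹ = expKer b a u := by
  unfold expKer; congr 1; rw [div_inv_eq_mul, div_eq_mul_inv]; ring

/-- Inversion u ↦ 1/u exchanges the two ends of (0, ∞) and the roles of a and b. -/
lemma tendsto_rpow_mul_expKer_zero {a b : ℝ} (ha : 0 < a) (hb : 0 < b) (p : ℝ) :
    Tendsto (fun u => u ^ p * expKer a b u) (𝓝[>] 0) (𝓝 0) := by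
  have h := (tendsto_rpow_mul_expKer_atTop hb ha (-p)).comp tendsto_inv_nhdsGT_zero
  refine h.congr' ?_
  filter_upwards [self_mem_nhdsWithin] with u hu
  rw [Function.comp_apply, expKer_inv, Real.inv_rpow (le_of_lt hu), Real.rpow_neg (le_of_lt hu),
    inv_inv]

lemma isBigO_expKer_atTop {a b : ℝ} (ha : 0 < a) (hb : 0 < b) (p : ℝ) :
    expKer a b =O[atTop] (fun u => u ^ (-p)) := by
  refine (Asymptotics.isBigO_of_div_tendsto_nhds ?_ 0 ?_)
  · filter_upwards [eventually_gt_atTop 0] with u hu h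
    exact absurd h (Real.rpow_pos_of_pos hu _).ne'
  · refine (tendsto_rpow_mul_expKer_atTop ha hb p).congr' ?_
    filter_upwards [eventually_gt_atTop 0] with u hu
    rw [Pi.div_apply, Real.rpow_neg hu.le, div_inv_eq_mul, mul_comm]

lemma isBigO_expKer_zero {a b : ℝ} (ha : 0 < a) (hb : 0 < b) (p : ℝ) :
    expKer a b =O[𝓝[>] 0] (fun u => u ^ (-p)) := by
  refine (Asymptotics.isBigO_of_div_tendsto_nhds ?_ 0 ?_)
  · filter_upwards [self_mem_nhdsWithin] with u hu h
    exact absurd h (Real.rpow_pos_of_pos hu _).ne'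
  · refine (tendsto_rpow_mul_expKer_zero ha hb p).congr' ?_
    filter_upwards [self_mem_nhdsWithin] with u hu
    rw [Pi.div_apply, Real.rpow_neg (le_of_lt hu), div_inv_eq_mul, mul_comm]

lemma integrableOn_rpow_mul_expKer {a b : ℝ} (ha : 0 < a) (hb : 0 < b) (p : ℝ) :
    IntegrableOn (fun u => u ^ p * expKer a b u) (Ioi 0) := by
  have h := mellin_convergent_of_isBigO_scalar (s := p + 1)
    ((continuousOn_expKer a b).locallyIntegrableOn measurableSet_Ioi)
    (isBigO_expKer_atTop ha hb (p + 2)) (by linarith) (isBigO_expKer_zero ha hb p) (by linarith)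
  simpa using h

lemma expKer_nonneg (a b u : ℝ) : 0 ≤ expKer a b u := (Real.exp_pos _).le

/-- Uniform exponential decay: half of the exponent is kept for the integration, and the other
half is estimated by the inequality of the means. -/
lemma expKer_le {a b a₀ b₀ u q : ℝ} (ha : a₀ ≤ a) (hb : b₀ ≤ b) (hu : 0 < u)
    (hqab : q ^ 2 = a * b) (ha0 : 0 < a) :
    expKer a b u ≤ Real.exp (-q) * expKer (a₀ / 2) (b₀ / 2) u := by
  unfold expKer
  rw [← Real.exp_add, Real.exp_le_exp]
  have h1 : 2 * q ≤ a * u + b / u := by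
    have hb' : b = q ^ 2 / a := by field_simp; linarith
    have : a * u + b / u - 2 * q = (a * u - q) ^ 2 / (a * u) := by
      rw [hb']; field_simp; ring
    have h2 : 0 ≤ (a * u - q) ^ 2 / (a * u) := by positivity
    linarith
  have h2 : a₀ / 2 * u ≤ a * u / 2 := by nlinarith
  have h3 : b₀ / 2 / u ≤ b / u / 2 := by
    rw [div_div, div_div, mul_comm 2 u, mul_comm u 2]; gcongr
  linarith

/-- The substitution u ↦ (q/p)²/u fixes the kernel and exchanges the two powers of u. -/
lemma integral_expKer_symm {p q : ℝ} (hp : 0 < p) (hq : 0 < q) :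
    p * ∫ u in Ioi 0, u ^ (-(1 / 2) : ℝ) * expKer (p ^ 2) (q ^ 2) u =
      q * ∫ u in Ioi 0, u ^ (-(3 / 2) : ℝ) * expKer (p ^ 2) (q ^ 2) u := by
  have hg := integral_comp_mul_left_Ioi
    (fun u => u ^ (-(3 / 2) : ℝ) * expKer (p ^ 2) (q ^ 2) u) 0 (b := (q / p)^2) (by positivity)
  have hi := integral_comp_rpow_Ioi
    (fun v => ((q / p) ^ 2 * v) ^ (-(3 / 2) : ℝ) * expKer (p ^ 2) (q ^ 2) ((q / p) ^ 2 * v))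
    (p := -1) (by norm_num)
  rw [mul_zero] at hg
  rw [hg] at hi
  have hqp : 0 < q / p := by positivity
  have key : ∀ u ∈ Ioi (0:ℝ), (|(-1:ℝ)| * u ^ ((-1:ℝ) - 1)) • (((q / p) ^ 2 * u ^ (-1:ℝ)) ^ (-(3 / 2) : ℝ)
      * expKer (p ^ 2) (q ^ 2) ((q / p) ^ 2 * u ^ (-1:ℝ))) =
      (q / p) ^ (-3 : ℝ) * (u ^ (-(1 / 2) : ℝ) * expKer (p ^ 2) (q ^ 2) u) := by
    intro u hu
    have hu' : (0:ℝ) < u := hu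
    have h1 : expKer (p ^ 2) (q ^ 2) ((q / p) ^ 2 * u ^ (-1:ℝ)) = expKer (p ^ 2) (q ^ 2) u := by
      unfold expKer
      rw [Real.rpow_neg_one]
      congr 2
      field_simp
      ring
    rw [h1, Real.mul_rpow (by positivity) (by positivity), ← Real.rpow_natCast (q / p) 2,
      ← Real.rpow_mul hqp.le, ← Real.rpow_mul hu'.le, smul_eq_mul,
      show ((2 : ℕ) : ℝ) * -(3 / 2) = -3 by norm_num, show (-1 : ℝ) * -(3 / 2) = 3 / 2 by norm_num,
      abs_neg, abs_one, one_mul, show (-1 : ℝ) - 1 = -2 by norm_num]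
    have : u ^ (-2 : ℝ) * u ^ (3 / 2 : ℝ) = u ^ (-(1 / 2) : ℝ) := by
      rw [← Real.rpow_add hu']; norm_num
    linear_combination ((q / p) ^ (-3 : ℝ) * expKer (p ^ 2) (q ^ 2) u) * this
  rw [setIntegral_congr_fun measurableSet_Ioi key, integral_const_mul, smul_eq_mul] at hi
  have h3 : (q / p) ^ (-3 : ℝ) = ((q / p) ^ 2)⁻¹ * (p / q) := by
    rw [show (-3 : ℝ) = -((3 : ℕ) : ℝ) by norm_num, Real.rpow_neg hqp.le, Real.rpow_natCast]
    field_simp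
  rw [h3, mul_assoc] at hi
  have h4 := mul_left_cancel₀ (by positivity) hi
  rw [← h4]; field_simp

/-- With t = p√u - q/√u one has p²u + q²/u = t² + 2pq, and dt is half of the weight p u^{-1/2} + q
u^{-3/2}. As t runs once over ℝ, a Gaussian integral remains. -/
lemma integral_expKer_sum {p q : ℝ} (hp : 0 < p) (hq : 0 < q) :
    p * (∫ u in Ioi 0, u ^ (-(1 / 2) : ℝ) * expKer (p ^ 2) (q ^ 2) u) +
      q * (∫ u in Ioi 0, u ^ (-(3 / 2) : ℝ) * expKer (p ^ 2) (q ^ 2) u) =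
    2 * √π * Real.exp (-(2 * p * q)) := by
  set f : ℝ → ℝ := fun u => p * √u - q / √u with hf
  set f' : ℝ → ℝ := fun u => 1 / 2 * (p * u ^ (-(1 / 2) : ℝ) + q * u ^ (-(3 / 2) : ℝ)) with hf'
  have hrp : ∀ u : ℝ, 0 < u → u ^ (-(1 / 2) : ℝ) = 1 / √u ∧ u ^ (-(3 / 2) : ℝ) = 1 / (u * √u) := by
    intro u hu
    rw [Real.sqrt_eq_rpow, one_div (u ^ _), one_div (u * _), Real.rpow_neg hu.le]
    refine ⟨rfl, ?_⟩
    rw [show (-(3 / 2) : ℝ) = -(1 + 1 / 2) by norm_num, Real.rpow_neg hu.le, Real.rpow_add hu,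
      Real.rpow_one]
  have hderiv : ∀ u ∈ Ioi (0:ℝ), HasDerivWithinAt f (f' u) (Ioi 0) u := by
    intro u hu
    have hu' : (0:ℝ) < u := hu
    have hs := Real.hasDerivAt_sqrt hu'.ne'
    have hsp : 0 < √u := Real.sqrt_pos.2 hu'
    have h1 := (hs.const_mul p).sub ((hasDerivAt_const u q).div hs hsp.ne')
    refine (h1.congr_deriv ?_).hasDerivWithinAt
    simp only [hf', (hrp u hu').1, (hrp u hu').2]
    have hsq : √u ^ 2 = u := Real.sq_sqrt hu'.le
    rw [hsq]
    field_simp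
    ring
  have hpos : ∀ u ∈ Ioi (0:ℝ), 0 < f' u := by
    intro u hu
    have hu' : (0:ℝ) < u := hu
    simp only [hf']; positivity
  have hinj : InjOn f (Ioi 0) := by
    have hmono : ∀ u v : ℝ, 0 < u → u < v → f u < f v := by
      intro u v hu huv
      have h1 : √u < √v := Real.sqrt_lt_sqrt hu.le huv
      have h2 : 0 < √u := Real.sqrt_pos.2 hu
      have h3 : q / √v < q / √u := by gcongr
      have h4 : p * √u < p * √v := by gcongr
      simp only [hf]; linarith
    intro u hu v hv huv
    rcases lt_trichotomy u v with h | h | h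
    · exact absurd huv (hmono u v hu h).ne
    · exact h
    · exact absurd huv (hmono v u hv h).ne'
  have himg : f '' Ioi 0 = univ := by
    refine eq_univ_of_forall fun t => ?_
    -- The positive root of p s² - t s - q = 0, that is, √u for the preimage u of t.
    set s := (t + √(t ^ 2 + 4 * p * q)) / (2 * p) with hs
    have hlt : |t| < √(t ^ 2 + 4 * p * q) := by
      rw [← Real.sqrt_sq_eq_abs]
      exact Real.sqrt_lt_sqrt (sq_nonneg t) (by linarith [mul_pos hp hq])
    have hspos : 0 < s := by
      have := (abs_lt.1 hlt).1
      rw [hs]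
      exact div_pos (by linarith) (by positivity)
    refine ⟨s ^ 2, mem_Ioi.2 (by positivity), ?_⟩
    simp only [hf, Real.sqrt_sq hspos.le]
    have h1 : 2 * p * s - t = √(t ^ 2 + 4 * p * q) := by rw [hs]; field_simp; ring
    have h2 : (2 * p * s - t) ^ 2 = t ^ 2 + 4 * p * q := by
      rw [h1]; exact Real.sq_sqrt (by positivity)
    field_simp
    nlinarith
  have key := integral_image_eq_integral_abs_deriv_smul measurableSet_Ioi hderiv hinj
    (fun t => Real.exp (-1 * t ^ 2))
  rw [himg, setIntegral_univ, integral_gaussian, div_one] at key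
  have hcongr : ∀ u ∈ Ioi (0:ℝ), |f' u| • Real.exp (-1 * f u ^ 2) =
      (Real.exp (2 * p * q) / 2) * (p * (u ^ (-(1 / 2) : ℝ) * expKer (p ^ 2) (q ^ 2) u) +
        q * (u ^ (-(3 / 2) : ℝ) * expKer (p ^ 2) (q ^ 2) u)) := by
    intro u hu
    have hu' : (0:ℝ) < u := hu
    have hsp : 0 < √u := Real.sqrt_pos.2 hu'
    have h1 : Real.exp (-1 * f u ^ 2) = Real.exp (2 * p * q) * expKer (p ^ 2) (q ^ 2) u := by
      unfold expKer
      rw [← Real.exp_add]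
      congr 1
      have hsq : √u ^ 2 = u := Real.sq_sqrt hu'.le
      have : q ^ 2 / u = (q / √u) ^ 2 := by rw [div_pow, hsq]
      have h2 : p ^ 2 * u = (p * √u) ^ 2 := by rw [mul_pow, hsq]
      have h3 : (p * √u) * (q / √u) = p * q := by field_simp
      rw [this, h2]
      simp only [hf]
      linear_combination 2 * h3
    rw [abs_of_pos (hpos u hu), h1, smul_eq_mul]
    simp only [hf']
    ring
  rw [setIntegral_congr_fun measurableSet_Ioi hcongr, integral_const_mul, integral_add
    ((integrableOn_rpow_mul_expKer (by positivity) (by positivity) _).const_mul _)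
    ((integrableOn_rpow_mul_expKer (by positivity) (by positivity) _).const_mul _),
    integral_const_mul, integral_const_mul] at key
  rw [Real.exp_neg]
  have := Real.exp_pos (2 * p * q)
  rw [key]
  field_simp

/-- The kernel `(r/u + l)^κ e^{-πy(l²u + r²/u)}`. -/
def bker (κ : ℕ) (r l y u : ℝ) : ℝ := (r / u + l) ^ κ * expKer (π * y * l ^ 2) (π * y * r ^ 2) u

/-- The integral `∫ u^{σ-3/2} (r/u + l)^κ e^{-πy(l²u + r²/u)} du` over `(0, ∞)`. -/
def besselInt (κ : ℕ) (r l y : ℝ) (σ : ℂ) : ℂ :=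
  mellin (fun u => (bker κ r l y u : ℂ)) (σ - 1 / 2)

/-- The derivative of `besselInt` with respect to `σ`. -/
def besselLog (κ : ℕ) (r l y : ℝ) (σ : ℂ) : ℂ :=
  mellin (fun u => Real.log u • (bker κ r l y u : ℂ)) (σ - 1 / 2)

lemma continuousOn_bker (κ : ℕ) (r l y : ℝ) : ContinuousOn (bker κ r l y) (Ioi 0) := by
  refine ContinuousOn.mul (ContinuousOn.pow ?_ κ) (continuousOn_expKer _ _)
  exact (continuousOn_const.div continuousOn_id fun u hu => (ne_of_gt hu)).add continuousOn_const

lemma isBigO_bker_atTop (κ : ℕ) {r l y : ℝ} (hr : r ≠ 0) (hl : 0 < l) (hy : 0 < y) (p : ℝ) :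
    bker κ r l y =O[atTop] (fun u => u ^ (-p)) := by
  have h1 : (fun u : ℝ => (r / u + l) ^ κ) =O[atTop] (fun _ => (1 : ℝ)) := by
    have : Tendsto (fun u : ℝ => (r / u + l) ^ κ) atTop (𝓝 ((0 + l) ^ κ)) :=
      ((tendsto_const_nhds.div_atTop tendsto_id).add_const l).pow κ
    exact this.isBigO_one ℝ
  have h2 := h1.mul (isBigO_expKer_atTop (a := π * y * l ^ 2) (b := π * y * r ^ 2)
    (by positivity) (by positivity) p)
  exact h2.congr' (Eventually.of_forall fun _ => rfl) (Eventually.of_forall fun _ => one_mul _)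

lemma isBigO_bker_zero (κ : ℕ) {r l y : ℝ} (hr : r ≠ 0) (hl : 0 < l) (hy : 0 < y) (p : ℝ) :
    bker κ r l y =O[𝓝[>] 0] (fun u => u ^ (-p)) := by
  have h1 : (fun u : ℝ => (r / u + l) ^ κ) =O[𝓝[>] 0] (fun u => u ^ (-(κ : ℝ))) := by
    have h0 : (fun u : ℝ => r / u + l) =O[𝓝[>] 0] (fun u => u ^ (-1 : ℝ)) := by
      refine Asymptotics.IsBigO.of_bound (|r| + |l|) ?_
      filter_upwards [Ioo_mem_nhdsGT (zero_lt_one' ℝ)] with u hu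
      rw [Real.rpow_neg_one, Real.norm_eq_abs, Real.norm_eq_abs, abs_inv, abs_of_pos hu.1]
      have h1 : 1 ≤ u⁻¹ := (one_le_inv₀ hu.1).2 hu.2.le
      calc |r / u + l| ≤ |r / u| + |l| := abs_add_le _ _
        _ = |r| * u⁻¹ + |l| := by rw [abs_div, abs_of_pos hu.1, div_eq_mul_inv]
        _ ≤ (|r| + |l|) * u⁻¹ := by nlinarith [abs_nonneg l]
    refine (h0.pow κ).congr' (Eventually.of_forall fun _ => rfl) ?_
    filter_upwards [self_mem_nhdsWithin] with u hu
    rw [← Real.rpow_natCast, ← Real.rpow_mul (le_of_lt hu), neg_one_mul]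
  have h2 := h1.mul (isBigO_expKer_zero (a := π * y * l ^ 2) (b := π * y * r ^ 2)
    (by positivity) (by positivity) (p - κ))
  refine h2.congr' (Eventually.of_forall fun _ => rfl) ?_
  filter_upwards [self_mem_nhdsWithin] with u hu
  rw [← Real.rpow_add hu]; congr 1; ring

lemma hasDerivAt_besselInt (κ : ℕ) {r l y : ℝ} (hr : r ≠ 0) (hl : 0 < l) (hy : 0 < y) (σ : ℂ) :
    MellinConvergent (fun u => Real.log u • (bker κ r l y u : ℂ)) (σ - 1 / 2) ∧
      HasDerivAt (besselInt κ r l y) (besselLog κ r l y σ) σ := by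
  have hc : LocallyIntegrableOn (fun u => (bker κ r l y u : ℂ)) (Ioi 0) :=
    (Complex.continuous_ofReal.comp_continuousOn
      (continuousOn_bker κ r l y)).locallyIntegrableOn measurableSet_Ioi
  have h1 : (fun u => (bker κ r l y u : ℂ)) =O[atTop] (fun u : ℝ => u ^ (-((σ - 1 / 2).re + 1))) :=
    Complex.isBigO_ofReal_left.2 (isBigO_bker_atTop κ hr hl hy _)
  have h2 : (fun u => (bker κ r l y u : ℂ)) =O[𝓝[>] 0] (fun u : ℝ => u ^ (-((σ - 1 / 2).re - 1))) :=
    Complex.isBigO_ofReal_left.2 (isBigO_bker_zero κ hr hl hy _)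
  have h := mellin_hasDerivAt_of_isBigO_rpow (s := σ - 1 / 2) hc h1 (by linarith) h2 (by linarith)
  exact ⟨h.1, (h.2.comp_sub_const σ (1 / 2))⟩

lemma mellinConvergent_bker (κ : ℕ) {r l y : ℝ} (hr : r ≠ 0) (hl : 0 < l) (hy : 0 < y) (σ : ℂ) :
    MellinConvergent (fun u => (bker κ r l y u : ℂ)) σ := by
  have hc : LocallyIntegrableOn (fun u => (bker κ r l y u : ℂ)) (Ioi 0) :=
    (Complex.continuous_ofReal.comp_continuousOn
      (continuousOn_bker κ r l y)).locallyIntegrableOn measurableSet_Ioi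
  exact mellinConvergent_of_isBigO_rpow (a := σ.re + 1) (b := σ.re - 1) hc
    (Complex.isBigO_ofReal_left.2 (isBigO_bker_atTop κ hr hl hy _)) (by linarith)
    (Complex.isBigO_ofReal_left.2 (isBigO_bker_zero κ hr hl hy _)) (by linarith)

lemma differentiable_besselInt (κ : ℕ) {r l y : ℝ} (hr : r ≠ 0) (hl : 0 < l) (hy : 0 < y) :
    Differentiable ℂ (besselInt κ r l y) := fun σ =>
  (hasDerivAt_besselInt κ hr hl hy σ).2.differentiableAt

/-- The bound must be uniform in σ on a strip and summable over all frequencies. By `expKer_le` with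
q = πyl|r|, half of the exponent yields the decay in l|r|; the other half is dominated, as |r| ≥ 1,
by one fixed kernel. -/
lemma exists_integral_norm_bker_le {κ : ℕ} (hκ : κ ≤ 1) (α β : ℝ) {l₀ y₀ : ℝ} (hl₀ : 0 < l₀)
    (hy₀ : 0 < y₀) : ∃ C, 0 ≤ C ∧ ∀ (r l y : ℝ) (σ : ℂ), 1 ≤ |r| → l₀ ≤ l → y₀ ≤ y →
      α ≤ σ.re → σ.re ≤ β →
      ∫ u in Ioi (0:ℝ), ‖(u : ℂ) ^ (σ - 1 / 2 - 1) • (bker κ r l y u : ℂ)‖ ≤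
        C * (1 + |r| + l) * Real.exp (-(π * y * l * |r|)) := by
  set a₀ := π * y₀ * l₀ ^ 2 / 2
  set b₀ := π * y₀ / 2
  have ha₀ : 0 < a₀ := by positivity
  have hb₀ : 0 < b₀ := by positivity
  -- The powers at the two edges of the strip dominate those in between. The exponents shifted by
  -- 5/2 account for the factor 1/u that (r/u + l)^κ contributes when κ = 1.
  let M : ℝ → ℝ := fun u => u ^ (α - 3 / 2) * expKer a₀ b₀ u + u ^ (β - 3 / 2) * expKer a₀ b₀ u
    + (u ^ (α - 5 / 2) * expKer a₀ b₀ u + u ^ (β - 5 / 2) * expKer a₀ b₀ u)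
  have hM : IntegrableOn M (Ioi 0) :=
    ((integrableOn_rpow_mul_expKer ha₀ hb₀ _).add (integrableOn_rpow_mul_expKer ha₀ hb₀ _)).add
      ((integrableOn_rpow_mul_expKer ha₀ hb₀ _).add (integrableOn_rpow_mul_expKer ha₀ hb₀ _))
  have hMnn : ∀ u ∈ Ioi (0:ℝ), 0 ≤ M u := by
    intro u hu
    have hu' : (0:ℝ) < u := hu
    have := expKer_nonneg a₀ b₀ u
    simp only [M]; positivity
  refine ⟨∫ u in Ioi (0:ℝ), M u, setIntegral_nonneg measurableSet_Ioi hMnn, ?_⟩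
  intro r l y σ hr hl hy hα hβ
  have hl' : 0 < l := hl₀.trans_le hl
  have hy' : 0 < y := hy₀.trans_le hy
  have hr' : r ≠ 0 := by intro h; rw [h, abs_zero] at hr; linarith
  have hbound : ∀ u ∈ Ioi (0:ℝ), ‖(u : ℂ) ^ (σ - 1 / 2 - 1) • (bker κ r l y u : ℂ)‖ ≤
      (1 + |r| + l) * Real.exp (-(π * y * l * |r|)) * M u := by
    intro u hu
    have hu' : (0:ℝ) < u := hu
    have hre : (σ - 1 / 2 - 1).re = σ.re - 3 / 2 := by
      norm_num [Complex.sub_re, Complex.div_re]; ring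
    rw [norm_smul, Complex.norm_cpow_eq_rpow_re_of_pos hu', hre, Complex.norm_real, bker, norm_mul,
      Real.norm_of_nonneg (expKer_nonneg _ _ _)]
    have h1 : u ^ (σ.re - 3 / 2) ≤ u ^ (α - 3 / 2) + u ^ (β - 3 / 2) := by
      rcases le_total 1 u with h | h
      · have := Real.rpow_le_rpow_of_exponent_le h (show σ.re - 3 / 2 ≤ β - 3 / 2 by linarith)
        have := Real.rpow_nonneg hu'.le (α - 3 / 2)
        linarith
      · have := Real.rpow_le_rpow_of_exponent_ge hu' h (show α - 3 / 2 ≤ σ.re - 3 / 2 by linarith)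
        have := Real.rpow_nonneg hu'.le (β - 3 / 2)
        linarith
    have h2 : ‖(r / u + l) ^ κ‖ ≤ (1 + |r| + l) * (1 + u⁻¹) := by
      have hui : 0 < u⁻¹ := by positivity
      rcases Nat.le_one_iff_eq_zero_or_eq_one.1 hκ with rfl | rfl
      · simp only [pow_zero, norm_one]
        nlinarith [abs_nonneg r, mul_nonneg (abs_nonneg r) hui.le, mul_pos hl' hui]
      · rw [pow_one, Real.norm_eq_abs]
        calc |r / u + l| ≤ |r / u| + |l| := abs_add_le _ _
          _ = |r| * u⁻¹ + l := by rw [abs_div, abs_of_pos hu', abs_of_pos hl', div_eq_mul_inv]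
          _ ≤ _ := by nlinarith [abs_nonneg r, mul_nonneg (abs_nonneg r) hui.le, mul_pos hl' hui]
    have h3 : expKer (π * y * l ^ 2) (π * y * r ^ 2) u ≤
        Real.exp (-(π * y * l * |r|)) * expKer a₀ b₀ u := by
      refine expKer_le (a₀ := π * y₀ * l₀ ^ 2) (b₀ := π * y₀) ?_ ?_ hu' ?_ (by positivity)
      · gcongr
      · have : 1 ≤ r ^ 2 := by rw [← sq_abs]; nlinarith
        nlinarith [mul_le_mul_of_nonneg_left hy Real.pi_pos.le, mul_pos Real.pi_pos hy']
      · rw [mul_pow, sq_abs]; ring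
    have h4 : (1 + u⁻¹) * (u ^ (α - 3 / 2) + u ^ (β - 3 / 2)) * expKer a₀ b₀ u = M u := by
      have h5 : ∀ p : ℝ, u⁻¹ * u ^ (p - 3 / 2) = u ^ (p - 5 / 2) := by
        intro p
        rw [← Real.rpow_neg_one, ← Real.rpow_add hu']; congr 1; ring
      simp only [M, ← h5]; ring
    have hE := expKer_nonneg a₀ b₀ u
    have hui : 0 < u⁻¹ := by positivity
    calc _ ≤ (u ^ (α - 3 / 2) + u ^ (β - 3 / 2)) * (((1 + |r| + l) * (1 + u⁻¹)) *
          (Real.exp (-(π * y * l * |r|)) * expKer a₀ b₀ u)) := by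
          have := expKer_nonneg (π * y * l ^ 2) (π * y * r ^ 2) u
          gcongr
      _ = _ := by rw [← h4]; ring
  calc _ ≤ ∫ u in Ioi (0:ℝ), (1 + |r| + l) * Real.exp (-(π * y * l * |r|)) * M u :=
        setIntegral_mono_on (mellinConvergent_bker κ hr' hl' hy' _).norm (hM.const_mul _)
          measurableSet_Ioi hbound
    _ = _ := by rw [integral_const_mul]; ring

lemma exists_norm_besselInt_le {κ : ℕ} (hκ : κ ≤ 1) (α β : ℝ) {l₀ y₀ : ℝ} (hl₀ : 0 < l₀)
    (hy₀ : 0 < y₀) : ∃ C, 0 ≤ C ∧ ∀ (r l y : ℝ) (σ : ℂ), 1 ≤ |r| → l₀ ≤ l → y₀ ≤ y →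
      α ≤ σ.re → σ.re ≤ β →
      ‖besselInt κ r l y σ‖ ≤ C * (1 + |r| + l) * Real.exp (-(π * y * l * |r|)) := by
  obtain ⟨C, hC, h⟩ := exists_integral_norm_bker_le hκ α β hl₀ hy₀
  exact ⟨C, hC, fun r l y σ h1 h2 h3 h4 h5 =>
    (norm_integral_le_integral_norm _).trans (h r l y σ h1 h2 h3 h4 h5)⟩

lemma mellin_half_ofReal (f : ℝ → ℝ) :
    mellin (fun u => (f u : ℂ)) (1 - 1 / 2) = ((∫ u in Ioi (0:ℝ), u ^ (-(1 / 2) : ℝ) * f u : ℝ) : ℂ) := by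
  rw [mellin, ← integral_complex_ofReal]
  refine setIntegral_congr_fun measurableSet_Ioi fun u hu => ?_
  have hu' : (0:ℝ) < u := hu
  simp only [smul_eq_mul, Complex.ofReal_mul, Complex.ofReal_cpow hu'.le]
  norm_num

/-- For p = √(πy) l and q = √(πy) |r| the two weighted integrals are equal and their sum is known,
so each is half of it. -/
lemma besselInt_aux {r l y : ℝ} (hr : r ≠ 0) (hl : 0 < l) (hy : 0 < y) :
    l * (∫ u in Ioi (0:ℝ), u ^ (-(1 / 2) : ℝ) * expKer (π * y * l ^ 2) (π * y * r ^ 2) u) =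
      (√y)⁻¹ * Real.exp (-(2 * π * y * l * |r|)) ∧
    |r| * (∫ u in Ioi (0:ℝ), u ^ (-(3 / 2) : ℝ) * expKer (π * y * l ^ 2) (π * y * r ^ 2) u) =
      (√y)⁻¹ * Real.exp (-(2 * π * y * l * |r|)) := by
  have hr' : 0 < |r| := abs_pos.2 hr
  have hs : 0 < √π := Real.sqrt_pos.2 Real.pi_pos
  have hsy : 0 < √y := Real.sqrt_pos.2 hy
  have hp : 0 < √π * √y * l := by positivity
  have hq : 0 < √π * √y * |r| := by positivity
  have h1 := integral_expKer_symm hp hq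
  have h2 := integral_expKer_sum hp hq
  have e1 : (√π * √y * l) ^ 2 = π * y * l ^ 2 := by
    rw [mul_pow, mul_pow, Real.sq_sqrt Real.pi_pos.le, Real.sq_sqrt hy.le]
  have e2 : (√π * √y * |r|) ^ 2 = π * y * r ^ 2 := by
    rw [mul_pow, mul_pow, Real.sq_sqrt Real.pi_pos.le, Real.sq_sqrt hy.le, sq_abs]
  have e3 : 2 * (√π * √y * l) * (√π * √y * |r|) = 2 * π * y * l * |r| := by
    have a1 := Real.sq_sqrt Real.pi_pos.le
    have a2 := Real.sq_sqrt hy.le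
    calc _ = 2 * (√π ^ 2) * (√y ^ 2) * l * |r| := by ring
      _ = _ := by rw [a1, a2]
  rw [e1, e2] at h1 h2
  rw [e3] at h2
  have key : ∀ x X E : ℝ, √π * √y * x * X + √π * √y * x * X = 2 * √π * E →
      x * X = (√y)⁻¹ * E := by
    intro x X E h
    have h' : 2 * √π * (√y * (x * X)) = 2 * √π * E := by linarith
    rw [← mul_left_cancel₀ (by positivity) h', inv_mul_cancel_left₀ hsy.ne']
  exact ⟨key _ _ _ (by rw [← h1] at h2; exact h2), key _ _ _ (by rw [h1] at h2; exact h2)⟩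

lemma besselInt_zero_one {r l y : ℝ} (hr : r ≠ 0) (hl : 0 < l) (hy : 0 < y) : besselInt 0 r l y 1 =
    ((√y)⁻¹ * l⁻¹ * Real.exp (-(2 * π * y * l * |r|)) : ℝ) := by
  rw [besselInt, mellin_half_ofReal]
  congr 1
  simp only [bker, pow_zero, one_mul]
  rw [mul_right_comm (√y)⁻¹, ← (besselInt_aux hr hl hy).1, mul_comm l, mul_inv_cancel_right₀ hl.ne']

/-- The contributions of r/u and of l have equal absolute value; they add up for r > 0 and cancel
for r < 0. This makes the weight one series holomorphic at σ = 1, so that only its derivative in σ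
can have a non-zero image under ξ. -/
lemma integral_bker_one {r l y : ℝ} (hr : r ≠ 0) (hl : 0 < l) (hy : 0 < y) : ∫ u in Ioi (0:ℝ), u ^ (-(1 / 2) : ℝ) * bker 1 r l y u =
    if 0 < r then 2 * (√y)⁻¹ * Real.exp (-(2 * π * y * l * |r|)) else 0 := by
  have h := besselInt_aux hr hl hy
  have e : ∀ u ∈ Ioi (0:ℝ), u ^ (-(1 / 2) : ℝ) * bker 1 r l y u =
      r * (u ^ (-(3 / 2) : ℝ) * expKer (π * y * l ^ 2) (π * y * r ^ 2) u) +
      l * (u ^ (-(1 / 2) : ℝ) * expKer (π * y * l ^ 2) (π * y * r ^ 2) u) := by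
    intro u hu
    have hu' : (0:ℝ) < u := hu
    have : u ^ (-(1 / 2) : ℝ) / u = u ^ (-(3 / 2) : ℝ) := by
      rw [← Real.rpow_sub_one hu'.ne']; norm_num
    rw [bker, pow_one, ← this]; ring
  rw [setIntegral_congr_fun measurableSet_Ioi e, integral_add
    ((integrableOn_rpow_mul_expKer (by positivity) (by positivity) _).const_mul _)
    ((integrableOn_rpow_mul_expKer (by positivity) (by positivity) _).const_mul _),
    integral_const_mul, integral_const_mul, h.1]
  split_ifs with hr0
  · have h2 := h.2
    rw [abs_of_pos hr0] at h2 ⊢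
    rw [h2]; ring
  · have hr1 : r < 0 := lt_of_le_of_ne (not_lt.1 hr0) hr
    have h2 := h.2
    rw [abs_of_neg hr1] at h2 ⊢
    linarith

lemma besselInt_one_one {r l y : ℝ} (hr : r ≠ 0) (hl : 0 < l) (hy : 0 < y) : besselInt 1 r l y 1 =
    ((if 0 < r then 2 * (√y)⁻¹ * Real.exp (-(2 * π * y * l * |r|)) else 0 : ℝ) : ℂ) := by
  rw [besselInt, mellin_half_ofReal, integral_bker_one hr hl hy]

lemma abs_log_le_add_inv {u : ℝ} (hu : 0 < u) : |Real.log u| ≤ u + u⁻¹ := by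
  have h1 := Real.log_le_sub_one_of_pos hu
  have h2 := Real.log_le_sub_one_of_pos (inv_pos.2 hu)
  rw [Real.log_inv] at h2
  have := inv_pos.2 hu
  rw [abs_le]; constructor <;> linarith

/-- `√y` times the derivative at `σ = 1` of the Bessel integral of weight one. -/
def besselDer (r l y : ℝ) : ℝ :=
  √y * ∫ u in Ioi (0:ℝ), u ^ (-(1 / 2) : ℝ) * (Real.log u * bker 1 r l y u)

lemma besselLog_one (r l y : ℝ) : (√y : ℂ) * besselLog 1 r l y 1 = besselDer r l y := by
  have : (fun u : ℝ => Real.log u • (bker 1 r l y u : ℂ)) =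
      fun u : ℝ => ((Real.log u * bker 1 r l y u : ℝ) : ℂ) := by
    ext u; simp
  rw [besselLog, this, mellin_half_ofReal, besselDer, Complex.ofReal_mul]

lemma expKer_anti {a b a₀ b₀ u : ℝ} (ha : a₀ ≤ a) (hb : b₀ ≤ b) (hu : 0 < u) :
    expKer a b u ≤ expKer a₀ b₀ u := by
  unfold expKer; rw [Real.exp_le_exp]
  have : a₀ * u ≤ a * u := by gcongr
  have : b₀ / u ≤ b / u := by gcongr
  linarith

lemma integrableOn_log_mul {a b : ℝ} (ha : 0 < a) (hb : 0 < b) (p : ℝ) :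
    IntegrableOn (fun u => Real.log u * (u ^ p * expKer a b u)) (Ioi 0) := by
  have h1 := (integrableOn_rpow_mul_expKer ha hb (p + 1)).add
    (integrableOn_rpow_mul_expKer ha hb (p - 1))
  refine Integrable.mono' h1 ?_ ?_
  · refine ContinuousOn.aestronglyMeasurable ?_ measurableSet_Ioi
    refine ContinuousOn.mul (Real.continuousOn_log.mono fun u hu => (ne_of_gt hu))
      (ContinuousOn.mul ?_ (continuousOn_expKer _ _))
    exact fun u hu => (Real.continuousAt_rpow_const _ _ (Or.inl (ne_of_gt hu))).continuousWithinAt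
  · refine (ae_restrict_mem measurableSet_Ioi).mono fun u hu => ?_
    have hu' : (0:ℝ) < u := hu
    have hE := expKer_nonneg a b u
    have hp := Real.rpow_nonneg hu'.le p
    rw [norm_mul, Real.norm_of_nonneg (mul_nonneg hp hE), Real.norm_eq_abs]
    simp only [Pi.add_apply]
    rw [Real.rpow_add_one hu'.ne', Real.rpow_sub_one hu'.ne', div_eq_mul_inv]
    calc _ ≤ (u + u⁻¹) * (u ^ p * expKer a b u) :=
          mul_le_mul_of_nonneg_right (abs_log_le_add_inv hu') (mul_nonneg hp hE)
      _ = _ := by ring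

/-- Integration by parts in the logarithmic integral. -/
lemma integral_log_by_parts {r l y : ℝ} (hr : r ≠ 0) (hl : 0 < l) (hy : 0 < y) :
    ∫ u in Ioi (0:ℝ), Real.log u * (u ^ (-(1 / 2) : ℝ) * bker 1 r l y u *
      (1 / 2 - π * y * u * (l - r / u) ^ 2)) =
    - ∫ u in Ioi (0:ℝ), u ^ (-(1 / 2) : ℝ) * bker 1 (-r) l y u := by
  set a := π * y * l ^ 2
  set b := π * y * r ^ 2
  have ha : 0 < a := by positivity
  have hb : 0 < b := by positivity
  -- Here v = u^{-1/2}(lu - r)e^{-(au+b/u)}: its derivative is the factor of log u on the left, and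
  -- v/u is the integrand of the right-hand side, with -r in place of r.
  let v : ℝ → ℝ := fun u => l * (u ^ (1 / 2 : ℝ) * expKer a b u)
    - r * (u ^ (-(1 / 2) : ℝ) * expKer a b u)
  let v' : ℝ → ℝ := fun u => u ^ (-(1 / 2) : ℝ) * bker 1 r l y u *
      (1 / 2 - π * y * u * (l - r / u) ^ 2)
  have hpow : ∀ u : ℝ, 0 < u → u ^ (1 / 2 : ℝ) = u * u ^ (-(1 / 2) : ℝ) := by
    intro u hu; rw [mul_comm, ← Real.rpow_add_one hu.ne']; norm_num
  have hv : ∀ u ∈ Ioi (0:ℝ), HasDerivAt v (v' u) u := by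
    intro u hu
    have hu' : (0:ℝ) < u := hu
    have hE : HasDerivAt (expKer a b) (expKer a b u * (-(a + -b / u ^ 2))) u := by
      have h1 : HasDerivAt (fun u => -(a * u + b / u)) (-(a + -b / u ^ 2)) u := by
        have h2 := ((hasDerivAt_id u).const_mul a).add
          ((hasDerivAt_const u b).div (hasDerivAt_id u) hu'.ne')
        refine h2.neg.congr_deriv ?_
        simp
      exact h1.exp
    have h1 := ((Real.hasDerivAt_rpow_const (p := 1 / 2) (Or.inl hu'.ne')).mul hE).const_mul l
    have h2 := ((Real.hasDerivAt_rpow_const (p := -(1 / 2)) (Or.inl hu'.ne')).mul hE).const_mul r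
    refine (h1.sub h2).congr_deriv ?_
    have e1 : u ^ ((1 / 2 : ℝ) - 1) = u ^ (-(1 / 2) : ℝ) := by norm_num
    have e2 : u ^ (-(1 / 2 : ℝ) - 1) = u ^ (-(1 / 2) : ℝ) / u := Real.rpow_sub_one hu'.ne' _
    rw [e1, e2, hpow u hu']
    simp only [v', bker, pow_one, a, b]
    field_simp
    ring
  have hI : ∀ p : ℝ, IntegrableOn (fun u => Real.log u * (u ^ p * expKer a b u)) (Ioi 0) :=
    integrableOn_log_mul ha hb
  have huv' : IntegrableOn (Real.log * v') (Ioi 0) := by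
    have h := (((((hI (-(1/2))).const_mul (l / 2 + π * y * l ^ 2 * r)).add
      ((hI (-(3/2))).const_mul (r / 2 + π * y * l * r ^ 2))).sub
      ((hI (1/2)).const_mul (π * y * l ^ 3))).sub
      ((hI (-(5/2))).const_mul (π * y * r ^ 3)))
    refine IntegrableOn.congr_fun (μ := volume) h (fun u hu => ?_) measurableSet_Ioi
    have hu' : (0:ℝ) < u := hu
    have e2 : u ^ (-(3 / 2) : ℝ) = u ^ (-(1 / 2) : ℝ) / u := by
      rw [← Real.rpow_sub_one hu'.ne']; norm_num
    have e3 : u ^ (-(5 / 2) : ℝ) = u ^ (-(1 / 2) : ℝ) / u / u := by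
      rw [← Real.rpow_sub_one hu'.ne', ← Real.rpow_sub_one hu'.ne']; norm_num
    simp only [Pi.add_apply, Pi.sub_apply, Pi.mul_apply, e2, e3, hpow u hu', v', bker, pow_one]
    change _ = Real.log u * (u ^ (-(1 / 2) : ℝ) * ((r / u + l) * expKer a b u) * _)
    field_simp
    ring
  have hu'v : IntegrableOn ((fun u => u⁻¹) * v) (Ioi 0) := by
    have h := ((integrableOn_rpow_mul_expKer ha hb (-(1/2))).const_mul l).sub
      ((integrableOn_rpow_mul_expKer ha hb (-(3/2))).const_mul r)
    refine IntegrableOn.congr_fun (μ := volume) h (fun u hu => ?_) measurableSet_Ioi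
    have hu' : (0:ℝ) < u := hu
    have e2 : u ^ (-(3 / 2) : ℝ) = u ^ (-(1 / 2) : ℝ) / u := by
      rw [← Real.rpow_sub_one hu'.ne']; norm_num
    simp only [Pi.sub_apply, Pi.mul_apply, e2, hpow u hu', v]
    field_simp
  have hlim : ∀ F : Filter ℝ, (∀ᶠ u in F, 0 < u) →
      (∀ p : ℝ, Tendsto (fun u => u ^ p * expKer a b u) F (𝓝 0)) →
      Tendsto (Real.log * v) F (𝓝 0) := by
    intro F hF h
    have h1 := (((h (3/2)).const_mul l).add ((h (-(1/2))).const_mul l)).add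
      (((h (1/2)).const_mul |r|).add ((h (-(3/2))).const_mul |r|))
    simp only [mul_zero, add_zero] at h1
    refine squeeze_zero_norm' ?_ h1
    filter_upwards [hF] with u hu'
    have e2 : u ^ (-(3 / 2) : ℝ) = u ^ (-(1 / 2) : ℝ) * u⁻¹ := by
      rw [← div_eq_mul_inv, ← Real.rpow_sub_one hu'.ne']; norm_num
    have e3 : u ^ (3 / 2 : ℝ) = u * (u * u ^ (-(1 / 2) : ℝ)) := by
      rw [← hpow u hu', mul_comm, ← Real.rpow_add_one hu'.ne']; norm_num
    have hE := expKer_nonneg a b u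
    have hp := Real.rpow_nonneg hu'.le (-(1 / 2))
    rw [Pi.mul_apply, norm_mul, Real.norm_eq_abs, Real.norm_eq_abs, e2, e3]
    simp only [v, hpow u hu']
    have hb1 : |l * (u * u ^ (-(1 / 2) : ℝ) * expKer a b u) - r * (u ^ (-(1 / 2) : ℝ) * expKer a b u)|
        ≤ (l * u + |r|) * (u ^ (-(1 / 2) : ℝ) * expKer a b u) := by
      refine (abs_sub _ _).trans ?_
      rw [abs_mul, abs_mul r, abs_of_pos hl, abs_of_nonneg (by positivity),
        abs_of_nonneg (a := u ^ (-(1 / 2) : ℝ) * expKer a b u) (by positivity)]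
      apply le_of_eq; ring
    calc _ ≤ (u + u⁻¹) * ((l * u + |r|) * (u ^ (-(1 / 2) : ℝ) * expKer a b u)) := by
          gcongr
          exact abs_log_le_add_inv hu'
      _ = _ := by field_simp
  have key := integral_Ioi_mul_deriv_eq_deriv_mul (a := 0) (u := Real.log) (v := v)
    (u' := fun u => u⁻¹) (v' := v') (fun u hu => Real.hasDerivAt_log (ne_of_gt hu)) hv huv' hu'v
    (hlim _ self_mem_nhdsWithin (tendsto_rpow_mul_expKer_zero ha hb))
    (hlim _ (eventually_gt_atTop 0) (tendsto_rpow_mul_expKer_atTop ha hb))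
  rw [sub_zero, zero_sub] at key
  rw [key]
  congr 1
  refine setIntegral_congr_fun measurableSet_Ioi fun u hu => ?_
  have hu' : (0:ℝ) < u := hu
  simp only [v, hpow u hu', bker, pow_one, neg_sq]
  change _ = u ^ (-(1 / 2) : ℝ) * ((-r / u + l) * expKer a b u)
  field_simp
  ring

/-- Since l²u + r²/u = u(l - r/u)² + 2rl, the operator y∂_y + 1/2 + 2πyrl turns the integrand into
log u times a derivative in u, and `integral_log_by_parts` leaves an elementary integral that
vanishes for r > 0. The factor √y in `besselDer` absorbs the 1/2. -/
lemma hasDerivAt_besselDer {r l y : ℝ} (hr : r ≠ 0) (hl : 0 < l) (hy : 0 < y) :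
    HasDerivAt (besselDer r l)
      (-(2 * π * r * l) * besselDer r l y -
        if r < 0 then 2 * y⁻¹ * Real.exp (-(2 * π * y * l * |r|)) else 0) y := by
  set w : ℝ → ℝ := fun u => π * (l ^ 2 * u + r ^ 2 / u)
  let F : ℝ → ℝ → ℝ := fun y u => u ^ (-(1 / 2) : ℝ) * (Real.log u * bker 1 r l y u)
  let F' : ℝ → ℝ → ℝ := fun y u => u ^ (-(1 / 2) : ℝ) * (Real.log u * bker 1 r l y u) * (-w u)
  have hI : ∀ {y : ℝ}, 0 < y → ∀ p : ℝ, IntegrableOn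
      (fun u => Real.log u * (u ^ p * expKer (π * y * l ^ 2) (π * y * r ^ 2) u)) (Ioi 0) :=
    fun hy p => integrableOn_log_mul (by positivity) (by positivity) p
  have e2 : ∀ u : ℝ, 0 < u → u ^ (-(3 / 2) : ℝ) = u ^ (-(1 / 2) : ℝ) / u := by
    intro u hu'; rw [← Real.rpow_sub_one hu'.ne']; norm_num
  have e3 : ∀ u : ℝ, 0 < u → u ^ (-(5 / 2) : ℝ) = u ^ (-(1 / 2) : ℝ) / u / u := by
    intro u hu'; rw [← Real.rpow_sub_one hu'.ne', ← Real.rpow_sub_one hu'.ne']; norm_num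
  have e1 : ∀ u : ℝ, 0 < u → u ^ (1 / 2 : ℝ) = u * u ^ (-(1 / 2) : ℝ) := by
    intro u hu; rw [mul_comm, ← Real.rpow_add_one hu.ne']; norm_num
  have hFint : ∀ {y : ℝ}, 0 < y → IntegrableOn (F y) (Ioi 0) := by
    intro y hy
    refine IntegrableOn.congr_fun (μ := volume) (((hI hy (-(1/2))).const_mul l).add ((hI hy (-(3/2))).const_mul r))
      (fun u hu => ?_) measurableSet_Ioi
    simp only [Pi.add_apply, F, bker, pow_one, e2 u hu]
    have : u ≠ 0 := ne_of_gt hu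
    field_simp
    ring
  have hF'int : ∀ {y : ℝ}, 0 < y → IntegrableOn (F' y) (Ioi 0) := by
    intro y hy
    refine IntegrableOn.congr_fun (μ := volume) (((((hI hy (-(1/2))).const_mul (-π * (r * l ^ 2))).add
      ((hI hy (1/2)).const_mul (-π * l ^ 3))).add
      ((hI hy (-(5/2))).const_mul (-π * r ^ 3))).add
      ((hI hy (-(3/2))).const_mul (-π * (l * r ^ 2))))
      (fun u hu => ?_) measurableSet_Ioi
    simp only [Pi.add_apply, F', bker, pow_one, e2 u hu, e3 u hu, e1 u hu, w]
    have : u ≠ 0 := ne_of_gt hu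
    field_simp
    ring
  have hy2 : 0 < y / 2 := half_pos hy
  -- For parameters above y/2 the exponential is largest at y/2, and |r| in place of r bounds the
  -- linear factor.
  have hd := hasDerivAt_integral_of_dominated_loc_of_deriv_le (F := F) (F' := F') (x₀ := y)
    (μ := volume.restrict (Ioi 0)) (s := Ioi (y / 2)) (bound := fun u => ‖u ^ (-(1 / 2) : ℝ) *
      (Real.log u * ((|r| / u + l) ^ 1 * expKer (π * (y / 2) * l ^ 2) (π * (y / 2) * r ^ 2) u)) * w u‖)
    (Ioi_mem_nhds (by linarith))
    (by
      filter_upwards [Ioi_mem_nhds hy] with x hx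
      exact (hFint hx).aestronglyMeasurable)
    (hFint hy) (hF'int hy).aestronglyMeasurable
    (by
      refine (ae_restrict_mem measurableSet_Ioi).mono fun u hu x hx => ?_
      have hu' : (0:ℝ) < u := hu
      have hx' : y / 2 < x := hx
      simp only [F', bker, norm_mul, norm_neg, pow_one]
      have h1 : ‖r / u + l‖ ≤ ‖|r| / u + l‖ := by
        rw [Real.norm_of_nonneg (show 0 ≤ |r| / u + l by positivity), Real.norm_eq_abs]
        refine (abs_add_le _ _).trans ?_
        rw [abs_div, abs_of_pos hu', abs_of_pos hl]
      have h2 : ‖expKer (π * x * l ^ 2) (π * x * r ^ 2) u‖ ≤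
          ‖expKer (π * (y / 2) * l ^ 2) (π * (y / 2) * r ^ 2) u‖ := by
        rw [Real.norm_of_nonneg (expKer_nonneg _ _ _), Real.norm_of_nonneg (expKer_nonneg _ _ _)]
        exact expKer_anti (by gcongr) (by gcongr) hu'
      gcongr)
    (by
      refine Integrable.norm ?_
      refine IntegrableOn.congr_fun (μ := volume) (((((hI hy2 (-(1/2))).const_mul (π * (|r| * l ^ 2))).add
        ((hI hy2 (1/2)).const_mul (π * l ^ 3))).add
        ((hI hy2 (-(5/2))).const_mul (π * (|r| * r ^ 2)))).add
        ((hI hy2 (-(3/2))).const_mul (π * (l * r ^ 2))))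
        (fun u hu => ?_) measurableSet_Ioi
      simp only [Pi.add_apply, pow_one, e2 u hu, e3 u hu, e1 u hu, w]
      have : u ≠ 0 := ne_of_gt hu
      field_simp
      ring)
    (by
      refine (ae_restrict_mem measurableSet_Ioi).mono fun u hu x hx => ?_
      have hE : HasDerivAt (fun x => expKer (π * x * l ^ 2) (π * x * r ^ 2) u)
          (expKer (π * x * l ^ 2) (π * x * r ^ 2) u * (-w u)) x := by
        have h1 : HasDerivAt (fun x => -(π * x * l ^ 2 * u + π * x * r ^ 2 / u)) (-w u) x := by
          have h2 := (hasDerivAt_id x).mul_const (-w u)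
          rw [one_mul] at h2
          refine h2.congr_of_eventuallyEq (Eventually.of_forall fun x => ?_)
          simp only [w, id]; ring
        exact h1.exp
      have h3 := ((hE.const_mul ((r / u + l) ^ 1)).const_mul (Real.log u)).const_mul
        (u ^ (-(1 / 2) : ℝ))
      refine h3.congr_deriv ?_
      simp only [F', bker]; ring)
  have hsy : 0 < √y := Real.sqrt_pos.2 hy
  have hmain := (Real.hasDerivAt_sqrt hy.ne').mul hd.2
  refine hmain.congr_deriv ?_
  have hp := integral_log_by_parts hr hl hy
  rw [integral_bker_one (neg_ne_zero.2 hr) hl hy, abs_neg] at hp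
  simp only [neg_pos] at hp
  have hcomb : ∀ u ∈ Ioi (0:ℝ), Real.log u * (u ^ (-(1 / 2) : ℝ) * bker 1 r l y u *
      (1 / 2 - π * y * u * (l - r / u) ^ 2)) =
      (1 / 2 + 2 * π * y * r * l) * F y u + y * F' y u := by
    intro u hu
    have : u ≠ 0 := ne_of_gt hu
    simp only [F, F', w]
    field_simp
    ring
  rw [setIntegral_congr_fun measurableSet_Ioi hcomb, integral_add ((hFint hy).const_mul _)
    ((hF'int hy).const_mul _), integral_const_mul, integral_const_mul] at hp
  change _ = -(2 * π * r * l) * (√y * ∫ u in Ioi (0:ℝ), F y u) - _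
  have hsq : √y ^ 2 = y := Real.sq_sqrt hy.le
  generalize (∫ u in Ioi (0:ℝ), F y u) = X at *
  generalize (∫ u in Ioi (0:ℝ), F' y u) = Y at *
  have hY : Y = y⁻¹ * (-(if r < 0 then 2 * (√y)⁻¹ * Real.exp (-(2 * π * y * l * |r|)) else 0)
      - (1 / 2 + 2 * π * y * r * l) * X) := by
    rw [← hp]; field_simp; ring
  rw [hY]
  have h4 : 1 / (2 * √y) = √y / (2 * y) := by
    rw [div_eq_div_iff (by positivity) (by positivity)]
    linear_combination (-2) * hsq
  rw [h4]
  split_ifs with h0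
  · rw [show (√y) * (y⁻¹ * (-(2 * (√y)⁻¹ * Real.exp (-(2 * π * y * l * |r|))) -
      (1 / 2 + 2 * π * y * r * l) * X)) = y⁻¹ * (-(2 * (√y * (√y)⁻¹) *
        Real.exp (-(2 * π * y * l * |r|))) - √y * (1 / 2 + 2 * π * y * r * l) * X) by ring,
      mul_inv_cancel₀ hsy.ne']
    field_simp
    ring
  · field_simp
    ring

/-! ### Poisson summation along one row of the lattice. -/

/-- The points `ξ + j + i l y` of a row of a lattice. -/
def rowPt (ξ l y : ℝ) (j : ℤ) : ℂ := ((j + ξ : ℝ) : ℂ) + Complex.I * ((l * y : ℝ) : ℂ)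

lemma conj_rowPt (ξ l y : ℝ) (j : ℤ) :
    conj (rowPt ξ l y j) = ((j + ξ : ℝ) : ℂ) - Complex.I * ((l * y : ℝ) : ℂ) := by
  simp [rowPt]; ring

lemma norm_rowPt_sq (ξ l y : ℝ) (j : ℤ) : ‖rowPt ξ l y j‖ ^ 2 = (j + ξ) ^ 2 + (l * y) ^ 2 := by
  rw [← Complex.normSq_eq_norm_sq, Complex.normSq_apply]
  simp [rowPt]; ring

lemma abs_le_norm_rowPt (ξ l y : ℝ) (j : ℤ) : |(j:ℝ) + ξ| ≤ ‖rowPt ξ l y j‖ := by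
  have := Complex.abs_re_le_norm (rowPt ξ l y j)
  simpa [rowPt] using this

lemma norm_rowPt_pos {l y : ℝ} (hl : 0 < l) (hy : 0 < y) (ξ : ℝ) (j : ℤ) :
    0 < ‖rowPt ξ l y j‖ := by
  have h := Complex.abs_im_le_norm (rowPt ξ l y j)
  have : (rowPt ξ l y j).im = l * y := by simp [rowPt]
  rw [this, abs_of_pos (by positivity)] at h
  exact lt_of_lt_of_le (by positivity) h

/-- Poisson summation for a shifted Gaussian, in the form of the functional equation of the Hurwitz
theta kernel. `hasSum_theta_odd` is the version for a Gaussian times a linear factor. -/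
lemma hasSum_theta_even (ξ : ℝ) {x : ℝ} (hx : 0 < x) :
    HasSum (fun j : ℤ => ((Real.exp (-π * (j + ξ) ^ 2 * x) : ℝ) : ℂ))
        ((HurwitzZeta.evenKernel ξ x : ℝ) : ℂ) ∧
    HasSum (fun r : ℤ => ((x ^ (-(1 / 2) : ℝ) : ℝ) : ℂ) * (Complex.exp (2 * π * Complex.I * ξ * r) *
        Real.exp (-π * r ^ 2 * (1 / x)))) ((HurwitzZeta.evenKernel ξ x : ℝ) : ℂ) := by
  refine ⟨Complex.hasSum_ofReal.2 (HurwitzZeta.hasSum_int_evenKernel ξ hx), ?_⟩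
  have h := (HurwitzZeta.hasSum_int_cosKernel ξ (one_div_pos.2 hx)).mul_left
    (((x ^ (-(1 / 2) : ℝ) : ℝ) : ℂ))
  rw [HurwitzZeta.evenKernel_functional_equation, Complex.ofReal_mul, one_div (x ^ _),
    ← Real.rpow_neg hx.le]
  exact h

lemma hasSum_theta_odd (ξ : ℝ) {x : ℝ} (hx : 0 < x) :
    HasSum (fun j : ℤ => (((j + ξ) * Real.exp (-π * (j + ξ) ^ 2 * x) : ℝ) : ℂ))
        ((HurwitzZeta.oddKernel ξ x : ℝ) : ℂ) ∧
    HasSum (fun r : ℤ => ((x ^ (-(3 / 2) : ℝ) : ℝ) : ℂ) * (-Complex.I * r *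
      Complex.exp (2 * π * Complex.I * ξ * r) *
        Real.exp (-π * r ^ 2 * (1 / x)))) ((HurwitzZeta.oddKernel ξ x : ℝ) : ℂ) := by
  refine ⟨Complex.hasSum_ofReal.2 (HurwitzZeta.hasSum_int_oddKernel ξ hx), ?_⟩
  have h := (HurwitzZeta.hasSum_int_sinKernel ξ (one_div_pos.2 hx)).mul_left
    (((x ^ (-(3 / 2) : ℝ) : ℝ) : ℂ))
  rw [HurwitzZeta.oddKernel_functional_equation, Complex.ofReal_mul, one_div (x ^ _),
    ← Real.rpow_neg hx.le]
  exact h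

lemma exp_row_eq (ξ l : ℝ) {y : ℝ} (hy : 0 < y) (u : ℝ) (j : ℤ) :
    Real.exp (-(π * ‖rowPt ξ l y j‖ ^ 2 / y) * u) =
      Real.exp (-(π * l ^ 2 * y * u)) * Real.exp (-π * (j + ξ) ^ 2 * (u / y)) := by
  rw [← Real.exp_add, norm_rowPt_sq]
  congr 1
  field_simp
  ring

lemma bker_eq (κ : ℕ) (r l y : ℝ) (u : ℝ) : bker κ r l y u =
    (r / u + l) ^ κ * Real.exp (-(π * l ^ 2 * y * u)) * Real.exp (-π * r ^ 2 * (1 / (u / y))) := by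
  rw [bker, expKer, mul_assoc ((r / u + l) ^ κ), ← Real.exp_add]
  congr 2
  rw [one_div_div]
  ring

/-- Poisson summation along a row, before taking the Mellin transform. -/
lemma exists_hasSum_theta {κ : ℕ} (hκ : κ ≤ 1) (ξ : ℝ) {l y u : ℝ} (hy : 0 < y)
    (hu : 0 < u) : ∃ T : ℂ,
    HasSum (fun j : ℤ => conj (rowPt ξ l y j) ^ κ *
      (Real.exp (-(π * ‖rowPt ξ l y j‖ ^ 2 / y) * u) : ℝ)) T ∧
    HasSum (fun r : ℤ => (-Complex.I) ^ κ * ((y ^ (κ + 1 / 2 : ℝ) : ℝ) : ℂ) *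
      (Complex.exp (2 * π * Complex.I * ξ * r) *
        ((u ^ (-(1 / 2) : ℝ) * bker κ r l y u : ℝ) : ℂ))) T := by
  have hx : 0 < u / y := by positivity
  have hE := hasSum_theta_even ξ hx
  have hO := hasSum_theta_odd ξ hx
  have hyu : (u / y) ^ (-(1 / 2) : ℝ) = y ^ (1 / 2 : ℝ) * u ^ (-(1 / 2) : ℝ) := by
    rw [Real.div_rpow hu.le hy.le, Real.rpow_neg hy.le (1 / 2), div_inv_eq_mul, mul_comm]
  have hyu3 : (u / y) ^ (-(3 / 2) : ℝ) = y ^ (1 / 2 : ℝ) * u ^ (-(1 / 2) : ℝ) * (y / u) := by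
    rw [← hyu, show (-(3 / 2) : ℝ) = -(1 / 2) - 1 by norm_num, Real.rpow_sub_one hx.ne',
      div_div_eq_mul_div, mul_div_assoc]
  interval_cases κ
  · refine ⟨_, ((hE.1.mul_left ((Real.exp (-(π * l ^ 2 * y * u)) : ℝ) : ℂ)).congr_fun ?_),
      ((hE.2.mul_left ((Real.exp (-(π * l ^ 2 * y * u)) : ℝ) : ℂ)).congr_fun ?_)⟩
    · intro j
      simp only [pow_zero, one_mul, exp_row_eq ξ l hy, Complex.ofReal_mul]
    · intro r
      rw [bker_eq 0 r l y u, hyu]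
      simp only [pow_zero, one_mul, Complex.ofReal_mul, Nat.cast_zero, zero_add]
      ring
  -- The conjugate of a row point is (j + ξ) - ily, so weight one combines the odd series with ily
  -- times the even one; on the dual side they merge into the factor r/u + l.
  · refine ⟨_, (((hO.1.sub (hE.1.mul_left (Complex.I * ((l * y : ℝ) : ℂ)))).mul_left
      ((Real.exp (-(π * l ^ 2 * y * u)) : ℝ) : ℂ)).congr_fun ?_),
      (((hO.2.sub (hE.2.mul_left (Complex.I * ((l * y : ℝ) : ℂ)))).mul_left
      ((Real.exp (-(π * l ^ 2 * y * u)) : ℝ) : ℂ)).congr_fun ?_)⟩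
    · intro j
      simp only [pow_one, exp_row_eq ξ l hy, Complex.ofReal_mul, conj_rowPt]
      ring
    · intro r
      rw [bker_eq 1 r l y u, hyu, hyu3, Nat.cast_one, add_comm (1:ℝ), Real.rpow_add_one hy.ne']
      have : (u:ℂ) ≠ 0 := by exact_mod_cast hu.ne'
      push_cast
      field_simp
      ring

lemma summable_rowPt (ξ l y : ℝ) {p : ℝ} (hp : 1 < p) :
    Summable fun j : ℤ => ‖rowPt ξ l y j‖ ^ (-p) := by
  refine Summable.of_norm_bounded_eventually ((Real.summable_one_div_int_add_rpow ξ p).2 hp) ?_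
  have : {j : ℤ | ¬ ((j:ℝ) + ξ ≠ 0)}.Finite := by
    refine Set.Subsingleton.finite fun i hi j hj => ?_
    simp only [ne_eq, not_not, mem_ofPred_eq] at hi hj
    have : (i:ℝ) = j := by linarith
    exact_mod_cast this
  filter_upwards [this] with j hj
  have hj' : 0 < |(j:ℝ) + ξ| := abs_pos.2 hj
  rw [Real.norm_of_nonneg (Real.rpow_nonneg (norm_nonneg _) _), one_div, ← Real.rpow_neg hj'.le]
  exact Real.rpow_le_rpow_of_nonpos hj' (abs_le_norm_rowPt ξ l y j) (by linarith)

/-- For r = 0 the kernel does not decay at u = 0, so the integral is a Gamma integral with a genuine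
restriction on σ. This frequency is therefore continued by its explicit value. -/
lemma besselInt_zero_left (κ : ℕ) {l y : ℝ} (hl : 0 < l) (hy : 0 < y) {σ : ℂ}
    (hσ : 1 / 2 < σ.re) :
    MellinConvergent (fun u => (bker κ 0 l y u : ℂ)) (σ - 1 / 2) ∧
    besselInt κ 0 l y σ = (l:ℂ) ^ κ * (Complex.Gamma (σ - 1 / 2) *
      ((π * y * l ^ 2 : ℝ) : ℂ) ^ (1 / 2 - σ)) := by
  have hr : (0:ℝ) < π * y * l ^ 2 := by positivity
  have h0 : 0 < (σ - 1 / 2).re := by simpa using hσ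
  have e : ∀ u ∈ Ioi (0:ℝ), (u:ℂ) ^ (σ - 1 / 2 - 1) • (bker κ 0 l y u : ℂ) =
      (l:ℂ) ^ κ * ((u:ℂ) ^ (σ - 1 / 2 - 1) * Complex.exp (-(((π * y * l ^ 2 : ℝ) : ℂ) * u))) := by
    intro u hu
    simp only [bker, expKer, zero_div, zero_add, smul_eq_mul]
    push_cast
    simp only [ne_eq, OfNat.ofNat_ne_zero, not_false_eq_true, zero_pow, mul_zero, zero_div,
      add_zero]
    ring
  constructor
  · refine (integrableOn_congr_fun e measurableSet_Ioi).2 (Integrable.const_mul ?_ _)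
    have h1 : IntegrableOn (fun u : ℝ => u ^ ((σ - 1 / 2).re - 1) * Real.exp (-(π * y * l ^ 2) * u))
        (Ioi 0) := by
      simpa using integrableOn_rpow_mul_exp_neg_mul_rpow (s := (σ - 1 / 2).re - 1) (p := 1)
        (by linarith) zero_lt_one hr
    refine Integrable.mono' h1 ?_ ?_
    · refine ContinuousOn.aestronglyMeasurable ?_ measurableSet_Ioi
      refine ContinuousOn.mul ?_ (by fun_prop)
      intro u hu
      exact (Complex.continuousAt_ofReal_cpow_const u _ (Or.inr (ne_of_gt hu))).continuousWithinAt
    · refine (ae_restrict_iff' measurableSet_Ioi).2 (Eventually.of_forall fun u hu => ?_)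
      have hu' : (0:ℝ) < u := hu
      rw [norm_mul, Complex.norm_cpow_eq_rpow_re_of_pos hu', ← Complex.ofReal_mul, ← Complex.ofReal_neg,
        Complex.norm_exp, Complex.ofReal_re, neg_mul]
      simp
  · rw [besselInt, mellin, setIntegral_congr_fun measurableSet_Ioi e, integral_const_mul,
      Complex.integral_cpow_mul_exp_neg_mul_Ioi h0 (by simpa using hr), one_div, mul_comm
      (Complex.Gamma _), Complex.inv_cpow _ _ (by
        rw [Complex.arg_ofReal_of_nonneg hr.le]; exact Real.pi_ne_zero.symm),
      ← Complex.cpow_neg, neg_sub]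

lemma summable_int_exp {c : ℝ} (hc : 0 < c) : Summable fun r : ℤ => Real.exp (-(c * |(r:ℝ)|)) := by
  have h : Summable fun n : ℕ => Real.exp (-(c * (n:ℝ))) := by
    have := Real.summable_exp_nat_mul_iff.2 (neg_lt_zero.2 hc)
    exact this.congr fun n => by ring_nf
  refine Summable.of_nat_of_neg ?_ ?_ <;> simpa using h

lemma le_mul_exp_half {c : ℝ} (hc : 0 < c) (x : ℝ) : x ≤ 2 / c * Real.exp (c * x / 2) := by
  have := Real.add_one_le_exp (c * x / 2)
  calc x = 2 / c * (c * x / 2) := by field_simp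
    _ ≤ _ := by gcongr; linarith

lemma summable_int_mul_exp {c : ℝ} (hc : 0 < c) (l : ℝ) :
    Summable fun r : ℤ => (1 + |(r:ℝ)| + l) * Real.exp (-(c * |(r:ℝ)|)) := by
  have h1 := summable_int_exp hc
  have h2 : Summable fun r : ℤ => |(r:ℝ)| * Real.exp (-(c * |(r:ℝ)|)) := by
    refine Summable.of_nonneg_of_le (fun r => by positivity) (fun r => ?_)
      ((summable_int_exp (half_pos hc)).mul_left (2 / c))
    calc |(r:ℝ)| * Real.exp (-(c * |(r:ℝ)|))
        ≤ 2 / c * Real.exp (c * |(r:ℝ)| / 2) * Real.exp (-(c * |(r:ℝ)|)) := by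
          gcongr; exact le_mul_exp_half hc _
      _ = _ := by rw [mul_assoc, ← Real.exp_add]; ring_nf
  exact ((h1.mul_left (1 + l)).add h2).congr fun r => by ring

lemma int_one_le_abs {r : ℤ} (hr : r ≠ 0) : 1 ≤ |(r:ℝ)| := by
  rw [← Int.cast_abs]; exact_mod_cast Int.one_le_abs hr

/-- Poisson summation along a row of a lattice. -/
lemma hasSum_row {κ : ℕ} (hκ : κ ≤ 1) (ξ : ℝ) {l y : ℝ} (hl : 0 < l) (hy : 0 < y) {σ : ℂ}
    (hσ : 1 + κ < 2 * σ.re) :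
    (Summable fun j : ℤ => conj (rowPt ξ l y j) ^ κ * ((‖rowPt ξ l y j‖ : ℝ) : ℂ) ^ (-2 * σ)) ∧
    HasSum (fun r : ℤ => (-Complex.I) ^ κ * ((√y : ℝ) : ℂ) *
      (Complex.exp (2 * π * Complex.I * ξ * r) * besselInt κ r l y σ))
      (Complex.Gamma σ * (π : ℂ) ^ (-σ) * (y : ℂ) ^ (σ - κ) *
        ∑' j : ℤ, conj (rowPt ξ l y j) ^ κ * ((‖rowPt ξ l y j‖ : ℝ) : ℂ) ^ (-2 * σ)) := by
  have hκ0 : (0:ℝ) ≤ κ := κ.cast_nonneg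
  have hσ1 : 1 / 2 < σ.re := by linarith
  have hσ0 : 0 < σ.re := by linarith
  have hN := fun j => norm_rowPt_pos hl hy ξ j
  have hsum : Summable fun j : ℤ => conj (rowPt ξ l y j) ^ κ *
      ((‖rowPt ξ l y j‖ : ℝ) : ℂ) ^ (-2 * σ) := by
    refine Summable.of_norm ((summable_rowPt ξ l y (p := 2 * σ.re - κ) (by linarith)).congr
      fun j => ?_)
    rw [norm_mul, norm_pow, RCLike.norm_conj, Complex.norm_cpow_eq_rpow_re_of_pos (hN j),
      ← Real.rpow_natCast, ← Real.rpow_add (hN j)]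
    congr 1
    simp
    ring
  refine ⟨hsum, ?_⟩
  choose! T hT1 hT2 using fun u hu => exists_hasSum_theta hκ ξ (l := l) (u := u) hy hu
  have hcp : ∀ j, (((π * ‖rowPt ξ l y j‖ ^ 2 / y : ℝ) : ℂ) ^ σ)⁻¹ =
      (π : ℂ) ^ (-σ) * (y : ℂ) ^ σ * ((‖rowPt ξ l y j‖ : ℝ) : ℂ) ^ (-2 * σ) := by
    intro j
    have h0 := hN j
    rw [← Complex.cpow_neg, Complex.ofReal_div, Complex.div_cpow_ofReal_nonneg (by positivity)
      hy.le, Complex.ofReal_mul, Complex.mul_cpow_ofReal_nonneg Real.pi_pos.le (by positivity),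
      Complex.cpow_neg (y:ℂ), div_inv_eq_mul, mul_right_comm, Complex.ofReal_pow,
      ← Complex.cpow_nat_mul' ]
    · norm_num
    · rw [Complex.arg_ofReal_of_nonneg h0.le]; simp [Real.pi_pos]
    · rw [Complex.arg_ofReal_of_nonneg h0.le]; simp [Real.pi_pos.le]
  -- The Mellin transform of each Gaussian is Γ(σ)(π|w|²/y)^{-σ}; this is how |w|^{-2σ} arises from
  -- a theta series.
  have hleft := hasSum_mellin (a := fun j => conj (rowPt ξ l y j) ^ κ)
    (p := fun j => π * ‖rowPt ξ l y j‖ ^ 2 / y) (F := T) (s := σ)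
    (fun j => Or.inr (by have := hN j; positivity)) hσ0 (fun t ht => hT1 t ht) (by
      refine (hsum.norm.mul_left ‖(π : ℂ) ^ (-σ) * (y : ℂ) ^ σ‖).congr fun j => ?_
      have h0 := hN j
      have hp : 0 < π * ‖rowPt ξ l y j‖ ^ 2 / y := by positivity
      rw [div_eq_mul_inv, ← Complex.norm_cpow_eq_rpow_re_of_pos hp, ← norm_inv, hcp]
      simp only [norm_mul]
      ring)
  have hval : mellin T σ = Complex.Gamma σ * (π : ℂ) ^ (-σ) * (y : ℂ) ^ σ *
      ∑' j : ℤ, conj (rowPt ξ l y j) ^ κ * ((‖rowPt ξ l y j‖ : ℝ) : ℂ) ^ (-2 * σ) := by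
    rw [← hleft.tsum_eq, ← tsum_mul_left]
    refine tsum_congr fun j => ?_
    rw [div_eq_mul_inv, hcp]; ring
  set c : ℤ → ℂ := fun r => (-Complex.I) ^ κ * ((y ^ (κ + 1 / 2 : ℝ) : ℝ) : ℂ) *
      Complex.exp (2 * π * Complex.I * ξ * r) with hc
  have hcn : ∀ r, ‖c r‖ = y ^ (κ + 1 / 2 : ℝ) := by
    intro r
    have : ‖Complex.exp (2 * π * Complex.I * ξ * r)‖ = 1 := by
      rw [show (2 * π * Complex.I * ξ * r : ℂ) = ((2 * π * ξ * r : ℝ) : ℂ) * Complex.I by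
        push_cast; ring, Complex.norm_exp_ofReal_mul_I]
    rw [hc, norm_mul, norm_mul, this, norm_pow, norm_neg, Complex.norm_I, one_pow, one_mul, mul_one,
      Complex.norm_real, Real.norm_of_nonneg (by positivity)]
  let f : ℤ → ℝ → ℂ := fun r u => c r * ((u : ℂ) ^ (σ - 1 / 2 - 1) • (bker κ r l y u : ℂ))
  have hconv : ∀ r : ℤ, MellinConvergent (fun u => (bker κ r l y u : ℂ)) (σ - 1 / 2) := by
    intro r
    rcases eq_or_ne r 0 with rfl | hr
    · simpa using (besselInt_zero_left κ hl hy hσ1).1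
    · exact mellinConvergent_bker κ (by exact_mod_cast hr) hl hy _
  obtain ⟨C, hC, hbd⟩ := exists_integral_norm_bker_le hκ σ.re σ.re hl hy
  -- On the dual side sum and integral are interchanged by the exponential bounds in |r|; the
  -- frequency 0 is a single term and is ignored for summability.
  have hright := hasSum_integral_of_summable_integral_norm (μ := volume.restrict (Ioi 0)) (F := f)
    (fun r => (hconv r).const_mul _) (by
      have hs : Summable fun r : ℤ => y ^ (κ + 1 / 2 : ℝ) * (C * ((1 + |(r:ℝ)| + l) *
          Real.exp (-(π * y * l * |(r:ℝ)|)))) :=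
        ((summable_int_mul_exp (c := π * y * l) (by positivity) l).mul_left C).mul_left _
      refine Summable.of_norm_bounded_eventually hs ?_
      have : ∀ᶠ r : ℤ in cofinite, r ≠ 0 := (Set.finite_singleton 0).eventually_cofinite_notMem
      filter_upwards [this] with r hr
      rw [Real.norm_of_nonneg (integral_nonneg fun _ => norm_nonneg _)]
      simp only [f, norm_mul, hcn, integral_const_mul]
      gcongr
      exact (hbd r l y σ (int_one_le_abs hr) le_rfl le_rfl le_rfl le_rfl).trans_eq (by ring))
  have hint : ∫ u in Ioi (0:ℝ), ∑' r, f r u = mellin T σ := by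
    refine setIntegral_congr_fun measurableSet_Ioi fun u hu => ?_
    have hu' : (0:ℝ) < u := hu
    have h := (hT2 u hu).mul_left ((u:ℂ) ^ (σ - 1))
    simp only [smul_eq_mul, ← h.tsum_eq]
    refine tsum_congr fun r => ?_
    have : (u:ℂ) ^ (σ - 1 / 2 - 1) = (u:ℂ) ^ (σ - 1) * ((u ^ (-(1 / 2) : ℝ) : ℝ) : ℂ) := by
      rw [Complex.ofReal_cpow hu'.le, ← Complex.cpow_add _ _ (by exact_mod_cast hu'.ne')]
      congr 1; push_cast; ring
    simp only [f, hc, smul_eq_mul, this, Complex.ofReal_mul]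
    ring
  rw [hint, hval] at hright
  have hy0 : (y:ℂ) ≠ 0 := by exact_mod_cast hy.ne'
  have h := hright.mul_left ((y:ℂ) ^ (-(κ:ℂ)))
  have hv : (y:ℂ) ^ (-(κ:ℂ)) * (Complex.Gamma σ * (π : ℂ) ^ (-σ) * (y : ℂ) ^ σ *
      ∑' j : ℤ, conj (rowPt ξ l y j) ^ κ * ((‖rowPt ξ l y j‖ : ℝ) : ℂ) ^ (-2 * σ)) =
      Complex.Gamma σ * (π : ℂ) ^ (-σ) * (y : ℂ) ^ (σ - κ) *
        ∑' j : ℤ, conj (rowPt ξ l y j) ^ κ * ((‖rowPt ξ l y j‖ : ℝ) : ℂ) ^ (-2 * σ) := by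
    rw [sub_eq_add_neg, Complex.cpow_add _ _ hy0]
    ring
  rw [hv] at h
  refine h.congr_fun fun r => ?_
  have : (y:ℂ) ^ (-(κ:ℂ)) * ((y ^ (κ + 1 / 2 : ℝ) : ℝ) : ℂ) = ((√y : ℝ) : ℂ) := by
    rw [Complex.ofReal_cpow hy.le, ← Complex.cpow_add _ _ hy0, Real.sqrt_eq_rpow,
      Complex.ofReal_cpow hy.le]
    congr 1; push_cast; ring
  simp only [f, hc, integral_const_mul, besselInt, mellin]
  rw [← this]
  ring

/-! ### Lattice sums with periodic coefficients and the expansion of their rows. -/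

section Lattice

variable {A B : ℕ}

/-- The term of a lattice sum with periodic coefficients `g`. -/
def latTerm (κ : ℕ) (g : ZMod A → ZMod B → ℂ) (z σ : ℂ) (p : ℤ × ℤ) : ℂ :=
  g p.1 p.2 * (conj ((p.1 : ℂ) * z + p.2) ^ κ * ((‖(p.1 : ℂ) * z + p.2‖ : ℝ) : ℂ) ^ (-2 * σ))

/-- The lattice sum `1/2 ∑ g(m,n) conj(mz+n)^κ |mz+n|^{-2σ}`. -/
def latSum (κ : ℕ) (g : ZMod A → ZMod B → ℂ) (z σ : ℂ) : ℂ :=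
  (1 / 2 : ℂ) * ∑' p : ℤ × ℤ, latTerm κ g z σ p

/-- Functions of parity `κ`. -/
def HasParity (κ : ℕ) (g : ZMod A → ZMod B → ℂ) : Prop :=
  ∀ a b, g (-a) (-b) = (-1) ^ κ * g a b

/-- The summands of the lattice sum without coefficients are summable. -/
lemma summable_norm_lattice {z : ℂ} (hz : 0 < z.im) {k : ℝ} (hk : 2 < k) :
    Summable fun p : ℤ × ℤ => ‖(p.1 : ℂ) * z + p.2‖ ^ (-k) := by
  have h := (EisensteinSeries.summable_one_div_norm_rpow hk).mul_left
    (EisensteinSeries.r (⟨z, hz⟩ : ℍ) ^ (-k))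
  have h2 : Summable fun x : Fin 2 → ℤ => ‖(x 0 : ℂ) * z + x 1‖ ^ (-k) :=
    Summable.of_nonneg_of_le (fun x => by positivity)
      (fun x => EisensteinSeries.summand_bound (⟨z, hz⟩ : ℍ) (by linarith) x) h
  simpa [Function.comp_def, finTwoArrowEquiv] using (finTwoArrowEquiv ℤ).symm.summable_iff.2 h2

lemma lattice_ne_zero {z : ℂ} (hz : 0 < z.im) {p : ℤ × ℤ} (hp : p ≠ 0) :
    (p.1 : ℂ) * z + p.2 ≠ 0 := by
  intro h
  apply hp
  have h1 : (p.1 : ℝ) * z.im = 0 := by simpa using congrArg Complex.im h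
  have h2 : p.1 = 0 := by
    rcases mul_eq_zero.1 h1 with h | h
    · exact_mod_cast h
    · exact absurd h hz.ne'
  have h3 : p.2 = 0 := by rw [h2] at h; simpa using h
  exact Prod.ext h2 h3

lemma norm_latTerm (κ : ℕ) (g : ZMod A → ZMod B → ℂ) {z : ℂ} (hz : 0 < z.im) (σ : ℂ)
    {p : ℤ × ℤ} (hp : p ≠ 0) : ‖latTerm κ g z σ p‖ =
      ‖g p.1 p.2‖ * ‖(p.1 : ℂ) * z + p.2‖ ^ (-(2 * σ.re - κ)) := by
  have h := norm_pos_iff.2 (lattice_ne_zero hz hp)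
  rw [latTerm, norm_mul, norm_mul, norm_pow, RCLike.norm_conj,
    Complex.norm_cpow_eq_rpow_re_of_pos h, ← Real.rpow_natCast, ← Real.rpow_add h]
  congr 2
  simp
  ring

lemma latTerm_neg {κ : ℕ} {g : ZMod A → ZMod B → ℂ} (hg : HasParity κ g) (z σ : ℂ) (p : ℤ × ℤ) :
    latTerm κ g z σ (-p) = latTerm κ g z σ p := by
  have e : ((-p.1 : ℤ) : ℂ) * z + ((-p.2 : ℤ) : ℂ) = -((p.1 : ℂ) * z + p.2) := by push_cast; ring
  simp only [latTerm, Prod.fst_neg, Prod.snd_neg, e, Int.cast_neg (R := ZMod A),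
    Int.cast_neg (R := ZMod B), hg _ _, norm_neg, map_neg, neg_pow (conj _) κ]
  have : ((-1:ℂ) ^ κ) * (-1) ^ κ = 1 := by rw [← mul_pow]; simp
  linear_combination (g p.1 p.2 * (conj ((p.1 : ℂ) * z + p.2) ^ κ *
    ((‖(p.1 : ℂ) * z + p.2‖ : ℝ) : ℂ) ^ (-2 * σ))) * this

variable [NeZero A] [NeZero B]

lemma exists_norm_le_coeff (g : ZMod A → ZMod B → ℂ) : ∃ G, 0 ≤ G ∧ ∀ a b, ‖g a b‖ ≤ G := by
  refine ⟨∑ a, ∑ b, ‖g a b‖, by positivity, fun a b => ?_⟩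
  calc ‖g a b‖ ≤ ∑ b, ‖g a b‖ :=
        Finset.single_le_sum (f := fun b => ‖g a b‖) (fun _ _ => norm_nonneg _) (Finset.mem_univ b)
    _ ≤ _ := Finset.single_le_sum (f := fun a => ∑ b, ‖g a b‖)
        (fun _ _ => by positivity) (Finset.mem_univ a)

lemma summable_latTerm (κ : ℕ) (g : ZMod A → ZMod B → ℂ) {z : ℂ} (hz : 0 < z.im) {σ : ℂ}
    (hσ : 2 + κ < 2 * σ.re) : Summable (latTerm κ g z σ) := by
  obtain ⟨G, hG, hg⟩ := exists_norm_le_coeff g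
  refine Summable.of_norm_bounded_eventually
    ((summable_norm_lattice hz (k := 2 * σ.re - κ) (by linarith)).mul_left G) ?_
  have : ∀ᶠ p : ℤ × ℤ in cofinite, p ≠ 0 := (Set.finite_singleton 0).eventually_cofinite_notMem
  filter_upwards [this] with p hp
  rw [norm_latTerm κ g hz σ hp]
  gcongr
  exact hg _ _

/-- The finite Fourier transform in the second variable. -/
def ghat (g : ZMod A → ZMod B → ℂ) (a : ZMod A) (r : ZMod B) : ℂ :=
  ∑ b, g a b * ZMod.stdAddChar (b * r)

/-- Parity identifies the rows m and -m, which cancels the factor 1/2. In the row m = 0 it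
identifies n and -n, and for n > 0 the term is g(0,n) n^{κ-2σ}, whence the argument of the
L-function. -/
lemma latSum_eq_rows {κ : ℕ} {g : ZMod A → ZMod B → ℂ} (hg : HasParity κ g) {z : ℂ}
    (hz : 0 < z.im) {σ : ℂ} (hσ : 2 + κ < 2 * σ.re) :
    (Summable fun m : ℕ => ∑' n : ℤ, latTerm κ g z σ ((m + 1 : ℕ), n)) ∧
    latSum κ g z σ = ZMod.LFunction (g 0) (2 * σ - κ) +
      ∑' m : ℕ, ∑' n : ℤ, latTerm κ g z σ ((m + 1 : ℕ), n) := by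
  have hs := summable_latTerm κ g hz hσ
  have hκ0 : (0:ℝ) ≤ κ := κ.cast_nonneg
  set R : ℤ → ℂ := fun m => ∑' n : ℤ, latTerm κ g z σ (m, n) with hR
  have hRs : Summable R := hs.prod
  have hRe : ∀ m, R (-m) = R m := by
    intro m
    simp only [hR]
    rw [← (Equiv.neg ℤ).tsum_eq]
    exact tsum_congr fun n => latTerm_neg hg z σ (m, n)
  have h1 : ∑' p : ℤ × ℤ, latTerm κ g z σ p = R 0 + 2 * ∑' m : ℕ, R ((m + 1 : ℕ)) := by
    rw [hs.tsum_prod, tsum_int_eq_zero_add_two_mul_tsum_pnat hRe hRs,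
      tsum_pnat_eq_tsum_succ (f := fun m : ℕ => R m), nsmul_eq_mul]
    norm_num
  have h0s : Summable fun n : ℤ => latTerm κ g z σ (0, n) := hs.prod_factor 0
  have h0 : R 0 = 2 * ZMod.LFunction (g 0) (2 * σ - κ) := by
    have he : Function.Even fun n : ℤ => latTerm κ g z σ (0, n) := fun n => by
      simpa using latTerm_neg hg z σ (0, n)
    -- The origin contributes 0^{-2σ}, which is 0 because σ ≠ 0.
    have hz0 : latTerm κ g z σ (0, 0) = 0 := by
      have : (-2 * σ) ≠ 0 := by
        intro h
        have : σ = 0 := by simpa using h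
        rw [this] at hσ
        simp at hσ
        linarith
      simp only [latTerm, Int.cast_zero, zero_mul, add_zero, norm_zero, Complex.ofReal_zero,
        Complex.zero_cpow this, mul_zero]
    simp only [hR]
    rw [tsum_int_eq_zero_add_two_mul_tsum_pnat he h0s, hz0, zero_add,
      tsum_pnat_eq_tsum_succ (f := fun m : ℕ => latTerm κ g z σ (0, m)), nsmul_eq_mul,
      ZMod.LFunction_eq_LSeries _ (by simp; linarith), LSeries,
      (ZMod.LSeriesSummable_of_one_lt_re (g 0) (s := 2 * σ - κ) (by simp; linarith)).tsum_eq_zero_add]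
    rw [LSeries.term_zero, zero_add]
    congr 1
    refine tsum_congr fun n => ?_
    rw [LSeries.term_of_ne_zero (by positivity)]
    have hn : ((n + 1 : ℕ) : ℂ) ≠ 0 := by exact_mod_cast n.succ_ne_zero
    have e1 : ((0:ℤ):ℂ) * z + (((n + 1 : ℕ) : ℤ) : ℂ) = ((n + 1 : ℕ) : ℂ) := by push_cast; ring
    simp only [latTerm, e1]
    simp only [Complex.norm_natCast, Int.cast_zero, Int.cast_natCast,
      Complex.conj_natCast, Complex.ofReal_natCast]
    rw [div_eq_mul_inv, ← Complex.cpow_neg, neg_sub, sub_eq_add_neg, Complex.cpow_add _ _ hn,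
      Complex.cpow_natCast, neg_mul]
  refine ⟨?_, ?_⟩
  · exact (summable_int_iff_summable_nat_and_neg.1 hRs).1.comp_injective (add_left_injective 1)
  · rw [latSum, h1, h0]
    ring

lemma sum_by_residue {f : ℤ → ℂ} (hf : Summable f) :
    ∑' n, f n = ∑ b : ZMod B, ∑' j : ℤ, f (b.val + B * j) := by
  obtain ⟨n, rfl⟩ : ∃ n, B = n + 1 := ⟨B - 1, (Nat.succ_pred_eq_of_ne_zero (NeZero.ne B)).symm⟩
  have h : Summable fun p : ℤ × Fin (n + 1) => f (p.2.val + (n + 1 : ℕ) * p.1) := by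
    refine ((Int.divModEquiv (n + 1)).symm.summable_iff.2 hf).congr fun p => ?_
    simp only [Function.comp_apply, Int.divModEquiv_symm_apply]
    ring_nf
  have h1 : ∑' n, f n = ∑' p : ℤ × Fin (n + 1), f (p.2.val + (n + 1 : ℕ) * p.1) := by
    rw [← (Int.divModEquiv (n + 1)).symm.tsum_eq]
    refine tsum_congr fun p => ?_
    simp only [Int.divModEquiv_symm_apply]
    ring_nf
  rw [h1, ← (Equiv.prodComm _ _).tsum_eq]
  have h2 := (Equiv.prodComm (Fin (n + 1)) ℤ).summable_iff.2 h
  refine h2.tsum_prod.trans ?_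
  rw [tsum_fintype]
  rfl

/-- The Fourier expansion of a row of the lattice sum. -/
lemma hasSum_latRow {κ : ℕ} (hκ : κ ≤ 1) (g : ZMod A → ZMod B → ℂ) {z : ℂ}
    (hz : 0 < z.im) {σ : ℂ} (hσ : 2 + κ < 2 * σ.re) {m : ℕ} (hm : 0 < m) :
    HasSum (fun r : ℤ => (-Complex.I) ^ κ * ((√z.im : ℝ) : ℂ) * (ghat g m r *
        (Complex.exp (2 * π * Complex.I * (r * (m / B * z.re : ℝ))) *
          besselInt κ r (m / B) z.im σ)))
      (Complex.Gamma σ * (π : ℂ) ^ (-σ) * (z.im : ℂ) ^ (σ - κ) * (B : ℂ) ^ (2 * σ - κ) *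
        ∑' n : ℤ, latTerm κ g z σ (m, n)) := by
  have hB : (0:ℝ) < B := by exact_mod_cast Nat.pos_of_ne_zero (NeZero.ne B)
  have hB0 : (B:ℂ) ≠ 0 := by exact_mod_cast NeZero.ne B
  have hl : (0:ℝ) < m / B := by have : (0:ℝ) < m := by exact_mod_cast hm
                                positivity
  have hκ0 : (0:ℝ) ≤ κ := κ.cast_nonneg
  have hrow := fun b : ZMod B => hasSum_row hκ ((m * z.re + b.val) / B) hl hz (σ := σ)
    (by linarith)
  -- Inside a residue class mod B the coefficient is constant and the points form B times a row with
  -- offset ξ = (mx + v)/B and height parameter l = m/B.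
  have hpt : ∀ (v : ℕ) (j : ℤ), ((m : ℤ) : ℂ) * z + ((v + B * j : ℤ) : ℂ) =
      ((B:ℝ):ℂ) * rowPt ((m * z.re + v) / B) (m / B) z.im j := by
    intro v j
    conv_lhs => rw [← Complex.re_add_im z]
    rw [rowPt]
    push_cast
    field_simp
    ring
  have hterm : ∀ (b : ZMod B) (j : ℤ), latTerm κ g z σ (m, (b.val + B * j : ℤ)) =
      (B : ℂ) ^ (κ - 2 * σ) * (g m b * (conj (rowPt ((m * z.re + b.val) / B) (m / B) z.im j) ^ κ *
        ((‖rowPt ((m * z.re + b.val) / B) (m / B) z.im j‖ : ℝ) : ℂ) ^ (-2 * σ))) := by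
    intro b j
    simp only [latTerm, hpt, norm_mul, map_mul, Complex.conj_ofReal, Complex.norm_real,
      Real.norm_of_nonneg hB.le, mul_pow]
    rw [Complex.ofReal_mul, Complex.mul_cpow_ofReal_nonneg hB.le (norm_nonneg _),
      sub_eq_add_neg, Complex.cpow_add _ _ hB0, Complex.cpow_natCast]
    simp
    ring
  have hs : Summable fun n : ℤ => latTerm κ g z σ (m, n) :=
    (summable_latTerm κ g hz hσ).prod_factor (m : ℤ)
  rw [sum_by_residue (B := B) hs, Finset.mul_sum]
  have hfin := hasSum_sum (s := Finset.univ) fun (b : ZMod B) _ => (hrow b).2.mul_left (g m b)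
  have hv : ∑ b : ZMod B, g m b * (Complex.Gamma σ * (π : ℂ) ^ (-σ) * (z.im : ℂ) ^ (σ - κ) *
      ∑' j : ℤ, conj (rowPt ((m * z.re + b.val) / B) (m / B) z.im j) ^ κ *
        ((‖rowPt ((m * z.re + b.val) / B) (m / B) z.im j‖ : ℝ) : ℂ) ^ (-2 * σ)) =
      ∑ b : ZMod B, Complex.Gamma σ * (π : ℂ) ^ (-σ) * (z.im : ℂ) ^ (σ - κ) *
        (B : ℂ) ^ (2 * σ - κ) * ∑' j : ℤ, latTerm κ g z σ (m, b.val + B * j) := by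
    refine Finset.sum_congr rfl fun b _ => ?_
    have : (B : ℂ) ^ (2 * σ - κ) * (B : ℂ) ^ (κ - 2 * σ) = 1 := by
      rw [← Complex.cpow_add _ _ hB0]; simp
    simp only [hterm, tsum_mul_left]
    linear_combination (-g m b * (Complex.Gamma σ * (π : ℂ) ^ (-σ) * (z.im : ℂ) ^ (σ - κ) *
      ∑' j : ℤ, conj (rowPt ((m * z.re + b.val) / B) (m / B) z.im j) ^ κ *
        ((‖rowPt ((m * z.re + b.val) / B) (m / B) z.im j‖ : ℝ) : ℂ) ^ (-2 * σ))) * this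
  rw [hv] at hfin
  refine hfin.congr_fun fun r => ?_
  rw [ghat, Finset.sum_mul, Finset.mul_sum]
  refine Finset.sum_congr rfl fun b _ => ?_
  -- The phase e^{2πiξr} splits into an additive character of b, which assembles `ghat`, and a
  -- factor depending on x alone.
  have he : ZMod.stdAddChar (b * (r : ZMod B)) * Complex.exp (2 * π * Complex.I *
      (r * (m / B * z.re : ℝ))) =
      Complex.exp (2 * π * Complex.I * (((m * z.re + b.val) / B : ℝ) : ℂ) * r) := by
    have : b * (r : ZMod B) = ((b.val * r : ℤ) : ZMod B) := by simp
    rw [this, ZMod.stdAddChar_coe, ← Complex.exp_add]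
    congr 1
    generalize b.val = v
    push_cast
    ring
  rw [← he]
  ring

end Lattice

/-! ### The Fourier expansion of the lattice sum and its convergence for all σ. -/

/-- The exponential weight `e^{-c (m+1) |r|}` for `r ≠ 0`. -/
def expWt (c : ℝ) (p : ℕ × ℤ) : ℝ :=
  if p.2 = 0 then 0 else Real.exp (-(c * ((p.1 + 1 : ℕ) * |(p.2 : ℝ)|)))

lemma expWt_nonneg (c : ℝ) (p : ℕ × ℤ) : 0 ≤ expWt c p := by
  unfold expWt; split_ifs <;> positivity

lemma one_le_wt {p : ℕ × ℤ} (hp : p.2 ≠ 0) : 1 ≤ ((p.1 + 1 : ℕ) : ℝ) * |(p.2 : ℝ)| := by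
  have h1 := int_one_le_abs hp
  have h2 : (1:ℝ) ≤ ((p.1 + 1 : ℕ) : ℝ) := by exact_mod_cast Nat.le_add_left 1 _
  nlinarith

/-- For integers at least 1 the sum is at most twice the product, so the weight is dominated by a
product of two geometric series. -/
lemma summable_expWt {c : ℝ} (hc : 0 < c) : Summable (expWt c) := by
  have h1 : Summable fun m : ℕ => Real.exp (-(c / 2 * (m + 1 : ℕ))) := by
    have h := (Real.summable_exp_nat_mul_iff.2 (neg_lt_zero.2 (half_pos hc))).comp_injective
      (add_left_injective 1)
    exact h.congr fun n => by simp only [Function.comp_apply]; ring_nf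
  have h2 := summable_int_exp (half_pos hc)
  refine Summable.of_nonneg_of_le (expWt_nonneg c) (fun p => ?_)
    (h1.mul_of_nonneg h2 (fun _ => by positivity) (fun _ => by positivity))
  unfold expWt
  split_ifs with hp
  · positivity
  · rw [← Real.exp_add]
    gcongr
    have h1 := int_one_le_abs hp
    have h2 : (1:ℝ) ≤ ((p.1 + 1 : ℕ) : ℝ) := by exact_mod_cast Nat.le_add_left 1 _
    have : ((p.1 + 1 : ℕ) : ℝ) + |(p.2 : ℝ)| ≤ 2 * (((p.1 + 1 : ℕ) : ℝ) * |(p.2 : ℝ)|) := by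
      nlinarith
    nlinarith

lemma pow_mul_exp_le (n : ℕ) {c : ℝ} (hc : 0 < c) :
    ∃ K, 0 ≤ K ∧ ∀ x : ℝ, 0 ≤ x → x ^ n * Real.exp (-(c * x)) ≤ K * Real.exp (-(c / 2 * x)) := by
  refine ⟨(n.factorial : ℝ) * (2 / c) ^ n, by positivity, fun x hx => ?_⟩
  have h := Real.pow_div_factorial_le_exp (c * x / 2) (by positivity) n
  have h1 : x ^ n ≤ (n.factorial : ℝ) * (2 / c) ^ n * Real.exp (c * x / 2) := by
    rw [div_le_iff₀ (by positivity)] at h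
    calc x ^ n = (2 / c) ^ n * (c * x / 2) ^ n := by rw [← mul_pow]; congr 1; field_simp
      _ ≤ (2 / c) ^ n * (Real.exp (c * x / 2) * n.factorial) := by gcongr
      _ = _ := by ring
  calc x ^ n * Real.exp (-(c * x)) ≤
      (n.factorial : ℝ) * (2 / c) ^ n * Real.exp (c * x / 2) * Real.exp (-(c * x)) := by gcongr
    _ = _ := by rw [mul_assoc, ← Real.exp_add]; ring_nf

section Expansion

variable {A B : ℕ} [NeZero A] [NeZero B]

/-- The terms of the part of the Fourier expansion decaying at `i∞`. -/
def besselTerm (κ : ℕ) (g : ZMod A → ZMod B → ℂ) (z σ : ℂ) (p : ℕ × ℤ) : ℂ :=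
  if p.2 = 0 then 0 else ghat g (p.1 + 1 : ℕ) p.2 *
    (Complex.exp (2 * π * Complex.I * (p.2 * ((p.1 + 1 : ℕ) / B * z.re : ℝ))) *
      besselInt κ p.2 ((p.1 + 1 : ℕ) / B) z.im σ)

/-- The part of the Fourier expansion decaying at `i∞`. -/
def besselSum (κ : ℕ) (g : ZMod A → ZMod B → ℂ) (z σ : ℂ) : ℂ :=
  ∑' p : ℕ × ℤ, besselTerm κ g z σ p

/-- The analytic continuation of `y^{σ-κ}` times the lattice sum, given by its Fourier
expansion. -/
def latCont (κ : ℕ) (g : ZMod A → ZMod B → ℂ) (z σ : ℂ) : ℂ :=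
  (z.im : ℂ) ^ (σ - κ) * ZMod.LFunction (g 0) (2 * σ - κ) +
    (Complex.Gamma σ)⁻¹ * (π : ℂ) ^ σ * ((-Complex.I) ^ κ * ((√z.im : ℝ) : ℂ)) *
      ((B : ℂ)⁻¹ * Complex.Gamma (σ - 1 / 2) * ((π * z.im : ℝ) : ℂ) ^ (1 / 2 - σ) *
          ZMod.LFunction (fun a => ghat g a 0) (2 * σ - κ - 1) +
        (B : ℂ) ^ (κ - 2 * σ) * besselSum κ g z σ)

lemma exists_norm_ghat_le (g : ZMod A → ZMod B → ℂ) : ∃ G, 0 ≤ G ∧ ∀ a r, ‖ghat g a r‖ ≤ G :=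
  exists_norm_le_coeff (ghat g)

lemma wt_bound {p : ℕ × ℤ} (hp : p.2 ≠ 0) :
    1 + |(p.2 : ℝ)| + ((p.1 + 1 : ℕ) : ℝ) / B ≤ 3 * (((p.1 + 1 : ℕ) : ℝ) * |(p.2 : ℝ)|) := by
  have h1 := int_one_le_abs hp
  have h2 : (1:ℝ) ≤ ((p.1 + 1 : ℕ) : ℝ) := by exact_mod_cast Nat.le_add_left 1 _
  have hB : (1:ℝ) ≤ B := by exact_mod_cast NeZero.one_le
  have h3 : ((p.1 + 1 : ℕ) : ℝ) / B ≤ ((p.1 + 1 : ℕ) : ℝ) := div_le_self (by positivity) hB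
  nlinarith

lemma norm_exp_two_pi (x : ℝ) (r : ℤ) : ‖Complex.exp (2 * π * Complex.I * (r * (x : ℝ)))‖ = 1 := by
  rw [show (2 * π * Complex.I * (r * (x:ℝ)) : ℂ) = ((2 * π * r * x : ℝ) : ℂ) * Complex.I by
    push_cast; ring, Complex.norm_exp_ofReal_mul_I]

lemma exists_norm_besselTerm_le {κ : ℕ} (hκ : κ ≤ 1) (g : ZMod A → ZMod B → ℂ) (α β : ℝ) {y₀ : ℝ}
    (hy₀ : 0 < y₀) : ∃ C c, 0 ≤ C ∧ 0 < c ∧ ∀ (z σ : ℂ), y₀ ≤ z.im → α ≤ σ.re → σ.re ≤ β →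
      ∀ p, ‖besselTerm κ g z σ p‖ ≤ C * expWt c p := by
  obtain ⟨G, hG, hg⟩ := exists_norm_ghat_le g
  have hB : (0:ℝ) < B := by exact_mod_cast Nat.pos_of_ne_zero (NeZero.ne B)
  obtain ⟨C, hC, hbd⟩ := exists_norm_besselInt_le hκ α β (l₀ := 1 / B) (by positivity) hy₀
  have hc : 0 < π * y₀ / B := by positivity
  obtain ⟨K, hK, hpow⟩ := pow_mul_exp_le 1 hc
  refine ⟨G * (C * (3 * K)), π * y₀ / B / 2, by positivity, by positivity,
    fun z σ h1 h2 h3 p => ?_⟩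
  unfold besselTerm expWt
  split_ifs with hp
  · simp
  have h4 : (1:ℝ) ≤ ((p.1 + 1 : ℕ) : ℝ) := by exact_mod_cast Nat.le_add_left 1 _
  have hw := one_le_wt hp
  have h5 := hbd p.2 (((p.1 + 1 : ℕ) : ℝ) / B) z.im σ (int_one_le_abs hp) (by gcongr) h1 h2 h3
  rw [norm_mul, norm_mul, norm_exp_two_pi, one_mul, mul_assoc]
  gcongr
  · exact hg _ _
  refine h5.trans ?_
  rw [mul_assoc C, mul_assoc C]
  refine mul_le_mul_of_nonneg_left ?_ hC
  have h6 := hpow _ (zero_le_one.trans hw)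
  rw [pow_one] at h6
  calc (1 + |(p.2 : ℝ)| + ((p.1 + 1 : ℕ) : ℝ) / B) *
        Real.exp (-(π * z.im * (((p.1 + 1 : ℕ) : ℝ) / B) * |(p.2 : ℝ)|))
      ≤ 3 * (((p.1 + 1 : ℕ) : ℝ) * |(p.2 : ℝ)|) *
        Real.exp (-(π * y₀ / B * (((p.1 + 1 : ℕ) : ℝ) * |(p.2 : ℝ)|))) := by
        refine mul_le_mul (wt_bound hp) (Real.exp_le_exp.2 (neg_le_neg ?_)) (Real.exp_nonneg _)
          (by positivity)
        calc π * y₀ / B * (((p.1 + 1 : ℕ) : ℝ) * |(p.2 : ℝ)|)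
            = π * y₀ * (((p.1 + 1 : ℕ) : ℝ) / B) * |(p.2 : ℝ)| := by ring
          _ ≤ _ := by gcongr
    _ ≤ 3 * (K * Real.exp (-(π * y₀ / B / 2 * (((p.1 + 1 : ℕ) : ℝ) * |(p.2 : ℝ)|)))) := by
        rw [mul_assoc]; gcongr
    _ = _ := by ring

lemma summable_besselTerm {κ : ℕ} (hκ : κ ≤ 1) (g : ZMod A → ZMod B → ℂ) {z : ℂ} (hz : 0 < z.im)
    (σ : ℂ) : Summable (besselTerm κ g z σ) := by
  obtain ⟨C, c, hC, hc, h⟩ := exists_norm_besselTerm_le hκ g σ.re σ.re hz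
  exact Summable.of_norm_bounded ((summable_expWt hc).mul_left C) (h z σ le_rfl le_rfl le_rfl)

lemma differentiable_besselTerm (κ : ℕ) (g : ZMod A → ZMod B → ℂ) {z : ℂ} (hz : 0 < z.im)
    (p : ℕ × ℤ) : Differentiable ℂ fun σ => besselTerm κ g z σ p := by
  unfold besselTerm
  split_ifs with hp
  · simp
  have hB : (0:ℝ) < B := by exact_mod_cast Nat.pos_of_ne_zero (NeZero.ne B)
  exact ((differentiable_besselInt κ (by exact_mod_cast hp) (by positivity) hz).const_mul
    _).const_mul _

lemma hasSum_deriv_besselTerm {κ : ℕ} (hκ : κ ≤ 1) (g : ZMod A → ZMod B → ℂ) {z : ℂ}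
    (hz : 0 < z.im) (σ : ℂ) :
    DifferentiableAt ℂ (besselSum κ g z) σ ∧
    HasSum (fun p => deriv (fun σ => besselTerm κ g z σ p) σ) (deriv (besselSum κ g z) σ) := by
  obtain ⟨C, c, hC, hc, h⟩ := exists_norm_besselTerm_le hκ g (σ.re - 1) (σ.re + 1) hz
  have ho : IsOpen {s : ℂ | σ.re - 1 < s.re ∧ s.re < σ.re + 1} :=
    (isOpen_lt continuous_const Complex.continuous_re).inter
      (isOpen_lt Complex.continuous_re continuous_const)
  have hm : σ ∈ {s : ℂ | σ.re - 1 < s.re ∧ s.re < σ.re + 1} := by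
    constructor <;> linarith
  have hu := (summable_expWt hc).mul_left C
  have hd : ∀ p, DifferentiableOn ℂ (fun σ => besselTerm κ g z σ p)
      {s : ℂ | σ.re - 1 < s.re ∧ s.re < σ.re + 1} :=
    fun p => (differentiable_besselTerm κ g hz p).differentiableOn
  have hb : ∀ p, ∀ s ∈ {s : ℂ | σ.re - 1 < s.re ∧ s.re < σ.re + 1},
      ‖besselTerm κ g z s p‖ ≤ C * expWt c p := fun p s hs => h z s le_rfl hs.1.le hs.2.le p
  exact ⟨(Complex.differentiableOn_tsum_of_summable_norm hu hd ho hb).differentiableAt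
    (ho.mem_nhds hm), Complex.hasSum_deriv_of_summable_norm hu hd ho hb hm⟩

lemma differentiable_besselSum {κ : ℕ} (hκ : κ ≤ 1) (g : ZMod A → ZMod B → ℂ) {z : ℂ}
    (hz : 0 < z.im) : Differentiable ℂ (besselSum κ g z) := fun σ =>
  (hasSum_deriv_besselTerm hκ g hz σ).1

/-- The Fourier expansion of the lattice sum. -/
theorem latSum_eq_latCont {κ : ℕ} (hκ : κ ≤ 1) {g : ZMod A → ZMod B → ℂ} (hg : HasParity κ g)
    {z : ℂ} (hz : 0 < z.im) {σ : ℂ} (hσ : 2 + κ < 2 * σ.re) :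
    (z.im : ℂ) ^ (σ - κ) * latSum κ g z σ = latCont κ g z σ := by
  obtain ⟨hs, hrow⟩ := latSum_eq_rows hg hz hσ
  have hκ0 : (0:ℝ) ≤ κ := κ.cast_nonneg
  have hBp : (0:ℝ) < B := by exact_mod_cast Nat.pos_of_ne_zero (NeZero.ne B)
  have hB0 : (B:ℂ) ≠ 0 := by exact_mod_cast NeZero.ne B
  have hΓ : Complex.Gamma σ ≠ 0 := Complex.Gamma_ne_zero_of_re_pos (by linarith)
  have hπ : (π:ℂ) ≠ 0 := by exact_mod_cast Real.pi_ne_zero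
  set c₀ : ℂ := (-Complex.I) ^ κ * ((√z.im : ℝ) : ℂ) with hc₀
  have hsum := summable_besselTerm hκ g hz σ
  have hL : LSeriesSummable (fun n : ℕ => ghat g n 0) (2 * σ - κ - 1) :=
    ZMod.LSeriesSummable_of_one_lt_re (fun a => ghat g a 0) (by simp; linarith)
  -- At frequency 0 the Bessel integral is a power of the row index, so the sum over rows is the
  -- L-function of `fun a => ghat g a 0` at 2σ - κ - 1.
  have hzero : ∀ m : ℕ, ghat g (m + 1 : ℕ) 0 * besselInt κ 0 ((m + 1 : ℕ) / B) z.im σ =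
      Complex.Gamma (σ - 1 / 2) * ((π * z.im : ℝ) : ℂ) ^ (1 / 2 - σ) *
        (B : ℂ) ^ (2 * σ - κ - 1) * LSeries.term (fun n : ℕ => ghat g n 0) (2 * σ - κ - 1) (m + 1) := by
    intro m
    have hm : (0:ℝ) < (m + 1 : ℕ) := by exact_mod_cast m.succ_pos
    have hl : (0:ℝ) < (m + 1 : ℕ) / B := by positivity
    have hl0 : ((((m + 1 : ℕ) / B : ℝ)) : ℂ) ≠ 0 := by exact_mod_cast hl.ne'
    rw [(besselInt_zero_left κ hl hz (σ := σ) (by linarith)).2,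
      LSeries.term_of_ne_zero m.succ_ne_zero, Complex.ofReal_mul (π * z.im),
      Complex.mul_cpow_ofReal_nonneg (by positivity) (by positivity), Complex.ofReal_pow,
      ← Complex.cpow_nat_mul' (by rw [Complex.arg_ofReal_of_nonneg hl.le]; simp [Real.pi_pos])
        (by rw [Complex.arg_ofReal_of_nonneg hl.le]; simp [Real.pi_pos.le])]
    have e1 : ((((m + 1 : ℕ) / B : ℝ)) : ℂ) ^ κ * ((((m + 1 : ℕ) / B : ℝ)) : ℂ) ^
        (((2:ℕ):ℂ) * (1 / 2 - σ)) =
        (B : ℂ) ^ (2 * σ - κ - 1) / ((m + 1 : ℕ) : ℂ) ^ (2 * σ - κ - 1) := by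
      rw [← Complex.cpow_natCast, ← Complex.cpow_add _ _ hl0,
        show (κ:ℂ) + ((2:ℕ):ℂ) * (1 / 2 - σ) = -(2 * σ - κ - 1) by push_cast; ring,
        Complex.cpow_neg, Complex.ofReal_div, Complex.div_cpow_ofReal_nonneg hm.le hBp.le, inv_div]
      simp
    linear_combination (ghat g (m + 1 : ℕ) 0 * Complex.Gamma (σ - 1 / 2) *
      ((π * z.im : ℝ) : ℂ) ^ (1 / 2 - σ)) * e1
  have hrows : ∀ m : ℕ, Complex.Gamma σ * (π : ℂ) ^ (-σ) * (z.im : ℂ) ^ (σ - κ) *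
      (B : ℂ) ^ (2 * σ - κ) * ∑' n : ℤ, latTerm κ g z σ ((m + 1 : ℕ), n) =
      c₀ * (ghat g (m + 1 : ℕ) 0 * besselInt κ 0 ((m + 1 : ℕ) / B) z.im σ) +
        c₀ * ∑' r : ℤ, besselTerm κ g z σ (m, r) := by
    intro m
    have h := hasSum_latRow hκ g hz hσ m.succ_pos
    rw [← h.tsum_eq, h.summable.tsum_eq_add_tsum_ite 0, ← tsum_mul_left]
    congr 1
    · simp [hc₀]
    · refine tsum_congr fun r => ?_
      unfold besselTerm
      simp only [mul_ite, mul_zero]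
      rfl
  have htot : Complex.Gamma σ * (π : ℂ) ^ (-σ) * (z.im : ℂ) ^ (σ - κ) *
      (B : ℂ) ^ (2 * σ - κ) * ∑' m : ℕ, ∑' n : ℤ, latTerm κ g z σ ((m + 1 : ℕ), n) =
      c₀ * (Complex.Gamma (σ - 1 / 2) * ((π * z.im : ℝ) : ℂ) ^ (1 / 2 - σ) *
        (B : ℂ) ^ (2 * σ - κ - 1) * ZMod.LFunction (fun a => ghat g a 0) (2 * σ - κ - 1)) +
      c₀ * besselSum κ g z σ := by
    rw [← tsum_mul_left, tsum_congr hrows, Summable.tsum_add, tsum_mul_left, tsum_mul_left,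
      tsum_congr hzero, tsum_mul_left, besselSum, hsum.tsum_prod,
      ZMod.LFunction_eq_LSeries _ (by simp; linarith), LSeries,
      hL.tsum_eq_zero_add, LSeries.term_zero, zero_add]
    · refine Summable.mul_left _ ?_
      simp only [hzero]
      exact (hL.comp_injective (add_left_injective 1)).mul_left _
    · exact hsum.prod.mul_left _
  have eπ : (π : ℂ) ^ (-σ) = ((π : ℂ) ^ σ)⁻¹ := Complex.cpow_neg _ _
  have eB : (B : ℂ) ^ (κ - 2 * σ) = ((B : ℂ) ^ (2 * σ - κ))⁻¹ := by
    rw [← Complex.cpow_neg, neg_sub]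
  have eB1 : (B : ℂ) ^ (2 * σ - κ - 1) = (B : ℂ) ^ (2 * σ - κ) * (B : ℂ)⁻¹ := by
    rw [Complex.cpow_sub _ _ hB0, Complex.cpow_one, div_eq_mul_inv]
  have hπσ : (π : ℂ) ^ σ ≠ 0 := by simp [Complex.cpow_eq_zero_iff, hπ]
  have hBσ : (B : ℂ) ^ (2 * σ - κ) ≠ 0 := by simp [Complex.cpow_eq_zero_iff, hB0]
  rw [eπ, eB1] at htot
  rw [hrow, mul_add, latCont, eB, ← hc₀]
  congr 1
  generalize (B : ℂ) ^ (2 * σ - κ) = b at *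
  generalize (π : ℂ) ^ σ = p at *
  have h2 : (z.im : ℂ) ^ (σ - κ) * ∑' m : ℕ, ∑' n : ℤ, latTerm κ g z σ ((m + 1 : ℕ), n) =
      (Complex.Gamma σ)⁻¹ * p * b⁻¹ * (Complex.Gamma σ * p⁻¹ * (z.im : ℂ) ^ (σ - κ) * b *
        ∑' m : ℕ, ∑' n : ℤ, latTerm κ g z σ ((m + 1 : ℕ), n)) := by
    field_simp
  rw [h2, htot]
  field_simp

end Expansion

/-! ### Meromorphic continuation of the lattice sum and its possible poles. -/

lemma meromorphic_LFunction {N : ℕ} [NeZero N] (Φ : ZMod N → ℂ) :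
    Meromorphic (ZMod.LFunction Φ) := by
  intro s
  have hd : ∀ x : ℂ, x ≠ 1 → DifferentiableAt ℂ (ZMod.LFunction Φ) x := fun x hx =>
    ZMod.differentiableAt_LFunction Φ x (Or.inl hx)
  rcases ne_or_eq s 1 with hs | rfl
  · refine AnalyticAt.meromorphicAt (Complex.analyticAt_iff_eventually_differentiableAt.2 ?_)
    filter_upwards [isOpen_ne.mem_nhds hs] with x hx using hd x hx
  -- At 1 there is at most a simple pole: (s - 1)L(s), completed by the residue, is continuous and
  -- hence analytic.
  · set h : ℂ → ℂ := Function.update (fun s => (s - 1) * ZMod.LFunction Φ s) 1 (∑ j, Φ j / N)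
    have heq : ∀ x : ℂ, x ≠ 1 → h x = (x - 1) * ZMod.LFunction Φ x := fun x hx =>
      Function.update_of_ne hx _ _
    have han : AnalyticAt ℂ h 1 := by
      refine Complex.analyticAt_of_differentiable_on_punctured_nhds_of_continuousAt ?_
        (continuousAt_update_same.2 (ZMod.LFunction_residue_one Φ))
      filter_upwards [self_mem_nhdsWithin] with x hx
      have : DifferentiableAt ℂ (fun s => (s - 1) * ZMod.LFunction Φ s) x :=
        (by fun_prop : DifferentiableAt ℂ (fun s : ℂ => s - 1) x).mul (hd x hx)
      refine this.congr_of_eventuallyEq ?_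
      filter_upwards [isOpen_ne.mem_nhds hx] with w hw using heq w hw
    have hm : MeromorphicAt (fun x => (x - 1)⁻¹ * h x) 1 := by
      have := han.meromorphicAt
      fun_prop
    refine hm.congr ?_
    filter_upwards [self_mem_nhdsWithin] with x hx
    have : x - 1 ≠ 0 := sub_ne_zero.2 hx
    rw [heq x hx, inv_mul_cancel_left₀ this]

/-- Two meromorphic functions agreeing on a half-plane agree. -/
lemma meromorphic_identity {f g : ℂ → ℂ} (hf : Meromorphic f) (hg : Meromorphic g) (c : ℝ)
    (h : ∀ s : ℂ, c < s.re → f s = g s) (x : ℂ) : f =ᶠ[𝓝[≠] x] g := by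
  have hm : Meromorphic (f - g) := fun x => (hf x).sub (hg x)
  have htop : meromorphicOrderAt (f - g) ((c + 1 : ℝ) : ℂ) = ⊤ := by
    rw [meromorphicOrderAt_eq_top_iff]
    refine eventually_nhdsWithin_of_eventually_nhds ?_
    have : ∀ᶠ s : ℂ in 𝓝 ((c + 1 : ℝ) : ℂ), c < s.re :=
      (isOpen_lt continuous_const Complex.continuous_re).mem_nhds (by simp)
    filter_upwards [this] with s hs
    simp [h s hs]
  have hx : meromorphicOrderAt (f - g) x = ⊤ := by
    by_contra hne
    exact (hm.exists_meromorphicOrderAt_ne_top_iff_forall.1 ⟨x, hne⟩) _ htop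
  filter_upwards [meromorphicOrderAt_eq_top_iff.1 hx] with s hs
  exact sub_eq_zero.1 hs

lemma analyticAt_const_cpow_comp {c : ℂ} (hc : 0 < c.re) {f : ℂ → ℂ} {x : ℂ}
    (hf : AnalyticAt ℂ f x) : AnalyticAt ℂ (fun s => c ^ f s) x :=
  analyticAt_const.cpow hf (Or.inl hc)

section Continuation

variable {A B : ℕ} [NeZero A] [NeZero B]

lemma natCast_re_pos (N : ℕ) [NeZero N] : 0 < (N : ℂ).re := by
  simpa using Nat.pos_of_ne_zero (NeZero.ne N)

lemma meromorphic_latCont {κ : ℕ} (hκ : κ ≤ 1) (g : ZMod A → ZMod B → ℂ) {z : ℂ}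
    (hz : 0 < z.im) : Meromorphic (latCont κ g z) := by
  intro x
  have hS : AnalyticAt ℂ (besselSum κ g z) x := (differentiable_besselSum hκ g hz).analyticAt x
  have h1 : MeromorphicAt (fun σ => ZMod.LFunction (g 0) (2 * σ - κ)) x :=
    (meromorphic_LFunction (g 0) (2 * x - κ)).comp_analyticAt (g := fun s : ℂ => 2 * s - κ)
      (by fun_prop)
  have h2 : MeromorphicAt (fun σ => ZMod.LFunction (fun a => ghat g a 0) (2 * σ - κ - 1)) x :=
    (meromorphic_LFunction (fun a => ghat g a 0) (2 * x - κ - 1)).comp_analyticAt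
      (g := fun s : ℂ => 2 * s - κ - 1) (by fun_prop)
  have h3 : MeromorphicAt (fun σ => Complex.Gamma (σ - 1 / 2)) x :=
    (Meromorphic.Gamma (x - 1 / 2)).comp_analyticAt (g := fun s : ℂ => s - 1 / 2) (by fun_prop)
  have h4 := Meromorphic.Gamma x
  have h5 : MeromorphicAt (fun σ : ℂ => (z.im : ℂ) ^ (σ - κ)) x :=
    (analyticAt_const_cpow_comp (by simpa using hz) (by fun_prop)).meromorphicAt
  have h6 : MeromorphicAt (fun σ : ℂ => (π : ℂ) ^ σ) x :=
    (analyticAt_const_cpow_comp (by simpa using Real.pi_pos) (by fun_prop)).meromorphicAt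
  have h7 : MeromorphicAt (fun σ : ℂ => ((π * z.im : ℝ) : ℂ) ^ (1 / 2 - σ)) x :=
    (analyticAt_const_cpow_comp (by rw [Complex.ofReal_re]; positivity) (by fun_prop)).meromorphicAt
  have h8 : MeromorphicAt (fun σ : ℂ => (B : ℂ) ^ (κ - 2 * σ)) x :=
    (analyticAt_const_cpow_comp (natCast_re_pos B) (by fun_prop)).meromorphicAt
  have h9 := hS.meromorphicAt
  unfold latCont
  fun_prop

/-- Coefficients for which the lattice sum continues analytically to `Re σ > 1/2`. -/
structure IsAdmissible (κ : ℕ) (g : ZMod A → ZMod B → ℂ) : Prop where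
  parity : HasParity κ g
  sum_eq_zero : κ = 0 → ∑ a, ∑ b, g a b = 0

lemma ghat_zero (g : ZMod A → ZMod B → ℂ) (a : ZMod A) : ghat g a 0 = ∑ b, g a b := by
  simp [ghat]

/-- This sum is, up to a factor, the residue of the L-function at frequency 0. In weight one it
vanishes by oddness, in weight zero by hypothesis. -/
lemma IsAdmissible.sum_ghat {κ : ℕ} (hκ : κ ≤ 1) {g : ZMod A → ZMod B → ℂ}
    (hg : IsAdmissible κ g) : ∑ a, ghat g a 0 = 0 := by
  simp only [ghat_zero]
  interval_cases κ
  · exact hg.sum_eq_zero rfl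
  · have h : ∑ a, ∑ b, g a b = -∑ a, ∑ b, g a b := by
      conv_lhs => rw [← Equiv.sum_comp (Equiv.neg (ZMod A))]
      rw [← Finset.sum_neg_distrib]
      refine Finset.sum_congr rfl fun a _ => ?_
      rw [← Equiv.sum_comp (Equiv.neg (ZMod B)), ← Finset.sum_neg_distrib]
      refine Finset.sum_congr rfl fun b _ => ?_
      simpa using hg.parity a b
    exact self_eq_neg.1 h

lemma HasParity.sum_zero_row {g : ZMod A → ZMod B → ℂ} (hg : HasParity 1 g) : ∑ b, g 0 b = 0 := by
  have h : ∑ b, g 0 b = -∑ b, g 0 b := by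
    conv_lhs => rw [← Equiv.sum_comp (Equiv.neg (ZMod B))]
    rw [← Finset.sum_neg_distrib]
    refine Finset.sum_congr rfl fun b _ => ?_
    simpa using hg 0 b
  exact self_eq_neg.1 h

/-- For Re σ > 1/2 the factor Γ(σ - 1/2) is finite and 1/Γ is entire, so only an L-function at
argument 1 can spoil analyticity. -/
lemma differentiableAt_latCont_of_ne {κ : ℕ} (hκ : κ ≤ 1) {g : ZMod A → ZMod B → ℂ}
    {z : ℂ} (hz : 0 < z.im) {x : ℂ} (hx : 1 / 2 < x.re)
    (hg0 : 2 * x - κ ≠ 1 ∨ ∑ b, g 0 b = 0) (hg1 : 2 * x - κ - 1 ≠ 1 ∨ ∑ a, ghat g a 0 = 0) :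
    DifferentiableAt ℂ (latCont κ g z) x := by
  have hS : DifferentiableAt ℂ (besselSum κ g z) x := differentiable_besselSum hκ g hz x
  have h1 : DifferentiableAt ℂ (fun σ => ZMod.LFunction (g 0) (2 * σ - κ)) x :=
    DifferentiableAt.fun_comp' x (g := ZMod.LFunction (g 0)) (f := fun σ : ℂ => 2 * σ - κ)
      (ZMod.differentiableAt_LFunction _ _ hg0) (by fun_prop)
  have h2 : DifferentiableAt ℂ (fun σ => ZMod.LFunction (fun a => ghat g a 0) (2 * σ - κ - 1)) x :=
    DifferentiableAt.fun_comp' x (g := ZMod.LFunction (fun a => ghat g a 0))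
      (f := fun σ : ℂ => 2 * σ - κ - 1)
      (ZMod.differentiableAt_LFunction _ _ hg1) (by fun_prop)
  have h3 : DifferentiableAt ℂ (fun σ => Complex.Gamma (σ - 1 / 2)) x := by
    refine DifferentiableAt.fun_comp' x (g := Complex.Gamma) (f := fun σ => σ - 1 / 2)
      (Complex.differentiableAt_Gamma _ fun m h => ?_) (by fun_prop)
    have := congrArg Complex.re h
    simp at this
    have hm : (0:ℝ) ≤ m := m.cast_nonneg
    linarith
  have h4 : DifferentiableAt ℂ (fun σ => (Complex.Gamma σ)⁻¹) x :=
    Complex.differentiable_one_div_Gamma x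
  have h5 : DifferentiableAt ℂ (fun σ : ℂ => (z.im : ℂ) ^ (σ - κ)) x :=
    (analyticAt_const_cpow_comp (by simpa using hz) (by fun_prop)).differentiableAt
  have h6 : DifferentiableAt ℂ (fun σ : ℂ => (π : ℂ) ^ σ) x :=
    (analyticAt_const_cpow_comp (by simpa using Real.pi_pos) (by fun_prop)).differentiableAt
  have h7 : DifferentiableAt ℂ (fun σ : ℂ => ((π * z.im : ℝ) : ℂ) ^ (1 / 2 - σ)) x :=
    (analyticAt_const_cpow_comp (by rw [Complex.ofReal_re]; positivity)
      (by fun_prop)).differentiableAt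
  have h8 : DifferentiableAt ℂ (fun σ : ℂ => (B : ℂ) ^ (κ - 2 * σ)) x :=
    (analyticAt_const_cpow_comp (natCast_re_pos B) (by fun_prop)).differentiableAt
  unfold latCont
  fun_prop

/-- The row m = 0 could have a pole where 2σ - κ = 1. For κ = 0 this is σ = 1/2, outside the region;
for κ = 1 it is σ = 1, where oddness of g 0 removes the residue. -/
lemma differentiableAt_latCont {κ : ℕ} (hκ : κ ≤ 1) {g : ZMod A → ZMod B → ℂ}
    (hg : IsAdmissible κ g) {z : ℂ} (hz : 0 < z.im) {x : ℂ} (hx : 1 / 2 < x.re) :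
    DifferentiableAt ℂ (latCont κ g z) x := by
  refine differentiableAt_latCont_of_ne hκ hz hx ?_ (Or.inr (hg.sum_ghat hκ))
  interval_cases κ
  · left
    intro h
    have := congrArg Complex.re h
    simp at this
    linarith
  · exact Or.inr hg.parity.sum_zero_row

lemma analyticAt_latCont {κ : ℕ} (hκ : κ ≤ 1) {g : ZMod A → ZMod B → ℂ}
    (hg : IsAdmissible κ g) {z : ℂ} (hz : 0 < z.im) {x : ℂ} (hx : 1 / 2 < x.re) :
    AnalyticAt ℂ (latCont κ g z) x := by
  refine Complex.analyticAt_iff_eventually_differentiableAt.2 ?_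
  filter_upwards [(isOpen_lt continuous_const Complex.continuous_re).mem_nhds hx] with w hw
  exact differentiableAt_latCont hκ hg hz hw

end Continuation

/-! ### The Eisenstein series with characters and their continuation. -/

section Series

variable {L M : ℕ}

/-- The coefficients given by a pair of characters. -/
def charCoeff (ψ : DirichletCharacter ℂ L) (ϱ : DirichletCharacter ℂ M) :
    ZMod L → ZMod M → ℂ := fun a b => ψ a * ϱ b

lemma hasParity_charCoeff {κ : ℕ} {ψ : DirichletCharacter ℂ L} {ϱ : DirichletCharacter ℂ M}
    (h : ψ (-1) * ϱ (-1) = (-1) ^ κ) : HasParity κ (charCoeff ψ ϱ) := by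
  intro a b
  rw [charCoeff, charCoeff, neg_eq_neg_one_mul a, neg_eq_neg_one_mul b, map_mul, map_mul, ← h]
  ring

/-- As w^{-κ}|w|^{-2s} = conj(w)^κ |w|^{-2(s+κ)}, the variables are related by σ = s + κ. The
condition s + κ ≠ 0 makes 0^{-2σ} = 0 agree with the omission of the origin. -/
lemma nonholTerm_eq_latTerm (κ : ℕ) (ψ : DirichletCharacter ℂ L) (ϱ : DirichletCharacter ℂ M)
    {z : ℂ} (hz : 0 < z.im) {s : ℂ} (hs : s + κ ≠ 0) (p : ℤ × ℤ) :
    nonholTerm κ ψ ϱ z s p = latTerm κ (charCoeff ψ ϱ) z (s + κ) p := by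
  unfold nonholTerm
  split_ifs with hp
  · have : (-2 * (s + κ)) ≠ 0 := mul_ne_zero (by norm_num) hs
    simp only [latTerm, hp, Prod.fst_zero, Prod.snd_zero, Int.cast_zero, zero_mul, add_zero,
      norm_zero, Complex.ofReal_zero, Complex.zero_cpow this, mul_zero]
  · have hw := lattice_ne_zero hz hp
    rw [latTerm, charCoeff]
    generalize (p.1 : ℂ) * z + p.2 = w at hw
    have hn : ((‖w‖ : ℝ) : ℂ) ≠ 0 := by exact_mod_cast (norm_pos_iff.2 hw).ne'
    have h1 : ((‖w‖ : ℝ) : ℂ) ^ (-2 * (s + κ)) = ((‖w‖ : ℝ) : ℂ) ^ (-2 * s) *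
        ((w * conj w) ^ κ)⁻¹ := by
      rw [mul_add, Complex.cpow_add _ _ hn, Complex.mul_conj, Complex.normSq_eq_norm_sq,
        Complex.ofReal_pow, ← pow_mul, show (-2 * (κ:ℂ)) = -((2 * κ : ℕ) : ℂ) by push_cast; ring,
        Complex.cpow_neg, Complex.cpow_natCast]
    have hc : conj w ≠ 0 := (map_ne_zero _).2 hw
    rw [h1, zpow_neg, zpow_natCast, mul_pow]
    field_simp

lemma nonholSeries_eq_latSum (κ : ℕ) (ψ : DirichletCharacter ℂ L) (ϱ : DirichletCharacter ℂ M)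
    {z : ℂ} (hz : 0 < z.im) {s : ℂ} (hs : s + κ ≠ 0) :
    nonholSeries κ ψ ϱ z s = latSum κ (charCoeff ψ ϱ) z (s + κ) := by
  rw [nonholSeries, latSum]
  congr 1
  exact tsum_congr fun p => nonholTerm_eq_latTerm κ ψ ϱ hz hs p

variable [NeZero L] [NeZero M]

/-- The explicit continuation of the non-holomorphic Eisenstein series. -/
def explicitCont (κ : ℕ) (ψ : DirichletCharacter ℂ L) (ϱ : DirichletCharacter ℂ M)
    (z s : ℂ) : ℂ := (z.im : ℂ) ^ (-s) * latCont κ (charCoeff ψ ϱ) z (s + κ)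

lemma meromorphic_explicitCont {κ : ℕ} (hκ : κ ≤ 1) (ψ : DirichletCharacter ℂ L)
    (ϱ : DirichletCharacter ℂ M) {z : ℂ} (hz : 0 < z.im) :
    Meromorphic (explicitCont κ ψ ϱ z) := by
  intro x
  have h1 : MeromorphicAt (fun σ : ℂ => (z.im : ℂ) ^ (-σ)) x :=
    (analyticAt_const_cpow_comp (by simpa using hz) (by fun_prop)).meromorphicAt
  have h2 : MeromorphicAt (fun s => latCont κ (charCoeff ψ ϱ) z (s + κ)) x :=
    (meromorphic_latCont hκ _ hz (x + κ)).comp_analyticAt (g := fun s : ℂ => s + κ) (by fun_prop)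
  unfold explicitCont
  fun_prop

lemma explicitCont_eq {κ : ℕ} (hκ : κ ≤ 1) {ψ : DirichletCharacter ℂ L}
    {ϱ : DirichletCharacter ℂ M} (h : ψ (-1) * ϱ (-1) = (-1) ^ κ) {z : ℂ} (hz : 0 < z.im)
    {s : ℂ} (hs : 2 < (κ : ℝ) + 2 * s.re) :
    explicitCont κ ψ ϱ z s = nonholSeries κ ψ ϱ z s := by
  have hκ0 : (0:ℝ) ≤ κ := κ.cast_nonneg
  have hκ1 : (κ:ℝ) ≤ 1 := by exact_mod_cast hκ
  have hs0 : s + κ ≠ 0 := by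
    intro h0
    have := congrArg Complex.re h0
    simp at this
    linarith
  have hy : (z.im : ℂ) ≠ 0 := by exact_mod_cast hz.ne'
  rw [nonholSeries_eq_latSum κ ψ ϱ hz hs0, explicitCont,
    ← latSum_eq_latCont hκ (hasParity_charCoeff h) hz (by simp; linarith), add_sub_cancel_right,
    ← mul_assoc, ← Complex.cpow_add _ _ hy, neg_add_cancel, Complex.cpow_zero, one_mul]

lemma exists_isContinuation {κ : ℕ} (hκ : κ ≤ 1) {ψ : DirichletCharacter ℂ L}
    {ϱ : DirichletCharacter ℂ M} (h : ψ (-1) * ϱ (-1) = (-1) ^ κ) {z : ℂ} (hz : 0 < z.im) :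
    ∃ g, IsContinuation κ ψ ϱ z g := by
  have hm := meromorphic_explicitCont hκ ψ ϱ hz
  have hmu : MeromorphicOn (explicitCont κ ψ ϱ z) univ := fun x _ => hm x
  refine ⟨toMeromorphicNFOn (explicitCont κ ψ ϱ z) univ, meromorphicNFOn_toMeromorphicNFOn _ _,
    fun s hs => ?_⟩
  have hκ0 : (0:ℝ) ≤ κ := κ.cast_nonneg
  have hκ1 : (κ:ℝ) ≤ 1 := by exact_mod_cast hκ
  have hy : (z.im : ℂ) ≠ 0 := by exact_mod_cast hz.ne'
  rw [Int.cast_natCast] at hs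
  -- Passing to normal form can only change isolated values, and changes none where the function is
  -- already analytic, as it is in the half-plane of convergence.
  rw [toMeromorphicNFOn_eq_toMeromorphicNFAt hmu (mem_univ s), ← explicitCont_eq hκ h hz hs,
    toMeromorphicNFAt_eq_self.2]
  refine AnalyticAt.meromorphicNFAt (Complex.analyticAt_iff_eventually_differentiableAt.2 ?_)
  have ho : ∀ᶠ w : ℂ in 𝓝 s, 2 < (κ : ℝ) + 2 * w.re :=
    (isOpen_lt continuous_const (by fun_prop)).mem_nhds hs
  filter_upwards [ho] with w hw
  have h1 : DifferentiableAt ℂ (fun σ => latCont κ (charCoeff ψ ϱ) z σ) (w + κ) := by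
    refine differentiableAt_latCont_of_ne hκ hz (by simp; linarith) (Or.inl fun h => ?_)
      (Or.inl fun h => ?_) <;>
    · have := congrArg Complex.re h
      simp at this
      linarith
  have h2 : DifferentiableAt ℂ (fun s => latCont κ (charCoeff ψ ϱ) z (s + κ)) w :=
    DifferentiableAt.fun_comp' w h1 (by fun_prop)
  have h3 : DifferentiableAt ℂ (fun σ : ℂ => (z.im : ℂ) ^ (-σ)) w :=
    (analyticAt_const_cpow_comp (by simpa using hz) (by fun_prop)).differentiableAt
  unfold explicitCont
  fun_prop

lemma isContinuation_nonholCont {κ : ℕ} (hκ : κ ≤ 1) {ψ : DirichletCharacter ℂ L}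
    {ϱ : DirichletCharacter ℂ M} (h : ψ (-1) * ϱ (-1) = (-1) ^ κ) {z : ℂ} (hz : 0 < z.im) :
    IsContinuation κ ψ ϱ z (nonholCont κ ψ ϱ z) := by
  have he := exists_isContinuation hκ h hz
  rw [nonholCont, dif_pos he]
  exact he.choose_spec

lemma meromorphic_nonholCont {κ : ℕ} (hκ : κ ≤ 1) {ψ : DirichletCharacter ℂ L}
    {ϱ : DirichletCharacter ℂ M} (h : ψ (-1) * ϱ (-1) = (-1) ^ κ) {z : ℂ} (hz : 0 < z.im) :
    Meromorphic (nonholCont κ ψ ϱ z) := fun x =>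
  ((isContinuation_nonholCont hκ h hz).1 (mem_univ x)).meromorphicAt

lemma nonholCont_eq {κ : ℕ} (hκ : κ ≤ 1) {ψ : DirichletCharacter ℂ L}
    {ϱ : DirichletCharacter ℂ M} (h : ψ (-1) * ϱ (-1) = (-1) ^ κ) {z : ℂ} (hz : 0 < z.im)
    {s : ℂ} (hs : 1 < s.re) :
    nonholCont κ ψ ϱ z s = latSum κ (charCoeff ψ ϱ) z (s + κ) := by
  have hκ0 : (0:ℝ) ≤ κ := κ.cast_nonneg
  rw [(isContinuation_nonholCont hκ h hz).2 s (by rw [Int.cast_natCast]; linarith),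
    nonholSeries_eq_latSum κ ψ ϱ hz]
  intro h0
  have := congrArg Complex.re h0
  simp at this
  linarith

/-- The continuation of the Eisenstein series coincides with any analytic function given by the
series on a half-plane. -/
lemma nonholCont_eventuallyEq {κ : ℕ} (hκ : κ ≤ 1) {ψ : DirichletCharacter ℂ L}
    {ϱ : DirichletCharacter ℂ M} (h : ψ (-1) * ϱ (-1) = (-1) ^ κ) {z : ℂ} (hz : 0 < z.im)
    {f : ℂ → ℂ} (hf : Meromorphic f)
    (hfs : ∀ s : ℂ, 1 < s.re → f s = latSum κ (charCoeff ψ ϱ) z (s + κ)) {x : ℂ}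
    (hx : AnalyticAt ℂ f x) : nonholCont κ ψ ϱ z =ᶠ[𝓝 x] f := by
  have hc := (isContinuation_nonholCont hκ h hz).1 (mem_univ x)
  refine (hc.eventuallyEq_nhdsNE_iff_eventuallyEq_nhds hx.meromorphicNFAt).1 ?_
  exact meromorphic_identity (meromorphic_nonholCont hκ h hz) hf 1
    (fun s hs => by rw [nonholCont_eq hκ h hz hs, hfs s hs]) x

end Series

/-! ### The action of SL₂(ℤ) and of dilations on periodic coefficients. -/

section Transform

/-- The action of `SL₂(ℤ)` on periodic coefficients. -/
def slashCoeff {N : ℕ} (γ : SL(2, ℤ)) (g : ZMod N → ZMod N → ℂ) : ZMod N → ZMod N → ℂ :=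
  fun a b => g (γ 1 1 * a - γ 1 0 * b) (-(γ 0 1 * a) + γ 0 0 * b)

/-- Pull back coefficients in the second variable to a larger modulus. -/
def liftCoeff {A M N : ℕ} (h : M ∣ N) (g : ZMod A → ZMod M → ℂ) : ZMod A → ZMod N → ℂ :=
  fun a b => g a (ZMod.castHom h (ZMod M) b)

/-- The coefficients `g(m/c, n)`, supported on `c ∣ m`. -/
def scaleCoeff {L M : ℕ} (N c : ℕ) (g : ZMod L → ZMod M → ℂ) : ZMod N → ZMod M → ℂ :=
  fun a b => if c ∣ a.val then g ((a.val / c : ℕ) : ZMod L) b else 0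

/-- Right multiplication by `γ` on row vectors. -/
def rowEquiv (γ : SL(2, ℤ)) : ℤ × ℤ ≃ ℤ × ℤ where
  toFun p := (p.1 * γ 0 0 + p.2 * γ 1 0, p.1 * γ 0 1 + p.2 * γ 1 1)
  invFun q := (γ 1 1 * q.1 - γ 1 0 * q.2, -(γ 0 1 * q.1) + γ 0 0 * q.2)
  left_inv p := by
    have h := γ.det_coe
    rw [Matrix.det_fin_two] at h
    ext
    · simp only; linear_combination p.1 * h
    · simp only; linear_combination p.2 * h
  right_inv p := by
    have h := γ.det_coe
    rw [Matrix.det_fin_two] at h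
    ext
    · simp only; linear_combination p.1 * h
    · simp only; linear_combination p.2 * h

lemma slashCoeff_rowEquiv {N : ℕ} (γ : SL(2, ℤ)) (g : ZMod N → ZMod N → ℂ) (p : ℤ × ℤ) :
    slashCoeff γ g ((rowEquiv γ p).1 : ℤ) ((rowEquiv γ p).2 : ℤ) = g p.1 p.2 := by
  have h := (rowEquiv γ).symm_apply_apply p
  rw [slashCoeff]
  conv_rhs => rw [← h]
  simp [rowEquiv]

lemma lattice_smul (γ : SL(2, ℤ)) (z : ℍ) (p : ℤ × ℤ) :
    (p.1 : ℂ) * ((γ • z : ℍ) : ℂ) + p.2 =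
      ((((rowEquiv γ p).1 : ℤ) : ℂ) * z + ((rowEquiv γ p).2 : ℤ)) /
        ((γ 1 0 : ℂ) * z + (γ 1 1 : ℂ)) := by
  have h0 : (γ 1 0 : ℂ) * z + (γ 1 1 : ℂ) ≠ 0 := denom_ne_zero' γ z.im_pos
  rw [coe_smul_eq, rowEquiv, eq_div_iff h0, add_mul, mul_assoc (p.1 : ℂ), div_mul_cancel₀ _ h0]
  simp only [Equiv.coe_fn_mk]
  push_cast
  ring

lemma im_smul_eq (γ : SL(2, ℤ)) (z : ℍ) :
    (γ • z).im = z.im / ‖(γ 1 0 : ℂ) * z + (γ 1 1 : ℂ)‖ ^ 2 := by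
  rw [ModularGroup.im_smul_eq_div_normSq, Complex.normSq_eq_norm_sq]
  rfl

lemma latTerm_smul (κ : ℕ) {N : ℕ} (g : ZMod N → ZMod N → ℂ) (γ : SL(2, ℤ)) (z : ℍ) (σ : ℂ)
    (p : ℤ × ℤ) : latTerm κ g ((γ • z : ℍ) : ℂ) σ p =
      (conj ((γ 1 0 : ℂ) * z + (γ 1 1 : ℂ)) ^ κ)⁻¹ *
        ((‖(γ 1 0 : ℂ) * z + (γ 1 1 : ℂ)‖ : ℝ) : ℂ) ^ (2 * σ) *
        latTerm κ (slashCoeff γ g) z σ (rowEquiv γ p) := by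
  have h0 : (γ 1 0 : ℂ) * z + (γ 1 1 : ℂ) ≠ 0 := denom_ne_zero' γ z.im_pos
  rw [latTerm, latTerm, lattice_smul, slashCoeff_rowEquiv]
  generalize (γ 1 0 : ℂ) * z + (γ 1 1 : ℂ) = j at h0
  rw [norm_div, map_div₀, div_pow, Complex.ofReal_div,
    Complex.div_cpow_ofReal_nonneg (norm_nonneg _) (norm_nonneg _), neg_mul,
    Complex.cpow_neg _ (2 * σ), Complex.cpow_neg ((‖j‖ : ℝ) : ℂ), div_inv_eq_mul]
  ring

/-- Writing m·γz + n = (m'z + n')/j with (m',n') = (m,n)γ, the lattice is permuted and γ acts on the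
coefficients. Reindexing by a bijection needs no convergence, so no condition on σ appears. -/
lemma latSum_smul (κ : ℕ) {N : ℕ} (g : ZMod N → ZMod N → ℂ) (γ : SL(2, ℤ)) (z : ℍ) (σ : ℂ) :
    ((γ • z).im : ℂ) ^ (σ - κ) * latSum κ g ((γ • z : ℍ) : ℂ) σ =
      ((γ 1 0 : ℂ) * z + (γ 1 1 : ℂ)) ^ κ *
        ((z.im : ℂ) ^ (σ - κ) * latSum κ (slashCoeff γ g) z σ) := by
  have h0 : (γ 1 0 : ℂ) * z + (γ 1 1 : ℂ) ≠ 0 := denom_ne_zero' γ z.im_pos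
  rw [latSum, latSum, tsum_congr (latTerm_smul κ g γ z σ), tsum_mul_left, im_smul_eq,
    (rowEquiv γ).tsum_eq (latTerm κ (slashCoeff γ g) z σ)]
  generalize (γ 1 0 : ℂ) * z + (γ 1 1 : ℂ) = j at h0
  have hn : ((‖j‖ : ℝ) : ℂ) ≠ 0 := by exact_mod_cast (norm_pos_iff.2 h0).ne'
  have hc : conj j ≠ 0 := (map_ne_zero _).2 h0
  have e : (((z.im / ‖j‖ ^ 2 : ℝ)) : ℂ) ^ (σ - κ) * ((‖j‖ : ℝ) : ℂ) ^ (2 * σ) =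
      (z.im : ℂ) ^ (σ - κ) * (j * conj j) ^ κ := by
    rw [Complex.ofReal_div, Complex.div_cpow_ofReal_nonneg z.im_pos.le (by positivity),
      Complex.ofReal_pow, ← Complex.cpow_nat_mul' (by
        rw [Complex.arg_ofReal_of_nonneg (norm_nonneg _)]; simp [Real.pi_pos]) (by
        rw [Complex.arg_ofReal_of_nonneg (norm_nonneg _)]; simp [Real.pi_pos.le]),
      Complex.mul_conj, Complex.normSq_eq_norm_sq, Complex.ofReal_pow, ← pow_mul, div_mul_eq_mul_div,
      mul_div_assoc, ← Complex.cpow_sub _ _ hn, ← Complex.cpow_natCast]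
    congr 2
    push_cast
    ring
  have hmul : (j * conj j) ^ κ * (conj j ^ κ)⁻¹ = j ^ κ := by
    rw [mul_pow, mul_assoc, mul_inv_cancel₀ (pow_ne_zero _ hc), mul_one]
  rw [← hmul]
  linear_combination (2⁻¹ * (conj j ^ κ)⁻¹ * ∑' p, latTerm κ (slashCoeff γ g) z σ p) * e

/-- Independence of the representative: because cL divides N, both divisibility by c and the class
of m/c mod L depend only on m mod N. -/
lemma scaleCoeff_intCast {L M N c : ℕ} [NeZero N] (h : c * L ∣ N) (g : ZMod L → ZMod M → ℂ)
    (m : ℤ) (b : ZMod M) :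
    scaleCoeff N c g m b = if (c : ℤ) ∣ m then g ((m / c : ℤ) : ZMod L) b else 0 := by
  have hN : 0 < N := Nat.pos_of_ne_zero (NeZero.ne N)
  have hc : (c : ℤ) ≠ 0 := by
    rintro h0
    have h0' : c = 0 := by exact_mod_cast h0
    rw [h0', zero_mul, zero_dvd_iff] at h
    omega
  obtain ⟨k, hk⟩ := h
  have hv : (((m : ZMod N).val : ℕ) : ℤ) = m % N := ZMod.val_intCast m
  have hm : m = m % N + c * (L * k * (m / N)) := by
    conv_lhs => rw [← Int.emod_add_mul_ediv m N]
    rw [hk]; push_cast; ring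
  have h1 : c ∣ (m : ZMod N).val ↔ (c : ℤ) ∣ m := by
    rw [← Int.natCast_dvd_natCast, hv]
    conv_rhs => rw [hm]
    exact (Int.dvd_add_left (dvd_mul_right _ _)).symm
  rw [scaleCoeff]
  simp only [h1]
  split_ifs with hd
  · congr 1
    have : (((m : ZMod N).val / c : ℕ) : ℤ) = (m % N) / c := by push_cast; rw [hv]
    rw [← Int.cast_natCast, this]
    have h2 : m / c = (m % N) / c + L * k * (m / N) := by
      conv_lhs => rw [hm]
      rw [Int.add_mul_ediv_left _ _ hc]
    rw [h2]
    push_cast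
    simp
  · rfl

/-- As m(cz) + n = (cm)z + n, the dilation becomes a condition on the support. All series can then
be compared at the same point z. -/
lemma latSum_scale (κ : ℕ) {L M N c : ℕ} [NeZero N] (h : c * L ∣ N) (g : ZMod L → ZMod M → ℂ)
    (z σ : ℂ) : latSum κ (scaleCoeff N c g) z σ = latSum κ g (c * z) σ := by
  have hN : 0 < N := Nat.pos_of_ne_zero (NeZero.ne N)
  have hc : (c : ℤ) ≠ 0 := by
    rintro h0
    have h0' : c = 0 := by exact_mod_cast h0
    rw [h0', zero_mul, zero_dvd_iff] at h
    omega
  let i : ℤ × ℤ → ℤ × ℤ := fun p => (c * p.1, p.2)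
  have hi : Function.Injective i := by
    intro p q hpq
    have h1 := congrArg Prod.fst hpq
    have h2 := congrArg Prod.snd hpq
    exact Prod.ext (mul_left_cancel₀ hc h1) h2
  have hsupp : Function.support (latTerm κ (scaleCoeff N c g) z σ) ⊆ Set.range i := by
    intro p hp
    have : scaleCoeff N c g (p.1 : ℤ) (p.2 : ZMod M) ≠ 0 := by
      intro h0; apply hp; rw [latTerm, h0, zero_mul]
    rw [scaleCoeff_intCast h] at this
    have hd : (c : ℤ) ∣ p.1 := by
      by_contra hd; rw [if_neg hd] at this; exact this rfl
    obtain ⟨q, hq⟩ := hd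
    exact ⟨(q, p.2), Prod.ext hq.symm rfl⟩
  rw [latSum, latSum, ← hi.tsum_eq hsupp]
  congr 1
  refine tsum_congr fun p => ?_
  have e : ((c * p.1 : ℤ) : ℂ) * z + p.2 = (p.1 : ℂ) * (c * z) + p.2 := by push_cast; ring
  simp only [i, latTerm]
  rw [scaleCoeff_intCast h, if_pos (dvd_mul_right _ _), Int.mul_ediv_cancel_left _ hc, e]

lemma sum_zmod_val {N : ℕ} [NeZero N] (F : ℕ → ℂ) :
    ∑ a : ZMod N, F a.val = ∑ i ∈ Finset.range N, F i := by
  obtain ⟨n, rfl⟩ : ∃ n, N = n + 1 := ⟨N - 1, (Nat.succ_pred_eq_of_ne_zero (NeZero.ne N)).symm⟩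
  exact Fin.sum_univ_eq_sum_range F (n + 1)

lemma sum_range_mul_periodic {L : ℕ} [NeZero L] (f : ZMod L → ℂ) (k : ℕ) :
    ∑ i ∈ Finset.range (L * k), f (i : ZMod L) = k * ∑ a, f a := by
  induction k with
  | zero => simp
  | succ k ih =>
    rw [Nat.mul_succ, Finset.sum_range_add, ih]
    have : ∑ a : ZMod L, f a = ∑ i ∈ Finset.range L, f (i : ZMod L) := by
      rw [← sum_zmod_val fun i => f (i : ZMod L)]
      simp
    simp [this]
    ring

/-- Sums over residues of a scaled function. -/
lemma sum_scale {L N c : ℕ} [NeZero N] [NeZero L] (h : c * L ∣ N) (f : ZMod L → ℂ) :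
    ∑ a : ZMod N, (if c ∣ a.val then f ((a.val / c : ℕ) : ZMod L) else 0) =
      ((N / (c * L) : ℕ) : ℂ) * ∑ a, f a := by
  have hN : 0 < N := Nat.pos_of_ne_zero (NeZero.ne N)
  obtain ⟨k, hk⟩ := h
  have hcL : 0 < c * L := Nat.pos_of_ne_zero fun h0 => by rw [h0, zero_mul] at hk; omega
  have hc : 0 < c := Nat.pos_of_mul_pos_right hcL
  rw [sum_zmod_val fun i => if c ∣ i then f ((i / c : ℕ) : ZMod L) else 0, ← Finset.sum_filter,
    show N / (c * L) = k by rw [hk, Nat.mul_div_cancel_left _ hcL], ← sum_range_mul_periodic]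
  refine Finset.sum_bij' (fun i _ => i / c) (fun j _ => c * j) ?_ ?_ ?_ ?_ ?_
  · intro i hi
    rw [Finset.mem_filter, Finset.mem_range, hk, mul_assoc] at hi
    exact Finset.mem_range.2 (Nat.div_lt_of_lt_mul hi.1)
  · intro j hj
    rw [Finset.mem_range] at hj
    rw [Finset.mem_filter, Finset.mem_range, hk, mul_assoc]
    exact ⟨Nat.mul_lt_mul_of_pos_left hj hc, dvd_mul_right _ _⟩
  · intro i hi
    exact Nat.mul_div_cancel' (Finset.mem_filter.1 hi).2
  · intro j _
    exact Nat.mul_div_cancel_left _ hc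
  · intro i _
    rfl

lemma HasParity.slash {κ N : ℕ} {g : ZMod N → ZMod N → ℂ} (hg : HasParity κ g) (γ : SL(2, ℤ)) :
    HasParity κ (slashCoeff γ g) := by
  intro a b
  rw [slashCoeff, slashCoeff, ← hg]
  congr 1 <;> ring

lemma HasParity.lift {κ A M N : ℕ} {g : ZMod A → ZMod M → ℂ} (hg : HasParity κ g) (h : M ∣ N) :
    HasParity κ (liftCoeff h g) := by
  intro a b
  rw [liftCoeff, liftCoeff, map_neg, hg]

lemma HasParity.scale {κ L M N c : ℕ} [NeZero N] {g : ZMod L → ZMod M → ℂ} (hg : HasParity κ g)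
    (h : c * L ∣ N) : HasParity κ (scaleCoeff N c g) := by
  intro a b
  obtain ⟨m, rfl⟩ := ZMod.intCast_surjective a
  rw [← Int.cast_neg, scaleCoeff_intCast h, scaleCoeff_intCast h]
  simp only [dvd_neg]
  split_ifs with hd
  · rw [Int.neg_ediv_of_dvd hd, Int.cast_neg, hg]
  · simp

/-- The action of `SL₂(ℤ)` on pairs of residues. -/
def residueEquiv (N : ℕ) (γ : SL(2, ℤ)) : ZMod N × ZMod N ≃ ZMod N × ZMod N where
  toFun q := (γ 1 1 * q.1 - γ 1 0 * q.2, -(γ 0 1 * q.1) + γ 0 0 * q.2)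
  invFun p := (p.1 * γ 0 0 + p.2 * γ 1 0, p.1 * γ 0 1 + p.2 * γ 1 1)
  left_inv p := by
    have h := congrArg (Int.cast : ℤ → ZMod N) γ.det_coe
    rw [Matrix.det_fin_two] at h
    push_cast at h
    ext
    · simp only; linear_combination p.1 * h
    · simp only; linear_combination p.2 * h
  right_inv p := by
    have h := congrArg (Int.cast : ℤ → ZMod N) γ.det_coe
    rw [Matrix.det_fin_two] at h
    push_cast at h
    ext
    · simp only; linear_combination p.1 * h
    · simp only; linear_combination p.2 * h

lemma sum_slashCoeff {N : ℕ} [NeZero N] (γ : SL(2, ℤ)) (g : ZMod N → ZMod N → ℂ) :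
    ∑ a, ∑ b, slashCoeff γ g a b = ∑ a, ∑ b, g a b := by
  rw [← Fintype.sum_prod_type', ← Fintype.sum_prod_type']
  exact (residueEquiv N γ).sum_comp fun q => g q.1 q.2

lemma IsAdmissible.slash {κ N : ℕ} [NeZero N] {g : ZMod N → ZMod N → ℂ} (hg : IsAdmissible κ g)
    (γ : SL(2, ℤ)) : IsAdmissible κ (slashCoeff γ g) :=
  ⟨hg.parity.slash γ, fun h => by rw [sum_slashCoeff, hg.sum_eq_zero h]⟩

/-- Transfer of identities between lattice sums to their continuations. -/
lemma latCont_eventuallyEq {κ : ℕ} (hκ : κ ≤ 1) {A₁ B₁ A₂ B₂ : ℕ} [NeZero A₁] [NeZero B₁]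
    [NeZero A₂] [NeZero B₂] {g₁ : ZMod A₁ → ZMod B₁ → ℂ} {g₂ : ZMod A₂ → ZMod B₂ → ℂ}
    (hg₁ : IsAdmissible κ g₁) (hg₂ : IsAdmissible κ g₂) {z₁ z₂ : ℂ} (hz₁ : 0 < z₁.im)
    (hz₂ : 0 < z₂.im) (c : ℂ)
    (h : ∀ σ : ℂ, (z₁.im : ℂ) ^ (σ - κ) * latSum κ g₁ z₁ σ =
      c * ((z₂.im : ℂ) ^ (σ - κ) * latSum κ g₂ z₂ σ)) {x : ℂ} (hx : 1 / 2 < x.re) :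
    latCont κ g₁ z₁ =ᶠ[𝓝 x] fun σ => c * latCont κ g₂ z₂ σ := by
  have hκ1 : (κ:ℝ) ≤ 1 := by exact_mod_cast hκ
  have h1 := analyticAt_latCont hκ hg₁ hz₁ hx
  have h2 : AnalyticAt ℂ (fun σ => c * latCont κ g₂ z₂ σ) x :=
    analyticAt_const.mul (analyticAt_latCont hκ hg₂ hz₂ hx)
  refine (h1.meromorphicNFAt.eventuallyEq_nhdsNE_iff_eventuallyEq_nhds h2.meromorphicNFAt).1 ?_
  refine meromorphic_identity (meromorphic_latCont hκ g₁ hz₁) (fun x => ?_) 2 (fun s hs => ?_) x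
  · have := meromorphic_latCont hκ g₂ hz₂ x
    fun_prop
  · rw [← latSum_eq_latCont hκ hg₁.parity hz₁ (by linarith),
      ← latSum_eq_latCont hκ hg₂.parity hz₂ (by linarith), h s]

/-- An equality of germs in σ, not just of values, because weight one differentiates it. -/
lemma latCont_smul {κ : ℕ} (hκ : κ ≤ 1) {N : ℕ} [NeZero N] {g : ZMod N → ZMod N → ℂ}
    (hg : IsAdmissible κ g) (γ : SL(2, ℤ)) (z : ℍ) {x : ℂ} (hx : 1 / 2 < x.re) :
    latCont κ g ((γ • z : ℍ) : ℂ) =ᶠ[𝓝 x] fun σ =>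
      ((γ 1 0 : ℂ) * z + (γ 1 1 : ℂ)) ^ κ * latCont κ (slashCoeff γ g) z σ :=
  latCont_eventuallyEq hκ hg (hg.slash γ) (γ • z).im_pos z.im_pos _ (latSum_smul κ g γ z) hx

end Transform

/-! ### Series of exponentials with coefficients of polynomial growth. -/

/-- The frequency `(m+1)|r|/B`. -/
def freq (B : ℕ) (p : ℕ × ℤ) : ℝ := ((p.1 + 1 : ℕ) : ℝ) / B * |(p.2 : ℝ)|

/-- The exponential `e^{2πi z (m+1)|r|/B}`. -/
def qexp (B : ℕ) (p : ℕ × ℤ) (z : ℂ) : ℂ := Complex.exp (2 * π * Complex.I * freq B p * z)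

/-- A series of exponentials. -/
def qSeries (B : ℕ) (c : ℕ × ℤ → ℂ) (z : ℂ) : ℂ := ∑' p, c p * qexp B p z

/-- Coefficients of polynomial growth, vanishing for `r = 0`. -/
def IsPolyBdd (c : ℕ × ℤ → ℂ) : Prop :=
  ∃ G : ℝ, ∃ n : ℕ, 0 ≤ G ∧ ∀ p, ‖c p‖ ≤
    if p.2 = 0 then 0 else G * (((p.1 + 1 : ℕ) : ℝ) * |(p.2 : ℝ)|) ^ n

lemma norm_qexp (B : ℕ) (p : ℕ × ℤ) (z : ℂ) :
    ‖qexp B p z‖ = Real.exp (-(2 * π * freq B p * z.im)) := by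
  rw [qexp, Complex.norm_exp]
  congr 1
  have : (2 * π * Complex.I * freq B p * z : ℂ) = ((2 * π * freq B p : ℝ) : ℂ) * (Complex.I * z) := by
    push_cast; ring
  rw [this, Complex.re_ofReal_mul]
  simp

lemma hasDerivAt_qexp (B : ℕ) (p : ℕ × ℤ) (z : ℂ) :
    HasDerivAt (qexp B p) (2 * π * Complex.I * freq B p * qexp B p z) z := by
  have h := ((hasDerivAt_id z).const_mul (2 * π * Complex.I * freq B p)).cexp
  refine h.congr_deriv ?_
  simp [qexp]
  ring

section Series

variable {B : ℕ} [NeZero B]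

lemma exists_pow_wt_mul_norm_qexp_le (n : ℕ) {y₀ : ℝ} (hy₀ : 0 < y₀) : ∃ K c, 0 ≤ K ∧ 0 < c ∧
    ∀ z : ℂ, y₀ ≤ z.im → ∀ p : ℕ × ℤ, p.2 ≠ 0 →
      (((p.1 + 1 : ℕ) : ℝ) * |(p.2 : ℝ)|) ^ n * Real.exp (-(2 * π * freq B p * z.im)) ≤
        K * expWt c p := by
  have hB : (0:ℝ) < B := by exact_mod_cast Nat.pos_of_ne_zero (NeZero.ne B)
  have hc : 0 < 2 * π * y₀ / B := by positivity
  obtain ⟨K, hK, h⟩ := pow_mul_exp_le n hc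
  refine ⟨K, 2 * π * y₀ / B / 2, hK, by positivity, fun z hz p hp => ?_⟩
  rw [expWt, if_neg hp]
  refine (mul_le_mul_of_nonneg_left (Real.exp_le_exp.2 (neg_le_neg ?_)) (by positivity)).trans
    (h _ (by positivity))
  rw [freq]
  calc 2 * π * y₀ / B * (((p.1 + 1 : ℕ) : ℝ) * |(p.2 : ℝ)|)
      = 2 * π * (((p.1 + 1 : ℕ) : ℝ) / B * |(p.2 : ℝ)|) * y₀ := by ring
    _ ≤ _ := by gcongr

lemma IsPolyBdd.exists_norm_le {c : ℕ × ℤ → ℂ} (hc : IsPolyBdd c) {y₀ : ℝ} (hy₀ : 0 < y₀) :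
    ∃ K d, 0 ≤ K ∧ 0 < d ∧ ∀ z : ℂ, y₀ ≤ z.im → ∀ p, ‖c p * qexp B p z‖ ≤ K * expWt d p := by
  obtain ⟨G, n, hG, h⟩ := hc
  obtain ⟨K, d, hK, hd, h1⟩ := exists_pow_wt_mul_norm_qexp_le (B := B) n hy₀
  refine ⟨G * K, d, by positivity, hd, fun z hz p => ?_⟩
  have h2 := h p
  rw [norm_mul, norm_qexp]
  split_ifs at h2 with hp
  · have : ‖c p‖ = 0 := le_antisymm h2 (norm_nonneg _)
    rw [this, zero_mul]
    exact mul_nonneg (by positivity) (expWt_nonneg _ _)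
  · calc _ ≤ G * (((p.1 + 1 : ℕ) : ℝ) * |(p.2 : ℝ)|) ^ n *
          Real.exp (-(2 * π * freq B p * z.im)) := by gcongr
      _ ≤ _ := by rw [mul_assoc G, mul_assoc G]; exact mul_le_mul_of_nonneg_left (h1 z hz p hp) hG

lemma IsPolyBdd.summable {c : ℕ × ℤ → ℂ} (hc : IsPolyBdd c) {z : ℂ} (hz : 0 < z.im) :
    Summable fun p => c p * qexp B p z := by
  obtain ⟨K, d, _, hd, h⟩ := hc.exists_norm_le (B := B) hz
  exact Summable.of_norm_bounded ((summable_expWt hd).mul_left K) (h z le_rfl)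

lemma IsPolyBdd.exists_norm_qSeries_le {c : ℕ × ℤ → ℂ} (hc : IsPolyBdd c) {y₀ : ℝ}
    (hy₀ : 0 < y₀) : ∃ K, ∀ z : ℂ, y₀ ≤ z.im → ‖qSeries B c z‖ ≤ K := by
  obtain ⟨K, d, _, hd, h⟩ := hc.exists_norm_le (B := B) hy₀
  refine ⟨∑' p, K * expWt d p, fun z hz => ?_⟩
  exact tsum_of_norm_bounded ((summable_expWt hd).mul_left K).hasSum (h z hz)

lemma IsPolyBdd.hasDerivAt {c : ℕ × ℤ → ℂ} (hc : IsPolyBdd c) {z : ℂ} (hz : 0 < z.im) :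
    HasDerivAt (qSeries B c) (qSeries B (fun p => c p * (2 * π * Complex.I * freq B p)) z) z := by
  obtain ⟨K, d, _, hd, h⟩ := hc.exists_norm_le (B := B) (half_pos hz)
  have ho : IsOpen {w : ℂ | z.im / 2 < w.im} := isOpen_lt continuous_const Complex.continuous_im
  have hm : z ∈ {w : ℂ | z.im / 2 < w.im} := half_lt_self hz
  have hu := (summable_expWt hd).mul_left K
  have hdiff : ∀ p, DifferentiableOn ℂ (fun w => c p * qexp B p w) {w : ℂ | z.im / 2 < w.im} :=
    fun p w _ => ((hasDerivAt_qexp B p w).const_mul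
      (c p)).differentiableAt.differentiableWithinAt
  have hb : ∀ p, ∀ w ∈ {w : ℂ | z.im / 2 < w.im}, ‖c p * qexp B p w‖ ≤ K * expWt d p :=
    fun p w hw => h w (le_of_lt hw) p
  have h1 := (Complex.differentiableOn_tsum_of_summable_norm hu hdiff ho hb).differentiableAt
    (ho.mem_nhds hm)
  have h2 := Complex.hasSum_deriv_of_summable_norm hu hdiff ho hb hm
  refine h1.hasDerivAt.congr_deriv ?_
  rw [← h2.tsum_eq, qSeries]
  refine tsum_congr fun p => ?_
  rw [((hasDerivAt_qexp B p z).const_mul (c p)).deriv]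
  ring

lemma IsPolyBdd.differentiableOn {c : ℕ × ℤ → ℂ} (hc : IsPolyBdd c) :
    DifferentiableOn ℂ (qSeries B c) upperHalf := fun _ hz =>
  (hc.hasDerivAt hz).differentiableAt.differentiableWithinAt

end Series

/-! ### Coefficients split by the sign of the frequency, and the candidate for the image under ξ. -/

section Expansion

variable {A B : ℕ} [NeZero A] [NeZero B]

/-- Coefficients supported on `r > 0`. -/
def posCoeff (g : ZMod A → ZMod B → ℂ) (f : ℕ × ℤ → ℝ) (p : ℕ × ℤ) : ℂ :=
  if 0 < p.2 then f p * ghat g (p.1 + 1 : ℕ) p.2 else 0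

/-- Coefficients supported on `r < 0`. -/
def negCoeff (g : ZMod A → ZMod B → ℂ) (f : ℕ × ℤ → ℝ) (p : ℕ × ℤ) : ℂ :=
  if p.2 < 0 then f p * conj (ghat g (p.1 + 1 : ℕ) p.2) else 0

lemma isPolyBdd_posCoeff (g : ZMod A → ZMod B → ℂ) {f : ℕ × ℤ → ℝ} {C : ℝ} {n : ℕ} (hC : 0 ≤ C)
    (hf : ∀ p : ℕ × ℤ, p.2 ≠ 0 → |f p| ≤ C * (((p.1 + 1 : ℕ) : ℝ) * |(p.2 : ℝ)|) ^ n) :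
    IsPolyBdd (posCoeff g f) := by
  obtain ⟨G, hG, hg⟩ := exists_norm_ghat_le g
  refine ⟨C * G, n, by positivity, fun p => ?_⟩
  unfold posCoeff
  rcases lt_trichotomy p.2 0 with h | h | h
  · rw [if_neg h.not_gt, if_neg h.ne, norm_zero]; positivity
  · simp [h]
  · rw [if_pos h, if_neg h.ne', norm_mul, Complex.norm_real, Real.norm_eq_abs, mul_right_comm]
    have := hf p h.ne'
    have h1 := hg ((p.1 + 1 : ℕ) : ZMod A) p.2
    gcongr

lemma isPolyBdd_negCoeff (g : ZMod A → ZMod B → ℂ) {f : ℕ × ℤ → ℝ} {C : ℝ} {n : ℕ} (hC : 0 ≤ C)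
    (hf : ∀ p : ℕ × ℤ, p.2 ≠ 0 → |f p| ≤ C * (((p.1 + 1 : ℕ) : ℝ) * |(p.2 : ℝ)|) ^ n) :
    IsPolyBdd (negCoeff g f) := by
  obtain ⟨G, hG, hg⟩ := exists_norm_ghat_le g
  refine ⟨C * G, n, by positivity, fun p => ?_⟩
  unfold negCoeff
  rcases lt_trichotomy p.2 0 with h | h | h
  · rw [if_pos h, if_neg h.ne, norm_mul, Complex.norm_real, Real.norm_eq_abs, mul_right_comm,
      RCLike.norm_conj]
    have := hf p h.ne
    have h1 := hg ((p.1 + 1 : ℕ) : ZMod A) p.2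
    gcongr
  · simp [h]
  · rw [if_neg h.not_gt, if_neg h.ne', norm_zero]; positivity

lemma abs_pow_le_wt (p : ℕ × ℤ) (n : ℕ) :
    |(|(p.2 : ℝ)| ^ n)| ≤ 1 * (((p.1 + 1 : ℕ) : ℝ) * |(p.2 : ℝ)|) ^ n := by
  have h2 : (1:ℝ) ≤ ((p.1 + 1 : ℕ) : ℝ) := by exact_mod_cast Nat.le_add_left 1 _
  rw [abs_of_nonneg (by positivity), one_mul]
  gcongr
  exact le_mul_of_one_le_left (abs_nonneg _) h2

lemma inv_le_wt {p : ℕ × ℤ} (B : ℕ) :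
    |(((p.1 + 1 : ℕ) : ℝ) / B)⁻¹| ≤ B * (((p.1 + 1 : ℕ) : ℝ) * |(p.2 : ℝ)|) ^ 0 := by
  have h2 : (1:ℝ) ≤ ((p.1 + 1 : ℕ) : ℝ) := by exact_mod_cast Nat.le_add_left 1 _
  rw [inv_div, abs_of_nonneg (by positivity), pow_zero, mul_one]
  exact div_le_self (by positivity) h2

/-- The image under `ξ` of the preimage attached to `g`. -/
def xiImage (k : ℕ) (g : ZMod A → ZMod B → ℂ) (z : ℂ) : ℂ :=
  conj (ZMod.LFunction (g 0) k) +
    (if k = 1 then -(π * Complex.I / B) * conj (ZMod.LFunction (fun a => ghat g a 0) 0) else 0) +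
    (-(2 * π * Complex.I / B)) ^ k / ((k - 1).factorial : ℂ) *
      qSeries B (negCoeff g fun p => |(p.2 : ℝ)| ^ (k - 1)) z

lemma differentiableOn_xiImage (k : ℕ) (g : ZMod A → ZMod B → ℂ) :
    DifferentiableOn ℂ (xiImage k g) upperHalf := by
  have := (isPolyBdd_negCoeff g zero_le_one fun p _ => abs_pow_le_wt p (k - 1)).differentiableOn
    (B := B)
  unfold xiImage
  fun_prop

lemma exists_norm_xiImage_le (k : ℕ) (g : ZMod A → ZMod B → ℂ) {y₀ : ℝ} (hy₀ : 0 < y₀) :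
    ∃ K, ∀ z : ℂ, y₀ ≤ z.im → ‖xiImage k g z‖ ≤ K := by
  obtain ⟨K, hK⟩ := (isPolyBdd_negCoeff g zero_le_one fun p _ =>
    abs_pow_le_wt p (k - 1)).exists_norm_qSeries_le (B := B) hy₀
  refine ⟨‖conj (ZMod.LFunction (g 0) k) + (if k = 1 then
    -(π * Complex.I / B) * conj (ZMod.LFunction (fun a => ghat g a 0) 0) else 0)‖ +
    ‖(-(2 * π * Complex.I / B)) ^ k / ((k - 1).factorial : ℂ)‖ * K, fun z hz => ?_⟩
  rw [xiImage]
  refine (norm_add_le _ _).trans (add_le_add_right ?_ _)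
  rw [norm_mul]
  exact mul_le_mul_of_nonneg_left (hK z hz) (norm_nonneg _)

end Expansion

/-! ### Weight zero: the value of the continuation at σ = 1. -/

section Expansion

variable {A B : ℕ} [NeZero A] [NeZero B]

lemma exp_split (w : ℂ) (c : ℝ) : Complex.exp (2 * π * Complex.I * c * w) =
    Complex.exp (2 * π * Complex.I * (c * w.re)) * (Real.exp (-(2 * π * c * w.im)) : ℝ) := by
  rw [Complex.ofReal_exp, ← Complex.exp_add]
  congr 1
  conv_lhs => rw [← Complex.re_add_im w]
  push_cast
  linear_combination (2 * π * c * w.im) * Complex.I_sq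

lemma qexp_of_pos {p : ℕ × ℤ} (hp : 0 < p.2) (z : ℂ) :
    Complex.exp (2 * π * Complex.I * (p.2 * (((p.1 + 1 : ℕ) / B * z.re : ℝ) : ℂ))) *
      (Real.exp (-(2 * π * z.im * (((p.1 + 1 : ℕ) : ℝ) / B) * |(p.2 : ℝ)|)) : ℝ) = qexp B p z := by
  have hp' : (0:ℝ) < p.2 := by exact_mod_cast hp
  rw [qexp, exp_split, freq, abs_of_pos hp']
  push_cast
  ring_nf

lemma conj_qexp_of_neg {p : ℕ × ℤ} (hp : p.2 < 0) (z : ℂ) :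
    Complex.exp (2 * π * Complex.I * (p.2 * (((p.1 + 1 : ℕ) / B * z.re : ℝ) : ℂ))) *
      (Real.exp (-(2 * π * z.im * (((p.1 + 1 : ℕ) : ℝ) / B) * |(p.2 : ℝ)|)) : ℝ) =
      conj (qexp B p z) := by
  have hp' : (p.2 : ℝ) < 0 := by exact_mod_cast hp
  rw [qexp, exp_split, freq, abs_of_neg hp', map_mul, Complex.conj_ofReal, ← Complex.exp_conj]
  simp only [map_mul, Complex.conj_I, Complex.conj_ofReal, map_ofNat]
  push_cast
  ring_nf

/-- The coefficient `1/l`. -/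
def invWt (B : ℕ) (p : ℕ × ℤ) : ℝ := (((p.1 + 1 : ℕ) : ℝ) / B)⁻¹

lemma isPolyBdd_posCoeff_invWt (g : ZMod A → ZMod B → ℂ) : IsPolyBdd (posCoeff g (invWt B)) :=
  isPolyBdd_posCoeff g (Nat.cast_nonneg B) fun _ _ => inv_le_wt B

lemma isPolyBdd_negCoeff_invWt (g : ZMod A → ZMod B → ℂ) : IsPolyBdd (negCoeff g (invWt B)) :=
  isPolyBdd_negCoeff g (Nat.cast_nonneg B) fun _ _ => inv_le_wt B

/-- At σ = 1 the Bessel integral is an exponential; together with e^{2πirlx} it is holomorphic in z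
for r > 0 and the conjugate of a holomorphic exponential for r < 0. -/
lemma sqrt_mul_besselSum_zero (g : ZMod A → ZMod B → ℂ) {z : ℂ} (hz : 0 < z.im) :
    ((√z.im : ℝ) : ℂ) * besselSum 0 g z 1 = qSeries B (posCoeff g (invWt B)) z +
      conj (qSeries B (negCoeff g (invWt B)) z) := by
  have h1 := (isPolyBdd_posCoeff_invWt g).summable (B := B) hz
  have h2 := (isPolyBdd_negCoeff_invWt g).summable (B := B) hz
  have hs : ((√z.im : ℝ) : ℂ) ≠ 0 := by exact_mod_cast (Real.sqrt_pos.2 hz).ne'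
  have hB : (0:ℝ) < B := by exact_mod_cast Nat.pos_of_ne_zero (NeZero.ne B)
  rw [besselSum, qSeries, qSeries, Complex.conj_tsum, ← h1.tsum_add (Complex.summable_conj.2 h2),
    ← tsum_mul_left]
  refine tsum_congr fun p => ?_
  unfold besselTerm posCoeff negCoeff
  have hl : (0:ℝ) < ((p.1 + 1 : ℕ) : ℝ) / B := by positivity
  rcases lt_trichotomy p.2 0 with h | h | h
  · have hr : (p.2 : ℝ) ≠ 0 := by exact_mod_cast h.ne
    rw [if_neg h.ne, if_neg h.not_gt, if_pos h, besselInt_zero_one hr hl hz, map_mul, map_mul,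
      Complex.conj_conj, Complex.conj_ofReal, ← conj_qexp_of_neg h, invWt]
    generalize Complex.exp (2 * π * Complex.I * (p.2 * (((p.1 + 1 : ℕ) / B * z.re : ℝ) : ℂ))) = e
    generalize Real.exp _ = E
    generalize ((p.1 + 1 : ℕ) : ℝ) / B = l at hl
    push_cast
    field_simp
    simp
  · simp [h]
  · have hr : (p.2 : ℝ) ≠ 0 := by exact_mod_cast h.ne'
    rw [if_neg h.ne', if_pos h, if_neg h.not_gt, besselInt_zero_one hr hl hz, ← qexp_of_pos h,
      invWt]
    generalize Complex.exp (2 * π * Complex.I * (p.2 * (((p.1 + 1 : ℕ) / B * z.re : ℝ) : ℂ))) = e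
    generalize Real.exp _ = E
    generalize ((p.1 + 1 : ℕ) : ℝ) / B = l at hl
    push_cast
    field_simp
    simp

/-- The Fourier expansion of the weight `0` form. -/
lemma exists_latCont_zero_one (g : ZMod A → ZMod B → ℂ) : ∃ C₀ : ℂ, ∀ z : ℂ, 0 < z.im →
    latCont 0 g z 1 = ZMod.LFunction (g 0) 2 * z.im + C₀ + π / B ^ 2 *
      (qSeries B (posCoeff g (invWt B)) z + conj (qSeries B (negCoeff g (invWt B)) z)) := by
  -- At σ = 1 the factors √y and (πy)^{-1/2} cancel up to a constant, so the zero frequency does not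
  -- depend on z. The L-value at 1 enters as a mere number, which is why g is arbitrary here.
  refine ⟨(π : ℂ) / B * ZMod.LFunction (fun a => ghat g a 0) 1, fun z hz => ?_⟩
  have hs : ((√z.im : ℝ) : ℂ) ≠ 0 := by exact_mod_cast (Real.sqrt_pos.2 hz).ne'
  have hπ : ((√π : ℝ) : ℂ) ≠ 0 := by exact_mod_cast (Real.sqrt_pos.2 Real.pi_pos).ne'
  have hB0 : (B:ℂ) ≠ 0 := by exact_mod_cast NeZero.ne B
  have e1 : ((π * z.im : ℝ) : ℂ) ^ (1 / 2 - (1:ℂ)) = (((√π : ℝ) : ℂ) * ((√z.im : ℝ) : ℂ))⁻¹ := by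
    rw [← Complex.ofReal_mul, ← Real.sqrt_mul Real.pi_pos.le, Real.sqrt_eq_rpow,
      ← Complex.ofReal_inv, ← Real.rpow_neg (by positivity), Complex.ofReal_cpow (by positivity)]
    norm_num
  have e2 : Complex.Gamma (1 - 1 / 2) = ((√π : ℝ) : ℂ) := by
    rw [show (1:ℂ) - 1 / 2 = 1 / 2 by norm_num, Complex.Gamma_one_half_eq, Real.sqrt_eq_rpow,
      Complex.ofReal_cpow Real.pi_pos.le]
    norm_num
  have e3 : (B:ℂ) ^ (((0:ℕ):ℂ) - 2 * 1) = ((B:ℂ) ^ 2)⁻¹ := by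
    rw [show (((0:ℕ):ℂ) - 2 * 1) = -((2:ℕ):ℂ) by norm_num, Complex.cpow_neg, Complex.cpow_natCast]
  rw [← sqrt_mul_besselSum_zero g hz, latCont, e1, e2, e3]
  simp only [Nat.cast_zero, sub_zero, Complex.cpow_one, mul_one, Complex.Gamma_one, inv_one,
    pow_zero, one_mul]
  rw [show (2:ℂ) - 1 = 1 by norm_num]
  field_simp
  ring

lemma qSeries_smul (B : ℕ) (c : ℕ × ℤ → ℂ) (a z : ℂ) :
    qSeries B (fun p => a * c p) z = a * qSeries B c z := by
  simp only [qSeries, mul_assoc, tsum_mul_left]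

/-- Differentiation brings down the frequency l|r|, which against the coefficient 1/l leaves |r|,
the power |r|^{k-1} of weight k = 2. -/
lemma negCoeff_invWt_mul_freq (g : ZMod A → ZMod B → ℂ) (z : ℂ) :
    qSeries B (fun p => negCoeff g (invWt B) p * (2 * π * Complex.I * freq B p)) z =
      2 * π * Complex.I * qSeries B (negCoeff g fun p => |(p.2 : ℝ)| ^ 1) z := by
  have hB : (B:ℂ) ≠ 0 := by exact_mod_cast NeZero.ne B
  rw [← qSeries_smul]
  congr 1
  ext p
  unfold negCoeff invWt freq
  split_ifs
  · have : ((p.1 + 1 : ℕ) : ℂ) ≠ 0 := by exact_mod_cast p.1.succ_ne_zero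
    push_cast at this ⊢
    field_simp
  · simp

/-- The weight `0` form is real differentiable, with the expected antiholomorphic derivative. -/
lemma exists_hasWirt_latCont_zero (g : ZMod A → ZMod B → ℂ) {z : ℂ} (hz : 0 < z.im) :
    ∃ a b, HasWirt (fun w => latCont 0 g w 1) a b z ∧
      2 * Complex.I * conj b = xiImage 2 g z := by
  obtain ⟨C₀, h⟩ := exists_latCont_zero_one g
  have hp := HasDerivAt.hasWirt ((isPolyBdd_posCoeff_invWt g).hasDerivAt (B := B) hz)
  have hn := (HasDerivAt.hasWirt ((isPolyBdd_negCoeff_invWt g).hasDerivAt (B := B) hz)).conj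
  -- The series over r > 0 is lost under ∂/∂z̄; the term linear in y gives the constant term of the
  -- image and the conjugated series gives the rest.
  have hw := ((((hasWirt_im z).const_mul (ZMod.LFunction (g 0) 2)).add (hasWirt_const C₀ z)).add
    ((hp.add hn).const_mul (π / B ^ 2 : ℂ))).congr_of_eventuallyEq
    (g := fun w => latCont 0 g w 1) (by
      filter_upwards [isOpen_upperHalf.mem_nhds hz] with w hw using h w hw)
  refine ⟨_, _, hw, ?_⟩
  rw [negCoeff_invWt_mul_freq, xiImage]
  have hB0 : (B:ℂ) ≠ 0 := by exact_mod_cast NeZero.ne B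
  simp only [map_add, map_mul, map_div₀, Complex.conj_I, Complex.conj_ofReal, map_pow,
    Complex.conj_natCast, Complex.conj_conj, map_ofNat, zero_add, Nat.cast_ofNat, map_zero]
  norm_num
  field_simp
  ring_nf
  simp only [Complex.I_sq]
  ring

end Expansion

/-! ### Weight one: the derivative of the continuation at σ = 1. -/

section Expansion

variable {A B : ℕ} [NeZero A] [NeZero B]

lemma sqrt_mul_cpow {y : ℝ} (hy : 0 < y) (σ : ℂ) : ((√y : ℝ) : ℂ) *
    ((π * y : ℝ) : ℂ) ^ (1 / 2 - σ) = (π : ℂ) ^ (1 / 2 - σ) * (y : ℂ) ^ (1 - σ) := by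
  have hy0 : (y:ℂ) ≠ 0 := by exact_mod_cast hy.ne'
  rw [Complex.ofReal_mul, Complex.mul_cpow_ofReal_nonneg Real.pi_pos.le hy.le, Real.sqrt_eq_rpow,
    Complex.ofReal_cpow hy.le, mul_left_comm, ← Complex.cpow_add _ _ hy0]
  congr 2
  push_cast
  ring

/-- The weight `1` form as a derivative. -/
lemma exists_deriv_latCont_one {g : ZMod A → ZMod B → ℂ} (hg : HasParity 1 g) :
    ∃ C₀ C₁ : ℂ, ∀ z : ℂ, 0 < z.im → deriv (latCont 1 g z) 1 =
      (ZMod.LFunction (g 0) 1 + Complex.I * π / B * ZMod.LFunction (fun a => ghat g a 0) 0) *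
          (Real.log z.im : ℂ) + C₀ + C₁ * (((√z.im : ℝ) : ℂ) * besselSum 1 g z 1) +
        -(Complex.I * π / B) * (((√z.im : ℝ) : ℂ) * deriv (besselSum 1 g z) 1) := by
  -- The factors independent of z are isolated. Since y^{σ-1} and y^{1-σ} have derivatives log y and
  -- -log y at σ = 1, the coefficient of log y in the result is a(1) - r(1).
  set a : ℂ → ℂ := fun σ => ZMod.LFunction (g 0) (2 * σ - 1) with ha
  set r : ℂ → ℂ := fun σ => (Complex.Gamma σ)⁻¹ * (π : ℂ) ^ σ * (-Complex.I * ((B : ℂ)⁻¹ *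
    Complex.Gamma (σ - 1 / 2) * ((π : ℂ) ^ (1 / 2 - σ) *
      ZMod.LFunction (fun a => ghat g a 0) (2 * σ - 1 - 1)))) with hr
  set s : ℂ → ℂ := fun σ => (Complex.Gamma σ)⁻¹ * (π : ℂ) ^ σ * (-Complex.I *
    (B : ℂ) ^ (1 - 2 * σ)) with hs
  have hB0 : (B:ℂ) ≠ 0 := by exact_mod_cast NeZero.ne B
  have hπ : (π:ℂ) ≠ 0 := by exact_mod_cast Real.pi_ne_zero
  have h4 : DifferentiableAt ℂ (fun σ => (Complex.Gamma σ)⁻¹) 1 :=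
    Complex.differentiable_one_div_Gamma 1
  have h6 : ∀ f : ℂ → ℂ, Differentiable ℂ f → DifferentiableAt ℂ (fun σ : ℂ => (π : ℂ) ^ f σ) 1 :=
    fun f hf => (analyticAt_const_cpow_comp (by simpa using Real.pi_pos)
      (hf.analyticAt 1)).differentiableAt
  have had : DifferentiableAt ℂ a 1 :=
    DifferentiableAt.fun_comp' 1 (g := ZMod.LFunction (g 0)) (f := fun σ : ℂ => 2 * σ - 1)
      (ZMod.differentiableAt_LFunction _ _ (Or.inr hg.sum_zero_row)) (by fun_prop)
  have hrd : DifferentiableAt ℂ r 1 := by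
    have h1 : DifferentiableAt ℂ
        (fun σ => ZMod.LFunction (fun a => ghat g a 0) (2 * σ - 1 - 1)) 1 :=
      DifferentiableAt.fun_comp' 1 (g := ZMod.LFunction (fun a => ghat g a 0))
        (f := fun σ : ℂ => 2 * σ - 1 - 1)
        (ZMod.differentiableAt_LFunction _ _ (Or.inl (by norm_num))) (by fun_prop)
    have h2 : DifferentiableAt ℂ (fun σ => Complex.Gamma (σ - 1 / 2)) 1 := by
      refine DifferentiableAt.fun_comp' 1 (g := Complex.Gamma) (f := fun σ : ℂ => σ - 1 / 2)
        (Complex.differentiableAt_Gamma _ fun m h => ?_) (by fun_prop)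
      have := congrArg Complex.re h
      simp at this
      have hm : (0:ℝ) ≤ m := m.cast_nonneg
      linarith
    have h3 := h6 (fun σ => 1 / 2 - σ) (by fun_prop)
    have h5 := h6 (fun σ => σ) (by fun_prop)
    rw [hr]
    fun_prop
  have hsd : DifferentiableAt ℂ s 1 := by
    have h1 : DifferentiableAt ℂ (fun σ : ℂ => (B : ℂ) ^ (1 - 2 * σ)) 1 :=
      (analyticAt_const_cpow_comp (natCast_re_pos B) (by fun_prop)).differentiableAt
    have h5 := h6 (fun σ => σ) (by fun_prop)
    rw [hs]
    fun_prop
  refine ⟨deriv a 1 + deriv r 1, deriv s 1, fun z hz => ?_⟩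
  have hy0 : (z.im:ℂ) ≠ 0 := by exact_mod_cast hz.ne'
  have heq : latCont 1 g z = fun σ => (z.im : ℂ) ^ (σ - 1) * a σ + r σ * (z.im : ℂ) ^ (1 - σ) +
      s σ * (((√z.im : ℝ) : ℂ) * besselSum 1 g z σ) := by
    ext σ
    have h := sqrt_mul_cpow hz σ
    simp only [latCont, ha, hr, hs, Nat.cast_one, pow_one]
    linear_combination ((Complex.Gamma σ)⁻¹ * (π : ℂ) ^ σ * (-Complex.I * ((B : ℂ)⁻¹ *
      Complex.Gamma (σ - 1 / 2) * ZMod.LFunction (fun a => ghat g a 0) (2 * σ - 1 - 1)))) * h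
  have hd1 : HasDerivAt (fun σ : ℂ => (z.im : ℂ) ^ (σ - 1)) (Real.log z.im : ℂ) 1 := by
    have := ((hasDerivAt_id (1:ℂ)).sub_const 1).const_cpow (c := (z.im : ℂ)) (Or.inl hy0)
    refine this.congr_deriv ?_
    simp [Complex.ofReal_log hz.le]
  have hd2 : HasDerivAt (fun σ : ℂ => (z.im : ℂ) ^ (1 - σ)) (-(Real.log z.im : ℂ)) 1 := by
    have := ((hasDerivAt_id (1:ℂ)).const_sub 1).const_cpow (c := (z.im : ℂ)) (Or.inl hy0)
    refine this.congr_deriv ?_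
    simp [Complex.ofReal_log hz.le]
  have hd3 := ((differentiable_besselSum le_rfl g hz 1).hasDerivAt).const_mul ((√z.im : ℝ) : ℂ)
  have hD := ((hd1.mul had.hasDerivAt).add (hrd.hasDerivAt.mul hd2)).add (hsd.hasDerivAt.mul hd3)
  have hr1 : r 1 = -(Complex.I * π / B) * ZMod.LFunction (fun a => ghat g a 0) 0 := by
    have e2 : Complex.Gamma (1 - 1 / 2) * (π : ℂ) ^ (1 / 2 - (1:ℂ)) = 1 := by
      rw [show (1:ℂ) - 1 / 2 = 1 / 2 by norm_num, Complex.Gamma_one_half_eq,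
        ← Complex.cpow_add _ _ hπ]
      norm_num
    simp only [hr, Complex.Gamma_one, Complex.cpow_one]
    rw [show (2:ℂ) * 1 - 1 - 1 = 0 by norm_num]
    linear_combination (π * -Complex.I * (B:ℂ)⁻¹ * ZMod.LFunction (fun a => ghat g a 0) 0) * e2
  have hs1 : s 1 = -(Complex.I * π / B) := by
    simp only [hs, Complex.Gamma_one, Complex.cpow_one]
    rw [show (1:ℂ) - 2 * 1 = -1 by norm_num, Complex.cpow_neg_one]
    ring
  have ha1 : a 1 = ZMod.LFunction (g 0) 1 := by
    simp only [ha]; norm_num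
  rw [heq]
  refine hD.deriv.trans ?_
  rw [hr1, hs1, ha1]
  simp only [sub_self, Complex.cpow_zero]
  ring

/-- By `besselInt_one_one` only r > 0 survives, so this contribution to the derivative is
holomorphic and invisible to ξ. -/
lemma sqrt_mul_besselSum_one (g : ZMod A → ZMod B → ℂ) {z : ℂ} (hz : 0 < z.im) :
    ((√z.im : ℝ) : ℂ) * besselSum 1 g z 1 = qSeries B (posCoeff g fun _ => 2) z := by
  have hs : ((√z.im : ℝ) : ℂ) ≠ 0 := by exact_mod_cast (Real.sqrt_pos.2 hz).ne'
  have hB : (0:ℝ) < B := by exact_mod_cast Nat.pos_of_ne_zero (NeZero.ne B)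
  rw [besselSum, qSeries, ← tsum_mul_left]
  refine tsum_congr fun p => ?_
  unfold besselTerm posCoeff
  have hl : (0:ℝ) < ((p.1 + 1 : ℕ) : ℝ) / B := by positivity
  rcases lt_trichotomy p.2 0 with h | h | h
  · have hr : (p.2 : ℝ) ≠ 0 := by exact_mod_cast h.ne
    have hr' : ¬ 0 < (p.2 : ℝ) := by exact_mod_cast h.not_gt
    rw [if_neg h.ne, if_neg h.not_gt, besselInt_one_one hr hl hz, if_neg hr']
    simp
  · simp [h]
  · have hr : (p.2 : ℝ) ≠ 0 := by exact_mod_cast h.ne'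
    have hr' : 0 < (p.2 : ℝ) := by exact_mod_cast h
    rw [if_neg h.ne', if_pos h, besselInt_one_one hr hl hz, if_pos hr', ← qexp_of_pos h]
    generalize Complex.exp (2 * π * Complex.I * (p.2 * (((p.1 + 1 : ℕ) / B * z.re : ℝ) : ℂ))) = e
    generalize Real.exp _ = E
    push_cast
    field_simp

/-- The terms of the derivative of the Fourier expansion in weight `1`. -/
def derTerm (g : ZMod A → ZMod B → ℂ) (p : ℕ × ℤ) (z : ℂ) : ℂ :=
  if p.2 = 0 then 0 else ghat g (p.1 + 1 : ℕ) p.2 *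
    (Complex.exp (2 * π * Complex.I * (p.2 * ((p.1 + 1 : ℕ) / B * z.re : ℝ))) *
      besselDer p.2 ((p.1 + 1 : ℕ) / B) z.im)

lemma hasSum_derTerm (g : ZMod A → ZMod B → ℂ) {z : ℂ} (hz : 0 < z.im) :
    HasSum (fun p => derTerm g p z) (((√z.im : ℝ) : ℂ) * deriv (besselSum 1 g z) 1) := by
  have hB : (0:ℝ) < B := by exact_mod_cast Nat.pos_of_ne_zero (NeZero.ne B)
  refine ((hasSum_deriv_besselTerm le_rfl g hz 1).2.mul_left ((√z.im : ℝ) : ℂ)).congr_fun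
    fun p => ?_
  unfold derTerm besselTerm
  have hl : (0:ℝ) < ((p.1 + 1 : ℕ) : ℝ) / B := by positivity
  split_ifs with h
  · simp
  · have hr : (p.2 : ℝ) ≠ 0 := by exact_mod_cast h
    rw [(((hasDerivAt_besselInt 1 hr hl hz 1).2.const_mul _).const_mul _).deriv, ← besselLog_one]
    ring

/-- Cauchy's estimate on the unit circle around σ = 1, which lies in the strip 0 ≤ Re σ ≤ 2 where
`exists_norm_besselInt_le` is uniform. -/
lemma exists_abs_besselDer_le {l₀ y₀ : ℝ} (hl₀ : 0 < l₀) (hy₀ : 0 < y₀) :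
    ∃ C, 0 ≤ C ∧ ∀ (r l y : ℝ), 1 ≤ |r| → l₀ ≤ l → y₀ ≤ y →
      |besselDer r l y| ≤ √y * (C * (1 + |r| + l) * Real.exp (-(π * y * l * |r|))) := by
  obtain ⟨C, hC, h⟩ := exists_norm_besselInt_le (κ := 1) le_rfl 0 2 hl₀ hy₀
  refine ⟨C, hC, fun r l y hr hl hy => ?_⟩
  have hr0 : r ≠ 0 := by rintro rfl; norm_num at hr
  have h1 := (hasDerivAt_besselInt 1 hr0 (hl₀.trans_le hl) (hy₀.trans_le hy) 1).2
  have h2 : ‖deriv (besselInt 1 r l y) 1‖ ≤ C * (1 + |r| + l) * Real.exp (-(π * y * l * |r|)) / 1 := by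
    refine Complex.norm_deriv_le_of_forall_mem_sphere_norm_le zero_lt_one
      (differentiable_besselInt 1 hr0 (hl₀.trans_le hl) (hy₀.trans_le hy)).diffContOnCl
      fun w hw => ?_
    have hw1 : |w.re - 1| ≤ 1 := by
      have := Complex.abs_re_le_norm (w - 1)
      rw [mem_sphere_iff_norm] at hw
      rw [hw] at this
      simpa using this
    rw [abs_le] at hw1
    exact h r l y w hr hl hy (by linarith) (by linarith)
  rw [h1.deriv, div_one] at h2
  rw [← Real.norm_eq_abs, ← Complex.norm_real, ← besselLog_one, norm_mul, Complex.norm_real,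
    Real.norm_of_nonneg (Real.sqrt_nonneg y)]
  gcongr

end Expansion

section Expansion

variable {A B : ℕ} [NeZero A] [NeZero B]

lemma exists_abs_besselDer_le_wt {y₀ : ℝ} (hy₀ : 0 < y₀) : ∃ C, 0 ≤ C ∧
    ∀ y, y₀ ≤ y → ∀ p : ℕ × ℤ, p.2 ≠ 0 → |besselDer p.2 ((p.1 + 1 : ℕ) / B) y| ≤
      √y * (C * (((p.1 + 1 : ℕ) : ℝ) * |(p.2 : ℝ)|) *
        Real.exp (-(π * y₀ / B * (((p.1 + 1 : ℕ) : ℝ) * |(p.2 : ℝ)|)))) := by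
  have hB : (0:ℝ) < B := by exact_mod_cast Nat.pos_of_ne_zero (NeZero.ne B)
  obtain ⟨C, hC, h⟩ := exists_abs_besselDer_le (l₀ := (B : ℝ)⁻¹) (by positivity) hy₀
  refine ⟨3 * C, by positivity, fun y hy p hp => ?_⟩
  have h2 : (1:ℝ) ≤ ((p.1 + 1 : ℕ) : ℝ) := by exact_mod_cast Nat.le_add_left 1 _
  have hl : (B : ℝ)⁻¹ ≤ ((p.1 + 1 : ℕ) : ℝ) / B := by
    rw [inv_eq_one_div]; gcongr
  refine (h _ _ y (int_one_le_abs hp) hl hy).trans ?_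
  have h3 := wt_bound (B := B) hp
  have h4 : π * y₀ / B * (((p.1 + 1 : ℕ) : ℝ) * |(p.2 : ℝ)|) ≤
      π * y * (((p.1 + 1 : ℕ) : ℝ) / B) * |(p.2 : ℝ)| := by
    calc _ = π * y₀ * (((p.1 + 1 : ℕ) : ℝ) / B) * |(p.2 : ℝ)| := by ring
      _ ≤ _ := by gcongr
  rw [show 3 * C * (((p.1 + 1 : ℕ) : ℝ) * |(p.2 : ℝ)|) =
    C * (3 * (((p.1 + 1 : ℕ) : ℝ) * |(p.2 : ℝ)|)) by ring]
  gcongr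

lemma exists_norm_derTerm_le (g : ZMod A → ZMod B → ℂ) {y₀ : ℝ} (hy₀ : 0 < y₀) :
    ∃ K c, 0 ≤ K ∧ 0 < c ∧ ∀ z : ℂ, y₀ ≤ z.im → ∀ p, ‖derTerm g p z‖ ≤ √z.im * (K * expWt c p) := by
  have hB : (0:ℝ) < B := by exact_mod_cast Nat.pos_of_ne_zero (NeZero.ne B)
  obtain ⟨G, hG, hg⟩ := exists_norm_ghat_le g
  obtain ⟨C, hC, h⟩ := exists_abs_besselDer_le_wt (B := B) hy₀
  obtain ⟨K, hK, hk⟩ := pow_mul_exp_le 1 (c := π * y₀ / B) (by positivity)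
  refine ⟨G * (C * K), π * y₀ / B / 2, by positivity, by positivity, fun z hz p => ?_⟩
  unfold derTerm expWt
  split_ifs with hp
  · simp
  · rw [norm_mul, norm_mul, norm_exp_two_pi, one_mul, Complex.norm_real, Real.norm_eq_abs]
    have h1 := h z.im hz p hp
    have h2 := hk (((p.1 + 1 : ℕ) : ℝ) * |(p.2 : ℝ)|) (by positivity)
    rw [pow_one] at h2
    calc _ ≤ G * (√z.im * (C * (((p.1 + 1 : ℕ) : ℝ) * |(p.2 : ℝ)|) *
        Real.exp (-(π * y₀ / B * (((p.1 + 1 : ℕ) : ℝ) * |(p.2 : ℝ)|))))) := by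
          gcongr; exact hg _ _
      _ ≤ G * (√z.im * (C * (K * Real.exp (-(π * y₀ / B / 2 *
          (((p.1 + 1 : ℕ) : ℝ) * |(p.2 : ℝ)|)))))) := by
          rw [mul_assoc C]; gcongr
      _ = _ := by ring

/-- The holomorphic derivative of `derTerm`. -/
def derTermD (g : ZMod A → ZMod B → ℂ) (p : ℕ × ℤ) (z : ℂ) : ℂ :=
  if p.2 = 0 then 0 else ghat g (p.1 + 1 : ℕ) p.2 * (Complex.I *
    Complex.exp (2 * π * Complex.I * (p.2 * ((p.1 + 1 : ℕ) / B * z.re : ℝ))) *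
    ((2 * π * p.2 * ((p.1 + 1 : ℕ) / B : ℝ) * besselDer p.2 ((p.1 + 1 : ℕ) / B) z.im +
      if (p.2 : ℝ) < 0 then z.im⁻¹ * Real.exp (-(2 * π * z.im * (((p.1 + 1 : ℕ) : ℝ) / B) *
        |(p.2 : ℝ)|)) else 0 : ℝ) : ℂ))

lemma hasWirt_exp_re (c : ℝ) (r : ℤ) (z : ℂ) :
    HasWirt (fun z : ℂ => Complex.exp (2 * π * Complex.I * (r * (c * z.re : ℝ))))
      (π * Complex.I * r * c * Complex.exp (2 * π * Complex.I * (r * (c * z.re : ℝ))))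
      (π * Complex.I * r * c * Complex.exp (2 * π * Complex.I * (r * (c * z.re : ℝ)))) z := by
  have h1 := HasDerivAt.hasWirt (hasDerivAt_id z)
  have h2 := ((h1.add h1.conj).const_mul (π * Complex.I * r * c))
  have h3 : HasDerivAt Complex.exp _ ((π * Complex.I * r * c) * (id z + conj (id z))) :=
    Complex.hasDerivAt_exp _
  have h4 := HasWirt.scomp (f := fun w : ℂ => (π * Complex.I * r * c) * (id w + conj (id w))) h3 h2
  have e : ∀ w : ℂ, (π * Complex.I * r * c) * (id w + conj (id w)) =
      2 * π * Complex.I * (r * (c * w.re : ℝ)) := by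
    intro w
    rw [id, Complex.add_conj]; push_cast; ring
  simp only [e] at h4
  refine h4.congr ?_ ?_ <;> simp <;> ring

/-- For e^{2πirlx}V(y) with V = `besselDer`, the differential equation makes V itself drop out of
∂/∂z̄. What remains is the inhomogeneous term, present for r < 0 only, where it is a conjugated
exponential divided by y. -/
lemma hasWirt_derTerm (g : ZMod A → ZMod B → ℂ) (p : ℕ × ℤ) {z : ℂ} (hz : 0 < z.im) :
    HasWirt (derTerm g p) (derTermD g p z)
      (-(Complex.I * (z.im : ℂ)⁻¹) * conj (negCoeff g (fun p => |(p.2 : ℝ)| ^ 0) p * qexp B p z)) z := by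
  have hB : (0:ℝ) < B := by exact_mod_cast Nat.pos_of_ne_zero (NeZero.ne B)
  have hl : (0:ℝ) < ((p.1 + 1 : ℕ) : ℝ) / B := by positivity
  by_cases h0 : p.2 = 0
  · have : derTerm g p = fun _ => 0 := by ext w; simp [derTerm, h0]
    rw [this]
    refine (hasWirt_const 0 z).congr ?_ ?_ <;> simp [derTermD, negCoeff, h0]
  have hr : (p.2 : ℝ) ≠ 0 := by exact_mod_cast h0
  have hV := hasWirt_comp_im (hasDerivAt_besselDer hr hl hz).ofReal_comp
  have hw := ((hasWirt_exp_re (((p.1 + 1 : ℕ) : ℝ) / B) p.2 z).mul hV).const_mul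
    (ghat g (p.1 + 1 : ℕ) p.2)
  have : derTerm g p = fun w => ghat g (p.1 + 1 : ℕ) p.2 *
    (Complex.exp (2 * π * Complex.I * (p.2 * ((p.1 + 1 : ℕ) / B * w.re : ℝ))) *
      besselDer p.2 ((p.1 + 1 : ℕ) / B) w.im) := by
    ext w; rw [derTerm, if_neg h0]
  rw [this]
  refine hw.congr ?_ ?_
  · rw [derTermD, if_neg h0]
    split_ifs <;> push_cast <;> ring
  · rw [negCoeff]
    rcases lt_or_gt_of_ne h0 with h | h
    · have hr' : (p.2 : ℝ) < 0 := by exact_mod_cast h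
      rw [if_pos h, if_pos hr', map_mul, map_mul, ← conj_qexp_of_neg h, Complex.conj_conj]
      push_cast
      simp
      ring
    · have hr' : ¬ (p.2 : ℝ) < 0 := by exact_mod_cast h.not_gt
      rw [if_neg h.not_gt, if_neg hr', zero_mul, map_zero, mul_zero]
      push_cast
      ring

/-- The bound for `besselDer` carries √y, so Im z is bounded above as well; local uniformity
suffices for termwise differentiation. -/
lemma exists_norm_derTermD_le (g : ZMod A → ZMod B → ℂ) {y₀ y₁ : ℝ} (hy₀ : 0 < y₀) :
    ∃ K c, 0 ≤ K ∧ 0 < c ∧ ∀ z : ℂ, y₀ ≤ z.im → z.im ≤ y₁ → ∀ p,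
      ‖derTermD g p z‖ ≤ K * expWt c p := by
  have hB : (0:ℝ) < B := by exact_mod_cast Nat.pos_of_ne_zero (NeZero.ne B)
  obtain ⟨G, hG, hg⟩ := exists_norm_ghat_le g
  obtain ⟨C, hC, h⟩ := exists_abs_besselDer_le_wt (B := B) hy₀
  -- The exponent 2: one factor (m+1)|r| comes from the bound for `besselDer`, another from the
  -- differentiation.
  obtain ⟨K, hK, hk⟩ := pow_mul_exp_le 2 (c := π * y₀ / B) (by positivity)
  refine ⟨G * ((2 * π / B * √y₁ * C + y₀⁻¹) * K), π * y₀ / B / 2, by positivity, by positivity,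
    fun z hz hz1 p => ?_⟩
  unfold derTermD expWt
  by_cases hp : p.2 = 0
  · simp [hp]
  rw [if_neg hp, if_neg hp, norm_mul, norm_mul, norm_mul, norm_exp_two_pi, Complex.norm_I, one_mul,
    one_mul, Complex.norm_real, Real.norm_eq_abs]
  have h1 := h z.im hz p hp
  have h2 := hk (((p.1 + 1 : ℕ) : ℝ) * |(p.2 : ℝ)|) (by positivity)
  have hw1 := one_le_wt hp
  have h5 : 2 * π * z.im * (((p.1 + 1 : ℕ) : ℝ) / B) * |(p.2 : ℝ)| =
      2 * π * z.im / B * (((p.1 + 1 : ℕ) : ℝ) * |(p.2 : ℝ)|) := by ring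
  have h6 : |2 * π * p.2 * (((p.1 + 1 : ℕ) : ℝ) / B) * besselDer p.2 ((p.1 + 1 : ℕ) / B) z.im| =
      2 * π / B * (((p.1 + 1 : ℕ) : ℝ) * |(p.2 : ℝ)|) *
        |besselDer p.2 ((p.1 + 1 : ℕ) / B) z.im| := by
    rw [abs_mul, abs_mul, abs_mul, abs_of_pos (by positivity : (0:ℝ) < 2 * π),
      abs_of_pos (by positivity : (0:ℝ) < ((p.1 + 1 : ℕ) : ℝ) / B)]
    ring
  rw [h5]
  set w := ((p.1 + 1 : ℕ) : ℝ) * |(p.2 : ℝ)| with hw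
  have hw0 : 0 ≤ w := by positivity
  have h7 : |if (p.2 : ℝ) < 0 then z.im⁻¹ * Real.exp (-(2 * π * z.im / B * w)) else 0| ≤
      y₀⁻¹ * (w ^ 2 * Real.exp (-(π * y₀ / B * w))) := by
    split_ifs
    · rw [abs_of_nonneg (mul_nonneg (inv_nonneg.2 (hy₀.le.trans hz)) (Real.exp_pos _).le)]
      have e1 : π * y₀ / B * w ≤ 2 * π * z.im / B * w := by
        gcongr ?_ / _ * _
        nlinarith [Real.pi_pos, mul_pos Real.pi_pos hy₀]
      have e2 : Real.exp (-(2 * π * z.im / B * w)) ≤ w ^ 2 * Real.exp (-(π * y₀ / B * w)) :=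
        (Real.exp_le_exp.2 (neg_le_neg e1)).trans
          (le_mul_of_one_le_left (Real.exp_pos _).le (one_le_pow₀ hw1))
      gcongr
    · simp only [abs_zero]; positivity
  calc _ ≤ G * (2 * π / B * w * (√y₁ * (C * w * Real.exp (-(π * y₀ / B * w)))) +
        y₀⁻¹ * (w ^ 2 * Real.exp (-(π * y₀ / B * w)))) := by
        refine mul_le_mul (hg _ _) ((abs_add_le _ _).trans (add_le_add ?_ h7)) (abs_nonneg _) hG
        rw [h6]
        refine mul_le_mul_of_nonneg_left (h1.trans ?_) (by positivity)
        gcongr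
    _ = G * ((2 * π / B * √y₁ * C + y₀⁻¹) * (w ^ 2 * Real.exp (-(π * y₀ / B * w)))) := by ring
    _ ≤ G * ((2 * π / B * √y₁ * C + y₀⁻¹) * (K * Real.exp (-(π * y₀ / B / 2 * w)))) := by
        gcongr
    _ = _ := by ring

lemma exists_hasWirt_sqrt_mul_deriv (g : ZMod A → ZMod B → ℂ) {z : ℂ} (hz : 0 < z.im) :
    ∃ a, HasWirt (fun w => ((√w.im : ℝ) : ℂ) * deriv (besselSum 1 g w) 1) a
      (-(Complex.I * (z.im : ℂ)⁻¹) * conj (qSeries B (negCoeff g fun p => |(p.2 : ℝ)| ^ 0) z)) z := by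
  obtain ⟨K, c, hK, hc, h⟩ := exists_norm_derTermD_le g (y₁ := 2 * z.im) (half_pos hz)
  obtain ⟨K', c', hK', hc', h'⟩ := (isPolyBdd_negCoeff g zero_le_one fun p _ =>
    abs_pow_le_wt p 0).exists_norm_le (B := B) (half_pos hz)
  set s : Set ℂ := Complex.im ⁻¹' Ioo (z.im / 2) (2 * z.im) with hs
  have hso : IsOpen s := isOpen_Ioo.preimage Complex.continuous_im
  have hsp : IsPreconnected s :=
    ((convex_Ioo (z.im / 2) (2 * z.im)).linear_preimage Complex.imLm).isPreconnected
  have hzs : z ∈ s := ⟨by linarith, by linarith⟩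
  have key := hasWirt_tsum (u := fun p => K * expWt c p + (z.im / 2)⁻¹ * (K' * expWt c' p))
    (((summable_expWt hc).mul_left K).add (((summable_expWt hc').mul_left K').mul_left _))
    hso hsp (fun p w hw => hasWirt_derTerm g p ((half_pos hz).trans hw.1)) (fun p w hw => by
      refine add_le_add (h w hw.1.le hw.2.le p) ?_
      rw [norm_mul, RCLike.norm_conj, norm_neg, norm_mul, Complex.norm_I, one_mul, norm_inv,
        Complex.norm_real, Real.norm_of_nonneg ((half_pos hz).trans hw.1).le]
      have := h' w hw.1.le p
      have h3 := hw.1.le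
      have h4 := half_pos hz
      gcongr) hzs (hasSum_derTerm g hz).summable hzs
  refine ⟨_, (key.congr rfl ?_).congr_of_eventuallyEq ?_⟩
  · rw [tsum_mul_left, qSeries, Complex.conj_tsum]
  · filter_upwards [isOpen_upperHalf.mem_nhds hz] with w hw
    exact (hasSum_derTerm g hw).tsum_eq.symm

lemma hasWirt_log_im {z : ℂ} (hz : 0 < z.im) :
    HasWirt (fun w : ℂ => (Real.log w.im : ℂ)) (-Complex.I / 2 * (z.im : ℂ)⁻¹)
      (Complex.I / 2 * (z.im : ℂ)⁻¹) z :=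
  (hasWirt_comp_im (Real.hasDerivAt_log hz.ne').ofReal_comp).congr (by simp) (by simp)

/-- The weight `1` form is real differentiable, with the expected antiholomorphic derivative. -/
lemma exists_hasWirt_deriv_latCont_one {g : ZMod A → ZMod B → ℂ} (hg : HasParity 1 g) {z : ℂ}
    (hz : 0 < z.im) : ∃ a b, HasWirt (fun w => deriv (latCont 1 g w) 1) a b z ∧
      2 * Complex.I * z.im * conj b = xiImage 1 g z := by
  obtain ⟨C₀, C₁, h⟩ := exists_deriv_latCont_one hg
  obtain ⟨a, ha⟩ := exists_hasWirt_sqrt_mul_deriv g hz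
  have hq := HasDerivAt.hasWirt ((isPolyBdd_posCoeff g (f := fun _ => 2) (n := 0) zero_le_two
    (by simp)).hasDerivAt (B := B) hz)
  -- In weight one ξ sends log y to 1, so the coefficient of log y accounts for both constant terms
  -- of the image.
  have hw := (((((hasWirt_log_im hz).const_mul (ZMod.LFunction (g 0) 1 +
    Complex.I * π / B * ZMod.LFunction (fun a => ghat g a 0) 0)).add (hasWirt_const C₀ z)).add
    (hq.const_mul C₁)).add (ha.const_mul (-(Complex.I * π / B)))).congr_of_eventuallyEq
    (g := fun w => deriv (latCont 1 g w) 1) (by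
      filter_upwards [isOpen_upperHalf.mem_nhds hz] with w hw
      rw [h w hw, sqrt_mul_besselSum_one g hw])
  refine ⟨_, _, hw, ?_⟩
  rw [xiImage]
  have hy : (z.im:ℂ) ≠ 0 := by exact_mod_cast hz.ne'
  have hB0 : (B:ℂ) ≠ 0 := by exact_mod_cast NeZero.ne B
  simp only [map_add, map_mul, map_div₀, Complex.conj_I, Complex.conj_ofReal, map_neg, map_inv₀,
    Complex.conj_natCast, Complex.conj_conj, map_ofNat, map_zero, tsub_self, if_true,
    Nat.factorial_zero, Nat.cast_one]
  field_simp
  ring_nf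
  simp only [Complex.I_sq, Complex.I_pow_three]
  ring

/-! ### Growth -/

lemma exists_norm_latCont_zero_le (g : ZMod A → ZMod B → ℂ) :
    ∃ C, ∀ z : ℂ, 1 ≤ z.im → ‖latCont 0 g z 1‖ ≤ C * Real.exp z.im := by
  obtain ⟨C₀, h⟩ := exists_latCont_zero_one g
  obtain ⟨K, hK⟩ := (isPolyBdd_posCoeff_invWt g).exists_norm_qSeries_le (B := B) one_pos
  obtain ⟨K', hK'⟩ := (isPolyBdd_negCoeff_invWt g).exists_norm_qSeries_le (B := B) one_pos
  refine ⟨‖ZMod.LFunction (g 0) 2‖ + ‖C₀‖ + ‖(π / B ^ 2 : ℂ)‖ * (K + K'), fun z hz => ?_⟩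
  have h1 : (1:ℝ) ≤ Real.exp z.im := Real.one_le_exp (by linarith)
  have h2 : z.im ≤ Real.exp z.im := by linarith [Real.add_one_le_exp z.im]
  have hK1 := hK z hz
  have hK2 := hK' z hz
  have hK0 : 0 ≤ K + K' := add_nonneg ((norm_nonneg _).trans hK1) ((norm_nonneg _).trans hK2)
  rw [h z (by linarith), add_mul, add_mul]
  refine (norm_add_le _ _).trans (add_le_add ((norm_add_le _ _).trans (add_le_add ?_ ?_)) ?_)
  · rw [norm_mul, Complex.norm_real, Real.norm_of_nonneg (by linarith)]
    gcongr
  · exact le_mul_of_one_le_right (norm_nonneg _) h1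
  · rw [norm_mul]
    refine le_trans ?_ (le_mul_of_one_le_right (by positivity) h1)
    refine mul_le_mul_of_nonneg_left ((norm_add_le _ _).trans ?_) (norm_nonneg _)
    rw [RCLike.norm_conj]
    exact add_le_add hK1 hK2

lemma exists_norm_deriv_latCont_one_le {g : ZMod A → ZMod B → ℂ} (hg : HasParity 1 g) :
    ∃ C, ∀ z : ℂ, 1 ≤ z.im → ‖deriv (latCont 1 g z) 1‖ ≤ C * Real.exp z.im := by
  obtain ⟨C₀, C₁, h⟩ := exists_deriv_latCont_one hg
  obtain ⟨K, hK⟩ := (isPolyBdd_posCoeff g (f := fun _ => 2) (n := 0) zero_le_two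
    (by simp)).exists_norm_qSeries_le (B := B) one_pos
  obtain ⟨K', c, hK'0, hc, hK'⟩ := exists_norm_derTerm_le g one_pos
  set S := ∑' p, K' * expWt c p with hS
  have hS0 : 0 ≤ S := tsum_nonneg fun p => mul_nonneg hK'0 (expWt_nonneg _ _)
  refine ⟨‖ZMod.LFunction (g 0) 1 + Complex.I * π / B * ZMod.LFunction (fun a => ghat g a 0) 0‖ +
    ‖C₀‖ + ‖C₁‖ * K + ‖-(Complex.I * π / B)‖ * S, fun z hz => ?_⟩
  have hz0 : 0 < z.im := by linarith
  have h1 : (1:ℝ) ≤ Real.exp z.im := Real.one_le_exp (by linarith)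
  have h2 : z.im ≤ Real.exp z.im := by linarith [Real.add_one_le_exp z.im]
  have hK1 := hK z hz
  have hK0 : 0 ≤ K := (norm_nonneg _).trans hK1
  have hD : ‖((√z.im : ℝ) : ℂ) * deriv (besselSum 1 g z) 1‖ ≤ √z.im * S := by
    rw [← (hasSum_derTerm g hz0).tsum_eq]
    exact tsum_of_norm_bounded (((summable_expWt hc).mul_left K').hasSum.mul_left _)
      (hK' z hz)
  have hsq : √z.im ≤ z.im := by
    rw [Real.sqrt_le_left hz0.le]; nlinarith
  rw [h z hz0, sqrt_mul_besselSum_one g hz0]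
  generalize ZMod.LFunction (g 0) 1 + Complex.I * π / B * ZMod.LFunction (fun a => ghat g a 0) 0 = D
  rw [add_mul, add_mul, add_mul]
  refine (norm_add_le _ _).trans (add_le_add ((norm_add_le _ _).trans (add_le_add
    ((norm_add_le _ _).trans (add_le_add ?_ ?_)) ?_)) ?_)
  · rw [norm_mul, Complex.norm_real, Real.norm_of_nonneg (Real.log_nonneg hz)]
    have := Real.log_le_sub_one_of_pos hz0
    gcongr
    linarith
  · exact le_mul_of_one_le_right (norm_nonneg _) h1
  · rw [norm_mul]
    refine le_trans ?_ (le_mul_of_one_le_right (by positivity) h1)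
    gcongr
  · rw [norm_mul, mul_assoc]
    refine mul_le_mul_of_nonneg_left (hD.trans ?_) (norm_nonneg _)
    rw [mul_comm]
    gcongr
    exact hsq.trans h2

end Expansion

/-! ### Holomorphic Eisenstein series of weight at least three. -/

lemma LFunction_conj {N : ℕ} [NeZero N] (Φ : ZMod N → ℂ) {s : ℂ}
    (hs : s ≠ 1 ∨ ∑ j, Φ j = 0) :
    ZMod.LFunction (fun j => conj (Φ j)) s = conj (ZMod.LFunction Φ (conj s)) := by
  have key : ∀ U : Set ℂ, IsOpen U → IsPreconnected U → 2 ∈ U → s ∈ U →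
      (∀ w ∈ U, w ≠ 1 ∨ ∑ j, Φ j = 0) →
      ZMod.LFunction (fun j => conj (Φ j)) s = conj (ZMod.LFunction Φ (conj s)) := by
    intro U hU hUp h2 hsU hw
    have h1 : AnalyticOnNhd ℂ (ZMod.LFunction fun j => conj (Φ j)) U := by
      refine DifferentiableOn.analyticOnNhd (fun w hwU => ?_) hU
      refine (ZMod.differentiableAt_LFunction _ w ((hw w hwU).imp_right fun h => ?_)).differentiableWithinAt
      rw [← map_sum, h, map_zero]
    have h3 : AnalyticOnNhd ℂ (conj ∘ ZMod.LFunction Φ ∘ conj) U := by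
      refine DifferentiableOn.analyticOnNhd (fun w hwU => ?_) hU
      refine (differentiableAt_conj_conj_iff.2 (ZMod.differentiableAt_LFunction _ _
        ((hw w hwU).imp_left fun h h' => h ?_))).differentiableWithinAt
      simpa using congrArg conj h'
    -- Identity theorem from the Dirichlet series near 2; U is the plane without 1, or the whole
    -- plane when the residue vanishes.
    refine h1.eqOn_of_preconnected_of_eventuallyEq h3 hUp h2 ?_ hsU
    filter_upwards [(isOpen_lt continuous_const Complex.continuous_re).mem_nhds
      (show (1:ℝ) < (2:ℂ).re by norm_num)] with w hw
    have hw' : 1 < w.re := hw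
    simp only [Function.comp_apply]
    rw [ZMod.LFunction_eq_LSeries _ hw', ZMod.LFunction_eq_LSeries _ (by simpa using hw'), LSeries,
      LSeries, Complex.conj_tsum]
    refine tsum_congr fun n => ?_
    rcases eq_or_ne n 0 with rfl | hn
    · simp
    · rw [LSeries.term_of_ne_zero hn, LSeries.term_of_ne_zero hn, map_div₀,
        Complex.cpow_conj _ _ (by rw [Complex.natCast_arg]; exact Real.pi_ne_zero.symm),
        Complex.conj_natCast, Complex.conj_conj]
  rcases hs with hs | hs
  · exact key {1}ᶜ isOpen_compl_singleton
      (isConnected_compl_singleton_of_one_lt_rank (by simp) _).isPreconnected (by simp) hs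
      fun w hw => Or.inl hw
  · exact key univ isOpen_univ isPreconnected_univ (mem_univ _) (mem_univ _) fun w _ => Or.inr hs

section Expansion

variable {A B : ℕ} [NeZero A] [NeZero B]

/-- At σ = k the absolute value disappears, conj(w)^k |w|^{-2k} = w^{-k}, so the lattice sum there
is the classical holomorphic series. -/
lemma latTerm_self {A B : ℕ} (k : ℕ) (h : ZMod A → ZMod B → ℂ) {z : ℂ} (hz : 0 < z.im) {p : ℤ × ℤ}
    (hp : p ≠ 0) : latTerm k h z k p = h p.1 p.2 * (((p.1 : ℂ) * z + p.2) ^ k)⁻¹ := by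
  have hw := lattice_ne_zero hz hp
  rw [latTerm]
  generalize (p.1 : ℂ) * z + p.2 = w at *
  congr 1
  have hc := (map_ne_zero (starRingEnd ℂ)).2 hw
  rw [show -2 * (k : ℂ) = ((-((2 * k : ℕ) : ℤ) : ℤ) : ℂ) by push_cast; ring,
    Complex.cpow_intCast, zpow_neg, zpow_natCast, pow_mul, ← Complex.ofReal_pow,
    ← Complex.normSq_eq_norm_sq, ← Complex.mul_conj, mul_pow]
  field_simp

/-- The Fourier expansion of a row of the holomorphic Eisenstein series, from the Lipschitz
formula. -/
lemma tsum_latTerm_row (g : ZMod A → ZMod B → ℂ) {k : ℕ} (hk : 2 < k) {z : ℂ} (hz : 0 < z.im)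
    (m : ℕ) : ∑' n : ℤ, latTerm k (fun a b => conj (g a b)) z k ((m + 1 : ℕ), n) =
      (-(2 * π * Complex.I / B)) ^ k / ((k - 1).factorial : ℂ) *
        ∑' r : ℤ, negCoeff g (fun p => |(p.2 : ℝ)| ^ (k - 1)) (m, r) * qexp B (m, r) z := by
  obtain ⟨k, rfl⟩ : ∃ j, k = j + 1 := ⟨k - 1, by omega⟩
  have hB : (0:ℝ) < B := by exact_mod_cast Nat.pos_of_ne_zero (NeZero.ne B)
  have hB0 : (B:ℂ) ≠ 0 := by exact_mod_cast NeZero.ne B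
  have hs : Summable fun n : ℤ =>
      latTerm (k + 1) (fun a b => conj (g a b)) z ((k + 1 : ℕ) : ℂ) ((m + 1 : ℕ), n) :=
    (summable_latTerm (k + 1) (fun a b => conj (g a b)) hz (by
      have : (2:ℝ) < ((k + 1 : ℕ) : ℝ) := by exact_mod_cast hk
      simp at this ⊢
      linarith)).prod_factor (((m + 1 : ℕ)) : ℤ)
  have hterm : ∀ n : ℤ, latTerm (k + 1) (fun a b => conj (g a b)) z ((k + 1 : ℕ) : ℂ)
      ((m + 1 : ℕ), n) = conj (g (m + 1 : ℕ) n) * (((m + 1 : ℕ) * z + n) ^ (k + 1))⁻¹ := by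
    intro n
    rw [latTerm_self _ _ hz]
    · simp only [Int.cast_natCast]
    · intro h
      have := congrArg Prod.fst h
      simp at this
      omega
  rw [sum_by_residue (B := B) hs]
  have him : ∀ b : ZMod B, 0 < (((m + 1 : ℕ) * z + b.val) / B : ℂ).im := by
    intro b
    have : (((m + 1 : ℕ) * z + b.val) / B : ℂ).im = ((m + 1 : ℕ) : ℝ) * z.im / B := by
      rw [Complex.div_natCast_im, Complex.add_im, ← Complex.ofReal_natCast, Complex.im_ofReal_mul,
        Complex.natCast_im, add_zero]
    rw [this]
    have : (0:ℝ) < ((m + 1 : ℕ) : ℝ) := by positivity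
    positivity
  have hrow : ∀ b : ZMod B, ∑' j : ℤ, latTerm (k + 1) (fun a b => conj (g a b)) z
      ((k + 1 : ℕ) : ℂ) ((m + 1 : ℕ), b.val + B * j) =
      (-(2 * π * Complex.I / B)) ^ (k + 1) / (k.factorial : ℂ) * ∑' r : ℕ,
        conj (g (m + 1 : ℕ) b) * ((r : ℂ) ^ k *
          Complex.exp (2 * π * Complex.I * (((m + 1 : ℕ) * z + b.val) / B)) ^ r) := by
    intro b
    -- The Lipschitz formula at the point ((m+1)z + b)/B, one application for each residue b.
    have hL := EisensteinSeries.qExpansion_identity (k := k) (by omega) ⟨_, him b⟩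
    dsimp only at hL
    rw [tsum_mul_left]
    have e : (-(2 * π * Complex.I / B)) ^ (k + 1) / (k.factorial : ℂ) =
        ((B : ℂ) ^ (k + 1))⁻¹ * ((-2 * π * Complex.I) ^ (k + 1) / (k.factorial : ℂ)) := by
      rw [← neg_div, div_pow]
      ring
    rw [e, mul_left_comm, mul_assoc ((B : ℂ) ^ (k + 1))⁻¹, ← hL, ← tsum_mul_left, ← tsum_mul_left]
    refine tsum_congr fun j => ?_
    have : ((b.val + B * j : ℤ) : ZMod B) = b := by simp
    rw [hterm, this]
    congr 1
    rw [one_div, ← mul_inv, ← mul_pow]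
    congr 2
    generalize b.val = v
    push_cast
    field_simp
    ring
  rw [Finset.sum_congr rfl fun b _ => hrow b, ← Finset.mul_sum, Nat.add_sub_cancel]
  congr 1
  rw [← Summable.tsum_finsetSum fun b _ => ?_]
  -- The exponent r of the Lipschitz formula corresponds to the frequency -r; the term r = 0
  -- vanishes because r is raised to a positive power.
  · have hinj : Function.Injective fun r : ℕ => -(r : ℤ) := fun a b h => by simpa using h
    rw [← hinj.tsum_eq]
    · refine tsum_congr fun r => ?_
      rcases Nat.eq_zero_or_pos r with rfl | hr
      · have hk0 : k ≠ 0 := by omega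
        simp [negCoeff, hk0]
      · rw [negCoeff, if_pos (by simpa using hr), ghat, map_sum, Finset.mul_sum, Finset.sum_mul]
        refine Finset.sum_congr rfl fun b _ => ?_
        have e1 : b * ((-(r : ℤ) : ℤ) : ZMod B) = ((-(b.val * r : ℤ) : ℤ) : ZMod B) := by simp
        have e2 : freq B (m, -(r : ℤ)) = ((m + 1 : ℕ) : ℝ) / B * r := by simp [freq]
        rw [e1, ZMod.stdAddChar_coe, map_mul, ← Complex.exp_conj, qexp, e2, ← Complex.exp_nat_mul]
        have e3 : ((|((-(r:ℤ) : ℤ) : ℝ)| ^ k : ℝ) : ℂ) = (r : ℂ) ^ k := by simp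
        rw [e3]
        generalize b.val = v
        have e4 : Complex.exp (r * (2 * π * Complex.I * (((m + 1 : ℕ) * z + v) / B))) =
            Complex.exp (conj (2 * π * Complex.I * ((-(v * r : ℤ) : ℤ) : ℂ) / B)) *
            Complex.exp (2 * π * Complex.I * ((((m + 1 : ℕ) : ℝ) / B * r : ℝ) : ℂ) * z) := by
          rw [← Complex.exp_add]
          congr 1
          simp only [map_div₀, map_mul, Complex.conj_I, Complex.conj_ofReal, map_ofNat,
            Complex.conj_natCast, map_intCast]
          push_cast
          field_simp
          ring
        rw [e4]
        ring
    · intro r hr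
      rw [Function.mem_support] at hr
      by_contra h
      apply hr
      have : ¬ r < 0 := by
        intro h0
        exact h ⟨r.natAbs, by simp [abs_of_neg h0]⟩
      simp [negCoeff, this]
  · refine Summable.mul_left _ ?_
    have h1 := UpperHalfPlane.norm_exp_two_pi_I_lt_one ⟨_, him b⟩
    exact (summable_norm_pow_mul_geometric_of_norm_lt_one k h1).of_norm

lemma HasParity.conj {k : ℕ} {g : ZMod A → ZMod B → ℂ} (hg : HasParity k g) :
    HasParity k fun a b => conj (g a b) := by
  intro a b
  simp [hg a b]

/-- The Fourier expansion of the holomorphic Eisenstein series of weight at least `3`. -/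
lemma latSum_conj_eq_xiImage {k : ℕ} (hk : 2 < k) {g : ZMod A → ZMod B → ℂ} (hg : HasParity k g)
    {z : ℂ} (hz : 0 < z.im) :
    latSum k (fun a b => conj (g a b)) z k = xiImage k g z := by
  have hkr : (2:ℝ) < k := by exact_mod_cast hk
  have hkr' : 2 + (k:ℝ) < 2 * (k:ℂ).re := by
    rw [Complex.natCast_re]; linarith
  have hrows := (latSum_eq_rows hg.conj hz hkr').2
  rw [hrows, xiImage, if_neg (by omega), add_zero]
  congr 1
  · rw [show (2 * (k:ℂ) - k) = k by ring, LFunction_conj (g 0), Complex.conj_natCast]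
    left
    exact_mod_cast (by omega : k ≠ 1)
  · rw [tsum_congr (tsum_latTerm_row g hk hz), tsum_mul_left, qSeries]
    congr 1
    exact (((isPolyBdd_negCoeff g zero_le_one fun p _ => abs_pow_le_wt p (k - 1)).summable
      (B := B) hz).tsum_prod).symm

end Expansion

/-! ### Negative weights: absolutely convergent non-holomorphic series. -/

/-- The lattice sums `∑ |mz+n|^{-k}` are bounded on `Im z ≥ 1`. -/
lemma exists_tsum_norm_lattice_le {k : ℝ} (hk : 2 < k) : ∃ C, ∀ z : ℂ, 1 ≤ z.im →
    ∑' p : ℤ × ℤ, ‖(p.1 : ℂ) * z + p.2‖ ^ (-k) ≤ C := by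
  set r₀ := EisensteinSeries.r ⟨⟨1, 1⟩, one_pos⟩ ^ (-k)
  have hs := (EisensteinSeries.summable_one_div_norm_rpow hk).mul_left r₀
  have hs' := (finTwoArrowEquiv ℤ).symm.summable_iff.2 hs
  refine ⟨∑' p : ℤ × ℤ, r₀ * ‖(finTwoArrowEquiv ℤ).symm p‖ ^ (-k), fun z hz => ?_⟩
  -- A shear of the lattice moves the real part into [0,1), where a bound uniform on vertical strips
  -- is available.
  set w : ℂ := z - (⌊z.re⌋ : ℤ) with hw
  have hwi : w.im = z.im := by simp [hw]
  have hwr : w.re = Int.fract z.re := by simp [hw]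
  let e : ℤ × ℤ ≃ ℤ × ℤ :=
    { toFun := fun p => (p.1, p.2 - p.1 * ⌊z.re⌋)
      invFun := fun p => (p.1, p.2 + p.1 * ⌊z.re⌋)
      left_inv := fun p => by simp
      right_inv := fun p => by simp }
  have h1 : ∀ p : ℤ × ℤ, ‖(((e p).1 : ℤ) : ℂ) * z + ((e p).2 : ℤ)‖ ^ (-k) =
      ‖(p.1 : ℂ) * w + p.2‖ ^ (-k) := by
    intro p
    congr 2
    simp only [e, Equiv.coe_fn_mk, hw]
    push_cast
    ring
  rw [← e.tsum_eq, tsum_congr h1]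
  refine Summable.tsum_le_tsum (fun p => ?_) (summable_norm_lattice (by rw [hwi]; linarith) hk) hs'
  have h2 := EisensteinSeries.summand_bound_of_mem_verticalStrip
    (z := (⟨w, by rw [hwi]; linarith⟩ : ℍ)) (k := k) (by linarith) ((finTwoArrowEquiv ℤ).symm p)
    (A := 1) (B := 1) one_pos (by
      rw [UpperHalfPlane.mem_verticalStrip_iff]
      constructor
      · change |w.re| ≤ 1
        rw [hwr, abs_of_nonneg (Int.fract_nonneg _)]
        exact (Int.fract_lt_one _).le
      · change 1 ≤ w.im
        rwa [hwi])
  simpa [finTwoArrowEquiv] using h2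

section Expansion

variable {A B : ℕ} [NeZero A] [NeZero B]

/-- The terms of the non-holomorphic Eisenstein series of weight `-n`. -/
def negTerm (n : ℕ) (g : ZMod A → ZMod B → ℂ) (p : ℤ × ℤ) (z : ℂ) : ℂ :=
  (z.im : ℂ) ^ (n + 1) *
    (g p.1 p.2 * (conj ((p.1 : ℂ) * z + p.2) ^ (n + 1) * ((p.1 : ℂ) * z + p.2))⁻¹)

lemma negTerm_eq {n : ℕ} (g : ZMod A → ZMod B → ℂ) (p : ℤ × ℤ) {z : ℂ} (hz : 0 < z.im) :
    negTerm n g p z = (z.im : ℂ) ^ (n + 1) *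
      conj (latTerm n (fun a b => conj (g a b)) z (n + 1) p) := by
  rw [negTerm, latTerm]
  congr 1
  simp only [map_mul, map_pow, Complex.conj_conj]
  congr 1
  by_cases hp : p = 0
  · have : -2 * ((n:ℂ) + 1) ≠ 0 := by
      have : (n:ℂ) + 1 ≠ 0 := by exact_mod_cast n.succ_ne_zero
      simpa using this
    simp only [hp, Prod.fst_zero, Prod.snd_zero, Int.cast_zero, zero_mul, add_zero, map_zero,
      norm_zero, Complex.ofReal_zero, Complex.zero_cpow this, mul_zero, inv_zero]
  · have hw := lattice_ne_zero hz hp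
    generalize (p.1 : ℂ) * z + p.2 = w at *
    have hc := (map_ne_zero (starRingEnd ℂ)).2 hw
    rw [show -2 * ((n : ℂ) + 1) = ((-((2 * (n + 1) : ℕ) : ℤ) : ℤ) : ℂ) by push_cast; ring,
      Complex.cpow_intCast, zpow_neg, zpow_natCast, pow_mul, ← Complex.ofReal_pow,
      ← Complex.normSq_eq_norm_sq, ← Complex.mul_conj, mul_pow, map_inv₀, map_mul, map_pow,
      map_pow, Complex.conj_conj]
    field_simp
    ring

/-- With w = mz + n', the product rule for ∂/∂z̄ produces the numerator (i/2)conj(w) - my, which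
equals (i/2)w because conj(w) = w - 2imy. The factor w cancels and a pure power of conj(w) is left.
-/
lemma hasWirt_negTerm (n : ℕ) (g : ZMod A → ZMod B → ℂ) (p : ℤ × ℤ) {z : ℂ} (hz : 0 < z.im) :
    HasWirt (negTerm n g p)
      (g p.1 p.2 * (-(Complex.I / 2) * (n + 1) * (z.im : ℂ) ^ n *
        (conj ((p.1 : ℂ) * z + p.2) ^ (n + 1) * ((p.1 : ℂ) * z + p.2))⁻¹ -
        p.1 * (z.im : ℂ) ^ (n + 1) *
          (conj ((p.1 : ℂ) * z + p.2) ^ (n + 1) * ((p.1 : ℂ) * z + p.2) ^ 2)⁻¹))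
      (Complex.I / 2 * (n + 1) * (z.im : ℂ) ^ n *
        (g p.1 p.2 * (conj ((p.1 : ℂ) * z + p.2) ^ (n + 2))⁻¹)) z := by
  by_cases hp : p = 0
  · subst hp
    have : negTerm n g 0 = fun _ => 0 := by
      ext w; simp [negTerm]
    rw [this]
    refine (hasWirt_const 0 z).congr ?_ ?_ <;> simp
  have hw := lattice_ne_zero hz hp
  have hc := (map_ne_zero (starRingEnd ℂ)).2 hw
  have h1 : HasDerivAt (fun w : ℂ => (p.1 : ℂ) * w + p.2) p.1 z := by
    simpa using ((hasDerivAt_id z).const_mul (p.1 : ℂ)).add_const (p.2 : ℂ)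
  have h1w := HasDerivAt.hasWirt h1
  have h2 := (HasWirt.scomp (hasDerivAt_pow (n + 1) _) h1w.conj).mul h1w
  have h3 := HasWirt.scomp (h := fun u => u⁻¹)
    (f := fun w : ℂ => conj ((p.1 : ℂ) * w + p.2) ^ (n + 1) * ((p.1 : ℂ) * w + p.2)) (hasDerivAt_inv (mul_ne_zero (pow_ne_zero (n + 1) hc) hw)) h2
  have h4 := (HasWirt.scomp (hasDerivAt_pow (n + 1) _) (hasWirt_im z)).mul
    (h3.const_mul (g p.1 p.2))
  have hy : conj ((p.1 : ℂ) * z + p.2) = ((p.1 : ℂ) * z + p.2) - 2 * Complex.I * p.1 * z.im := by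
    simp only [map_add, map_mul, map_intCast]
    have := Complex.sub_conj z
    push_cast at this
    linear_combination (-(p.1:ℂ)) * this
  refine h4.congr ?_ ?_
  · simp only [map_zero, Nat.add_sub_cancel]
    generalize (p.1 : ℂ) * z + p.2 = w at *
    push_cast
    field_simp
    ring
  · simp only [map_intCast, Nat.add_sub_cancel]
    generalize (p.1 : ℂ) * z + p.2 = w at *
    have hI : (p.1 : ℂ) * z.im * 2 * Complex.I = w - conj w := by
      rw [hy]; ring
    generalize conj w = c at *
    push_cast
    rw [pow_succ (z.im : ℂ) n]
    field_simp
    linear_combination ((z.im : ℂ) ^ n * g p.1 p.2 * (n + 1) * w * c ^ (2 * n + 2)) *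
      (Complex.I * hI - 2 * p.1 * z.im * Complex.I_sq)

lemma abs_mul_im_le_norm_lattice (p : ℤ × ℤ) (z : ℂ) :
    |(p.1 : ℝ) * z.im| ≤ ‖(p.1 : ℂ) * z + p.2‖ := by
  have := Complex.abs_im_le_norm ((p.1 : ℂ) * z + p.2)
  simpa using this

/-- Termwise differentiation on a rectangle around z. By |m|y ≤ |w| both derivatives are
O(|w|^{-(n+2)}), with n + 2 > 2; the constant n + 2 of the majorant is (n+1)/2 + 1 from ∂_z plus
(n+1)/2 from ∂_z̄. -/
lemma exists_hasWirt_latSum {n : ℕ} (hn : 0 < n) (g : ZMod A → ZMod B → ℂ) {z : ℂ}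
    (hz : 0 < z.im) : ∃ a b, HasWirt (fun w => ((n : ℂ) + 1)⁻¹ * (w.im : ℂ) ^ (n + 1) *
        conj (latSum n (fun a b => conj (g a b)) w (n + 1))) a b z ∧
      2 * Complex.I * ((z.im : ℂ) ^ n)⁻¹ * conj b =
        latSum (n + 2) (fun a b => conj (g a b)) z ((n + 2 : ℕ) : ℂ) := by
  obtain ⟨G, hG, hg⟩ := exists_norm_le_coeff g
  have hn' : (0:ℝ) < n := by exact_mod_cast hn
  have hk : (2:ℝ) < ((n + 2 : ℕ) : ℝ) := by push_cast; linarith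
  set X := |z.re| + 1 with hX
  set s : Set ℂ := Complex.re ⁻¹' Ioo (-X) X ∩ Complex.im ⁻¹' Ioo (z.im / 2) (2 * z.im) with hs
  have hso : IsOpen s := (isOpen_Ioo.preimage Complex.continuous_re).inter
    (isOpen_Ioo.preimage Complex.continuous_im)
  have hsp : IsPreconnected s := (((convex_Ioo (-X) X).linear_preimage Complex.reLm).inter
    ((convex_Ioo (z.im / 2) (2 * z.im)).linear_preimage Complex.imLm)).isPreconnected
  have hzs : z ∈ s := ⟨⟨by linarith [neg_abs_le z.re], by linarith [le_abs_self z.re]⟩,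
    by linarith, by linarith⟩
  set r₀ := EisensteinSeries.r ⟨⟨X, z.im / 2⟩, half_pos hz⟩ ^ (-((n + 2 : ℕ) : ℝ)) with hr₀
  have hu := (finTwoArrowEquiv ℤ).symm.summable_iff.2
    (((EisensteinSeries.summable_one_div_norm_rpow hk).mul_left r₀).mul_left
      (G * ((n + 2) * (2 * z.im) ^ n)))
  have hbd : ∀ (p : ℤ × ℤ), ∀ w ∈ s, ‖(((p.1 : ℂ) * w + p.2) ^ (n + 2))⁻¹‖ ≤
      r₀ * ‖(finTwoArrowEquiv ℤ).symm p‖ ^ (-((n + 2 : ℕ) : ℝ)) := by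
    intro p w hw
    have h2 := EisensteinSeries.summand_bound_of_mem_verticalStrip
      (z := (⟨w, (half_pos hz).trans hw.2.1⟩ : ℍ)) (k := ((n + 2 : ℕ) : ℝ)) (by positivity)
      ((finTwoArrowEquiv ℤ).symm p) (A := X) (B := z.im / 2) (half_pos hz) (by
        rw [UpperHalfPlane.mem_verticalStrip_iff]
        exact ⟨(abs_lt.2 hw.1).le, hw.2.1.le⟩)
    rw [norm_inv, norm_pow, ← Real.rpow_natCast, ← Real.rpow_neg (norm_nonneg _)]
    rw [← hr₀] at h2
    simpa [finTwoArrowEquiv] using h2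
  have hsum : Summable fun p => negTerm n g p z := by
    have h := (summable_latTerm n (fun a b => conj (g a b)) hz (σ := (n : ℂ) + 1) (by
      simp; linarith))
    have h2 := ((Complex.summable_conj.2 h).mul_left ((z.im : ℂ) ^ (n + 1)))
    exact h2.congr fun p => (negTerm_eq g p hz).symm
  have key := (hasWirt_tsum hu hso hsp
    (fun p w hw => hasWirt_negTerm n g p ((half_pos hz).trans hw.2.1)) (fun p w hw => ?_)
    hzs hsum hzs).const_mul (((n : ℂ) + 1)⁻¹ * (1 / 2))
  · refine ⟨_, _, key.congr_of_eventuallyEq ?_, ?_⟩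
    · filter_upwards [isOpen_upperHalf.mem_nhds hz] with w hw
      rw [tsum_congr fun p => negTerm_eq g p hw, tsum_mul_left, ← Complex.conj_tsum, latSum]
      simp only [map_mul, map_div₀, map_one, map_ofNat]
      ring
    · have hy : (z.im : ℂ) ≠ 0 := by exact_mod_cast hz.ne'
      have hn0 : (n : ℂ) + 1 ≠ 0 := by exact_mod_cast n.succ_ne_zero
      rw [tsum_mul_left, latSum]
      have e : ∑' p, latTerm (n + 2) (fun a b => conj (g a b)) z ((n + 2 : ℕ) : ℂ) p =
          conj (∑' p : ℤ × ℤ, g p.1 p.2 * (conj ((p.1 : ℂ) * z + p.2) ^ (n + 2))⁻¹) := by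
        rw [Complex.conj_tsum]
        refine tsum_congr fun p => ?_
        by_cases hp : p = 0
        · simp [hp, latTerm]
        · rw [latTerm_self _ _ hz hp]
          simp
      rw [e]
      generalize ∑' p : ℤ × ℤ, g p.1 p.2 * (conj ((p.1 : ℂ) * z + p.2) ^ (n + 2))⁻¹ = S
      simp only [map_mul, map_inv₀, map_div₀, map_add, map_one, Complex.conj_natCast,
        Complex.conj_I, map_ofNat, map_pow, Complex.conj_ofReal]
      field_simp
      simp only [Complex.I_sq]
      ring
  · have hw0 : 0 < w.im := (half_pos hz).trans hw.2.1
    have h1 := hbd p w hw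
    have h2 := abs_mul_im_le_norm_lattice p w
    have h3 := hg p.1 p.2
    have h4 : w.im ≤ 2 * z.im := hw.2.2.le
    by_cases hp : p = 0
    · subst hp
      refine le_trans (le_of_eq (by simp)) (mul_nonneg (mul_nonneg hG (by positivity))
        ((norm_nonneg _).trans h1))
    have hwn := norm_pos_iff.2 (lattice_ne_zero hw0 hp)
    simp only [Function.comp_apply]
    refine le_trans ?_ (mul_le_mul_of_nonneg_left h1 (by positivity))
    rw [abs_mul, abs_of_pos hw0] at h2
    set N := ‖(p.1 : ℂ) * w + p.2‖ with hN
    have ha : ‖g p.1 p.2 * (-(Complex.I / 2) * (n + 1) * (w.im : ℂ) ^ n *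
        (conj ((p.1 : ℂ) * w + p.2) ^ (n + 1) * ((p.1 : ℂ) * w + p.2))⁻¹ -
        p.1 * (w.im : ℂ) ^ (n + 1) *
          (conj ((p.1 : ℂ) * w + p.2) ^ (n + 1) * ((p.1 : ℂ) * w + p.2) ^ 2)⁻¹)‖ ≤
        G * ((1 / 2 * (n + 1) + 1) * w.im ^ n * (N ^ (n + 2))⁻¹) := by
      rw [norm_mul]
      refine mul_le_mul h3 ((norm_sub_le _ _).trans ?_) (norm_nonneg _) hG
      have e1 : ‖(n:ℂ) + 1‖ = n + 1 := by exact_mod_cast Complex.norm_natCast (n + 1)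
      simp only [norm_mul, norm_inv, norm_pow, RCLike.norm_conj, norm_neg, norm_div, Complex.norm_I,
        Complex.norm_real, Real.norm_of_nonneg hw0.le, e1, ← hN, Complex.norm_intCast,
        RCLike.norm_ofNat]
      have e2 : |(p.1 : ℝ)| * w.im ^ (n + 1) * (N ^ (n + 1) * N ^ 2)⁻¹ ≤
          w.im ^ n * (N ^ (n + 2))⁻¹ := by
        calc _ = |(p.1 : ℝ)| * w.im * (w.im ^ n * (N ^ (n + 1) * N ^ 2)⁻¹) := by ring
          _ ≤ N * (w.im ^ n * (N ^ (n + 1) * N ^ 2)⁻¹) := by gcongr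
          _ = _ := by field_simp; ring
      refine (add_le_add_right e2 _).trans (le_of_eq ?_)
      field_simp
      ring
    have hb : ‖Complex.I / 2 * (n + 1) * (w.im : ℂ) ^ n *
        (g p.1 p.2 * (conj ((p.1 : ℂ) * w + p.2) ^ (n + 2))⁻¹)‖ ≤
        G * (1 / 2 * (n + 1) * w.im ^ n * (N ^ (n + 2))⁻¹) := by
      have e1 : ‖(n:ℂ) + 1‖ = n + 1 := by exact_mod_cast Complex.norm_natCast (n + 1)
      simp only [norm_mul, norm_inv, norm_pow, RCLike.norm_conj, norm_div, Complex.norm_I,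
        Complex.norm_real, Real.norm_of_nonneg hw0.le, e1, ← hN, RCLike.norm_ofNat]
      rw [mul_left_comm]
      gcongr
    refine (add_le_add ha hb).trans ?_
    rw [norm_inv, norm_pow, ← hN]
    calc _ = G * ((n + 2) * w.im ^ n) * (N ^ (n + 2))⁻¹ := by ring
      _ ≤ _ := by gcongr

/-! ### The forms of weight 2 - k attached to periodic coefficients, for all k at once. -/

/-- The non-holomorphic Eisenstein series attached to periodic coefficients, in weight `2 - k`. -/
def preForm (k : ℕ) (g : ZMod A → ZMod B → ℂ) (z : ℂ) : ℂ :=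
  if 2 < k then ((k : ℂ) - 1)⁻¹ * (z.im : ℂ) ^ (k - 1) *
    conj (latSum (k - 2) (fun a b => conj (g a b)) z (k - 1))
  else if k = 2 then latCont 0 g z 1 else deriv (latCont 1 g z) 1

lemma preForm_add_two {n : ℕ} (hn : 0 < n) (g : ZMod A → ZMod B → ℂ) (z : ℂ) :
    preForm (n + 2) g z = ((n : ℂ) + 1)⁻¹ * (z.im : ℂ) ^ (n + 1) *
        conj (latSum n (fun a b => conj (g a b)) z (n + 1)) := by
  have e : (((n + 2 : ℕ) : ℂ) - 1) = n + 1 := by push_cast; ring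
  rw [preForm, if_pos (by omega), e, Nat.add_sub_cancel, show n + 2 - 1 = n + 1 by omega]

lemma exists_norm_preForm_le {k : ℕ} (hk : 1 ≤ k) {g : ZMod A → ZMod B → ℂ} (hg : HasParity k g) :
    ∃ C c : ℝ, ∀ z : ℂ, 1 ≤ z.im → ‖preForm k g z‖ ≤ C * Real.exp (c * z.im) := by
  rcases lt_trichotomy k 2 with h | rfl | h
  · obtain rfl : k = 1 := by omega
    obtain ⟨C, hC⟩ := exists_norm_deriv_latCont_one_le hg
    exact ⟨C, 1, fun z hz => by simpa [preForm] using hC z hz⟩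
  · obtain ⟨C, hC⟩ := exists_norm_latCont_zero_le g
    exact ⟨C, 1, fun z hz => by simpa [preForm] using hC z hz⟩
  · obtain ⟨n, rfl⟩ : ∃ n, k = n + 2 := ⟨k - 2, by omega⟩
    have hn : 0 < n := by omega
    have hn' : (0:ℝ) < n := by exact_mod_cast hn
    obtain ⟨G, hG, hgb⟩ := exists_norm_le_coeff g
    obtain ⟨C, hC⟩ := exists_tsum_norm_lattice_le (k := n + 2) (by linarith)
    refine ⟨((n:ℝ) + 1)⁻¹ * (1 / 2 * (G * C)), n + 1, fun z hz => ?_⟩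
    have hz0 : 0 < z.im := by linarith
    have e1 : ‖(n:ℂ) + 1‖ = n + 1 := by exact_mod_cast Complex.norm_natCast (n + 1)
    have h1 : ‖latSum n (fun a b => conj (g a b)) z (n + 1)‖ ≤ 1 / 2 * (G * C) := by
      rw [latSum, norm_mul]
      have : ‖(1 / 2 : ℂ)‖ = 1 / 2 := by norm_num
      rw [this]
      refine mul_le_mul_of_nonneg_left ?_ (by norm_num)
      refine (tsum_of_norm_bounded ((summable_norm_lattice hz0 (k := n + 2)
        (by linarith)).mul_left G).hasSum fun p => ?_).trans
        (by rw [tsum_mul_left]; exact mul_le_mul_of_nonneg_left (hC z hz) hG)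
      by_cases hp : p = 0
      · subst hp
        have : (0:ℝ) ≤ G * ‖(((0 : ℤ × ℤ).1 : ℤ) : ℂ) * z + ((0 : ℤ × ℤ).2 : ℤ)‖ ^ (-((n:ℝ) + 2)) :=
          by positivity
        simpa [latTerm, hn.ne'] using this
      · rw [norm_latTerm n _ hz0 _ hp, RCLike.norm_conj]
        have e : -(2 * ((n : ℂ) + 1).re - n) = -((n:ℝ) + 2) := by simp; ring
        rw [e]
        gcongr
        exact hgb _ _
    have h0 : 0 ≤ 1 / 2 * (G * C) := (norm_nonneg _).trans h1
    have h2 : z.im ≤ Real.exp z.im := by linarith [Real.add_one_le_exp z.im]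
    rw [preForm_add_two hn, norm_mul, norm_mul, norm_inv, e1, norm_pow, RCLike.norm_conj,
      Complex.norm_real, Real.norm_of_nonneg hz0.le]
    have h3 : z.im ^ (n + 1) ≤ Real.exp ((n + 1) * z.im) := by
      calc z.im ^ (n + 1) ≤ Real.exp z.im ^ (n + 1) := by gcongr
        _ = _ := by rw [← Real.exp_nat_mul]; push_cast; rfl
    calc _ ≤ ((n:ℝ) + 1)⁻¹ * Real.exp ((n + 1) * z.im) * (1 / 2 * (G * C)) := by gcongr
      _ = _ := by ring

lemma exists_hasWirt_preForm {k : ℕ} (hk : 1 ≤ k) {g : ZMod A → ZMod B → ℂ} (hg : HasParity k g)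
    {z : ℂ} (hz : 0 < z.im) : ∃ a b, HasWirt (preForm k g) a b z ∧
      2 * Complex.I * (z.im : ℂ) ^ (2 - (k : ℤ)) * conj b = xiImage k g z := by
  rcases lt_trichotomy k 2 with h | rfl | h
  · obtain rfl : k = 1 := by omega
    obtain ⟨a, b, hw, hb⟩ := exists_hasWirt_deriv_latCont_one hg hz
    refine ⟨a, b, hw, ?_⟩
    rw [← hb]
    norm_num
  · obtain ⟨a, b, hw, hb⟩ := exists_hasWirt_latCont_zero g hz
    refine ⟨a, b, hw, ?_⟩
    rw [← hb]
    norm_num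
  · obtain ⟨n, rfl⟩ : ∃ n, k = n + 2 := ⟨k - 2, by omega⟩
    obtain ⟨a, b, hw, hb⟩ := exists_hasWirt_latSum (by omega : 0 < n) g hz
    refine ⟨a, b, ?_, ?_⟩
    · have : preForm (n + 2) g = _ := funext fun w => preForm_add_two (by omega : 0 < n) g w
      rw [this]
      exact hw
    · rw [← latSum_conj_eq_xiImage h hg hz, ← hb,
        show (2:ℤ) - ((n + 2 : ℕ) : ℤ) = -(n : ℤ) by push_cast; ring, zpow_neg, zpow_natCast]

end Expansion

/-- Coefficients for which the Eisenstein series `preForm k g` has the expected transformation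
behaviour. -/
structure IsEisCoeff {A B : ℕ} [NeZero A] [NeZero B] (k : ℕ) (g : ZMod A → ZMod B → ℂ) :
    Prop where
  parity : HasParity k g
  sum_eq_zero : k = 2 → ∑ a, ∑ b, g a b = 0

lemma IsEisCoeff.isAdmissible_one {A B : ℕ} [NeZero A] [NeZero B] {g : ZMod A → ZMod B → ℂ}
    (hg : IsEisCoeff 1 g) : IsAdmissible 1 g :=
  ⟨hg.parity, fun h => absurd h one_ne_zero⟩

lemma IsEisCoeff.isAdmissible_zero {A B : ℕ} [NeZero A] [NeZero B] {g : ZMod A → ZMod B → ℂ}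
    (hg : IsEisCoeff 2 g) : IsAdmissible 0 g :=
  ⟨fun a b => by simpa using hg.parity a b, fun _ => hg.sum_eq_zero rfl⟩

lemma IsEisCoeff.slash {k N : ℕ} [NeZero N] {g : ZMod N → ZMod N → ℂ} (hg : IsEisCoeff k g)
    (γ : SL(2, ℤ)) : IsEisCoeff k (slashCoeff γ g) :=
  ⟨hg.parity.slash γ, fun h => by rw [sum_slashCoeff, hg.sum_eq_zero h]⟩

lemma sum_liftCoeff {A M N : ℕ} [NeZero A] [NeZero M] [NeZero N] (h : M ∣ N)
    (g : ZMod A → ZMod M → ℂ) (a : ZMod A) :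
    ∑ b, liftCoeff h g a b = ((N / M : ℕ) : ℂ) * ∑ b, g a b := by
  have := sum_scale (N := N) (c := 1) (by simpa using h) (g a)
  rw [one_mul] at this
  rw [← this]
  refine Finset.sum_congr rfl fun b _ => ?_
  rw [liftCoeff, if_pos (one_dvd _), Nat.div_one]
  congr 1
  obtain ⟨n, rfl⟩ := ZMod.natCast_zmod_surjective b
  rw [map_natCast, ZMod.val_natCast]
  exact ((ZMod.natCast_eq_natCast_iff _ _ _).2 ((Nat.mod_modEq n N).of_dvd h)).symm

lemma IsEisCoeff.lift {k A M N : ℕ} [NeZero A] [NeZero M] [NeZero N] {g : ZMod A → ZMod M → ℂ}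
    (hg : IsEisCoeff k g) (h : M ∣ N) : IsEisCoeff k (liftCoeff h g) :=
  ⟨hg.parity.lift h, fun h0 => by
    simp only [sum_liftCoeff, ← Finset.mul_sum, hg.sum_eq_zero h0, mul_zero]⟩

lemma latSum_congr_mul (κ : ℕ) {A₁ B₁ A₂ B₂ : ℕ} {g₁ : ZMod A₁ → ZMod B₁ → ℂ}
    {g₂ : ZMod A₂ → ZMod B₂ → ℂ} {c : ℂ} (h : ∀ p : ℤ × ℤ, g₁ p.1 p.2 = c * g₂ p.1 p.2)
    (z σ : ℂ) : latSum κ g₁ z σ = c * latSum κ g₂ z σ := by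
  have : ∀ p, latTerm κ g₁ z σ p = c * latTerm κ g₂ z σ p := fun p => by
    rw [latTerm, latTerm, h, mul_assoc]
  simp only [latSum, this, tsum_mul_left]
  ring

/-- Only the values at integer pairs matter, so the moduli may differ. This serves both for lifting
to a common modulus and for extracting a character value. -/
lemma preForm_congr_mul (k : ℕ) (hk : 1 ≤ k) {A₁ B₁ A₂ B₂ : ℕ} [NeZero A₁] [NeZero B₁]
    [NeZero A₂] [NeZero B₂] {g₁ : ZMod A₁ → ZMod B₁ → ℂ} {g₂ : ZMod A₂ → ZMod B₂ → ℂ}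
    (hg₁ : IsEisCoeff k g₁) (hg₂ : IsEisCoeff k g₂) {c : ℂ}
    (h : ∀ p : ℤ × ℤ, g₁ p.1 p.2 = c * g₂ p.1 p.2) {z : ℂ} (hz : 0 < z.im) :
    preForm k g₁ z = c * preForm k g₂ z := by
  have hx : (1 / 2 : ℝ) < (1 : ℂ).re := by norm_num
  have hl : ∀ (κ : ℕ) (σ : ℂ), (z.im : ℂ) ^ (σ - κ) * latSum κ g₁ z σ =
      c * ((z.im : ℂ) ^ (σ - κ) * latSum κ g₂ z σ) := fun κ σ => by
    rw [latSum_congr_mul κ h, mul_left_comm]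
  rcases lt_trichotomy k 2 with h2 | rfl | h2
  · obtain rfl : k = 1 := by omega
    have := latCont_eventuallyEq le_rfl hg₁.isAdmissible_one hg₂.isAdmissible_one hz hz c (hl 1) hx
    simp only [preForm, if_neg (by norm_num : ¬ 2 < 1), if_neg (by norm_num : ¬ 1 = 2)]
    rw [this.deriv_eq, deriv_const_mul_field]
  · have := latCont_eventuallyEq zero_le_one hg₁.isAdmissible_zero hg₂.isAdmissible_zero hz hz c
      (hl 0) hx
    simp only [preForm, if_neg (by norm_num : ¬ 2 < 2), if_true]
    exact this.eq_of_nhds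
  · rw [preForm, preForm, if_pos h2, if_pos h2, latSum_congr_mul (k - 2)
      (g₂ := fun a b => conj (g₂ a b)) (c := conj c) (fun p => by rw [h, map_mul]), map_mul,
      Complex.conj_conj]
    ring

/-- For k ≤ 2 this is `latCont_smul`. For k = n + 2 > 2 it is the conjugate of `latSum_smul`:
conj(j)^n and the factor |j|^{-2n} of Im(γz)^n combine to j^{-n}. -/
lemma preForm_smul {k : ℕ} (hk : 1 ≤ k) {N : ℕ} [NeZero N] {g : ZMod N → ZMod N → ℂ}
    (hg : IsEisCoeff k g) (γ : SL(2, ℤ)) (z : ℍ) :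
    preForm k g ((γ • z : ℍ) : ℂ) = ((γ 1 0 : ℂ) * z + (γ 1 1 : ℂ)) ^ (2 - (k : ℤ)) *
      preForm k (slashCoeff γ g) z := by
  have hx : (1 / 2 : ℝ) < (1 : ℂ).re := by norm_num
  rcases lt_trichotomy k 2 with h2 | rfl | h2
  · obtain rfl : k = 1 := by omega
    have := latCont_smul le_rfl hg.isAdmissible_one γ z hx
    simp only [preForm, if_neg (by norm_num : ¬ 2 < 1), if_neg (by norm_num : ¬ 1 = 2)]
    rw [this.deriv_eq, deriv_const_mul_field]
    norm_num
  · have := latCont_smul zero_le_one hg.isAdmissible_zero γ z hx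
    simp only [preForm, if_neg (by norm_num : ¬ 2 < 2), if_true]
    rw [this.eq_of_nhds]
    norm_num
  · obtain ⟨n, rfl⟩ : ∃ n, k = n + 2 := ⟨k - 2, by omega⟩
    have hn : 0 < n := by omega
    have hj : (γ 1 0 : ℂ) * z + (γ 1 1 : ℂ) ≠ 0 := denom_ne_zero' γ z.im_pos
    have h1 := congrArg conj (latSum_smul n (fun a b => conj (g a b)) γ z (n + 1))
    have e : (slashCoeff γ fun a b => conj (g a b)) = fun a b => conj (slashCoeff γ g a b) := rfl
    rw [add_sub_cancel_left, Complex.cpow_one, Complex.cpow_one, e] at h1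
    simp only [map_mul, map_pow, Complex.conj_ofReal] at h1
    rw [preForm_add_two hn, preForm_add_two hn, UpperHalfPlane.coe_im, UpperHalfPlane.coe_im,
      pow_succ, mul_assoc, mul_assoc ((_ : ℂ) ^ n), h1, im_smul_eq, Complex.ofReal_div,
      Complex.ofReal_pow, ← Complex.ofReal_pow, ← Complex.normSq_eq_norm_sq, ← Complex.mul_conj,
      show (2:ℤ) - ((n + 2 : ℕ) : ℤ) = -(n : ℤ) by push_cast; ring, zpow_neg, zpow_natCast]
    generalize (γ 1 0 : ℂ) * z + (γ 1 1 : ℂ) = j at *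
    have hc := (map_ne_zero (starRingEnd ℂ)).2 hj
    rw [div_pow, mul_pow]
    field_simp
    ring

/-- The expansion at the cusp γ∞ is an expansion at i∞ with other coefficients; this reduces all
conditions at cusps to i∞. -/
lemma slash_preForm {k : ℕ} (hk : 1 ≤ k) {N : ℕ} [NeZero N] {g : ZMod N → ZMod N → ℂ}
    (hg : IsEisCoeff k g) (γ : SL(2, ℤ)) :
    (fun z : ℍ => preForm k g z) ∣[2 - (k : ℤ)] γ = fun z : ℍ => preForm k (slashCoeff γ g) z := by
  ext z
  have hj : (γ 1 0 : ℂ) * z + (γ 1 1 : ℂ) ≠ 0 := denom_ne_zero' γ z.im_pos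
  rw [ModularForm.SL_slash_apply, denom_eq, preForm_smul hk hg, mul_comm, ← mul_assoc,
    ← zpow_add₀ hj, neg_add_cancel, zpow_zero, one_mul]

lemma xi_preForm {A B : ℕ} [NeZero A] [NeZero B] {k : ℕ} (hk : 1 ≤ k) {g : ZMod A → ZMod B → ℂ}
    (hg : HasParity k g) (z : ℍ) :
    DifferentiableAt ℝ ((fun z : ℍ => preForm k g z) ∘ ofComplex) z ∧
    xi (2 - (k : ℤ)) (fun z : ℍ => preForm k g z) z = xiImage k g z := by
  obtain ⟨a, b, hw, hb⟩ := exists_hasWirt_preForm hk hg z.im_pos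
  have h := hw.congr_of_eventuallyEq (comp_ofComplex_eventuallyEq (F := fun z : ℍ => preForm k g z)
    (f := preForm k g) (fun _ => rfl) z.im_pos)
  exact ⟨h.differentiableAt, by rw [xi_eq_of_hasWirt h, ← hb]; rfl⟩

/-- Eisenstein series attached to periodic coefficients are harmonic Maass forms. -/
lemma memH_preForm {k : ℕ} (hk : 1 ≤ k) {N : ℕ} [NeZero N] {g : ZMod N → ZMod N → ℂ}
    (hg : IsEisCoeff k g) {χ : DirichletCharacter ℂ N}
    (hχ : ∀ γ ∈ CongruenceSubgroup.Gamma0 N, ∀ a b, slashCoeff γ g a b =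
      χ ((γ 1 1 : ℤ) : ZMod N) * g a b) :
    MemH (2 - (k : ℤ)) N χ fun z : ℍ => preForm k g z := by
  refine memH_of_xi (G := xiImage k g) (fun z => (xi_preForm hk hg.parity z).1)
    (differentiableOn_xiImage k g) (fun z => (xi_preForm hk hg.parity z).2) (fun γ hγ z => ?_)
    (fun γ => ?_) (fun γ => ?_)
  · rw [preForm_smul hk hg, preForm_congr_mul k hk (hg.slash γ) hg (fun p => hχ γ hγ _ _) z.im_pos]
    ring
  · obtain ⟨C, c, h⟩ := exists_norm_preForm_le hk (hg.slash γ).parity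
    refine ⟨c, ?_⟩
    rw [slash_preForm hk hg]
    refine Asymptotics.IsBigO.of_bound C ?_
    rw [Filter.eventually_iff, UpperHalfPlane.atImInfty_mem]
    refine ⟨1, fun z hz => ?_⟩
    simpa using h z hz
  · obtain ⟨K, hK⟩ := exists_norm_xiImage_le k (slashCoeff γ g) one_pos
    rw [slash_preForm hk hg, UpperHalfPlane.isBoundedAtImInfty_iff]
    exact ⟨K, 1, fun z hz => by
      rw [(xi_preForm hk (hg.slash γ).parity z).2]; exact hK z hz⟩

/-! ### The coefficients coming from two characters. -/

section Coefficients

variable {L M N : ℕ} [NeZero L] [NeZero M] [NeZero N]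

lemma isCoprime_of_mem_Gamma0 {γ : SL(2, ℤ)} (hγ : γ ∈ CongruenceSubgroup.Gamma0 N) :
    IsCoprime (N : ℤ) (γ 1 1) := by
  rw [CongruenceSubgroup.Gamma0_mem, ZMod.intCast_zmod_eq_zero_iff_dvd] at hγ
  obtain ⟨e, he⟩ := hγ
  have h := γ.det_coe
  rw [Matrix.det_fin_two, he] at h
  exact ⟨-(γ 0 1 * e), γ 0 0, by linear_combination h⟩

/-- Let γ have diagonal a, d and upper right entry b. The lower left entry is 0 mod N, so (m,n) goes
to (dm, an - bm). As d is prime to c, divisibility of m by c is preserved; on the support bm is 0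
mod M since M | c | m, and ψ(d)ϱ(a) comes out. -/
lemma slashCoeff_scaleCoeff {c : ℕ} (hMc : M ∣ c) (hcN : c * L ∣ N) (hMN : M ∣ N)
    (ψ : DirichletCharacter ℂ L) (ϱ : DirichletCharacter ℂ M) {γ : SL(2, ℤ)}
    (hγ : γ ∈ CongruenceSubgroup.Gamma0 N) (a b : ZMod N) :
    slashCoeff γ (liftCoeff hMN (scaleCoeff N c (charCoeff ψ ϱ))) a b =
      ψ (γ 1 1 : ℤ) * ϱ (γ 0 0 : ℤ) * liftCoeff hMN (scaleCoeff N c (charCoeff ψ ϱ)) a b := by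
  obtain ⟨m, rfl⟩ := ZMod.intCast_surjective a
  obtain ⟨n, rfl⟩ := ZMod.intCast_surjective b
  have h10 : ((γ 1 0 : ℤ) : ZMod N) = 0 := CongruenceSubgroup.Gamma0_mem.1 hγ
  have hN0 : N ≠ 0 := NeZero.ne N
  have hc0 : (c : ℤ) ≠ 0 := by
    rintro h0
    have : c = 0 := by exact_mod_cast h0
    rw [this, zero_mul, zero_dvd_iff] at hcN
    exact hN0 hcN
  have hcop : IsCoprime (c : ℤ) (γ 1 1) := (isCoprime_of_mem_Gamma0 hγ).of_isCoprime_of_dvd_left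
    (Int.natCast_dvd_natCast.2 ((Dvd.intro L rfl).trans hcN))
  have e1 : ((γ 1 1 : ℤ) : ZMod N) * (m : ZMod N) - ((γ 1 0 : ℤ) : ZMod N) * (n : ZMod N) =
      ((γ 1 1 * m : ℤ) : ZMod N) := by rw [h10]; push_cast; ring
  have e2 : -(((γ 0 1 : ℤ) : ZMod N) * (m : ZMod N)) + ((γ 0 0 : ℤ) : ZMod N) * (n : ZMod N) =
      ((-(γ 0 1 * m) + γ 0 0 * n : ℤ) : ZMod N) := by push_cast; ring
  rw [slashCoeff, e1, e2, liftCoeff, liftCoeff, scaleCoeff_intCast hcN, scaleCoeff_intCast hcN,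
    map_intCast (ZMod.castHom hMN (ZMod M)), map_intCast (ZMod.castHom hMN (ZMod M))]
  have hdvd : (c : ℤ) ∣ γ 1 1 * m ↔ (c : ℤ) ∣ m :=
    ⟨fun h => hcop.dvd_of_dvd_mul_left h, fun h => h.mul_left _⟩
  by_cases h : (c : ℤ) ∣ m
  · rw [if_pos (hdvd.2 h), if_pos h]
    obtain ⟨m', rfl⟩ := h
    have hcM : (c : ZMod M) = 0 := (ZMod.natCast_eq_zero_iff _ _).2 hMc
    rw [show γ 1 1 * (c * m') = c * (γ 1 1 * m') by ring, Int.mul_ediv_cancel_left _ hc0,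
      Int.mul_ediv_cancel_left _ hc0, charCoeff, charCoeff]
    push_cast
    rw [hcM, zero_mul, mul_zero, neg_zero, zero_add, map_mul, map_mul]
    ring
  · rw [if_neg (fun h' => h (hdvd.1 h')), if_neg h, mul_zero]

/-- On Γ₀ the diagonal entries are inverse to each other mod M, so ϱ of the upper one is the
conjugate of ϱ of the lower one. -/
lemma star_prodChar_apply (t : ℕ) [NeZero t] (ψ : DirichletCharacter ℂ L)
    (ϱ : DirichletCharacter ℂ M) {γ : SL(2, ℤ)}
    (hγ : γ ∈ CongruenceSubgroup.Gamma0 (t * L * M)) :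
    star (prodChar t ψ ϱ) ((γ 1 1 : ℤ) : ZMod (t * L * M)) =
      (star ψ) ((γ 1 1 : ℤ) : ZMod L) * ϱ ((γ 0 0 : ℤ) : ZMod M) := by
  have hcop := (isCoprime_of_mem_Gamma0 hγ).symm
  have hM : M ∣ t * L * M := Dvd.intro_left _ rfl
  have h1 : ((γ 0 0 : ℤ) : ZMod M) * ((γ 1 1 : ℤ) : ZMod M) = 1 := by
    have h := congrArg (Int.cast : ℤ → ZMod M) γ.det_coe
    have h0 : ((γ 1 0 : ℤ) : ZMod M) = 0 := by
      rw [ZMod.intCast_zmod_eq_zero_iff_dvd]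
      exact (Int.natCast_dvd_natCast.2 hM).trans
        ((ZMod.intCast_zmod_eq_zero_iff_dvd _ _).1 (CongruenceSubgroup.Gamma0_mem.1 hγ))
    rw [Matrix.det_fin_two] at h
    push_cast at h
    rw [h0, mul_zero, sub_zero] at h
    exact h
  have h2 : (star ϱ) ((γ 1 1 : ℤ) : ZMod M) = ϱ ((γ 0 0 : ℤ) : ZMod M) := by
    have h3 : (star ϱ * ϱ) ((γ 1 1 : ℤ) : ZMod M) = 1 := by
      rw [MulChar.star_eq_inv, inv_mul_cancel]
      exact MulChar.one_apply (IsUnit.of_mul_eq_one _ ((mul_comm _ _).trans h1))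
    have h4 : ϱ ((γ 0 0 : ℤ) : ZMod M) * ϱ ((γ 1 1 : ℤ) : ZMod M) = 1 := by
      rw [← map_mul, h1, map_one]
    rw [MulChar.mul_apply] at h3
    linear_combination (ϱ ((γ 0 0 : ℤ) : ZMod M)) * h3 -
      (star ϱ) ((γ 1 1 : ℤ) : ZMod M) * h4
  rw [← h2, MulChar.star_apply, MulChar.star_apply, MulChar.star_apply, prodChar,
    MulChar.mul_apply, DirichletCharacter.changeLevel_eq_cast_of_dvd' _ _ hcop,
    DirichletCharacter.changeLevel_eq_cast_of_dvd' _ _ hcop, star_mul']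

lemma star_parity {k : ℕ} {ψ : DirichletCharacter ℂ L} {ϱ : DirichletCharacter ℂ M}
    (h : ψ (-1) * ϱ (-1) = (-1) ^ k) : (star ψ) (-1) * ϱ (-1) = (-1) ^ k := by
  have hψ : (star ψ) (-1) = ψ (-1) := by
    have h1 : ψ (-1) * ψ (-1) = 1 := by rw [← map_mul]; simp
    rcases mul_self_eq_one_iff.1 h1 with h2 | h2 <;> simp [MulChar.star_apply, h2]
  rw [hψ, h]

/-- The total sum is a multiple of the product of the two character sums, which is zero unless both
characters are trivial. -/
lemma isEisCoeff_scaleCoeff {k c : ℕ} (hcN : c * L ∣ N) {ψ : DirichletCharacter ℂ L}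
    {ϱ : DirichletCharacter ℂ M} (h : ψ (-1) * ϱ (-1) = (-1) ^ k)
    (hne : k = 2 → ¬ (ψ = 1 ∧ ϱ = 1)) : IsEisCoeff k (scaleCoeff N c (charCoeff ψ ϱ)) := by
  refine ⟨(hasParity_charCoeff h).scale hcN, fun hk => ?_⟩
  rw [Finset.sum_comm]
  have h1 : ∀ b, ∑ a, scaleCoeff N c (charCoeff ψ ϱ) a b =
      ((N / (c * L) : ℕ) : ℂ) * ∑ a, charCoeff ψ ϱ a b := fun b =>
    sum_scale hcN fun a => charCoeff ψ ϱ a b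
  simp only [h1, ← Finset.mul_sum, charCoeff, ← Finset.sum_mul]
  by_cases hψ : ψ = 1
  · have hϱ : ϱ ≠ 1 := fun h' => hne hk ⟨hψ, h'⟩
    rw [MulChar.sum_eq_zero_of_ne_one hϱ, mul_zero, mul_zero]
  · rw [MulChar.sum_eq_zero_of_ne_one hψ, zero_mul, mul_zero]

lemma preForm_lift {k A : ℕ} [NeZero A] (hk : 1 ≤ k) (hMN : M ∣ N) {g : ZMod A → ZMod M → ℂ}
    (hg : IsEisCoeff k g) {z : ℂ} (hz : 0 < z.im) :
    preForm k (liftCoeff hMN g) z = preForm k g z := by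
  rw [preForm_congr_mul k hk (hg.lift hMN) hg (c := 1) (fun p => by simp [liftCoeff]) hz, one_mul]

/-! ### Identification of the preimage -/

lemma nonholTerm_neg_weight {n : ℕ} (hn : 0 < n) (ψ : DirichletCharacter ℂ L)
    (ϱ : DirichletCharacter ℂ M) {z : ℂ} (p : ℤ × ℤ) :
    nonholTerm (-(n : ℤ)) ψ ϱ z (n + 1) p =
      conj (latTerm n (fun a b => conj (charCoeff ψ ϱ a b)) z (n + 1) p) := by
  unfold nonholTerm
  split_ifs with hp
  · simp [hp, latTerm, hn.ne']
  · rw [latTerm, charCoeff, neg_neg, zpow_natCast]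
    rw [show -2 * ((n : ℂ) + 1) = ((-(2 * ((n : ℤ) + 1)) : ℤ) : ℂ) by push_cast; ring,
      Complex.cpow_intCast]
    simp only [map_mul, map_pow, Complex.conj_conj, map_zpow₀, Complex.conj_ofReal]
    rw [mul_assoc]

lemma summable_nonholTerm_neg_weight {n : ℕ} (hn : 0 < n) (ψ : DirichletCharacter ℂ L)
    (ϱ : DirichletCharacter ℂ M) {z : ℂ} (hz : 0 < z.im) :
    Summable (nonholTerm (-(n : ℤ)) ψ ϱ z (n + 1)) := by
  have hn' : (0:ℝ) < n := by exact_mod_cast hn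
  refine (Complex.summable_conj.2 (summable_latTerm n (fun a b => conj (charCoeff ψ ϱ a b)) hz
    (σ := (n : ℂ) + 1) (by simp; linarith))).congr fun p => (nonholTerm_neg_weight hn ψ ϱ p).symm

lemma nonholSeries_neg_weight {n c : ℕ} (hn : 0 < n) (hcN : c * L ∣ N) (ψ : DirichletCharacter ℂ L)
    (ϱ : DirichletCharacter ℂ M) (z : ℂ) :
    nonholSeries (-(n : ℤ)) ψ ϱ (c * z) (n + 1) =
      conj (latSum n (fun a b => conj (scaleCoeff N c (charCoeff ψ ϱ) a b)) z (n + 1)) := by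
  have e : (fun (a : ZMod N) (b : ZMod M) => conj (scaleCoeff N c (charCoeff ψ ϱ) a b)) =
      scaleCoeff N c (fun a b => conj (charCoeff ψ ϱ a b)) := by
    ext a b
    simp only [scaleCoeff, apply_ite conj, map_zero]
  rw [e, latSum_scale n hcN, nonholSeries, latSum, map_mul, Complex.conj_tsum,
    tsum_congr (nonholTerm_neg_weight hn ψ ϱ)]
  simp only [map_div₀, map_one, map_ofNat]

lemma natCast_mul_im (c : ℕ) (z : ℂ) : ((c : ℂ) * z).im = c * z.im := by
  rw [← Complex.ofReal_natCast, Complex.im_ofReal_mul]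

/-- The condition x + κ = 1 is σ = 1, hence s = 1 in weight zero and s = 0 in weight one. The power
y^{-s} removes the normalisation y^{σ-κ} of `latCont`, taken at z and not at cz. -/
lemma nonholCont_eventuallyEq_latCont {κ c : ℕ} (hκ : κ ≤ 1) (hcN : c * L ∣ N)
    {ψ : DirichletCharacter ℂ L} {ϱ : DirichletCharacter ℂ M} (h : ψ (-1) * ϱ (-1) = (-1) ^ κ)
    {z : ℂ} (hz : 0 < z.im) (hc : 0 < c)
    (hg : IsAdmissible κ (scaleCoeff N c (charCoeff ψ ϱ))) {x : ℂ} (hx : x + κ = 1) :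
    AnalyticAt ℂ (nonholCont κ ψ ϱ (c * z)) x ∧ nonholCont κ ψ ϱ (c * z) =ᶠ[𝓝 x] fun s =>
      (z.im : ℂ) ^ (-s) * latCont κ (scaleCoeff N c (charCoeff ψ ϱ)) z (s + κ) := by
  have hcz : 0 < ((c : ℂ) * z).im := by
    rw [natCast_mul_im]
    have : (0:ℝ) < c := by exact_mod_cast hc
    positivity
  have hy : (z.im : ℂ) ≠ 0 := by exact_mod_cast hz.ne'
  have hpow : ∀ x, AnalyticAt ℂ (fun s : ℂ => (z.im : ℂ) ^ (-s)) x := fun x =>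
    analyticAt_const_cpow_comp (by simpa using hz) (by fun_prop)
  have hf : Meromorphic fun s : ℂ =>
      (z.im : ℂ) ^ (-s) * latCont κ (scaleCoeff N c (charCoeff ψ ϱ)) z (s + κ) := fun x =>
    (hpow x).meromorphicAt.mul ((meromorphic_latCont hκ _ hz (x + κ)).comp_analyticAt
      (g := fun s : ℂ => s + κ) (by fun_prop))
  have hfx : AnalyticAt ℂ (fun s : ℂ =>
      (z.im : ℂ) ^ (-s) * latCont κ (scaleCoeff N c (charCoeff ψ ϱ)) z (s + κ)) x := by
    refine (hpow x).mul (AnalyticAt.fun_comp (g := latCont κ (scaleCoeff N c (charCoeff ψ ϱ)) z)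
      (f := fun s : ℂ => s + κ) ?_ (by fun_prop))
    rw [hx]
    exact analyticAt_latCont hκ hg hz (by norm_num)
  have hκ0 : (0:ℝ) ≤ κ := κ.cast_nonneg
  have hκ1 : (κ:ℝ) ≤ 1 := by exact_mod_cast hκ
  have key := nonholCont_eventuallyEq hκ h hcz hf (fun s hs => by
    rw [← latSum_eq_latCont hκ hg.parity hz (by simp; linarith), latSum_scale κ hcN,
      add_sub_cancel_right, ← mul_assoc, ← Complex.cpow_add _ _ hy, neg_add_cancel,
      Complex.cpow_zero, one_mul]) hfx
  exact ⟨hfx.congr key.symm, key⟩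

end Coefficients

section Preimage

variable {L M : ℕ} [NeZero L] [NeZero M]

/-- The coefficients of the preimage, except in the case of weight two and trivial characters. -/
def preCoeff (t : ℕ) (ψ : DirichletCharacter ℂ L) (ϱ : DirichletCharacter ℂ M) :
    ZMod (t * L * M) → ZMod M → ℂ :=
  scaleCoeff (t * L * M) (t * M) (charCoeff (star ψ) ϱ)

lemma scale_dvd (t L M : ℕ) : t * M * L ∣ t * L * M := ⟨1, by ring⟩

lemma isEisCoeff_preCoeff {k t : ℕ} [NeZero t] {ψ : DirichletCharacter ℂ L}
    {ϱ : DirichletCharacter ℂ M} (h : ψ (-1) * ϱ (-1) = (-1) ^ k)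
    (hne : ¬ (k = 2 ∧ ψ = 1 ∧ ϱ = 1)) : IsEisCoeff k (preCoeff t ψ ϱ) := by
  refine isEisCoeff_scaleCoeff (scale_dvd t L M) (star_parity h) fun hk h' => hne ⟨hk, ?_, h'.2⟩
  have := h'.1
  rw [MulChar.star_eq_inv, inv_eq_one] at this
  exact this

lemma preimage_eq_preForm {k t : ℕ} (hk : 1 ≤ k) [NeZero t] {ψ : DirichletCharacter ℂ L}
    {ϱ : DirichletCharacter ℂ M} (h : ψ (-1) * ϱ (-1) = (-1) ^ k)
    (hne : ¬ (k = 2 ∧ ψ = 1 ∧ ϱ = 1)) (z : ℍ) :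
    preimage k t ψ ϱ z = preForm k (preCoeff t ψ ϱ) z := by
  have hg := isEisCoeff_preCoeff (t := t) h hne
  have hy : (z.im : ℂ) ≠ 0 := im_ofReal_ne_zero z
  have hc : 0 < t * M := Nat.pos_of_ne_zero (mul_ne_zero (NeZero.ne t) (NeZero.ne M))
  have e : (t : ℂ) * M * z = ((t * M : ℕ) : ℂ) * z := by push_cast; ring
  rcases lt_trichotomy k 2 with h2 | rfl | h2
  · obtain rfl : k = 1 := by omega
    have key := (nonholCont_eventuallyEq_latCont le_rfl (scale_dvd t L M) (star_parity h) z.im_pos hc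
      hg.isAdmissible_one (x := 0) (by simp)).2
    simp only [preimage, preForm, if_neg (by norm_num : ¬ 2 < 1), if_neg (by norm_num : ¬ 1 = 2), e]
    rw [Nat.cast_one] at key
    have key2 : (fun s : ℂ => (z.im : ℂ) ^ s * nonholCont 1 (star ψ) ϱ ((t * M : ℕ) * z) s) =ᶠ[𝓝 0]
        fun s => latCont 1 (preCoeff t ψ ϱ) z (s + 1) := by
      filter_upwards [key] with s hs
      rw [hs, ← mul_assoc, UpperHalfPlane.coe_im, ← Complex.cpow_add _ _ hy, add_neg_cancel,
        Complex.cpow_zero, one_mul, Nat.cast_one]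
      rfl
    rw [key2.deriv_eq, deriv_comp_add_const, zero_add]
  · have key := (nonholCont_eventuallyEq_latCont zero_le_one (scale_dvd t L M) (κ := 0)
      (by simpa using star_parity h) z.im_pos hc hg.isAdmissible_zero (x := 1) (by simp)).2.eq_of_nhds
    have hne' : ¬ (ψ = 1 ∧ ϱ = 1) := fun h' => hne ⟨rfl, h'⟩
    simp only [preimage, preForm, if_neg (by norm_num : ¬ 2 < 2), if_true, if_neg hne', e]
    rw [Nat.cast_zero] at key
    rw [key, UpperHalfPlane.coe_im, Complex.cpow_neg_one, mul_inv_cancel_left₀ hy, Nat.cast_zero,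
      add_zero]
    rfl
  · obtain ⟨n, rfl⟩ : ∃ n, k = n + 2 := ⟨k - 2, by omega⟩
    have hn : 0 < n := by omega
    have e1 : (((n + 2 : ℕ) : ℂ) - 1) = n + 1 := by push_cast; ring
    rw [preForm_add_two hn, preimage, if_pos h2, e1, e,
      show (2:ℤ) - ((n + 2 : ℕ) : ℤ) = -(n : ℤ) by push_cast; ring,
      nonholSeries_neg_weight hn (scale_dvd t L M)]
    rfl

/-- The coefficients of the preimage in weight two for trivial characters. -/
def regCoeff (L M t : ℕ) [NeZero L] [NeZero M] : ZMod (t * L * M) → ZMod M → ℂ := fun a b =>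
  scaleCoeff (t * L * M) M (charCoeff (1 : DirichletCharacter ℂ L) (1 : DirichletCharacter ℂ M)) a b -
    t * scaleCoeff (t * L * M) (t * M)
      (charCoeff (1 : DirichletCharacter ℂ L) (1 : DirichletCharacter ℂ M)) a b

lemma scale_dvd' (t L M : ℕ) : M * L ∣ t * L * M := ⟨t, by ring⟩

/-- The coefficients supported on M | m have t times the total sum of those supported on tM | m. The
factor t of the regularisation balances this, so the residues at σ = 1 cancel. -/
lemma isEisCoeff_regCoeff (t : ℕ) [NeZero t] : IsEisCoeff 2 (regCoeff L M t) := by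
  have hp : HasParity 2 (charCoeff (1 : DirichletCharacter ℂ L) (1 : DirichletCharacter ℂ M)) :=
    hasParity_charCoeff (by
      rw [MulChar.one_apply isUnit_one.neg, MulChar.one_apply isUnit_one.neg]; norm_num)
  refine ⟨fun a b => ?_, fun _ => ?_⟩
  · rw [regCoeff, regCoeff, hp.scale (scale_dvd' t L M), hp.scale (scale_dvd t L M)]
    ring
  · rw [Finset.sum_comm]
    have h1 : ∀ (c : ℕ), c * L ∣ t * L * M → ∀ b, ∑ a, scaleCoeff (t * L * M) c (charCoeff
        (1 : DirichletCharacter ℂ L) (1 : DirichletCharacter ℂ M)) a b =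
        ((t * L * M / (c * L) : ℕ) : ℂ) * ∑ a, charCoeff (1 : DirichletCharacter ℂ L)
          (1 : DirichletCharacter ℂ M) a b := fun c hc b => sum_scale hc fun a => charCoeff 1 1 a b
    simp only [regCoeff, Finset.sum_sub_distrib, ← Finset.mul_sum, h1 _ (scale_dvd t L M),
      h1 _ (scale_dvd' t L M)]
    have e1 : t * L * M / (M * L) = t := by
      rw [show t * L * M = t * (M * L) by ring]
      exact Nat.mul_div_cancel _ (Nat.pos_of_ne_zero (mul_ne_zero (NeZero.ne M) (NeZero.ne L)))
    have e2 : t * L * M / (t * M * L) = 1 := by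
      rw [show t * L * M = t * M * L by ring]
      exact Nat.div_self (Nat.pos_of_ne_zero
        (mul_ne_zero (mul_ne_zero (NeZero.ne t) (NeZero.ne M)) (NeZero.ne L)))
    rw [e1, e2]
    push_cast
    ring

/-- The two summands may have poles at 1, but off 1 the combination agrees with the continuation of
a single lattice sum that is analytic there, and a punctured neighbourhood suffices for the limit.
-/
lemma tendsto_regularized (t : ℕ) [NeZero t] (z : ℍ) :
    Tendsto (regularized L M t z) (𝓝[≠] (1 : ℂ)) (𝓝 (preForm 2 (regCoeff L M t) z)) := by
  have hpar : (1 : DirichletCharacter ℂ L) (-1) * (1 : DirichletCharacter ℂ M) (-1) =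
      (-1) ^ 0 := by
    rw [MulChar.one_apply isUnit_one.neg, MulChar.one_apply isUnit_one.neg]; norm_num
  have hg := (isEisCoeff_regCoeff (L := L) (M := M) t).isAdmissible_zero
  have hmul : ∀ c : ℕ, 0 < c → 0 < ((c : ℂ) * z).im := fun c hc => by
    rw [natCast_mul_im]
    have : (0:ℝ) < c := by exact_mod_cast hc
    have := z.im_pos
    simp only [UpperHalfPlane.coe_im]
    positivity
  have hM := hmul M (Nat.pos_of_ne_zero (NeZero.ne M))
  have htM := hmul (t * M) (Nat.pos_of_ne_zero (mul_ne_zero (NeZero.ne t) (NeZero.ne M)))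
  have e : (t : ℂ) * M * z = ((t * M : ℕ) : ℂ) * z := by push_cast; ring
  have hpow : Meromorphic fun s : ℂ => (z.im : ℂ) ^ s := fun x =>
    (analyticAt_const_cpow_comp (by simpa using z.im_pos) (by fun_prop)).meromorphicAt
  have hreg : Meromorphic (regularized L M t z) := by
    intro x
    have h1 := meromorphic_nonholCont zero_le_one hpar hM x
    have h2 := meromorphic_nonholCont zero_le_one hpar htM x
    have h3 := hpow x
    unfold regularized
    rw [e]
    exact (h3.mul h1).sub (((MeromorphicAt.const (t : ℂ) x).mul h3).mul h2)
  have heq : regularized L M t z =ᶠ[𝓝[≠] 1] latCont 0 (regCoeff L M t) z := by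
    refine meromorphic_identity hreg (meromorphic_latCont zero_le_one _ z.im_pos) 1
      (fun s hs => ?_) 1
    have h1 := nonholCont_eq zero_le_one hpar hM hs
    have h2 := nonholCont_eq zero_le_one hpar htM hs
    have hs' : 2 + ((0:ℕ):ℝ) < 2 * s.re := by simp; linarith
    have h3 := latSum_eq_latCont zero_le_one hg.parity z.im_pos hs'
    rw [← latSum_scale 0 (scale_dvd' t L M)] at h1
    rw [← latSum_scale 0 (scale_dvd t L M)] at h2
    simp only [Nat.cast_zero, add_zero, sub_zero] at h1 h2 h3
    have h4 : latSum 0 (regCoeff L M t) z s =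
        latSum 0 (scaleCoeff (t * L * M) M (charCoeff (1 : DirichletCharacter ℂ L)
          (1 : DirichletCharacter ℂ M))) z s -
        t * latSum 0 (scaleCoeff (t * L * M) (t * M) (charCoeff (1 : DirichletCharacter ℂ L)
          (1 : DirichletCharacter ℂ M))) z s := by
      have s1 := summable_latTerm 0 (scaleCoeff (t * L * M) M (charCoeff (1 : DirichletCharacter ℂ L)
        (1 : DirichletCharacter ℂ M))) z.im_pos hs'
      have s2 := (summable_latTerm 0 (scaleCoeff (t * L * M) (t * M)
        (charCoeff (1 : DirichletCharacter ℂ L) (1 : DirichletCharacter ℂ M))) z.im_pos hs').mul_left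
          (t : ℂ)
      rw [latSum, latSum, latSum, mul_left_comm, ← mul_sub, ← tsum_mul_left (a := (t : ℂ)), ← s1.tsum_sub s2]
      congr 1
      refine tsum_congr fun p => ?_
      simp only [latTerm, regCoeff]
      ring
    rw [← h3, h4, regularized, e, h1, h2, UpperHalfPlane.coe_im]
    ring
  have hcont := (analyticAt_latCont zero_le_one hg z.im_pos (x := 1) (by norm_num)).continuousAt
  simp only [preForm, if_neg (by norm_num : ¬ 2 < 2), if_true]
  exact (hcont.tendsto.mono_left nhdsWithin_le_nhds).congr' heq.symm

lemma preimage_two_one (t : ℕ) [NeZero t] (z : ℍ) :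
    preimage 2 t (1 : DirichletCharacter ℂ L) (1 : DirichletCharacter ℂ M) z =
      preForm 2 (regCoeff L M t) z := by
  simp only [preimage, if_neg (by norm_num : ¬ 2 < 2), if_true, and_self]
  exact (tendsto_regularized t z).limUnder_eq

/-! ### Membership -/

/-- SL₂(ℤ) mixes the two variables, so the second is first lifted from M to tLM, which leaves the
form unchanged. -/
lemma memH_of_coeff {k t : ℕ} (hk : 1 ≤ k) [NeZero t] {g : ZMod (t * L * M) → ZMod M → ℂ}
    (hg : IsEisCoeff k g) {χ : DirichletCharacter ℂ (t * L * M)}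
    (hχ : ∀ γ ∈ CongruenceSubgroup.Gamma0 (t * L * M), ∀ a b,
      slashCoeff γ (liftCoeff (Dvd.intro_left (t * L) rfl) g) a b =
        χ ((γ 1 1 : ℤ) : ZMod (t * L * M)) * liftCoeff (Dvd.intro_left (t * L) rfl) g a b)
    {F : ℍ → ℂ} (hF : ∀ z : ℍ, F z = preForm k g z) :
    MemH (2 - (k : ℤ)) (t * L * M) χ F := by
  have h := memH_preForm hk (hg.lift (Dvd.intro_left (t * L) rfl)) hχ
  have : F = fun z : ℍ => preForm k (liftCoeff (Dvd.intro_left (t * L) rfl) g) z := by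
    ext z
    rw [hF, preForm_lift hk _ hg z.im_pos]
  rwa [this]

lemma memH_preimage {k t : ℕ} (hk : 1 ≤ k) [NeZero t] {ψ : DirichletCharacter ℂ L}
    {ϱ : DirichletCharacter ℂ M} (h : ψ (-1) * ϱ (-1) = (-1) ^ k) :
    MemH (2 - (k : ℤ)) (t * L * M) (star (prodChar t ψ ϱ)) (preimage k t ψ ϱ) := by
  by_cases hne : k = 2 ∧ ψ = 1 ∧ ϱ = 1
  · obtain ⟨rfl, rfl, rfl⟩ := hne
    refine memH_of_coeff hk (isEisCoeff_regCoeff t) (fun γ hγ a b => ?_) (preimage_two_one t)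
    have h1 := slashCoeff_scaleCoeff dvd_rfl (scale_dvd' t L M) (Dvd.intro_left (t * L) rfl)
      1 1 hγ a b
    have h2 := slashCoeff_scaleCoeff (Dvd.intro_left t rfl) (scale_dvd t L M)
      (Dvd.intro_left (t * L) rfl) 1 1 hγ a b
    rw [star_prodChar_apply t _ _ hγ, star_one]
    simp only [slashCoeff, liftCoeff, regCoeff] at h1 h2 ⊢
    linear_combination h1 - t * h2
  · refine memH_of_coeff hk (isEisCoeff_preCoeff h hne) (fun γ hγ a b => ?_)
      (preimage_eq_preForm hk h hne)
    rw [star_prodChar_apply t _ _ hγ]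
    exact slashCoeff_scaleCoeff (Dvd.intro_left t rfl) (scale_dvd t L M) _ _ _ hγ a b

lemma xi_preimage {k t : ℕ} (hk : 1 ≤ k) [NeZero t] {ψ : DirichletCharacter ℂ L}
    {ϱ : DirichletCharacter ℂ M} (h : ψ (-1) * ϱ (-1) = (-1) ^ k)
    (hne : ¬ (k = 2 ∧ ψ = 1 ∧ ϱ = 1)) (z : ℍ) :
    xi (2 - (k : ℤ)) (preimage k t ψ ϱ) z = xiImage k (preCoeff t ψ ϱ) z := by
  rw [funext (preimage_eq_preForm hk h hne)]
  exact (xi_preForm hk (isEisCoeff_preCoeff h hne).parity z).2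

lemma xi_preimage_two_one (t : ℕ) [NeZero t] (z : ℍ) :
    xi 0 (preimage 2 t (1 : DirichletCharacter ℂ L) (1 : DirichletCharacter ℂ M)) z =
      xiImage 2 (regCoeff L M t) z := by
  rw [funext (preimage_two_one t)]
  exact (xi_preForm one_le_two (isEisCoeff_regCoeff t).parity z).2

end Preimage

/-! ### Gauss sums of imprimitive characters -/

lemma sum_range_mul_ite_dvd {e : ℕ} (he : 0 < e) (n : ℕ) (f : ℕ → ℂ) :
    ∑ i ∈ Finset.range (e * n), (if e ∣ i then f i else 0) = ∑ j ∈ Finset.range n, f (e * j) := by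
  induction n with
  | zero => simp
  | succ n ih =>
    rw [Nat.mul_succ, Finset.sum_range_add, ih, Finset.sum_range_succ,
      Finset.sum_eq_single_of_mem 0 (Finset.mem_range.2 he)]
    · simp
    · intro i hi h0
      rw [if_neg]
      rw [Nat.dvd_add_right (dvd_mul_right e n)]
      exact fun h => h0 (Nat.eq_zero_of_dvd_of_lt h (Finset.mem_range.1 hi))

lemma sum_range_mul_split (m d : ℕ) (f : ℕ → ℂ) :
    ∑ j ∈ Finset.range (m * d), f j =
      ∑ v ∈ Finset.range d, ∑ u ∈ Finset.range m, f (m * v + u) := by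
  induction d with
  | zero => simp
  | succ d ih => rw [Nat.mul_succ, Finset.sum_range_add, ih, Finset.sum_range_succ]

lemma sum_range_exp (d : ℕ) [NeZero d] (r : ℕ) :
    ∑ v ∈ Finset.range d, Complex.exp (2 * π * Complex.I * (v * r / d)) =
      if d ∣ r then (d : ℂ) else 0 := by
  have h := AddChar.sum_mulShift (r : ZMod d) (ZMod.isPrimitive_stdAddChar d)
  rw [ZMod.card] at h
  rw [← sum_zmod_val]
  simp only [ZMod.natCast_eq_zero_iff] at h
  rw [Nat.cast_ite, Nat.cast_zero] at h
  rw [← h]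
  refine Finset.sum_congr rfl fun v _ => ?_
  have : v * (r : ZMod d) = ((v.val * r : ℤ) : ZMod d) := by simp
  rw [this, ZMod.stdAddChar_coe]
  congr 1
  push_cast
  ring

/-- Separability of Gauss sums of primitive characters, conjugated so that χ(a) appears on the
right; hence the start from the inverse additive character. -/
lemma gaussSum_inv_mulShift {m : ℕ} [NeZero m] {χ : DirichletCharacter ℂ m}
    (hχ : χ.IsPrimitive) (a : ZMod m) :
    gaussSum χ⁻¹ ((ZMod.stdAddChar (N := m)).mulShift a) = χ a * gaussSum χ⁻¹ ZMod.stdAddChar := by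
  have h := congrArg star (gaussSum_mulShift_of_isPrimitive (e := (ZMod.stdAddChar (N := m))⁻¹) hχ a)
  rw [star_gaussSum_eq, star_mul', star_gaussSum_eq, inv_inv, MulChar.star_apply', inv_inv] at h
  rw [← h]
  congr 1
  ext x
  simp [AddChar.mulShift_apply]

lemma gaussW_eq_gaussSum {m : ℕ} [NeZero m] (χ : DirichletCharacter ℂ m) :
    gaussW χ = gaussSum χ ZMod.stdAddChar := by
  have h1 : ∀ n : ℕ, Complex.exp (2 * π * Complex.I * n / m) =
      ZMod.stdAddChar (n : ZMod m) := fun n => by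
    have := ZMod.stdAddChar_coe (N := m) n
    simpa using this.symm
  have h2 : ∑ n ∈ Finset.range m, χ (n : ZMod m) * ZMod.stdAddChar (n : ZMod m) =
      gaussSum χ ZMod.stdAddChar := by
    rw [← sum_zmod_val, gaussSum]
    exact Finset.sum_congr rfl fun a _ => by simp
  rw [gaussW, ← h2, Finset.range_eq_Ico, Finset.sum_congr rfl fun n _ => by rw [h1 n]]
  have hm : 0 < m := Nat.pos_of_ne_zero (NeZero.ne m)
  obtain ⟨k, hk⟩ : ∃ k, m = k + 1 := ⟨m - 1, by omega⟩
  -- The ranges 1, …, m and 0, …, m - 1 differ in the endpoints m and 0, which are the same residue.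
  have e1 : Finset.Icc 1 m = insert m (Finset.Ico 1 m) := by
    ext x; simp; omega
  have e2 : Finset.Ico 0 m = insert 0 (Finset.Ico 1 m) := by
    ext x; simp; omega
  rw [e1, e2, Finset.sum_insert (by simp), Finset.sum_insert (by simp)]
  simp

section Gauss

variable {M : ℕ} [NeZero M]

/-- Write j = mv + u. The character sees only u; the sum over v is d or 0 according to whether d |
r, and in the first case the sum over u is a shifted primitive Gauss sum. -/
lemma sum_range_char_mul_exp {m : ℕ} [NeZero m] {χ : DirichletCharacter ℂ m}
    (hχ : χ.IsPrimitive) (d : ℕ) [NeZero d] (r : ℕ) :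
    ∑ j ∈ Finset.range (m * d), conj (χ (j : ZMod m)) *
        Complex.exp (2 * π * Complex.I * (j * r / (m * d))) =
      if d ∣ r then d * χ ((r / d : ℕ) : ZMod m) * gaussW (star χ) else 0 := by
  have hm0 : (m : ℂ) ≠ 0 := by exact_mod_cast NeZero.ne m
  have hd0 : (d : ℂ) ≠ 0 := by exact_mod_cast NeZero.ne d
  have h1 : ∀ v u : ℕ, conj (χ ((m * v + u : ℕ) : ZMod m)) *
      Complex.exp (2 * π * Complex.I * ((m * v + u : ℕ) * r / (m * d))) =
      Complex.exp (2 * π * Complex.I * (v * r / d)) * (conj (χ (u : ZMod m)) *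
        Complex.exp (2 * π * Complex.I * (u * r / (m * d)))) := by
    intro v u
    rw [mul_left_comm, ← Complex.exp_add]
    congr 2
    · simp
    · push_cast
      field_simp
  rw [sum_range_mul_split]
  simp only [h1, ← Finset.mul_sum, ← Finset.sum_mul]
  rw [sum_range_exp]
  split_ifs with h
  · obtain ⟨q, rfl⟩ := h
    rw [Nat.mul_div_cancel_left _ (Nat.pos_of_ne_zero (NeZero.ne d)), mul_assoc (d : ℂ),
      gaussW_eq_gaussSum, MulChar.star_eq_inv, ← gaussSum_inv_mulShift hχ, gaussSum]
    congr 1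
    rw [← sum_zmod_val fun u => conj (χ (u : ZMod m)) *
        Complex.exp (2 * π * Complex.I * (u * (d * q : ℕ) / (m * d)))]
    refine Finset.sum_congr rfl fun u _ => ?_
    have : (q : ZMod m) * u = ((u.val * q : ℤ) : ZMod m) := by simp [mul_comm]
    rw [AddChar.mulShift_apply, this, ZMod.stdAddChar_coe, ← MulChar.star_apply']
    rw [ZMod.natCast_zmod_val]
    congr 2
    generalize u.val = v
    push_cast
    field_simp
  · simp

lemma sum_divisors_moebius {n : ℕ} :
    ∑ e ∈ n.divisors, (ArithmeticFunction.moebius e : ℂ) = if n = 1 then 1 else 0 := by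
  have h := congrArg (fun f : ArithmeticFunction ℤ => f n) ArithmeticFunction.moebius_mul_coe_zeta
  simp only [ArithmeticFunction.coe_mul_zeta_apply, ArithmeticFunction.one_apply] at h
  exact_mod_cast congrArg (Int.cast : ℤ → ℂ) h

lemma conductor_mul_ell (ϱ : DirichletCharacter ℂ M) : ϱ.conductor * ell ϱ = M :=
  Nat.mul_div_cancel' ϱ.conductor_dvd_level

/-- An imprimitive character in terms of the primitive one. -/
lemma char_eq_primitive (ϱ : DirichletCharacter ℂ M) (i : ℕ) :
    ϱ (i : ZMod M) = ϱ.primitiveCharacter (i : ZMod ϱ.conductor) *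
      ∑ e ∈ (ell ϱ).divisors, if e ∣ i then (ArithmeticFunction.moebius e : ℂ) else 0 := by
  have hM := conductor_mul_ell ϱ
  have hℓ : ell ϱ ≠ 0 := fun h => NeZero.ne M (by rw [← hM, h, mul_zero])
  -- Möbius inversion detects that i is prime to ℓ; being prime to M means being prime to both the
  -- conductor and ℓ.
  have h1 : (∑ e ∈ (ell ϱ).divisors, if e ∣ i then (ArithmeticFunction.moebius e : ℂ) else 0) =
      if Nat.gcd i (ell ϱ) = 1 then 1 else 0 := by
    rw [← sum_divisors_moebius, ← Finset.sum_filter]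
    refine Finset.sum_congr ?_ fun _ _ => rfl
    ext e
    simp only [Finset.mem_filter, Nat.mem_divisors, Nat.dvd_gcd_iff]
    have : Nat.gcd i (ell ϱ) ≠ 0 := fun h => hℓ (Nat.gcd_eq_zero_iff.1 h).2
    tauto
  rw [h1]
  by_cases hc : Nat.Coprime i M
  · have h2 : Nat.gcd i (ell ϱ) = 1 := Nat.Coprime.coprime_dvd_right ⟨_, (mul_comm _ _).trans hM |>.symm⟩ hc
    have h3 := ϱ.primitiveCharacter_apply_of_isCoprime (a := (i : ℤ)) (Nat.isCoprime_iff_coprime.2 hc)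
    rw [if_pos h2, mul_one]
    simpa using h3.symm
  · have h0 : ϱ (i : ZMod M) = 0 :=
      MulChar.map_nonunit _ fun h => hc ((ZMod.isUnit_iff_coprime i M).1 h)
    rw [h0]
    by_cases h2 : Nat.gcd i (ell ϱ) = 1
    · have h3 : ¬ Nat.Coprime i ϱ.conductor := fun h => hc (by
        rw [← hM]; exact Nat.Coprime.mul_right h h2)
      rw [MulChar.map_nonunit _ fun h => h3 ((ZMod.isUnit_iff_coprime i _).1 h), zero_mul]
    · rw [if_neg h2, mul_zero]

/-- The Gauss sum of an imprimitive character. -/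
lemma sum_conj_char_mul_stdAddChar (ϱ : DirichletCharacter ℂ M) (r : ℕ) :
    ∑ b : ZMod M, conj (ϱ b) * ZMod.stdAddChar (b * (r : ZMod M)) = gaussW (star ϱ.primitiveCharacter) *
      ∑ d ∈ (Nat.gcd (ell ϱ) r).divisors,
      (d : ℂ) * (ArithmeticFunction.moebius (ell ϱ / d) : ℂ) *
        conj (ϱ.primitiveCharacter ((ell ϱ / d : ℕ) : ZMod ϱ.conductor)) *
        ϱ.primitiveCharacter ((r / d : ℕ) : ZMod ϱ.conductor) := by
  have hM := conductor_mul_ell ϱ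
  have hℓ : ell ϱ ≠ 0 := fun h => NeZero.ne M (by rw [← hM, h, mul_zero])
  have : NeZero ϱ.conductor := ⟨fun h => NeZero.ne M (by rw [← hM, h, zero_mul])⟩
  have hM0 : (M : ℂ) ≠ 0 := by exact_mod_cast NeZero.ne M
  have h1 : ∑ b : ZMod M, conj (ϱ b) * ZMod.stdAddChar (b * (r : ZMod M)) =
      ∑ i ∈ Finset.range M, conj (ϱ (i : ZMod M)) * Complex.exp (2 * π * Complex.I * (i * r / M)) := by
    rw [← sum_zmod_val]
    refine Finset.sum_congr rfl fun b _ => ?_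
    have : b * (r : ZMod M) = ((b.val * r : ℤ) : ZMod M) := by simp
    rw [this, ZMod.stdAddChar_coe]
    rw [ZMod.natCast_zmod_val]
    congr 2
    generalize b.val = v
    push_cast
    ring
  have h2 : ∀ i : ℕ, conj (ϱ (i : ZMod M)) * Complex.exp (2 * π * Complex.I * (i * r / M)) =
      ∑ e ∈ (ell ϱ).divisors, (ArithmeticFunction.moebius e : ℂ) * if e ∣ i then
        conj (ϱ.primitiveCharacter (i : ZMod ϱ.conductor)) *
          Complex.exp (2 * π * Complex.I * (i * r / M)) else 0 := by
    intro i
    rw [char_eq_primitive, map_mul, map_sum, mul_right_comm, Finset.mul_sum]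
    refine Finset.sum_congr rfl fun e _ => ?_
    split_ifs
    · rw [map_intCast]; ring
    · simp
  -- For ℓ = ed the multiples i = ej of e have j running over conductor times d values, the
  -- situation of `sum_range_char_mul_exp`.
  have h3 : ∀ e d : ℕ, e * d = ell ϱ → ∑ i ∈ Finset.range M, (if e ∣ i then
        conj (ϱ.primitiveCharacter (i : ZMod ϱ.conductor)) *
          Complex.exp (2 * π * Complex.I * (i * r / M)) else 0) =
      conj (ϱ.primitiveCharacter (e : ZMod ϱ.conductor)) * if d ∣ r then
        d * ϱ.primitiveCharacter ((r / d : ℕ) : ZMod ϱ.conductor) *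
          gaussW (star ϱ.primitiveCharacter) else 0 := by
    intro e d hed
    have he : e ≠ 0 := fun h => hℓ (by rw [← hed, h, zero_mul])
    have : NeZero d := ⟨fun h => hℓ (by rw [← hed, h, mul_zero])⟩
    have hMe : M = e * (ϱ.conductor * d) := by
      refine hM.symm.trans ?_
      rw [← hed]
      ring
    have he0 : (e : ℂ) ≠ 0 := by exact_mod_cast he
    have hMc : (M : ℂ) = e * (ϱ.conductor * d) := by exact_mod_cast congrArg (Nat.cast : ℕ → ℂ) hMe
    refine (Finset.sum_congr (congrArg Finset.range hMe) fun _ _ => rfl).trans ?_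
    rw [← sum_range_char_mul_exp ϱ.primitiveCharacter_isPrimitive, Finset.mul_sum,
      sum_range_mul_ite_dvd (Nat.pos_of_ne_zero he)]
    refine Finset.sum_congr rfl fun j _ => ?_
    have hm0 : (ϱ.conductor : ℂ) ≠ 0 := by exact_mod_cast NeZero.ne ϱ.conductor
    have hd0 : (d : ℂ) ≠ 0 := by exact_mod_cast NeZero.ne d
    rw [Nat.cast_mul, map_mul, map_mul, mul_assoc, hMc]
    congr 4
    push_cast
    field_simp
  rw [h1, Finset.sum_congr rfl fun i _ => h2 i, Finset.sum_comm,
    ← Nat.sum_div_divisors, Finset.mul_sum]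
  have h4 : (Nat.gcd (ell ϱ) r).divisors = (ell ϱ).divisors.filter fun d => d ∣ r := by
    ext d
    simp only [Finset.mem_filter, Nat.mem_divisors, Nat.dvd_gcd_iff]
    have : Nat.gcd (ell ϱ) r ≠ 0 := fun h => hℓ (Nat.gcd_eq_zero_iff.1 h).1
    tauto
  rw [h4, Finset.sum_filter]
  refine Finset.sum_congr rfl fun d hd => ?_
  rw [← Finset.mul_sum, h3 (ell ϱ / d) d (Nat.div_mul_cancel (Nat.dvd_of_mem_divisors hd))]
  split_ifs
  · ring
  · simp

end Gauss

/-! ### The image of the preimage -/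

lemma tsum_pnat_prod_eq_tsum_divisors {F : ℕ → ℕ → ℂ}
    (hF : Summable fun p : ℕ+ × ℕ+ => F p.1 p.2) :
    ∑' p : ℕ+ × ℕ+, F p.1 p.2 = ∑' n : ℕ, ∑ i ∈ (n + 1).divisors, F ((n + 1) / i) i := by
  rw [← sigmaAntidiagonalEquivProd.tsum_eq]
  rw [← sigmaAntidiagonalEquivProd.summable_iff] at hF
  refine (Summable.tsum_sigma hF).trans ?_
  rw [← tsum_pnat_eq_tsum_succ (f := fun n => ∑ i ∈ n.divisors, F (n / i) i)]
  refine tsum_congr fun n => ?_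
  rw [← Nat.sum_divisorsAntidiagonal', ← Finset.sum_coe_sort, tsum_fintype]
  rfl

/-- For Re s > 1 only multiples of c contribute to the Dirichlet series; the rest is the identity
theorem on the plane without 1. -/
lemma LFunction_scale {L N c : ℕ} [NeZero L] [NeZero N] (hc : 0 < c) (hcN : c * L ∣ N)
    (Φ : ZMod L → ℂ) {s : ℂ} (hs : s ≠ 1) :
    ZMod.LFunction (fun a : ZMod N => if c ∣ a.val then Φ (a.val / c : ℕ) else 0) s =
      (c : ℂ) ^ (-s) * ZMod.LFunction Φ s := by
  have hc0 : (c : ℂ) ≠ 0 := by exact_mod_cast hc.ne'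
  have h1 : AnalyticOnNhd ℂ (ZMod.LFunction
      fun a : ZMod N => if c ∣ a.val then Φ (a.val / c : ℕ) else 0) {1}ᶜ :=
    DifferentiableOn.analyticOnNhd (fun w hw =>
      (ZMod.differentiableAt_LFunction _ w (Or.inl hw)).differentiableWithinAt)
      isOpen_compl_singleton
  have h2 : AnalyticOnNhd ℂ (fun s : ℂ => (c : ℂ) ^ (-s) * ZMod.LFunction Φ s) {1}ᶜ :=
    DifferentiableOn.analyticOnNhd (fun w hw =>
      ((differentiableAt_id.neg.const_cpow (Or.inl hc0)).mul
        (ZMod.differentiableAt_LFunction _ w (Or.inl hw))).differentiableWithinAt)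
      isOpen_compl_singleton
  refine h1.eqOn_of_preconnected_of_eventuallyEq h2
    (isConnected_compl_singleton_of_one_lt_rank (by simp) _).isPreconnected
    (show (2:ℂ) ∈ ({1}ᶜ : Set ℂ) by simp) ?_ hs
  filter_upwards [(isOpen_lt continuous_const Complex.continuous_re).mem_nhds
    (show (1:ℝ) < (2:ℂ).re by norm_num)] with w hw
  have hw' : 1 < w.re := hw
  rw [ZMod.LFunction_eq_LSeries _ hw', ZMod.LFunction_eq_LSeries _ hw', LSeries, LSeries,
    ← tsum_mul_left]
  have hinj : Function.Injective fun n : ℕ => c * n := fun a b h => Nat.eq_of_mul_eq_mul_left hc h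
  have hval : ∀ n : ℕ, (if c ∣ ((n : ℕ) : ZMod N).val then
      Φ ((((n : ℕ) : ZMod N).val / c : ℕ) : ZMod L) else 0) =
      if c ∣ n then Φ ((n / c : ℕ) : ZMod L) else 0 := by
    intro n
    have := scaleCoeff_intCast (M := 1) hcN (fun a _ => Φ a) (n : ℤ) 0
    rw [scaleCoeff, Int.cast_natCast] at this
    rw [this]
    simp only [Int.natCast_dvd_natCast]
    norm_cast
  rw [← hinj.tsum_eq]
  · refine tsum_congr fun n => ?_
    rcases eq_or_ne n 0 with rfl | hn
    · simp
    · rw [LSeries.term_of_ne_zero (mul_ne_zero hc.ne' hn), LSeries.term_of_ne_zero hn, hval,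
        if_pos (dvd_mul_right _ _), Nat.mul_div_cancel_left _ hc, Nat.cast_mul,
        Complex.natCast_mul_natCast_cpow, Complex.cpow_neg]
      field_simp
  · intro n hn
    rw [Function.mem_support] at hn
    by_contra h
    apply hn
    rcases eq_or_ne n 0 with rfl | h0
    · simp
    · rw [LSeries.term_of_ne_zero h0, hval, if_neg, zero_div]
      rintro ⟨q, rfl⟩
      exact h ⟨q, rfl⟩

section Image

variable {L M N : ℕ} [NeZero L] [NeZero M] [NeZero N]

lemma conj_ghat_scaleCoeff {s : ℕ} (hN : s * M * L ∣ N) (ψ : DirichletCharacter ℂ L)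
    (ϱ : DirichletCharacter ℂ M) (m e : ℕ) :
    conj (ghat (scaleCoeff N (s * M) (charCoeff (star ψ) ϱ)) (m : ZMod N) ((-(e : ℤ) : ℤ) : ZMod M)) =
      if s * M ∣ m then ψ ((m / (s * M) : ℕ) : ZMod L) *
        ∑ b : ZMod M, conj (ϱ b) * ZMod.stdAddChar (b * (e : ZMod M)) else 0 := by
  have h1 : ∀ b, scaleCoeff N (s * M) (charCoeff (star ψ) ϱ) (m : ZMod N) b =
      if s * M ∣ m then charCoeff (star ψ) ϱ ((m / (s * M) : ℕ) : ZMod L) b else 0 := by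
    intro b
    have := scaleCoeff_intCast hN (charCoeff (star ψ) ϱ) (m : ℤ) b
    rw [Int.cast_natCast] at this
    rw [this]
    simp only [Int.natCast_dvd_natCast]
    norm_cast
  rw [ghat]
  simp only [h1]
  split_ifs
  · rw [map_sum, Finset.mul_sum]
    refine Finset.sum_congr rfl fun b _ => ?_
    rw [charCoeff, map_mul, map_mul, MulChar.star_apply, starRingEnd_apply, starRingEnd_apply,
      star_star, mul_assoc, ← AddChar.map_neg_eq_conj]
    congr 3
    simp
  · simp

/-- The term with row sMd and frequency -e has exponent sde. Grouping by n = de gives the divisor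
sum, and the Gauss sum of the imprimitive ϱ supplies its inner sum. -/
lemma qSeries_negCoeff_scaleCoeff (k : ℕ) {s : ℕ} (hs : 0 < s) (hN : s * M * L ∣ N)
    (ψ : DirichletCharacter ℂ L) (ϱ : DirichletCharacter ℂ M) {z : ℂ} (hz : 0 < z.im) :
    qSeries M (negCoeff (scaleCoeff N (s * M) (charCoeff (star ψ) ϱ))
        fun p => |(p.2 : ℝ)| ^ (k - 1)) z =
      gaussW (star ϱ.primitiveCharacter) * ∑' n : ℕ, sigma k ψ ϱ (n + 1) *
        Complex.exp (2 * π * Complex.I * ((n + 1 : ℕ) : ℂ) * (s * z)) := by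
  have hM0 : (M : ℂ) ≠ 0 := by exact_mod_cast NeZero.ne M
  have hc : 0 < s * M := Nat.mul_pos hs (Nat.pos_of_ne_zero (NeZero.ne M))
  set W := gaussW (star ϱ.primitiveCharacter)
  set G : ℕ → ℂ := fun e => ∑ d ∈ (Nat.gcd (ell ϱ) e).divisors,
      (d : ℂ) * (ArithmeticFunction.moebius (ell ϱ / d) : ℂ) *
        conj (ϱ.primitiveCharacter ((ell ϱ / d : ℕ) : ZMod ϱ.conductor)) *
        ϱ.primitiveCharacter ((e / d : ℕ) : ZMod ϱ.conductor) with hG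
  set F : ℕ → ℕ → ℂ := fun d e => W * (ψ (d : ZMod L) * (e : ℂ) ^ (k - 1) * G e *
    Complex.exp (2 * π * Complex.I * ((d * e : ℕ) : ℂ) * (s * z))) with hF
  set f : ℕ × ℤ → ℂ := fun p => negCoeff (scaleCoeff N (s * M) (charCoeff (star ψ) ϱ))
        (fun p => |(p.2 : ℝ)| ^ (k - 1)) p * qexp M p z with hf
  have hsum : Summable f :=
    (isPolyBdd_negCoeff _ zero_le_one fun p _ => abs_pow_le_wt p (k - 1)).summable hz
  -- Rows are indexed by m with row number m + 1, hence the subtraction of 1.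
  set ι : ℕ+ × ℕ+ → ℕ × ℤ := fun p => (s * M * p.1 - 1, -((p.2 : ℕ) : ℤ)) with hι
  have hpos : ∀ d : ℕ+, 0 < s * M * (d : ℕ) := fun d => Nat.mul_pos hc d.pos
  have hinj : Function.Injective ι := by
    rintro ⟨d, e⟩ ⟨d', e'⟩ h
    simp only [hι, Prod.mk.injEq, neg_inj, Nat.cast_inj] at h
    have h1 := hpos d
    have h2 := hpos d'
    have h3 : s * M * (d : ℕ) = s * M * (d' : ℕ) := by omega
    have h4 : (d : ℕ) = d' := Nat.eq_of_mul_eq_mul_left hc h3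
    exact Prod.ext (PNat.coe_injective h4) (PNat.coe_injective h.2)
  have hfι : ∀ p, f (ι p) = F p.1 p.2 := by
    rintro ⟨d, e⟩
    have h1 : s * M * (d : ℕ) - 1 + 1 = s * M * d := Nat.sub_add_cancel (hpos d)
    have he : (-((e : ℕ) : ℤ)) < 0 := by have := e.pos; omega
    have hq : qexp M (s * M * d - 1, -((e : ℕ) : ℤ)) z =
        Complex.exp (2 * π * Complex.I * (((d : ℕ) * (e : ℕ) : ℕ) : ℂ) * (s * z)) := by
      rw [qexp, freq, h1]
      congr 1
      push_cast
      rw [abs_neg, Nat.abs_cast]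
      push_cast
      field_simp
    simp only [hf, hι, hF, negCoeff, if_pos he, hq]
    rw [h1, conj_ghat_scaleCoeff hN, if_pos (dvd_mul_right _ _), Nat.mul_div_cancel_left _ hc,
      sum_conj_char_mul_stdAddChar]
    push_cast
    rw [abs_neg, Nat.abs_cast]
    push_cast
    ring
  have hsupp : Function.support f ⊆ range ι := by
    rintro ⟨m, r⟩ h
    rw [Function.mem_support] at h
    by_contra hno
    apply h
    simp only [hf, negCoeff]
    split_ifs with hr
    · obtain ⟨e, rfl⟩ : ∃ e : ℕ, r = -(e : ℤ) := ⟨r.natAbs, by change r < 0 at hr; omega⟩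
      rw [conj_ghat_scaleCoeff hN, if_neg]
      · simp
      · rintro ⟨d, hd⟩
        have hd0 : 0 < d := Nat.pos_of_ne_zero fun h0 => by simp [h0] at hd
        have he0 : 0 < e := by simpa using hr
        refine hno ⟨(⟨d, hd0⟩, ⟨e, he0⟩), ?_⟩
        refine Prod.ext ?_ rfl
        change s * M * d - 1 = m
        omega
    · simp
  rw [qSeries]
  change ∑' p, f p = _
  rw [← hinj.tsum_eq hsupp, tsum_congr hfι, tsum_pnat_prod_eq_tsum_divisors
    ((hsum.comp_injective hinj).congr hfι), ← tsum_mul_left]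
  refine tsum_congr fun n => ?_
  simp only [hF, sigma, ← Finset.mul_sum]
  rw [Finset.sum_mul]
  congr 1
  refine Finset.sum_congr rfl fun e he => ?_
  rw [Nat.div_mul_cancel (Nat.dvd_of_mem_divisors he)]

lemma natTotient_div_eq_eulerProd (M : ℕ) [NeZero M] : (M.totient : ℂ) / M = eulerProd M := by
  have h := congrArg (Rat.cast : ℚ → ℂ) (Nat.totient_eq_mul_prod_factors M)
  have hM0 : (M : ℂ) ≠ 0 := by exact_mod_cast NeZero.ne M
  push_cast at h
  rw [h, mul_div_cancel_left₀ _ hM0, eulerProd]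

/-- For the constants: the row m = 0 carries conj ψ(0), non-zero only for L = 1; the extra term of
weight one carries Σϱ, non-zero only for trivial ϱ, when φ(M)/M is the Euler product. The dilation
factor (sM)^{-w} is 1 at w = 0. -/
lemma xiImage_scaleCoeff {k : ℕ} {s : ℕ} (hs : 0 < s) (hN : s * M * L ∣ N)
    {ψ : DirichletCharacter ℂ L} {ϱ : DirichletCharacter ℂ M} (h : ψ (-1) * ϱ (-1) = (-1) ^ k)
    {z : ℂ} (hz : 0 < z.im) :
    xiImage k (scaleCoeff N (s * M) (charCoeff (star ψ) ϱ)) z =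
      constC k L ϱ + (if k = 1 then constD ψ ϱ else 0) + eisNonconst k ψ ϱ (s * z) := by
  have hM0 : (M : ℂ) ≠ 0 := by exact_mod_cast NeZero.ne M
  have hc : 0 < s * M := Nat.mul_pos hs (Nat.pos_of_ne_zero (NeZero.ne M))
  have h0 : scaleCoeff N (s * M) (charCoeff (star ψ) ϱ) 0 = fun b => (star ψ) 0 * ϱ b := by
    ext b
    simp [scaleCoeff, charCoeff]
  rw [xiImage, qSeries_negCoeff_scaleCoeff k hs hN ψ ϱ hz, eisNonconst, h0]
  congr 1
  · congr 1
    · rw [constC]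
      split_ifs with hL
      · subst hL
        have h1 : (star ψ) 0 = 1 := by rw [Subsingleton.elim (0 : ZMod 1) 1, map_one]
        -- At k = 1 the L-function is evaluated at its possible pole; but L = 1 and odd parity force
        -- ϱ to be non-trivial.
        have hϱ : (k : ℂ) ≠ 1 ∨ ∑ b, ϱ b = 0 := by
          by_cases hk1 : k = 1
          · right
            refine MulChar.sum_eq_zero_of_ne_one fun hϱ => ?_
            rw [hk1, hϱ, Subsingleton.elim (-1 : ZMod 1) 1, map_one,
              MulChar.one_apply isUnit_one.neg] at h
            norm_num at h
          · left
            exact_mod_cast hk1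
        have h2 : ⇑(star ϱ) = fun b => conj (ϱ b) := by
          ext b; rw [MulChar.star_apply]; rfl
        simp only [h1, one_mul]
        rw [DirichletCharacter.LFunction, h2, LFunction_conj _ hϱ, Complex.conj_natCast]
      · have h1 : (star ψ) 0 = 0 := by
          have : Nontrivial (ZMod L) := ZMod.nontrivial_iff.2 hL
          exact MulChar.map_zero _
        simp only [h1, zero_mul]
        have : ZMod.LFunction (fun _ : ZMod M => (0:ℂ)) k = 0 := by
          simp [ZMod.LFunction]
        rw [this, map_zero]
    · split_ifs with hk1
      · have h1 : (fun a => ghat (scaleCoeff N (s * M) (charCoeff (star ψ) ϱ)) a 0) =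
            fun a : ZMod N => if s * M ∣ a.val then
              ((∑ b, ϱ b) * conj (ψ ((a.val / (s * M) : ℕ) : ZMod L))) else 0 := by
          ext a
          rw [ghat_zero]
          simp only [scaleCoeff]
          split_ifs
          · simp only [charCoeff]
            rw [← Finset.mul_sum, MulChar.star_apply, mul_comm]
            rfl
          · simp
        have h2 : ZMod.LFunction (fun a : ZMod L => (∑ b, ϱ b) * conj (ψ a)) 0 =
            (∑ b, ϱ b) * conj (DirichletCharacter.LFunction ψ 0) := by
          have h3 := LFunction_conj ψ (s := 0) (Or.inl zero_ne_one)
          rw [map_zero] at h3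
          rw [DirichletCharacter.LFunction, ← h3]
          simp [ZMod.LFunction, Finset.mul_sum, mul_assoc]
        rw [h1, LFunction_scale hc hN (fun a => (∑ b, ϱ b) * conj (ψ a)) zero_ne_one, neg_zero,
          Complex.cpow_zero, one_mul, h2, map_mul, Complex.conj_conj, constD]
        split_ifs with hϱ
        · rw [hϱ, MulChar.sum_one_eq_card_units, ZMod.card_units_eq_totient, Complex.conj_natCast,
            ← natTotient_div_eq_eulerProd]
          ring
        · rw [MulChar.sum_eq_zero_of_ne_one hϱ]
          simp
      · rfl
  · ring

end Image

/-! ### Comparison with the holomorphic Eisenstein series. -/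

section Main

variable {L M : ℕ} [NeZero L] [NeZero M]

lemma xiImage_regCoeff (t : ℕ) [NeZero t] {z : ℂ} (hz : 0 < z.im) :
    xiImage 2 (regCoeff L M t) z =
      xiImage 2 (scaleCoeff (t * L * M) M
        (charCoeff (1 : DirichletCharacter ℂ L) (1 : DirichletCharacter ℂ M))) z -
      t * xiImage 2 (scaleCoeff (t * L * M) (t * M)
        (charCoeff (1 : DirichletCharacter ℂ L) (1 : DirichletCharacter ℂ M))) z := by
  set g₁ := scaleCoeff (t * L * M) M
    (charCoeff (1 : DirichletCharacter ℂ L) (1 : DirichletCharacter ℂ M)) with hg₁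
  set g₂ := scaleCoeff (t * L * M) (t * M)
    (charCoeff (1 : DirichletCharacter ℂ L) (1 : DirichletCharacter ℂ M)) with hg₂
  have hs : ∀ g : ZMod (t * L * M) → ZMod M → ℂ, Summable fun p =>
      negCoeff g (fun p => |(p.2 : ℝ)| ^ (2 - 1)) p * qexp M p z := fun g =>
    (isPolyBdd_negCoeff g zero_le_one fun p _ => abs_pow_le_wt p (2 - 1)).summable hz
  have h1 : qSeries M (negCoeff (regCoeff L M t) fun p => |(p.2 : ℝ)| ^ (2 - 1)) z =
      qSeries M (negCoeff g₁ fun p => |(p.2 : ℝ)| ^ (2 - 1)) z -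
      t * qSeries M (negCoeff g₂ fun p => |(p.2 : ℝ)| ^ (2 - 1)) z := by
    rw [qSeries, qSeries, qSeries, ← tsum_mul_left, ← (hs g₁).tsum_sub ((hs g₂).mul_left _)]
    refine tsum_congr fun p => ?_
    simp only [negCoeff]
    split_ifs
    · have : ghat (regCoeff L M t) (p.1 + 1 : ℕ) p.2 =
          ghat g₁ (p.1 + 1 : ℕ) p.2 - t * ghat g₂ (p.1 + 1 : ℕ) p.2 := by
        simp only [ghat, regCoeff, ← hg₁, ← hg₂, Finset.mul_sum, ← Finset.sum_sub_distrib]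
        exact Finset.sum_congr rfl fun b _ => by ring
      rw [this, map_sub, map_mul, Complex.conj_natCast]
      ring
    · simp
  have h2 : ZMod.LFunction (regCoeff L M t 0) 2 =
      ZMod.LFunction (g₁ 0) 2 - t * ZMod.LFunction (g₂ 0) 2 := by
    simp only [ZMod.LFunction, regCoeff, ← hg₁, ← hg₂, sub_mul, Finset.sum_sub_distrib, mul_sub,
      mul_assoc, Finset.mul_sum]
    congr 1
    exact Finset.sum_congr rfl fun b _ => by ring
  simp only [xiImage, if_neg (by norm_num : ¬ 2 = 1), Nat.cast_ofNat, h2, h1, map_sub, map_mul,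
    Complex.conj_natCast]
  ring

lemma xi_preimage_eq_eis {k t : ℕ} (hk : 1 ≤ k) [NeZero t] {ψ : DirichletCharacter ℂ L}
    {ϱ : DirichletCharacter ℂ M} (h : ψ (-1) * ϱ (-1) = (-1) ^ k) :
    xi (2 - (k : ℤ)) (preimage k t ψ ϱ) = eis k t ψ ϱ := by
  ext z
  have ht : 0 < t := Nat.pos_of_ne_zero (NeZero.ne t)
  by_cases hne : k = 2 ∧ ψ = 1 ∧ ϱ = 1
  · obtain ⟨rfl, rfl, rfl⟩ := hne
    have h1 := xiImage_scaleCoeff (N := t * L * M) one_pos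
      (by rw [one_mul]; exact scale_dvd' t L M) h z.im_pos
    have h2 := xiImage_scaleCoeff ht (scale_dvd t L M) h z.im_pos
    rw [star_one, if_neg (by norm_num), add_zero] at h1 h2
    rw [one_mul, Nat.cast_one, one_mul] at h1
    have hy : (z.im : ℂ) ≠ 0 := im_ofReal_ne_zero z
    have ht0 : (t : ℂ) ≠ 0 := by exact_mod_cast ht.ne'
    have hM0 : (M : ℂ) ≠ 0 := by exact_mod_cast NeZero.ne M
    rw [show (2:ℤ) - ((2:ℕ) : ℤ) = 0 by norm_num, xi_preimage_two_one, xiImage_regCoeff t z.im_pos,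
      h1, h2]
    -- The 1/y terms of E(z) and tE(tz) are equal, so they cancel in the difference and what remains
    -- is holomorphic.
    simp only [eis, eisBase, if_neg (by norm_num : ¬ 2 = 1), and_self, if_true, natCast_mul_im,
      UpperHalfPlane.coe_im]
    push_cast
    field_simp
    ring
  · rw [xi_preimage hk h hne, preCoeff, xiImage_scaleCoeff ht (scale_dvd t L M) h z.im_pos, eis,
      if_neg hne, eisBase]
    split_ifs
    · rfl
    · rw [add_zero]

end Main

end EisPreimage

end

theorem theorem4p1 (k L M t : ℕ) [NeZero L] [NeZero M] (hk : 1 ≤ k) (ht : 1 ≤ t)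
    (ψ : DirichletCharacter ℂ L) (ϱ : DirichletCharacter ℂ M)
    (hparity : ψ (-1) * ϱ (-1) = (-1) ^ k) :
    -- the objects entering the definition of the pre-image are well defined
    (2 < k → ∀ z : ℍ, Summable
      (EisPreimage.nonholTerm (2 - (k : ℤ)) (star ψ) ϱ (t * M * (z : ℂ)) ((k : ℂ) - 1))) ∧
    (k ≤ 2 → ∀ z : ℍ, ∃ g : ℂ → ℂ,
      EisPreimage.IsContinuation (2 - (k : ℤ)) (star ψ) ϱ (z : ℂ) g) ∧
    (k = 2 → ¬ (ψ = 1 ∧ ϱ = 1) → ∀ z : ℍ,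
      AnalyticAt ℂ (EisPreimage.nonholCont 0 (star ψ) ϱ (t * M * (z : ℂ))) 1) ∧
    (k = 2 → ψ = 1 ∧ ϱ = 1 → ∀ z : ℍ,
      Tendsto (EisPreimage.regularized L M t z) (𝓝[≠] (1 : ℂ))
        (𝓝 (EisPreimage.preimage k t ψ ϱ z))) ∧
    (k = 1 → ∀ z : ℍ,
      AnalyticAt ℂ (EisPreimage.nonholCont 1 (star ψ) ϱ (t * M * (z : ℂ))) 0) ∧
    -- the pre-image lies in the space of harmonic Maass forms, and `ξ` maps it to `E`
    EisPreimage.MemH (2 - (k : ℤ)) (t * L * M) (star (EisPreimage.prodChar t ψ ϱ))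
      (EisPreimage.preimage k t ψ ϱ) ∧
    EisPreimage.xi (2 - (k : ℤ)) (EisPreimage.preimage k t ψ ϱ) = EisPreimage.eis k t ψ ϱ := by
  have : NeZero t := ⟨by omega⟩
  have hc : 0 < t * M := Nat.mul_pos ht (Nat.pos_of_ne_zero (NeZero.ne M))
  have e : ∀ z : ℍ, (t : ℂ) * M * z = ((t * M : ℕ) : ℂ) * z := fun z => by push_cast; ring
  have hz : ∀ z : ℍ, 0 < (((t * M : ℕ) : ℂ) * z).im := fun z => by
    rw [EisPreimage.natCast_mul_im]
    exact mul_pos (by exact_mod_cast hc) z.im_pos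
  have hpar := EisPreimage.star_parity hparity
  refine ⟨fun h z => ?_, fun h z => ?_, ?_, ?_, ?_, EisPreimage.memH_preimage hk hparity,
    EisPreimage.xi_preimage_eq_eis hk hparity⟩
  · obtain ⟨n, rfl⟩ : ∃ n, k = n + 2 := ⟨k - 2, by omega⟩
    have e1 : (((n + 2 : ℕ) : ℂ) - 1) = n + 1 := by push_cast; ring
    rw [e1, e, show (2:ℤ) - ((n + 2 : ℕ) : ℤ) = -(n : ℤ) by push_cast; ring]
    exact EisPreimage.summable_nonholTerm_neg_weight (by omega) _ _ (hz z)
  · obtain ⟨κ, hκ⟩ : ∃ κ, κ + k = 2 := ⟨2 - k, by omega⟩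
    have hκ2 : (2:ℤ) - (k : ℤ) = (κ : ℤ) := by omega
    rw [hκ2]
    refine EisPreimage.exists_isContinuation (by omega) ?_ z.im_pos
    rw [hpar, show κ = 2 - k by omega]
    have : k = 1 ∨ k = 2 := by omega
    rcases this with rfl | rfl <;> norm_num
  · rintro rfl hne z
    rw [e]
    exact (EisPreimage.nonholCont_eventuallyEq_latCont zero_le_one (EisPreimage.scale_dvd t L M)
      (κ := 0) (by simpa using hpar) z.im_pos hc (EisPreimage.isEisCoeff_preCoeff hparity
        fun h => hne h.2).isAdmissible_zero (x := 1) (by simp)).1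
  · rintro rfl ⟨rfl, rfl⟩ z
    rw [EisPreimage.preimage_two_one]
    exact EisPreimage.tendsto_regularized t z
  · rintro rfl z
    rw [e]
    exact (EisPreimage.nonholCont_eventuallyEq_latCont le_rfl (EisPreimage.scale_dvd t L M)
      hpar z.im_pos hc (EisPreimage.isEisCoeff_preCoeff hparity fun h => by
        simp at h).isAdmissible_one (x := 0) (by simp)).1
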